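/- **Setting.** Let $n\ge 2$, $N\ge1$, $0=\alpha^{(0)}<\alpha^{(1)}<\dots<\alpha^{(N)}$ real, $a_0,\dots,a_N>0$, $g(s)=\sum_{i=0}^N a_i s^{\alpha^{(i)}}$ for $s\ge 0$, and $K(\xi)=1/g(s(\xi))$ for $\xi\ge0$, where $s(\xi)$ is the unique non-negative solution $s$ of $s\,g(s)=\xi$. Put $a=\alpha^{(N)}/(\alpha^{(N)}+1)\in(0,1)$. Let $\lambda\in(0,1]$, $\delta=1-\lambda$, and assume $a>\delta$. Put $$\alpha_*=\frac{n(a-\delta)}{2-a},\quad \mu_0=\frac{a-\delta}{1-a},\quad \theta_\alpha=\frac1{(1-a)(\alpha/\alpha_*-1)},\quad \mu_{1,\alpha}=\frac{\mu_0(1+\theta_\alpha(1-a))}{1-\theta_\alpha},\quad q_\alpha=\frac{2-a}{(1-a)(1-\theta_\alpha)}.$$ Let $U\subset\mathbb R^n$ be open and bounded with $C^1$ boundary $\Gamma=\partial U$, with surface measure $\sigma$. For $T>0$, a *non-negative solution on $(0,T)$* of $$(u^\lambda)_t=\nabla\cdot(K(|\nabla u|)\nabla u)\ \text{ in }U\times(0,T),\qquad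 K(|\nabla u|)\frac{\partial u}{\partial\vec\nu}+\varphi u^\lambda=0\ \text{ on }\Gamma\times(0,T),$$ where $\varphi$ is a measurable function on $\Gamma\times(0,T)$, is a continuous function $u\ge 0$ on $\bar U\times(0,T)$ with a weak spatial gradient $\nabla u$ such that, for all $0<t_1<t_2<T$, $\nabla u\in L^{2-a}(U\times(t_1,t_2))$, $\varphi u^\lambda\in L^1(\Gamma\times(t_1,t_2))$ and, for every $\eta\in C^1(\mathbb R^n\times\mathbb R)$, $$\int_U u^\lambda\eta\,dx\Big|_{t=t_1}^{t=t_2}=\int_{t_1}^{t_2}\!\!\int_U u^\lambda\eta_t\,dx\,dt-\int_{t_1}^{t_2}\!\!\int_U K(|\nabla u|)\nabla u\cdot\nabla\eta\,dx\,dt-\int_{t_1}^{t_2}\!\!\int_\Gamma\varphi u^\lambda\eta\,d\sigma\,dt .$$ It has *initial datum $u_0\in L^{q}(U)$* if $u(\cdot,t)\to u_0$ in $L^{q}(U)$ as $t\to0^+$. Write $\varphi^-=\max\{-\varphi,0\}$. **Theorem.** Let $\alpha_0\ge 2-\delta$ and $\alpha_0>\alpha_*$. Put $\kappa_*=1+\frac{2-a}{n}-\frac{a-\delta}{\alpha_0}>1$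 and $$\mu=\prod_{j=0}^\infty\frac{\alpha_0\kappa_*^j-2+\delta}{\alpha_0\kappa_*^j},\qquad \nu=\prod_{j=0}^\infty\frac{\alpha_0\kappa_*^j}{\alpha_0\kappa_*^j+\delta-a}.$$ There are a number $\omega>0$ (depending only on $n,\lambda,g,\alpha_0$), a number $C_3>0$ (depending only on $n,\lambda,g,\alpha_0,U$) and, for each open $U'$ with compact closure $\overline{U'}\subset U$, a number $C>0$ (depending only on $n,\lambda,g,\alpha_0,U,U'$) such that for all $T>0$, all $0<\varepsilon<\min\{1,T\}$, all measurable $\varphi$, and every non-negative solution $u$ on $(0,T)$: (1) $$\|u\|_{L^\infty(U'\times(\varepsilon,T))}\le C\varepsilon^{-2\omega}(1+T)^{3\omega}\max\Big\{\|u\|_{L^{\alpha_0}(U\times(0,T))}^{\mu},\|u\|_{L^{\alpha_0}(U\times(0,T))}^{\nu}\Big\}.$$ (2) Suppose in addition that $\alpha_0>n\mu_0$ and that $u$ has initial datum $u_0\in L^{\alpha_0}(U)$. If $$\int_0^T\big(1+\|\varphi^-(t)\|_{L^\infty(\Gamma)}^{q_{\alpha_0}}\big)dt<\frac1{C_3}\Big(1+\int_U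 u_0^{\alpha_0}dx\Big)^{-\mu_{1,\alpha_0}/\alpha_0},$$ then $$\|u\|_{L^\infty(U'\times(\varepsilon,T))}\le C\varepsilon^{-2\omega}(1+T)^{3\omega}\max\Big\{\Big(\int_0^T\mathcal U(t)\,dt\Big)^{\mu/\alpha_0},\Big(\int_0^T\mathcal U(t)\,dt\Big)^{\nu/\alpha_0}\Big\},$$ where $$\mathcal U(t)=\Big\{\Big(1+\int_Uu_0^{\alpha_0}dx\Big)^{-\mu_{1,\alpha_0}/\alpha_0}-C_3\int_0^t\big(1+\|\varphi^-(\tau)\|_{L^\infty(\Gamma)}^{q_{\alpha_0}}\big)d\tau\Big\}^{-\alpha_0/\mu_{1,\alpha_0}}.$$ (3) Under the assumptions $\alpha_0>n\mu_0$ and initial datum $u_0\in L^{\alpha_0}(U)$, if $$\int_0^T\big(1+\|\varphi^-(t)\|_{L^\infty(\Gamma)}^{q_{\alpha_0}}\big)dt\le\frac{1-2^{-\mu_{1,\alpha_0}/\alpha_0}}{C_3}\Big(1+\int_U u_0^{\alpha_0}dx\Big)^{-\mu_{1,\alpha_0}/\alpha_0},$$ then $$\|u\|_{L^\infty(U'\times(\varepsilon,T))}\le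 C\varepsilon^{-2\omega}(1+T)^{3\omega+\nu/\alpha_0}\big(1+\|u_0\|_{L^{\alpha_0}(U)}\big)^{\nu}.$$ -/

import Mathlib

open Set Filter Topology MeasureTheory
open scoped ENNReal RealInnerProductSpace

noncomputable section

namespace ForchheimerGas

/-! ### The generalized Forchheimer polynomial and the conductivity `K` -/

/-- The data of a generalized polynomial `g(s) = a₀ s^{α₀} + a₁ s^{α₁} + ⋯ + a_N s^{α_N}` with
`N ≥ 1`, positive coefficients `aᵢ` and real exponents `0 = α₀ < α₁ < ⋯ < α_N`. -/
structure GenPoly where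
  N : ℕ
  one_le_N : 1 ≤ N
  coeff : Fin (N + 1) → ℝ
  coeff_pos : ∀ i, 0 < coeff i
  expo : Fin (N + 1) → ℝ
  expo_zero : expo 0 = 0
  expo_strictMono : StrictMono expo

namespace GenPoly

variable (P : GenPoly)

/-- `g(s) = ∑ aᵢ s^{αᵢ}`, for `s ≥ 0`. -/
def g (s : ℝ) : ℝ := ∑ i, P.coeff i * s ^ P.expo i

/-- The number `a = α_N / (α_N + 1)`. -/
def a : ℝ := P.expo (Fin.last P.N) / (P.expo (Fin.last P.N) + 1)

theorem a_lt_one : P.a < 1 := by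
  have h : P.expo 0 ≤ P.expo (Fin.last P.N) := P.expo_strictMono.monotone (Fin.zero_le _)
  rw [P.expo_zero] at h
  rw [a, div_lt_one (by linarith)]; linarith

theorem expo_nonneg (i : Fin (P.N + 1)) : 0 ≤ P.expo i := by
  rw [← P.expo_zero]; exact P.expo_strictMono.monotone (Fin.zero_le i)

theorem g_pos {s : ℝ} (hs : 0 ≤ s) : 0 < P.g s := by
  refine Finset.sum_pos' (fun i _ => mul_nonneg (P.coeff_pos i).le (Real.rpow_nonneg hs _))
    ⟨0, Finset.mem_univ _, ?_⟩
  simpa [P.expo_zero] using P.coeff_pos 0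

theorem g_mono {s t : ℝ} (hs : 0 ≤ s) (hst : s ≤ t) : P.g s ≤ P.g t :=
  Finset.sum_le_sum fun i _ => mul_le_mul_of_nonneg_left
    (Real.rpow_le_rpow hs hst (P.expo_nonneg i)) (P.coeff_pos i).le

theorem coeff_zero_le_g {s : ℝ} (hs : 0 ≤ s) : P.coeff 0 ≤ P.g s := by
  have h := Finset.single_le_sum (f := fun i => P.coeff i * s ^ P.expo i)
    (fun i _ => mul_nonneg (P.coeff_pos i).le (Real.rpow_nonneg hs _)) (Finset.mem_univ 0)
  simpa [g, P.expo_zero] using h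

theorem continuous_g : Continuous P.g :=
  continuous_finsetSum _ fun i _ => continuous_const.mul
    (Real.continuous_rpow_const (P.expo_nonneg i))

/-- For every `ξ ≥ 0` the equation `s g(s) = ξ` has exactly one solution `s ≥ 0`. -/
theorem existsUnique_root {ξ : ℝ} (hξ : 0 ≤ ξ) : ∃! s : ℝ, 0 ≤ s ∧ s * P.g s = ξ := by
  have hc : 0 < P.coeff 0 := P.coeff_pos 0
  have hb : 0 ≤ ξ / P.coeff 0 := div_nonneg hξ hc.le
  have hcont : ContinuousOn (fun s : ℝ => s * P.g s) (Icc 0 (ξ / P.coeff 0)) :=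
    (continuous_id.mul P.continuous_g).continuousOn
  have hmem : ξ ∈ Icc ((0 : ℝ) * P.g 0) (ξ / P.coeff 0 * P.g (ξ / P.coeff 0)) := by
    refine ⟨by simpa using hξ, ?_⟩
    calc ξ = ξ / P.coeff 0 * P.coeff 0 := by field_simp
      _ ≤ _ := mul_le_mul_of_nonneg_left (P.coeff_zero_le_g hb) hb
  obtain ⟨s, hs, hsξ⟩ := intermediate_value_Icc hb hcont hmem
  refine ⟨s, ⟨hs.1, hsξ⟩, ?_⟩
  have key : ∀ x y : ℝ, 0 ≤ x → x < y → x * P.g x < y * P.g y := fun x y hx hxy =>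
    calc x * P.g x ≤ x * P.g y := mul_le_mul_of_nonneg_left (P.g_mono hx hxy.le) hx
      _ < y * P.g y := mul_lt_mul_of_pos_right hxy (P.g_pos (hx.trans hxy.le))
  rintro t ⟨ht, htξ⟩
  have hsξ' : s * P.g s = ξ := hsξ
  rcases lt_trichotomy t s with h | h | h
  · have := key t s ht h; linarith
  · exact h
  · have := key s t hs.1 h; linarith

/-- `s(ξ)`: the unique non-negative solution `s` of `s g(s) = ξ`. -/
def root (ξ : ℝ) : ℝ := Classical.epsilon fun s : ℝ => 0 ≤ s ∧ s * P.g s = ξ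

theorem root_spec {ξ : ℝ} (hξ : 0 ≤ ξ) : 0 ≤ P.root ξ ∧ P.root ξ * P.g (P.root ξ) = ξ :=
  Classical.epsilon_spec (p := fun s : ℝ => 0 ≤ s ∧ s * P.g s = ξ) (P.existsUnique_root hξ).exists

/-- `K(ξ) = 1 / g(s(ξ))`, for `ξ ≥ 0`. -/
def K (ξ : ℝ) : ℝ := 1 / P.g (P.root ξ)

end GenPoly

/-! ### The domain -/

/-- The boundary of `U` is of class `C¹`: near each boundary point, in suitable Cartesian
coordinates (`e` is the last coordinate direction), `U` is the region below the graph of a `C¹`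
function of the remaining coordinates. -/
def HasC1Boundary {n : ℕ} (U : Set (EuclideanSpace ℝ (Fin n))) : Prop :=
  ∀ x₀ ∈ frontier U, ∃ r : ℝ, 0 < r ∧ ∃ e : EuclideanSpace ℝ (Fin n), ‖e‖ = 1 ∧
    ∃ γ : (Submodule.span ℝ {e})ᗮ → ℝ, ContDiff ℝ 1 γ ∧
      ∀ x ∈ Metric.ball x₀ r,
        (x ∈ U ↔ ⟪e, x⟫ < γ ((Submodule.span ℝ {e})ᗮ.orthogonalProjectionOnto x))

/-- The surface measure `σ` on `Γ = ∂U`. -/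
def surfaceMeasure {n : ℕ} (U : Set (EuclideanSpace ℝ (Fin n))) :
    Measure (EuclideanSpace ℝ (Fin n)) :=
  (μHE[n - 1]).restrict (frontier U)

/-! ### Weak solutions -/

/-- `F` is the weak gradient of `f` on the open set `U`. -/
def HasWeakGradient {n : ℕ} (U : Set (EuclideanSpace ℝ (Fin n)))
    (f : EuclideanSpace ℝ (Fin n) → ℝ)
    (F : EuclideanSpace ℝ (Fin n) → EuclideanSpace ℝ (Fin n)) : Prop :=
  LocallyIntegrableOn f U ∧ LocallyIntegrableOn F U ∧
    ∀ ψ : EuclideanSpace ℝ (Fin n) → ℝ, ContDiff ℝ (⊤ : ℕ∞) ψ → HasCompactSupport ψ → tsupport ψ ⊆ U →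
      ∫ x in U, f x • gradient ψ x = - ∫ x in U, ψ x • F x

/-- `u` is a non-negative (weak) solution on the time interval `(0, T)` of
`(u^λ)_t = ∇ · (K(|∇u|) ∇u)` in `U`, with `K(|∇u|) ∂u/∂ν + φ u^λ = 0` on `Γ = ∂U`.

The function `u` is continuous on `closure U × (0, T)`, has a weak spatial gradient `Du` which lies
in `L^{2-a}(U × (t₁, t₂))` whenever `0 < t₁ < t₂ < T`, and satisfies the integral identity obtained
by testing the equation with an arbitrary `C¹` function `η(x, t)` on `U × (t₁, t₂)`. -/
structure IsSolution {n : ℕ} (P : GenPoly) (lam : ℝ) (U : Set (EuclideanSpace ℝ (Fin n)))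
    (T : ℝ) (φ u : EuclideanSpace ℝ (Fin n) → ℝ → ℝ) : Prop where
  nonneg : ∀ x ∈ closure U, ∀ t ∈ Ioo 0 T, 0 ≤ u x t
  continuousOn : ContinuousOn (Function.uncurry u) (closure U ×ˢ Ioo 0 T)
  boundary_integrable : ∀ t₁ t₂ : ℝ, 0 < t₁ → t₁ < t₂ → t₂ < T →
    Integrable (fun z : EuclideanSpace ℝ (Fin n) × ℝ => φ z.1 z.2 * u z.1 z.2 ^ lam)
      ((surfaceMeasure U).prod (volume.restrict (Ioo t₁ t₂)))
  weak_form : ∃ Du : EuclideanSpace ℝ (Fin n) → ℝ → EuclideanSpace ℝ (Fin n),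
    (∀ᵐ t ∂(volume.restrict (Ioo 0 T)), HasWeakGradient U (fun x => u x t) (fun x => Du x t)) ∧
    ∀ t₁ t₂ : ℝ, 0 < t₁ → t₁ < t₂ → t₂ < T →
      MemLp (Function.uncurry Du) (ENNReal.ofReal (2 - P.a))
        (volume.restrict (U ×ˢ Ioo t₁ t₂)) ∧
      ∀ η : EuclideanSpace ℝ (Fin n) → ℝ → ℝ, ContDiff ℝ 1 (Function.uncurry η) →
        (∫ x in U, u x t₂ ^ lam * η x t₂) - (∫ x in U, u x t₁ ^ lam * η x t₁)
          = (∫ t in t₁..t₂, ∫ x in U, u x t ^ lam * deriv (fun s => η x s) t)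
            - (∫ t in t₁..t₂, ∫ x in U,
                ⟪P.K ‖Du x t‖ • Du x t, gradient (fun y => η y t) x⟫)
            - ∫ t in t₁..t₂, ∫ x, φ x t * u x t ^ lam * η x t ∂(surfaceMeasure U)

/-- The initial datum `u₀` lies in `L^q(U)`, and `u(·, t) → u₀` in `L^q(U)` as `t → 0⁺`. -/
def HasInitialDatum {n : ℕ} (U : Set (EuclideanSpace ℝ (Fin n))) (q : ℝ)
    (u : EuclideanSpace ℝ (Fin n) → ℝ → ℝ) (u₀ : EuclideanSpace ℝ (Fin n) → ℝ) : Prop :=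
  MemLp u₀ (ENNReal.ofReal q) (volume.restrict U) ∧
    Tendsto (fun t => eLpNorm (fun x => u x t - u₀ x) (ENNReal.ofReal q) (volume.restrict U))
      (𝓝[>] 0) (𝓝 0)

/-! ### Exponents.  Throughout, `δ = 1 - λ`. -/

/-- `α_* = n (a - δ) / (2 - a)`. -/
def alphaStar (n : ℕ) (P : GenPoly) (lam : ℝ) : ℝ := n * (P.a - (1 - lam)) / (2 - P.a)

/-- `μ₀ = (a - δ) / (1 - a)`. -/
def mu0 (P : GenPoly) (lam : ℝ) : ℝ := (P.a - (1 - lam)) / (1 - P.a)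

/-- `θ_α = 1 / ((1 - a)(α / α_* - 1))`. -/
def theta (n : ℕ) (P : GenPoly) (lam α : ℝ) : ℝ :=
  1 / ((1 - P.a) * (α / alphaStar n P lam - 1))

/-- `μ_{1,α} = μ₀ (1 + θ_α (1 - a)) / (1 - θ_α)`. -/
def mu1 (n : ℕ) (P : GenPoly) (lam α : ℝ) : ℝ :=
  mu0 P lam * (1 + theta n P lam α * (1 - P.a)) / (1 - theta n P lam α)

/-- The power `(2 - a) / ((1 - a)(1 - θ_α))` of the boundary datum. -/
def phiExp (n : ℕ) (P : GenPoly) (lam α : ℝ) : ℝ :=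
  (2 - P.a) / ((1 - P.a) * (1 - theta n P lam α))

/-- `κ(α) = 1 + (2 - a)/n - (a - δ)/α`. -/
def kappa (n : ℕ) (P : GenPoly) (lam α : ℝ) : ℝ := 1 + (2 - P.a) / n - (P.a - (1 - lam)) / α

/-- The number `κ_* = κ(α₀)` is greater than one. -/
theorem one_lt_kappa {n : ℕ} (hn : 2 ≤ n) (P : GenPoly) {lam : ℝ} (hlam : 0 < lam)
    {α₀ : ℝ} (hα₁ : 2 - (1 - lam) ≤ α₀) (hα₂ : alphaStar n P lam < α₀) :
    1 < kappa n P lam α₀ := by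
  have hn' : (0 : ℝ) < n := by positivity
  have := P.a_lt_one
  unfold alphaStar at hα₂
  rw [div_lt_iff₀ (by linarith)] at hα₂
  unfold kappa
  have : (P.a - (1 - lam)) / α₀ < (2 - P.a) / n := by
    rw [div_lt_div_iff₀ (by linarith) hn']; linarith
  linarith

/-- The infinite products defining `μ` and `ν` converge. -/
theorem multipliable_mu_nu {n : ℕ} (P : GenPoly) {lam : ℝ} (hlam : 0 < lam) (hlam1 : lam ≤ 1)
    {α₀ : ℝ} (hα₁ : 2 - (1 - lam) ≤ α₀) (hk : 1 < kappa n P lam α₀) :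
    Multipliable (fun j : ℕ =>
      (α₀ * kappa n P lam α₀ ^ j - 2 + (1 - lam)) / (α₀ * kappa n P lam α₀ ^ j)) ∧
    Multipliable (fun j : ℕ =>
      (α₀ * kappa n P lam α₀ ^ j) / (α₀ * kappa n P lam α₀ ^ j + (1 - lam) - P.a)) := by
  set k := kappa n P lam α₀
  have ha := P.a_lt_one
  have hα : 0 < α₀ := by linarith
  have hs : Summable (fun j : ℕ => (k ^ j)⁻¹) := by
    simpa using summable_geometric_of_lt_one (r := k⁻¹) (by positivity) (inv_lt_one_of_one_lt₀ hk)
  have hk1 : ∀ j : ℕ, 1 ≤ k ^ j := fun j => one_le_pow₀ hk.le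
  constructor
  · refine (multipliable_one_add_of_summable
      (f := fun j : ℕ => (-2 + (1 - lam)) / α₀ * (k ^ j)⁻¹) (hs.mul_left _).norm).congr fun j => ?_
    have := hk1 j
    field_simp
    ring
  · have h3 : ∀ j, α₀ * k ^ j / 4 ≤ α₀ * k ^ j + (1 - lam) - P.a := fun j => by
      have h2 : α₀ * 1 ≤ α₀ * k ^ j := by gcongr; exact hk1 j
      linarith
    have h4 : ∀ j, 0 < α₀ * k ^ j / 4 := fun j => by have := hk1 j; positivity
    refine (multipliable_one_add_of_summable
      (f := fun j : ℕ => (P.a - (1 - lam)) / (α₀ * k ^ j + (1 - lam) - P.a)) ?_).congr fun j => ?_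
    · refine Summable.of_norm_bounded (g := fun j : ℕ => |P.a - (1 - lam)| * (4 / α₀) * (k ^ j)⁻¹)
        (hs.mul_left _) fun j => ?_
      have := hk1 j
      rw [norm_norm, norm_div, Real.norm_eq_abs, Real.norm_eq_abs,
        abs_of_pos ((h4 j).trans_le (h3 j)), div_eq_mul_inv, mul_assoc]
      gcongr
      calc _ ≤ (α₀ * k ^ j / 4)⁻¹ := inv_anti₀ (h4 j) (h3 j)
        _ = _ := by field_simp
    · have := ((h4 j).trans_le (h3 j)).ne'
      field_simp
      ring

/-- `μ = ∏_{j ≥ 0} (α₀ κ_*^j - 2 + δ) / (α₀ κ_*^j)` with `κ_* = κ(α₀)`. -/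
def muInf (n : ℕ) (P : GenPoly) (lam α₀ : ℝ) : ℝ :=
  ∏' j : ℕ, (α₀ * kappa n P lam α₀ ^ j - 2 + (1 - lam)) / (α₀ * kappa n P lam α₀ ^ j)

/-- `ν = ∏_{j ≥ 0} α₀ κ_*^j / (α₀ κ_*^j + δ - a)` with `κ_* = κ(α₀)`. -/
def nuInf (n : ℕ) (P : GenPoly) (lam α₀ : ℝ) : ℝ :=
  ∏' j : ℕ, (α₀ * kappa n P lam α₀ ^ j) / (α₀ * kappa n P lam α₀ ^ j + (1 - lam) - P.a)

/-! ### Quantities formed from the data -/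

/-- `‖φ⁻(t)‖_{L^∞(Γ)}`. -/
def negNorm {n : ℕ} (U : Set (EuclideanSpace ℝ (Fin n)))
    (φ : EuclideanSpace ℝ (Fin n) → ℝ → ℝ) (t : ℝ) : ℝ≥0∞ :=
  eLpNorm (fun x => max (-φ x t) 0) ∞ (surfaceMeasure U)

/-- `∫₀ᵗ (1 + ‖φ⁻(τ)‖_{L^∞(Γ)}^{(2-a)/((1-a)(1-θ_α))}) dτ`, possibly infinite. -/
def dataInt {n : ℕ} (P : GenPoly) (lam α : ℝ) (U : Set (EuclideanSpace ℝ (Fin n)))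
    (φ : EuclideanSpace ℝ (Fin n) → ℝ → ℝ) (t : ℝ) : ℝ≥0∞ :=
  ∫⁻ τ in Ioo 0 t, (1 + negNorm U φ τ ^ phiExp n P lam α)

/-- `(1 + ∫_U u₀^α dx)^{-μ_{1,α}/α}`. -/
def initTerm {n : ℕ} (P : GenPoly) (lam α : ℝ) (U : Set (EuclideanSpace ℝ (Fin n)))
    (u₀ : EuclideanSpace ℝ (Fin n) → ℝ) : ℝ :=
  (1 + ∫ x in U, u₀ x ^ α) ^ (-(mu1 n P lam α) / α)

/-- `𝒰_α(t) = {(1 + ∫_U u₀^α dx)^{-μ_{1,α}/α}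
  - C₃ ∫₀ᵗ (1 + ‖φ⁻‖_{L^∞(Γ)}^{(2-a)/((1-a)(1-θ_α))}) dτ}^{-α/μ_{1,α}}`. -/
def bigU {n : ℕ} (P : GenPoly) (lam α C₃ : ℝ) (U : Set (EuclideanSpace ℝ (Fin n)))
    (φ : EuclideanSpace ℝ (Fin n) → ℝ → ℝ) (u₀ : EuclideanSpace ℝ (Fin n) → ℝ) (t : ℝ) : ℝ :=
  (initTerm P lam α U u₀ - C₃ * (dataInt P lam α U φ t).toReal) ^ (-α / mu1 n P lam α)

end ForchheimerGas

end

/-! ### Growth of the conductivity `K`. -/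

noncomputable section

namespace ForchheimerGas

namespace GenPoly

variable (P : GenPoly)

/-! Write `p = 2 - a`. The growth of `g` gives `c ξ^p - C ≤ K(ξ) ξ²` and `K(ξ) ξ ≤ C ξ^{1-a}`, so
the equation behaves like a doubly nonlinear equation of `p`-Laplace type. Everything rests on one
energy inequality, `RegSol.energy_le`, obtained by testing with `u^β χ`, where `β = α - λ ≥ 1` and
`χ` depends on `x` only. It controls the growth of `(λ/α) ∫ u^α χ` by the flux tested against the
gradient of `u^β χ` and by the boundary term.

Two things stand in the way of that test: the weak form only admits `C¹` functions, and `u` has no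
time derivative. For the first, `strongApprox_of_hasWeakGradient` shows that a function continuous
on `closure U` with weak gradient in `L^p` is a limit of `C¹` functions, uniformly on `closure U`
and with gradients converging in `L^p(U)`; the approximants are mollifications along inner cones of
the boundary. For the second, the equation on a window `(τ - h, τ)` is tested with the frozen
function `u(τ)^β χ`. The inequality `rpow_sub_rpow_le` bounds the increment of `u^λ` against it from
below by an increment of the energy. Replacing `u(τ)` by `u(s)` in the test function costs an error
that vanishes with the shift, by continuity of translations in `L^p` and uniform continuity of `u`.
`le_of_lintegral_window` turns such averaged backward differences into monotonicity.

Interior bound. With `χ = ζ²` a cut-off, the energy inequality is a Caccioppoli inequality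
(`RegSol.exists_caccioppoli`). Combined with the Sobolev inequality at almost every time it improves
integrability from `α` to `α(1 + p/n) - (a - δ)` on a smaller cylinder
(`RegSol.exists_sobolev_step`). The estimate is not homogeneous: its right side carries the powers
`α - 2 + δ`, `α` and `α + δ - a` of `u`. Hence one step sends the norm `Y` to the larger of
`Y^{(α-2+δ)/α}` and `Y^{α/(α+δ-a)}`. Along `α_j = α₀ κ_*^j` these exponents multiply up to `μ` and
`ν` (`moser_iterate`, `RegSol.exists_interior_bound`); the condition `α₀ > α_*` says that `κ_* > 1`.

Global bound. With `χ = 1` and `X = ∫ u^α`, the boundary contributes at most `‖φ⁻‖ ∫_Γ u^α`. The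
trace inequality and Young's inequality convert this into a small multiple of the dissipation plus a
term in `∫ u^{α+μ₀}` (`exists_trace_bound`). The latter is interpolated between `X` and the
dissipation (`exists_interpolation_bound`), with weight `θ < 1` because `α > n μ₀`. Absorbing the
dissipation leaves `(1 + X)' ≤ C (1 + ‖φ⁻‖^q)(1 + X)^{1 + μ₁/α}` in integrated form, and the
Gronwall inequality `rpow_neg_sub_le_integral` yields `X ≤ 𝒰` (`RegSol.exists_integral_le_bigU`).
Inserting this into the interior bound gives (2); under the hypothesis of (3), `𝒰` stays below `2(1
+ ∫ u₀^α)`.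

The Sobolev and trace inequalities on a `C¹` domain are derived from boundary charts: the first from
the whole-space Gagliardo–Nirenberg–Sobolev inequality by cutting off thin boundary layers
(`Chart.exists_sobolev_bump`), the second by integrating along lines transversal to the boundary
(`Chart.exists_trace_le`). -/

theorem expo_last_pos : 0 < P.expo (Fin.last P.N) := by
  rw [← P.expo_zero]
  refine P.expo_strictMono ?_
  rw [Fin.lt_def]
  simpa using Nat.lt_of_lt_of_le Nat.zero_lt_one P.one_le_N

theorem a_pos : 0 < P.a := div_pos P.expo_last_pos (by linarith [P.expo_last_pos])

theorem one_sub_a : 1 - P.a = 1 / (P.expo (Fin.last P.N) + 1) := by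
  have := P.expo_last_pos
  rw [a]; field_simp; ring

theorem K_pos {ξ : ℝ} (hξ : 0 ≤ ξ) : 0 < P.K ξ :=
  one_div_pos.2 (P.g_pos (P.root_spec hξ).1)

theorem K_mul_self {ξ : ℝ} (hξ : 0 ≤ ξ) : P.K ξ * ξ = P.root ξ := by
  have h := P.root_spec hξ
  have := P.g_pos h.1
  rw [K]
  nth_rw 2 [← h.2]
  field_simp

theorem root_mono {ξ ξ' : ℝ} (hξ : 0 ≤ ξ) (h : ξ ≤ ξ') : P.root ξ ≤ P.root ξ' := by
  have h1 := P.root_spec hξ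
  have h2 := P.root_spec (hξ.trans h)
  by_contra! hlt
  have h3 : P.root ξ' * P.g (P.root ξ') < P.root ξ * P.g (P.root ξ) :=
    calc _ ≤ P.root ξ' * P.g (P.root ξ) := mul_le_mul_of_nonneg_left (P.g_mono h2.1 hlt.le) h2.1
      _ < _ := mul_lt_mul_of_pos_right hlt (P.g_pos h1.1)
  rw [h1.2, h2.2] at h3
  linarith

/-- On the half-line `K` is antitone, hence measurable. The truncation at `0` is needed because
`root` is an arbitrary choice at negative arguments. -/
theorem measurable_K_norm {V : Type*} [NormedAddCommGroup V] [MeasurableSpace V] [BorelSpace V] :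
    Measurable fun v : V => P.K ‖v‖ := by
  have h : Antitone fun ξ : ℝ => P.K (max ξ 0) := fun x y hxy => by
    have hx := P.root_spec (le_max_right x 0)
    exact one_div_le_one_div_of_le (P.g_pos hx.1)
      (P.g_mono hx.1 (P.root_mono (le_max_right x 0) (max_le_max_right 0 hxy)))
  have h2 := h.measurable.comp (measurable_norm (α := V))
  convert h2 using 2 with v
  simp

/-- Upper bound `K(ξ) ξ ≤ C ξ^{1-a}`. -/
theorem exists_K_mul_le : ∃ C : ℝ, 0 < C ∧ ∀ ξ : ℝ, 0 ≤ ξ → P.K ξ * ξ ≤ C * ξ ^ (1 - P.a) := by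
  set A := P.expo (Fin.last P.N)
  have hA := P.expo_last_pos
  set c := P.coeff (Fin.last P.N)
  have hc : 0 < c := P.coeff_pos _
  refine ⟨(1 / c) ^ (1 - P.a), by positivity, fun ξ hξ => ?_⟩
  have h := P.root_spec hξ
  rw [P.K_mul_self hξ, ← Real.mul_rpow (by positivity) hξ]
  have h1 : c * P.root ξ ^ A ≤ P.g (P.root ξ) :=
    Finset.single_le_sum (f := fun i => P.coeff i * P.root ξ ^ P.expo i)
      (fun i _ => mul_nonneg (P.coeff_pos i).le (Real.rpow_nonneg h.1 _)) (Finset.mem_univ _)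
  -- Only the top term of `g` is kept in `s g(s) = ξ`. Since `1 - a = 1/(A + 1)`, raising to the
  -- power `1 - a` finishes the proof.
  have h2 : P.root ξ ^ (A + 1) ≤ 1 / c * ξ := by
    rw [Real.rpow_add_one' h.1 (by positivity)]
    have : P.root ξ * (c * P.root ξ ^ A) ≤ ξ := by
      calc _ ≤ P.root ξ * P.g (P.root ξ) := mul_le_mul_of_nonneg_left h1 h.1
        _ = ξ := h.2
    rw [one_div, ← div_eq_inv_mul, le_div_iff₀ hc]; linarith
  calc P.root ξ = (P.root ξ ^ (A + 1)) ^ (1 - P.a) := by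
        rw [← Real.rpow_mul h.1, P.one_sub_a, mul_one_div_cancel (by positivity), Real.rpow_one]
    _ ≤ _ := Real.rpow_le_rpow (Real.rpow_nonneg h.1 _) h2 (by rw [P.one_sub_a]; positivity)

/-- Lower bound `c ξ^{2-a} - C ≤ K(ξ) ξ²`. -/
theorem exists_le_K_mul_sq : ∃ c C : ℝ, 0 < c ∧ 0 < C ∧
    ∀ ξ : ℝ, 0 ≤ ξ → c * ξ ^ (2 - P.a) - C ≤ P.K ξ * ξ ^ 2 := by
  set A := P.expo (Fin.last P.N)
  have hA := P.expo_last_pos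
  have ha1 := P.a_lt_one
  set G := P.g 1
  have hG : 0 < G := P.g_pos zero_le_one
  refine ⟨(1 / G) ^ (1 - P.a), (1 / G) ^ (1 - P.a) * G ^ (2 - P.a), by positivity, by positivity,
    fun ξ hξ => ?_⟩
  have h := P.root_spec hξ
  have hK : P.K ξ * ξ ^ 2 = P.root ξ * ξ := by rw [sq, ← mul_assoc, P.K_mul_self hξ]
  -- If the root is at most `1`, then `ξ ≤ g(1)` and the subtracted constant makes the left side
  -- non-positive. If it exceeds `1`, the top power dominates all others and `g(s) ≤ g(1) s^A`.
  rcases le_or_gt (P.root ξ) 1 with h1 | h1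
  · have : ξ ≤ G := by
      rw [← h.2]
      calc _ ≤ 1 * P.g (P.root ξ) := mul_le_mul_of_nonneg_right h1 (P.g_pos h.1).le
        _ ≤ G := by rw [one_mul]; exact P.g_mono h.1 h1
    have h2 : ξ ^ (2 - P.a) ≤ G ^ (2 - P.a) := Real.rpow_le_rpow hξ this (by linarith)
    have h3 : (1 / G) ^ (1 - P.a) * ξ ^ (2 - P.a) ≤ (1 / G) ^ (1 - P.a) * G ^ (2 - P.a) := by
      gcongr
    have : 0 ≤ P.K ξ * ξ ^ 2 := mul_nonneg (P.K_pos hξ).le (sq_nonneg _)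
    linarith
  · have hg : P.g (P.root ξ) ≤ G * P.root ξ ^ A := by
      simp only [G, g, Finset.sum_mul]
      refine Finset.sum_le_sum fun i _ => ?_
      rw [Real.one_rpow, mul_one]
      exact mul_le_mul_of_nonneg_left (Real.rpow_le_rpow_of_exponent_le h1.le
        (P.expo_strictMono.monotone (Fin.le_last i))) (P.coeff_pos i).le
    have h2 : 1 / G * ξ ≤ P.root ξ ^ (A + 1) := by
      rw [Real.rpow_add_one' h.1 (by positivity), one_div, ← div_eq_inv_mul, div_le_iff₀ hG]
      nth_rw 1 [← h.2]
      calc _ ≤ P.root ξ * (G * P.root ξ ^ A) := mul_le_mul_of_nonneg_left hg h.1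
        _ = _ := by ring
    have h3 : (1 / G * ξ) ^ (1 - P.a) ≤ P.root ξ :=
      calc _ ≤ (P.root ξ ^ (A + 1)) ^ (1 - P.a) :=
            Real.rpow_le_rpow (by positivity) h2 (by linarith)
        _ = P.root ξ := by
          rw [← Real.rpow_mul h.1, P.one_sub_a, mul_one_div_cancel (by positivity), Real.rpow_one]
    rw [Real.mul_rpow (by positivity) hξ] at h3
    have h4 : ξ ^ (2 - P.a) = ξ ^ (1 - P.a) * ξ := by
      rw [← Real.rpow_add_one' hξ (by linarith)]; congr 1; ring
    rw [hK, h4]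
    have h5 := mul_le_mul_of_nonneg_right h3 hξ
    have : 0 ≤ (1 / G) ^ (1 - P.a) * G ^ (2 - P.a) := by positivity
    linarith

end GenPoly

end ForchheimerGas

end

/-! ### Boundary charts and estimates along lines. -/

noncomputable section

namespace ForchheimerGas

/-- Euclidean space of dimension `n`. -/
abbrev Eu (n : ℕ) := EuclideanSpace ℝ (Fin n)

variable {n : ℕ}

/-- A local description of `U` near `x₀` as the set of positivity of a height function `H`
which decreases with unit speed in the direction `e`. -/
structure Chart (U : Set (Eu n)) (x₀ e : Eu n) (r M : ℝ) (H : Eu n → ℝ) : Prop where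
  r_pos : 0 < r
  one_le_M : 1 ≤ M
  norm_e : ‖e‖ = 1
  contDiff : ContDiff ℝ 1 H
  shift : ∀ x s, H (x + s • e) = H x - s
  lip : ∀ x ∈ Metric.ball x₀ r, ∀ y ∈ Metric.ball x₀ r, |H x - H y| ≤ M * ‖x - y‖
  mem_iff : ∀ x ∈ Metric.ball x₀ r, (x ∈ U ↔ 0 < H x)

/-- The height is `H x = γ(Qx) - ⟪e, x⟫`, with `Q` the projection onto the complement of `e`. Being
`C¹`, it is Lipschitz on a smaller ball, which is where `M` and the radius come from. -/
theorem HasC1Boundary.exists_chart {U : Set (Eu n)} (hU : HasC1Boundary U) {x₀ : Eu n}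
    (hx₀ : x₀ ∈ frontier U) : ∃ e r M H, Chart U x₀ e r M H := by
  obtain ⟨r, hr, e, he, γ, hγ, hmem⟩ := hU x₀ hx₀
  set Q := (Submodule.span ℝ {e})ᗮ.orthogonalProjectionOnto
  set H : Eu n → ℝ := fun x => γ (Q x) - ⟪e, x⟫
  have hH : ContDiff ℝ 1 H := by
    refine (hγ.comp Q.contDiff).sub ?_
    exact contDiff_const.inner ℝ contDiff_id
  obtain ⟨K, s, hs, hK⟩ := (hH.contDiffAt (x := x₀)).exists_lipschitzOnWith
  obtain ⟨r', hr', hsub⟩ := Metric.mem_nhds_iff.1 hs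
  refine ⟨e, min r r', max K 1, H, lt_min hr hr', le_max_right _ _, he, hH, fun x s => ?_,
    fun x hx y hy => ?_, fun x hx => ?_⟩
  · have h0 : Q (s • e) = 0 :=
      Submodule.orthogonalProjectionOnto_orthogonal_apply_eq_zero
        (Submodule.smul_mem _ _ (Submodule.mem_span_singleton_self e))
    simp only [H, map_add, h0, add_zero, inner_add_right, inner_smul_right,
      real_inner_self_eq_norm_sq, he]
    ring
  · have h1 := hK.dist_le_mul x (hsub (Metric.ball_subset_ball (min_le_right _ _) hx)) y
      (hsub (Metric.ball_subset_ball (min_le_right _ _) hy))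
    rw [Real.dist_eq, dist_eq_norm] at h1
    exact h1.trans (mul_le_mul_of_nonneg_right (le_max_left _ _) (norm_nonneg _))
  · rw [hmem x (Metric.ball_subset_ball (min_le_left _ _) hx)]
    simp [H, Q]

namespace Chart

variable {U : Set (Eu n)} {x₀ e : Eu n} {r M : ℝ} {H : Eu n → ℝ}

theorem shift_sub (h : Chart U x₀ e r M H) (x : Eu n) (s : ℝ) : H (x - s • e) = H x + s := by
  rw [sub_eq_add_neg, ← neg_smul, h.shift]; ring

theorem nonneg_of_mem_closure (h : Chart U x₀ e r M H) {x : Eu n} (hx : x ∈ Metric.ball x₀ r)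
    (hxU : x ∈ closure U) : 0 ≤ H x := by
  by_contra! hlt
  have hopen : IsOpen (Metric.ball x₀ r ∩ H ⁻¹' Iio 0) :=
    Metric.isOpen_ball.inter (isOpen_Iio.preimage h.contDiff.continuous)
  obtain ⟨y, ⟨hy1, hy2⟩, hyU⟩ := mem_closure_iff.1 hxU _ hopen ⟨hx, hlt⟩
  have := (h.mem_iff y hy1).1 hyU
  exact absurd this (not_lt.2 (le_of_lt hy2))

theorem eq_zero_of_mem_frontier (h : Chart U x₀ e r M H) (hU : IsOpen U) {x : Eu n}
    (hx : x ∈ Metric.ball x₀ r) (hxU : x ∈ frontier U) : H x = 0 := by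
  rw [hU.frontier_eq] at hxU
  refine le_antisymm ?_ (h.nonneg_of_mem_closure hx hxU.1)
  exact not_lt.1 fun hlt => hxU.2 ((h.mem_iff x hx).2 hlt)

/-- The inner cone property. -/
theorem sub_mem (h : Chart U x₀ e r M H) {x z : Eu n} {s c : ℝ}
    (hx : x ∈ Metric.ball x₀ (r / 2)) (hxU : x ∈ closure U) (hs : 0 < s) (hs' : s ≤ r / 4)
    (hc : c ≤ 1) (hMc : M * c < 1) (hz : ‖z - s • e‖ ≤ c * s) : x - z ∈ U := by
  have hr := h.r_pos
  have hes : ‖s • e‖ = s := by rw [norm_smul, h.norm_e, mul_one, Real.norm_of_nonneg hs.le]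
  have hzn : ‖z‖ ≤ 2 * s := by
    calc ‖z‖ = ‖(z - s • e) + s • e‖ := by simp
      _ ≤ ‖z - s • e‖ + ‖s • e‖ := norm_add_le _ _
      _ ≤ c * s + s := by rw [hes]; linarith
      _ ≤ 2 * s := by nlinarith
  rw [Metric.mem_ball, dist_eq_norm] at hx
  have hmem : ∀ y : Eu n, ‖y‖ ≤ 2 * s → x - y ∈ Metric.ball x₀ r := fun y hy => by
    rw [Metric.mem_ball, dist_eq_norm]
    calc ‖x - y - x₀‖ = ‖(x - x₀) - y‖ := by congr 1; abel
      _ ≤ ‖x - x₀‖ + ‖y‖ := norm_sub_le _ _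
      _ < r := by linarith
  rw [h.mem_iff _ (hmem z hzn)]
  have hxr : x ∈ Metric.ball x₀ r := by simpa using hmem 0 (by simp; linarith)
  -- The translation by `-s • e` raises `H` by exactly `s`; the remainder, of norm at most `c s`,
  -- lowers it by at most `M c s < s`.
  have e1 : x - z = (x - (z - s • e)) - s • e := by abel
  rw [e1, h.shift_sub]
  have h2 := h.lip (x - (z - s • e)) (hmem _ (hz.trans (by nlinarith))) x hxr
  have h3 := h.nonneg_of_mem_closure hxr hxU
  have h4 : ‖x - (z - s • e) - x‖ = ‖z - s • e‖ := by rw [sub_sub_cancel_left, norm_neg]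
  rw [h4] at h2
  have h5 : M * ‖z - s • e‖ ≤ M * (c * s) :=
    mul_le_mul_of_nonneg_left hz (by linarith [h.one_le_M])
  have h6 := (abs_le.1 h2).1
  nlinarith

theorem sub_smul_mem (h : Chart U x₀ e r M H) {x : Eu n} {s : ℝ}
    (hx : x ∈ Metric.ball x₀ (r / 2)) (hxU : x ∈ closure U) (hs : 0 < s) (hs' : s ≤ r / 4) :
    x - s • e ∈ U :=
  h.sub_mem (c := 0) hx hxU hs hs' zero_le_one (by simp) (by simp)

end Chart

/-- The `W^{1,1}` norm of a smooth function. -/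
def sobNorm (U : Set (Eu n)) (f : Eu n → ℝ) : ℝ≥0∞ :=
  ∫⁻ x in U, (‖f x‖ₑ + ‖fderiv ℝ f x‖ₑ)

/-- By the fundamental theorem of calculus, `|f x|` is at most `|f(x - s e)|` plus the integral of
the derivative along the segment. Averaging over `s ∈ (0, s₀)` replaces the point value by an
integral, at the price of the factor `1/s₀`. -/
theorem enorm_le_lintegral_line {f : Eu n → ℝ} (hf : ContDiff ℝ 1 f) {e : Eu n} (he : ‖e‖ = 1)
    (x : Eu n) {s₀ : ℝ} (hs₀ : 0 < s₀) :
    ‖f x‖ₑ ≤ ENNReal.ofReal (1 / s₀ + 1) *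
      ∫⁻ s in Ioo 0 s₀, (‖f (x - s • e)‖ₑ + ‖fderiv ℝ f (x - s • e)‖ₑ) := by
  have hline : Continuous fun s : ℝ => x - s • e := by fun_prop
  have hdf : Continuous (fderiv ℝ f) := hf.continuous_fderiv one_ne_zero
  have hm1 : Measurable fun s : ℝ => ‖f (x - s • e)‖ₑ := (hf.continuous.comp hline).enorm.measurable
  have hm2 : Measurable fun s : ℝ => ‖fderiv ℝ f (x - s • e)‖ₑ := (hdf.comp hline).enorm.measurable
  set I := ∫⁻ s in Ioo 0 s₀, ‖fderiv ℝ f (x - s • e)‖ₑ with hI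
  have key : ∀ s ∈ Ioo 0 s₀, ‖f x‖ₑ ≤ ‖f (x - s • e)‖ₑ + I := fun s hs => by
    have hder : ∀ τ ∈ uIcc 0 s, HasDerivAt (fun τ : ℝ => f (x - τ • e))
        (fderiv ℝ f (x - τ • e) (-e)) τ := fun τ _ => by
      have h1 := (hf.differentiable one_ne_zero (x - τ • e)).hasFDerivAt
      refine h1.comp_hasDerivAt τ ?_
      simpa using ((hasDerivAt_id τ).smul_const e).const_sub x
    have hint : IntervalIntegrable (fun τ : ℝ => fderiv ℝ f (x - τ • e) (-e)) volume 0 s :=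
      ((hdf.comp hline).clm_apply continuous_const).intervalIntegrable _ _
    have hftc := intervalIntegral.integral_eq_sub_of_hasDerivAt hder hint
    simp only [zero_smul, sub_zero] at hftc
    have hle : ‖f (x - s • e) - f x‖ₑ ≤ I := by
      rw [← hftc, intervalIntegral.integral_of_le hs.1.le]
      refine (enorm_integral_le_lintegral_enorm _).trans ?_
      rw [hI, restrict_Ioo_eq_restrict_Ioc]
      refine (lintegral_mono fun τ => ?_).trans
        (lintegral_mono_set (Ioc_subset_Ioc_right hs.2.le))
      have := (fderiv ℝ f (x - τ • e)).le_opENorm (-e)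
      rwa [enorm_neg, ← ofReal_norm e, he, ENNReal.ofReal_one, mul_one] at this
    calc ‖f x‖ₑ = ‖f (x - s • e) - (f (x - s • e) - f x)‖ₑ := by simp
      _ ≤ ‖f (x - s • e)‖ₑ + ‖f (x - s • e) - f x‖ₑ := enorm_sub_le
      _ ≤ _ := by gcongr
  have h2 : ‖f x‖ₑ * ENNReal.ofReal s₀ ≤
      (∫⁻ s in Ioo 0 s₀, ‖f (x - s • e)‖ₑ) + I * ENNReal.ofReal s₀ := by
    have := setLIntegral_mono' (μ := volume) measurableSet_Ioo key
    rw [lintegral_add_left hm1] at this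
    simpa using this
  have hs0 : ENNReal.ofReal s₀ ≠ 0 := by simpa using hs₀
  rw [lintegral_add_left hm1, ← ENNReal.mul_le_mul_iff_left hs0 ENNReal.ofReal_ne_top]
  refine h2.trans ?_
  have h3 : ENNReal.ofReal (1 / s₀ + 1) * ENNReal.ofReal s₀ = ENNReal.ofReal (1 + s₀) := by
    rw [← ENNReal.ofReal_mul (by positivity)]; congr 1; field_simp
  set J := ∫⁻ s in Ioo 0 s₀, ‖f (x - s • e)‖ₑ
  calc J + I * ENNReal.ofReal s₀ ≤ 1 * (J + I) + ENNReal.ofReal s₀ * (J + I) := by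
        rw [one_mul, mul_comm I]; gcongr <;> simp
    _ = ENNReal.ofReal (1 + s₀) * (J + I) := by
        rw [← add_mul, ENNReal.ofReal_add zero_le_one hs₀.le, ENNReal.ofReal_one]
    _ = _ := by rw [mul_right_comm, h3]

end ForchheimerGas

end

/-! ### Boundary layers and the local trace inequality. -/

noncomputable section

namespace ForchheimerGas

variable {n : ℕ}

namespace Chart

variable {U : Set (Eu n)} {x₀ e : Eu n} {r M : ℝ} {H : Eu n → ℝ}

/-- A smooth function on `U` is controlled in thin layers along the boundary. -/
theorem lintegral_layer_le (h : Chart U x₀ e r M H) (hU : IsOpen U) {f : Eu n → ℝ}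
    (hf : ContDiff ℝ 1 f) (ε : ℝ) :
    ∫⁻ x in {x | x ∈ U ∩ Metric.ball x₀ (r / 2) ∧ H x < ε}, ‖f x‖ₑ ≤
      ENNReal.ofReal (1 / (r / 4) + 1) * (ENNReal.ofReal ε * sobNorm U f) := by
  have hr := h.r_pos
  set s₀ := r / 4 with hs₀
  have hs₀p : 0 < s₀ := by positivity
  set A := {x | x ∈ U ∩ Metric.ball x₀ (r / 2) ∧ H x < ε} with hA
  have hAm : MeasurableSet A := ((hU.inter Metric.isOpen_ball).inter
    (isOpen_Iio.preimage h.contDiff.continuous)).measurableSet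
  set k : Eu n → ℝ≥0∞ := fun y => ‖f y‖ₑ + ‖fderiv ℝ f y‖ₑ with hk
  have hkm : Measurable k := (hf.continuous.enorm.add
    (hf.continuous_fderiv one_ne_zero).enorm).measurable
  set g := U.indicator k
  have hgm : Measurable g := hkm.indicator hU.measurableSet
  have h1 : ∀ x ∈ A, ‖f x‖ₑ ≤ ENNReal.ofReal (1 / s₀ + 1) *
      ∫⁻ s in Ioo 0 s₀, A.indicator 1 x * g (x - s • e) := fun x hx => by
    refine (enorm_le_lintegral_line hf h.norm_e x hs₀p).trans_eq ?_
    congr 1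
    refine setLIntegral_congr_fun measurableSet_Ioo fun s hs => ?_
    have : x - s • e ∈ U := h.sub_smul_mem hx.1.2 (subset_closure hx.1.1) hs.1 hs.2.le
    simp [hx, g, this, k]
  have hjm : Measurable fun z : Eu n × ℝ => A.indicator (1 : Eu n → ℝ≥0∞) z.1 * g (z.1 - z.2 • e) :=
    ((measurable_one.indicator hAm).comp measurable_fst).mul
      (hgm.comp (by fun_prop))
  calc ∫⁻ x in A, ‖f x‖ₑ ≤ ∫⁻ x in A, ENNReal.ofReal (1 / s₀ + 1) *
        ∫⁻ s in Ioo 0 s₀, A.indicator 1 x * g (x - s • e) := setLIntegral_mono' hAm h1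
    _ ≤ ENNReal.ofReal (1 / s₀ + 1) * ∫⁻ x, ∫⁻ s, A.indicator 1 x * g (x - s • e) := by
        rw [lintegral_const_mul' _ _ ENNReal.ofReal_ne_top]
        exact mul_le_mul' le_rfl ((setLIntegral_le_lintegral _ _).trans
          (lintegral_mono fun x => setLIntegral_le_lintegral _ _))
    _ = ENNReal.ofReal (1 / s₀ + 1) * ∫⁻ s : ℝ, ∫⁻ x, A.indicator 1 x * g (x - s • e) := by
        rw [lintegral_lintegral_swap]; exact hjm.aemeasurable
    _ = ENNReal.ofReal (1 / s₀ + 1) * ∫⁻ s : ℝ, ∫⁻ y, A.indicator 1 (y + s • e) * g y := by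
        congr 1
        refine lintegral_congr fun s => ?_
        rw [← lintegral_add_right_eq_self (fun x => A.indicator 1 x * g (x - s • e)) (s • e)]
        simp
    _ = ENNReal.ofReal (1 / s₀ + 1) * ∫⁻ y, ∫⁻ s : ℝ, A.indicator 1 (y + s • e) * g y := by
        rw [lintegral_lintegral_swap]
        exact (((measurable_one.indicator hAm).comp (by fun_prop)).mul
          (hgm.comp measurable_snd)).aemeasurable
    _ ≤ ENNReal.ofReal (1 / s₀ + 1) * ∫⁻ y, ENNReal.ofReal ε * g y := by
        gcongr with y
        have hm : Measurable fun s : ℝ => A.indicator (1 : Eu n → ℝ≥0∞) (y + s • e) :=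
          (measurable_one.indicator hAm).comp (by fun_prop)
        rw [lintegral_mul_const _ hm]
        gcongr
        -- Since `H` decreases with unit speed along `e`, every line in that direction meets the
        -- layer `0 < H < ε` in a set of length at most `ε`.
        have : ∀ s : ℝ, A.indicator (1 : Eu n → ℝ≥0∞) (y + s • e) ≤
            (Ioo (H y - ε) (H y)).indicator 1 s := fun s => by
          by_cases hs : y + s • e ∈ A
          swap
          · simp [hs]
          have h2 : 0 < H (y + s • e) := (h.mem_iff _ (Metric.ball_subset_ball (by linarith)
            hs.1.2)).1 hs.1.1
          have h3 := hs.2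
          rw [h.shift] at h2 h3
          have h4 : s ∈ Ioo (H y - ε) (H y) := ⟨by linarith, by linarith⟩
          simp [hs, h4]
        refine (lintegral_mono this).trans ?_
        rw [lintegral_indicator_one measurableSet_Ioo, Real.volume_Ioo]
        simp
    _ = _ := by
        rw [lintegral_const_mul _ hgm, lintegral_indicator hU.measurableSet, sobNorm]

/-- Split `x - y = q e + w` with `w` orthogonal to `e`. The height vanishes at `x` and `y`, so it
equals `-q` at `y + q e`; this point differs from `x` by `w`, and the Lipschitz bound gives `|q| ≤ M
‖w‖`. Near `x₀` the boundary is therefore a Lipschitz graph over the hyperplane. The radius `r / 4`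
keeps `y + q e` inside the chart. -/
theorem norm_sub_le_of_frontier (h : Chart U x₀ e r M H) (hU : IsOpen U) {x y : Eu n}
    (hx : x ∈ frontier U ∩ Metric.ball x₀ (r / 4)) (hy : y ∈ frontier U ∩ Metric.ball x₀ (r / 4)) :
    ‖x - y‖ ≤ (1 + M) * ‖(Submodule.span ℝ {e})ᗮ.orthogonalProjectionOnto (x - y)‖ := by
  have hr := h.r_pos
  have hM := h.one_le_M
  set q := ⟪e, x - y⟫ with hq
  have hdec : x - y = q • e + ((Submodule.span ℝ {e})ᗮ.orthogonalProjectionOnto (x - y) : Eu n) := by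
    have := (Submodule.span ℝ {e}).starProjection_add_starProjection_orthogonal (x - y)
    rw [Submodule.starProjection_unit_singleton ℝ h.norm_e] at this
    exact this.symm
  set w := (Submodule.span ℝ {e})ᗮ.orthogonalProjectionOnto (x - y)
  have hqe : ‖q • e‖ = |q| := by rw [norm_smul, h.norm_e, mul_one, Real.norm_eq_abs]
  have hx1 := Metric.mem_ball.1 hx.2
  have hy1 := Metric.mem_ball.1 hy.2
  have hxy : ‖x - y‖ < r / 2 := by
    rw [← dist_eq_norm]
    calc dist x y ≤ dist x x₀ + dist y x₀ := dist_triangle_right _ _ _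
      _ < r / 2 := by linarith
  have hq1 : |q| < r / 2 := by
    refine lt_of_le_of_lt (abs_real_inner_le_norm _ _) ?_
    rwa [h.norm_e, one_mul]
  have hxr : x ∈ Metric.ball x₀ r := Metric.ball_subset_ball (by linarith) hx.2
  have hyr : y ∈ Metric.ball x₀ r := Metric.ball_subset_ball (by linarith) hy.2
  have hyq : y + q • e ∈ Metric.ball x₀ r := by
    rw [dist_eq_norm] at hy1
    rw [Metric.mem_ball, dist_eq_norm]
    calc ‖y + q • e - x₀‖ = ‖(y - x₀) + q • e‖ := by congr 1; abel
      _ ≤ ‖y - x₀‖ + ‖q • e‖ := norm_add_le _ _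
      _ < r := by rw [hqe]; linarith
  have h1 := h.lip x hxr _ hyq
  rw [h.shift, h.eq_zero_of_mem_frontier hU hxr hx.1, h.eq_zero_of_mem_frontier hU hyr hy.1] at h1
  have h2 : x - (y + q • e) = w := by rw [← sub_sub, hdec]; abel
  rw [h2] at h1
  simp only [zero_sub, neg_neg] at h1
  rw [hdec]
  calc ‖q • e + (w : Eu n)‖ ≤ |q| + ‖(w : Eu n)‖ := by rw [← hqe]; exact norm_add_le _ _
    _ ≤ M * ‖(w : Eu n)‖ + ‖(w : Eu n)‖ := by gcongr
    _ = (1 + M) * ‖w‖ := by rw [Submodule.coe_norm]; ring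

/-- On this piece of the boundary the projection has a `(1 + M)`-Lipschitz inverse, and such a map
enlarges the `(n-1)`-dimensional Hausdorff measure by at most `(1 + M)^{n-1}`. On the hyperplane
that measure is Lebesgue measure. -/
theorem map_surface_le (h : Chart U x₀ e r M H) (hn : 2 ≤ n) (hU : IsOpen U) :
    Measure.map (Submodule.span ℝ {e})ᗮ.orthogonalProjectionOnto
      ((μHE[n - 1] : Measure (Eu n)).restrict (frontier U ∩ Metric.ball x₀ (r / 4))) ≤
    (ENNReal.ofReal (1 + M) ^ (n - 1)) • (volume : Measure ((Submodule.span ℝ {e})ᗮ : Submodule ℝ (Eu n))) := by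
  have hM := h.one_le_M
  set Q := (Submodule.span ℝ {e})ᗮ.orthogonalProjectionOnto
  have hfin : Module.finrank ℝ ((Submodule.span ℝ {e})ᗮ : Submodule ℝ (Eu n)) = n - 1 := by
    have : Fact (Module.finrank ℝ (Eu n) = (n - 1) + 1) := ⟨by simp; omega⟩
    exact Submodule.finrank_orthogonal_span_singleton (by
      intro h0; have := h.norm_e; simp [h0] at this)
  rw [← InnerProductSpace.euclideanHausdorffMeasure_eq_volume, hfin]
  refine Measure.le_iff.2 fun S hS => ?_
  set A := Q ⁻¹' S ∩ (frontier U ∩ Metric.ball x₀ (r / 4))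
  rw [Measure.map_apply Q.continuous.measurable hS,
    Measure.restrict_apply (Q.continuous.measurable hS)]
  have hG : LipschitzOnWith (Real.toNNReal (1 + M)) (Function.invFunOn Q A) (Q '' A) := by
    refine LipschitzOnWith.of_dist_le_mul ?_
    intro y hy z hz
    have hy1 := Function.invFunOn_mem hy
    have hz1 := Function.invFunOn_mem hz
    have := h.norm_sub_le_of_frontier hU hy1.2 hz1.2
    rw [map_sub] at this
    change _ ≤ _ * ‖Q _ - Q _‖ at this
    rw [Function.invFunOn_eq hy, Function.invFunOn_eq hz] at this
    rwa [dist_eq_norm, dist_eq_norm, Real.coe_toNNReal _ (by linarith)]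
  have himg : A ⊆ Function.invFunOn Q A '' (Q '' A) := fun x hx => by
    refine ⟨Q x, mem_image_of_mem _ hx, ?_⟩
    have hy1 := Function.invFunOn_mem (mem_image_of_mem Q hx)
    have := h.norm_sub_le_of_frontier hU hy1.2 hx.2
    rw [map_sub] at this
    change _ ≤ _ * ‖Q _ - Q _‖ at this
    rw [Function.invFunOn_eq (mem_image_of_mem Q hx), sub_self, norm_zero, mul_zero] at this
    exact sub_eq_zero.1 (norm_le_zero_iff.1 this)
  rw [Measure.euclideanHausdorffMeasure_def, Measure.euclideanHausdorffMeasure_def,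
    Measure.smul_apply, Measure.smul_apply, Measure.smul_apply, ENNReal.smul_def,
    smul_eq_mul, smul_eq_mul, ENNReal.smul_def, smul_eq_mul, mul_left_comm]
  gcongr
  calc μH[((n - 1 : ℕ) : ℝ)] A ≤ μH[((n - 1 : ℕ) : ℝ)] (Function.invFunOn Q A '' (Q '' A)) :=
        measure_mono himg
    _ ≤ _ := hG.hausdorffMeasure_image_le (Nat.cast_nonneg _)
    _ ≤ _ := by
      rw [ENNReal.rpow_natCast]
      refine mul_le_mul' le_rfl (measure_mono ?_)
      rintro _ ⟨x, hx, rfl⟩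
      exact hx.1

end Chart

/-- Lebesgue measure is comparable to the product measure in an orthogonal splitting. -/
theorem exists_lintegral_split_le {e : Eu n} (he : ‖e‖ = 1) : ∃ C : ℝ≥0∞, C ≠ ⊤ ∧
    ∀ g : Eu n → ℝ≥0∞, Measurable g →
      ∫⁻ y : ((Submodule.span ℝ {e})ᗮ : Submodule ℝ (Eu n)), ∫⁻ s : ℝ, g (y + s • e) ≤
        C * ∫⁻ x, g x := by
  set V := ((Submodule.span ℝ {e})ᗮ : Submodule ℝ (Eu n))
  let Θ : (V × ℝ) ≃ₗ[ℝ] Eu n :=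
    { toFun := fun z => (z.1 : Eu n) + z.2 • e
      map_add' := fun a b => by simp only [Prod.fst_add, Prod.snd_add, Submodule.coe_add]; module
      map_smul' := fun c a => by
        simp only [Prod.smul_fst, Prod.smul_snd, Submodule.coe_smul, RingHom.id_apply, smul_eq_mul]
        module
      invFun := fun x => (V.orthogonalProjectionOnto x, ⟪e, x⟫)
      left_inv := fun z => by
        have h1 : ⟪e, (z.1 : Eu n)⟫ = 0 :=
          Submodule.mem_orthogonal_singleton_iff_inner_right.1 z.1.2
        have h2 : V.orthogonalProjectionOnto (z.2 • e) = 0 :=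
          Submodule.orthogonalProjectionOnto_orthogonal_apply_eq_zero
            (Submodule.smul_mem _ _ (Submodule.mem_span_singleton_self e))
        ext1
        · simp [h2]
        · simp [inner_add_right, h1, inner_smul_right, he]
      right_inv := fun x => by
        have := (Submodule.span ℝ {e}).starProjection_add_starProjection_orthogonal x
        rw [Submodule.starProjection_unit_singleton ℝ he, add_comm] at this
        exact this }
  set ν := ((volume : Measure V).prod (volume : Measure ℝ)).map Θ
  -- A linear isomorphism carries Haar measure to Haar measure, so uniqueness supplies the constant;
  -- its exact value plays no role.
  have hν : ν.IsAddHaarMeasure := Θ.toContinuousLinearEquiv.isAddHaarMeasure_map _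
  refine ⟨ν.addHaarScalarFactor volume, ENNReal.coe_ne_top, fun g hg => ?_⟩
  have hΘ : Measurable Θ := Θ.toContinuousLinearEquiv.continuous.measurable
  have h1 : ∫⁻ y : V, ∫⁻ s : ℝ, g (y + s • e) = ∫⁻ x, g x ∂ν := by
    rw [lintegral_map hg hΘ]
    exact (lintegral_prod (fun z => g (Θ z)) (hg.comp hΘ).aemeasurable).symm
  have h2 : ∫⁻ x, g x ∂ν = ∫⁻ x, g x ∂(ν.addHaarScalarFactor volume • (volume : Measure (Eu n))) :=
    congrArg (fun μ => ∫⁻ x, g x ∂μ) (Measure.isAddLeftInvariant_eq_smul ν volume)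
  rw [h1, h2, lintegral_smul_measure]
  exact le_of_eq rfl

/-- The local trace inequality. -/
theorem Chart.exists_trace_le {U : Set (Eu n)} {x₀ e : Eu n} {r M : ℝ} {H : Eu n → ℝ}
    (h : Chart U x₀ e r M H) (hn : 2 ≤ n) (hU : IsOpen U) : ∃ C : ℝ≥0∞, C ≠ ⊤ ∧
    ∀ f : Eu n → ℝ, ContDiff ℝ 1 f →
      ∫⁻ x in frontier U ∩ Metric.ball x₀ (r / 4), ‖f x‖ₑ ∂(μHE[n - 1] : Measure (Eu n)) ≤
        C * sobNorm U f := by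
  have hr := h.r_pos
  obtain ⟨C, hC, hsplit⟩ := exists_lintegral_split_le h.norm_e
  set s₀ := r / 4 with hs₀
  have hs₀p : 0 < s₀ := by positivity
  refine ⟨ENNReal.ofReal (1 / s₀ + 1) * (ENNReal.ofReal (1 + M) ^ (n - 1) * C),
    ENNReal.mul_ne_top ENNReal.ofReal_ne_top (ENNReal.mul_ne_top
      (ENNReal.pow_ne_top ENNReal.ofReal_ne_top) hC), fun f hf => ?_⟩
  set V := ((Submodule.span ℝ {e})ᗮ : Submodule ℝ (Eu n))
  set A := frontier U ∩ Metric.ball x₀ s₀ with hA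
  have hAm : MeasurableSet A := isClosed_frontier.measurableSet.inter measurableSet_ball
  set k : Eu n → ℝ≥0∞ := fun y => ‖f y‖ₑ + ‖fderiv ℝ f y‖ₑ with hk
  have hkm : Measurable k := (hf.continuous.enorm.add
    (hf.continuous_fderiv one_ne_zero).enorm).measurable
  set g := U.indicator k
  have hgm : Measurable g := hkm.indicator hU.measurableSet
  set J : V → ℝ≥0∞ := fun y => ∫⁻ s : ℝ, g (y + s • e) with hJ
  have hJm : Measurable J := by
    refine Measurable.lintegral_prod_right' (f := fun z : V × ℝ => g (z.1 + z.2 • e)) ?_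
    exact hgm.comp (by fun_prop)
  -- The segment from a boundary point into `U` lies on the full line over its projection, so the
  -- value at `x` is bounded by a function of the projection alone. The surface integral can then be
  -- pushed to the hyperplane.
  have h1 : ∀ x ∈ A, ‖f x‖ₑ ≤ ENNReal.ofReal (1 / s₀ + 1) * J (V.orthogonalProjectionOnto x) := by
    intro x hx
    refine (enorm_le_lintegral_line hf h.norm_e x hs₀p).trans ?_
    gcongr
    have h2 : ∫⁻ s in Ioo 0 s₀, (‖f (x - s • e)‖ₑ + ‖fderiv ℝ f (x - s • e)‖ₑ) =
        ∫⁻ s in Ioo 0 s₀, g (x - s • e) := by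
      refine setLIntegral_congr_fun measurableSet_Ioo fun s hs => ?_
      have : x - s • e ∈ U := h.sub_smul_mem (Metric.ball_subset_ball (by linarith) hx.2)
        (frontier_subset_closure hx.1) hs.1 hs.2.le
      simp [g, this, k]
    rw [h2]
    refine (setLIntegral_le_lintegral _ _).trans_eq ?_
    rw [hJ]
    simp only
    rw [← lintegral_sub_left_eq_self _ ⟪e, x⟫]
    refine lintegral_congr fun s => ?_
    congr 1
    have := (Submodule.span ℝ {e}).starProjection_add_starProjection_orthogonal x
    rw [Submodule.starProjection_unit_singleton ℝ h.norm_e] at this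
    nth_rw 1 [← this]
    rw [sub_smul]
    change _ = V.starProjection x + _
    abel
  have hQm : Measurable V.orthogonalProjectionOnto := V.orthogonalProjectionOnto.continuous.measurable
  calc ∫⁻ x in A, ‖f x‖ₑ ∂(μHE[n - 1] : Measure (Eu n))
      ≤ ∫⁻ x in A, ENNReal.ofReal (1 / s₀ + 1) * J (V.orthogonalProjectionOnto x)
          ∂(μHE[n - 1] : Measure (Eu n)) := setLIntegral_mono' hAm h1
    _ = ENNReal.ofReal (1 / s₀ + 1) * ∫⁻ y, J y ∂(Measure.map V.orthogonalProjectionOnto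
          ((μHE[n - 1] : Measure (Eu n)).restrict A)) := by
        rw [lintegral_const_mul' _ _ ENNReal.ofReal_ne_top, lintegral_map hJm hQm]
    _ ≤ ENNReal.ofReal (1 / s₀ + 1) * ∫⁻ y, J y ∂((ENNReal.ofReal (1 + M) ^ (n - 1)) •
          (volume : Measure V)) := by
        exact mul_le_mul' le_rfl (lintegral_mono' (h.map_surface_le hn hU) le_rfl)
    _ ≤ ENNReal.ofReal (1 / s₀ + 1) * (ENNReal.ofReal (1 + M) ^ (n - 1) * (C * ∫⁻ x, g x)) := by
        rw [lintegral_smul_measure, smul_eq_mul]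
        gcongr
        exact hsplit g hgm
    _ = _ := by
        rw [lintegral_indicator hU.measurableSet, sobNorm]; ring

end ForchheimerGas

end

/-! ### Trace and Sobolev inequalities for smooth functions. -/

noncomputable section

namespace ForchheimerGas

open scoped Manifold ContDiff

variable {n : ℕ}

/-- A finite family of boundary charts with a subordinate partition of unity. -/
structure Atlas (U : Set (Eu n)) where
  ι : Finset (Eu n)
  e : Eu n → Eu n
  r : Eu n → ℝ
  M : Eu n → ℝ
  H : Eu n → Eu n → ℝ
  chart : ∀ i ∈ ι, Chart U i (e i) (r i) (M i) (H i)
  cover : frontier U ⊆ ⋃ i ∈ ι, Metric.ball i (r i / 4)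
  bump : Option ι → Eu n → ℝ
  bump_contDiff : ∀ o, ContDiff ℝ 1 (bump o)
  bump_compact : ∀ o, HasCompactSupport (bump o)
  bump_none : tsupport (bump none) ⊆ U
  bump_some : ∀ i : ι, tsupport (bump (some i)) ⊆ Metric.ball i (r i / 4)
  bump_sum : ∀ x ∈ closure U, ∑ o, bump o x = 1

/-- Compactness of the boundary gives finitely many quarter-balls; `U` itself completes them to an
open cover of `closure U`. Quarter radii leave room for the cone and layer estimates, which move
inside the larger balls of the charts. -/
theorem exists_atlas {U : Set (Eu n)} (hU : IsOpen U) (hb : Bornology.IsBounded U)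
    (hC : HasC1Boundary U) : Nonempty (Atlas U) := by
  classical
  have hcomp : IsCompact (closure U) := hb.isCompact_closure
  have hfr : IsCompact (frontier U) := hcomp.of_isClosed_subset isClosed_frontier
    frontier_subset_closure
  choose! e r M H hch using fun (x : Eu n) (hx : x ∈ frontier U) => hC.exists_chart hx
  obtain ⟨t, htf, htc⟩ := hfr.elim_nhds_subcover (fun x => Metric.ball x (r x / 4))
    (fun x hx => Metric.ball_mem_nhds x (by have := (hch x hx).r_pos; positivity))
  let V : Option t → Set (Eu n) := fun o => o.elim U fun i => Metric.ball i (r i / 4)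
  obtain ⟨f, hf⟩ := SmoothPartitionOfUnity.exists_isSubordinate 𝓘(ℝ, Eu n)
    (isClosed_closure (s := U)) V (by
      rintro (_ | i)
      · exact hU
      · exact Metric.isOpen_ball) (by
      intro x hx
      by_cases hxU : x ∈ U
      · exact mem_iUnion.2 ⟨none, hxU⟩
      · have : x ∈ frontier U := by rw [hU.frontier_eq]; exact ⟨hx, hxU⟩
        obtain ⟨i, hi, hxi⟩ := mem_iUnion₂.1 (htc this)
        exact mem_iUnion.2 ⟨some ⟨i, hi⟩, hxi⟩)
  refine ⟨⟨t, e, r, M, H, fun i hi => hch i (htf i hi), htc, fun o => f o, fun o => ?_,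
    fun o => ?_, hf none, fun i => hf (some i), fun x hx => ?_⟩⟩
  · exact ((f o).contMDiff.contDiff).of_le (by exact_mod_cast le_top)
  · have hbV : Bornology.IsBounded (V o) := by
      rcases o with (_ | i)
      · exact hb
      · exact Metric.isBounded_ball
    exact Metric.isCompact_of_isClosed_isBounded (isClosed_tsupport _) (hbV.subset (hf o))
  · rw [← f.sum_eq_one hx, finsum_eq_sum_of_fintype]

/-- Outside `(0, 1)` the transition sits at its global minimum or maximum, so its derivative
vanishes there; on `[0, 1]` compactness applies. -/
theorem exists_smoothTransition_deriv_le : ∃ C : ℝ, 0 < C ∧ ∀ x, |deriv Real.smoothTransition x| ≤ C := by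
  have hc : Continuous (deriv Real.smoothTransition) :=
    (Real.smoothTransition.contDiff (n := 1)).continuous_deriv le_rfl
  obtain ⟨C, hC⟩ := (isCompact_Icc (a := (0 : ℝ)) (b := 1)).exists_bound_of_continuousOn
    hc.continuousOn
  refine ⟨max C 1, by positivity, fun x => ?_⟩
  rcases le_or_gt x 0 with h | h
  · have : IsLocalMin Real.smoothTransition x := Eventually.of_forall fun y => by
      rw [Real.smoothTransition.zero_of_nonpos h]; exact Real.smoothTransition.nonneg y
    simp [this.deriv_eq_zero]
  rcases le_or_gt 1 x with h1 | h1
  · have : IsLocalMax Real.smoothTransition x := Eventually.of_forall fun y => by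
      rw [Real.smoothTransition.one_of_one_le h1]; exact Real.smoothTransition.le_one y
    simp [this.deriv_eq_zero]
  · exact (hC x ⟨h.le, h1.le⟩).trans (le_max_left _ _)

theorem deriv_smoothTransition_eq_zero {x : ℝ} (hx : x ≤ 0 ∨ 1 ≤ x) :
    deriv Real.smoothTransition x = 0 := by
  rcases hx with h | h
  · have : IsLocalMin Real.smoothTransition x := Eventually.of_forall fun y => by
      rw [Real.smoothTransition.zero_of_nonpos h]; exact Real.smoothTransition.nonneg y
    exact this.deriv_eq_zero
  · have : IsLocalMax Real.smoothTransition x := Eventually.of_forall fun y => by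
      rw [Real.smoothTransition.one_of_one_le h]; exact Real.smoothTransition.le_one y
    exact this.deriv_eq_zero

theorem enorm_clm_zero : ‖(0 : Eu n →L[ℝ] ℝ)‖ₑ = 0 := by
  rw [← ofReal_norm, norm_zero, ENNReal.ofReal_zero]

theorem enorm_fderiv_mul_le {f g : Eu n → ℝ} {x : Eu n} (hf : DifferentiableAt ℝ f x)
    (hg : DifferentiableAt ℝ g x) :
    ‖fderiv ℝ (fun y => f y * g y) x‖ₑ ≤ ‖f x‖ₑ * ‖fderiv ℝ g x‖ₑ + ‖g x‖ₑ * ‖fderiv ℝ f x‖ₑ := by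
  rw [fderiv_fun_mul hf hg]
  rw [← ofReal_norm, ← ofReal_norm, ← ofReal_norm, ← ofReal_norm, ← ofReal_norm,
    ← ENNReal.ofReal_mul (norm_nonneg _), ← ENNReal.ofReal_mul (norm_nonneg _),
    ← ENNReal.ofReal_add (by positivity) (by positivity)]
  refine ENNReal.ofReal_le_ofReal ((norm_add_le _ _).trans_eq ?_)
  rw [norm_smul, norm_smul]

theorem exists_bump_bound {χ : Eu n → ℝ} (hχ : ContDiff ℝ 1 χ) (hc : HasCompactSupport χ) :
    ∃ C : ℝ≥0∞, C ≠ ⊤ ∧ ∀ x, ‖χ x‖ₑ ≤ C ∧ ‖fderiv ℝ χ x‖ₑ ≤ C := by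
  obtain ⟨C1, h1⟩ := hχ.continuous.bounded_above_of_compact_support hc
  obtain ⟨C2, h2⟩ := (hχ.continuous_fderiv one_ne_zero).bounded_above_of_compact_support
    (hc.fderiv ℝ)
  refine ⟨ENNReal.ofReal (max C1 C2), ENNReal.ofReal_ne_top, fun x => ⟨?_, ?_⟩⟩
  · rw [← ofReal_norm]; exact ENNReal.ofReal_le_ofReal ((h1 x).trans (le_max_left _ _))
  · rw [← ofReal_norm]; exact ENNReal.ofReal_le_ofReal ((h2 x).trans (le_max_right _ _))

/-- The exponent `n / (n - 1)`. -/
def sobExp (n : ℕ) : NNReal := n / (n - 1 : NNReal)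

theorem holderConjugate_sobExp (hn : 2 ≤ n) :
    NNReal.HolderConjugate (Module.finrank ℝ (Eu n)) (sobExp n) := by
  rw [finrank_euclideanSpace, Fintype.card_fin]
  have h1 : (1 : NNReal) < n := by exact_mod_cast hn
  exact NNReal.HolderConjugate.conjExponent h1

theorem one_le_sobExp (hn : 2 ≤ n) : (1 : ℝ≥0∞) ≤ sobExp n := by
  have := (holderConjugate_sobExp hn).symm.lt
  exact_mod_cast this.le

/-- Localized Sobolev inequality in the interior. -/
theorem exists_sobolev_bump {U : Set (Eu n)} (hn : 2 ≤ n) {χ : Eu n → ℝ} (hχ : ContDiff ℝ 1 χ)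
    (hc : HasCompactSupport χ) (hs : tsupport χ ⊆ U) : ∃ C : ℝ≥0∞, C ≠ ⊤ ∧
    ∀ f : Eu n → ℝ, ContDiff ℝ 1 f →
      eLpNorm (fun x => χ x * f x) (sobExp n) (volume.restrict U) ≤ C * sobNorm U f := by
  obtain ⟨D, hD, hDb⟩ := exists_bump_bound hχ hc
  refine ⟨eLpNormLESNormFDerivOneConst (volume : Measure (Eu n)) (sobExp n) * D,
    ENNReal.mul_ne_top ENNReal.coe_ne_top hD, fun f hf => ?_⟩
  calc eLpNorm (fun x => χ x * f x) (sobExp n) (volume.restrict U)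
      ≤ eLpNorm (fun x => χ x * f x) (sobExp n) volume := eLpNorm_restrict_le _ _ _ _
    _ ≤ eLpNormLESNormFDerivOneConst (volume : Measure (Eu n)) (sobExp n) *
        eLpNorm (fderiv ℝ fun x => χ x * f x) 1 volume :=
      eLpNorm_le_eLpNorm_fderiv_one volume (hχ.mul hf) hc.mul_right (holderConjugate_sobExp hn)
    _ ≤ eLpNormLESNormFDerivOneConst (volume : Measure (Eu n)) (sobExp n) * (D * sobNorm U f) := by
        gcongr
        rw [eLpNorm_one_eq_lintegral_enorm, sobNorm, ← lintegral_const_mul' _ _ hD]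
        rw [← setLIntegral_eq_of_support_subset (s := U)]
        · refine lintegral_mono fun x => ?_
          refine (enorm_fderiv_mul_le (hχ.differentiable one_ne_zero x)
            (hf.differentiable one_ne_zero x)).trans ?_
          rw [mul_add, add_comm, mul_comm D]
          gcongr
          · exact (hDb x).2
          · exact (hDb x).1
        · intro x hx
          refine hs ((tsupport_mul_subset_left (f := χ) (g := f)) ?_)
          refine (support_fderiv_subset ℝ (f := fun x => χ x * f x)) ?_
          intro h0
          rw [Function.mem_support, h0, ← ofReal_norm, norm_zero, ENNReal.ofReal_zero] at hx
          exact hx rfl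
    _ = _ := by ring

theorem Chart.norm_fderiv_le {U : Set (Eu n)} {x₀ e : Eu n} {r M : ℝ} {H : Eu n → ℝ}
    (h : Chart U x₀ e r M H) {x : Eu n} (hx : x ∈ Metric.ball x₀ r) : ‖fderiv ℝ H x‖ ≤ M := by
  refine norm_fderiv_le_of_lip' ℝ (by linarith [h.one_le_M]) ?_
  filter_upwards [Metric.isOpen_ball.mem_nhds hx] with y hy
  exact h.lip y hy x hx

/-- Localized Sobolev inequality at the boundary. -/
theorem Chart.exists_sobolev_bump {U : Set (Eu n)} (hU : IsOpen U) {x₀ e : Eu n} {r M : ℝ}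
    {H : Eu n → ℝ} (h : Chart U x₀ e r M H) (hn : 2 ≤ n) {χ : Eu n → ℝ} (hχ : ContDiff ℝ 1 χ)
    (hc : HasCompactSupport χ) (hs : tsupport χ ⊆ Metric.ball x₀ (r / 4)) : ∃ C : ℝ≥0∞, C ≠ ⊤ ∧
    ∀ f : Eu n → ℝ, ContDiff ℝ 1 f →
      eLpNorm (fun x => χ x * f x) (sobExp n) (volume.restrict U) ≤ C * sobNorm U f := by
  have hr := h.r_pos
  have hM := h.one_le_M
  obtain ⟨D, hD, hDb⟩ := exists_bump_bound hχ hc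
  obtain ⟨B, hB, hBb⟩ := exists_smoothTransition_deriv_le
  set K := eLpNormLESNormFDerivOneConst (volume : Measure (Eu n)) (sobExp n)
  refine ⟨K * (D + ENNReal.ofReal (B * M) * D * ENNReal.ofReal (1 / (r / 4) + 1)),
    by finiteness, fun f hf => ?_⟩
  -- Multiplying by this cut-off makes `χ f` vanish outside `U`, so the inequality on the whole
  -- space applies. The cut-off has gradient of size `1/ε`, but only on a layer of height `ε`, where
  -- the integral of `|f|` is `O(ε)`. The bound is thus uniform in `ε`, and it survives as `ε → 0`,
  -- when the cut-off tends to `1` on `U`.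
  let θ : ℝ → Eu n → ℝ := fun ε x => Real.smoothTransition (H x / ε)
  have hθc : ∀ ε, ContDiff ℝ 1 (θ ε) := fun ε =>
    Real.smoothTransition.contDiff.comp (h.contDiff.div_const ε)
  have hθd : ∀ ε x, fderiv ℝ (θ ε) x = (deriv Real.smoothTransition (H x / ε) / ε) • fderiv ℝ H x := by
    intro ε x
    have h1 : HasFDerivAt (fun y => H y / ε) (ε⁻¹ • fderiv ℝ H x) x := by
      simpa [div_eq_inv_mul] using
        ((h.contDiff.differentiable one_ne_zero x).hasFDerivAt.const_mul ε⁻¹)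
    have h2 : HasDerivAt Real.smoothTransition (deriv Real.smoothTransition (H x / ε)) (H x / ε) :=
      ((Real.smoothTransition.contDiff (n := 1)).differentiable one_ne_zero _).hasDerivAt
    have h3 := HasDerivAt.comp_hasFDerivAt (h₂ := Real.smoothTransition) x h2 h1
    refine HasFDerivAt.fderiv ?_
    rw [div_eq_mul_inv _ ε, ← smul_smul]
    exact h3
  have hgc : ∀ ε, ContDiff ℝ 1 (fun x => (χ x * f x) * θ ε x) := fun ε => (hχ.mul hf).mul (hθc ε)
  have hgs : ∀ ε, HasCompactSupport (fun x => (χ x * f x) * θ ε x) := fun ε =>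
    (hc.mul_right (f' := f)).mul_right
  have hbound : ∀ ε : ℝ, 0 < ε → eLpNorm (fun x => (χ x * f x) * θ ε x) (sobExp n)
      (volume.restrict U) ≤
      K * (D + ENNReal.ofReal (B * M) * D * ENNReal.ofReal (1 / (r / 4) + 1)) * sobNorm U f := by
    intro ε hε
    set A := {x | x ∈ U ∩ Metric.ball x₀ (r / 2) ∧ H x < ε} with hA
    have hAm : MeasurableSet A := ((hU.inter Metric.isOpen_ball).inter
      (isOpen_Iio.preimage h.contDiff.continuous)).measurableSet
    set k : Eu n → ℝ≥0∞ := fun y => ‖f y‖ₑ + ‖fderiv ℝ f y‖ₑ with hk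
    have hkm : Measurable k := (hf.continuous.enorm.add
      (hf.continuous_fderiv one_ne_zero).enorm).measurable
    have hpt : ∀ x, ‖fderiv ℝ (fun x => (χ x * f x) * θ ε x) x‖ₑ ≤
        U.indicator (fun x => D * k x) x +
          A.indicator (fun x => ENNReal.ofReal (B * M / ε) * D * ‖f x‖ₑ) x := by
      intro x
      by_cases hxs : x ∈ tsupport χ
      swap
      · have : fderiv ℝ (fun x => (χ x * f x) * θ ε x) x = 0 := by
          by_contra hne
          have h1 := support_fderiv_subset ℝ (f := fun x => (χ x * f x) * θ ε x)
            (Function.mem_support.2 hne)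
          exact hxs (tsupport_mul_subset_left (f := χ) (g := f)
            (tsupport_mul_subset_left (f := fun x => χ x * f x) (g := θ ε) h1))
        simp [this, enorm_clm_zero]
      have hxb := hs hxs
      have hxr : x ∈ Metric.ball x₀ r := Metric.ball_subset_ball (by linarith) hxb
      have hxr2 : x ∈ Metric.ball x₀ (r / 2) := Metric.ball_subset_ball (by linarith) hxb
      have hprod := enorm_fderiv_mul_le (f := fun x => χ x * f x) (g := θ ε) (x := x)
        ((hχ.mul hf).differentiable one_ne_zero x) ((hθc ε).differentiable one_ne_zero x)
      have hprod2 : ‖fderiv ℝ (fun x => χ x * f x) x‖ₑ ≤ D * k x := by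
        refine (enorm_fderiv_mul_le (hχ.differentiable one_ne_zero x)
            (hf.differentiable one_ne_zero x)).trans ?_
        rw [hk, mul_add, add_comm, mul_comm D]
        gcongr
        · exact (hDb x).2
        · exact (hDb x).1
      by_cases hxU : x ∈ U
      · refine hprod.trans ?_
        rw [add_comm, indicator_of_mem hxU]
        refine add_le_add ?_ ?_
        · refine le_trans ?_ hprod2
          have : ‖θ ε x‖ₑ ≤ 1 := by
            rw [← ofReal_norm, Real.norm_of_nonneg (Real.smoothTransition.nonneg _)]
            exact ENNReal.ofReal_le_one.2 (Real.smoothTransition.le_one _)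
          exact (mul_le_mul' this le_rfl).trans_eq (one_mul _)
        · by_cases hxA : H x < ε
          · rw [indicator_of_mem (show x ∈ A from ⟨⟨hxU, hxr2⟩, hxA⟩), enorm_mul, mul_comm,
              mul_assoc]
            gcongr
            · rw [hθd, ← ofReal_norm, norm_smul]
              refine ENNReal.ofReal_le_ofReal ?_
              rw [norm_div, Real.norm_of_nonneg hε.le, div_mul_eq_mul_div]
              gcongr
              · exact hBb _
              · exact h.norm_fderiv_le hxr
            · exact (hDb x).1
          · have : fderiv ℝ (θ ε) x = 0 := by
              rw [hθd, deriv_smoothTransition_eq_zero (Or.inr ((one_le_div hε).2 (not_lt.1 hxA)))]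
              simp
            simp [this, enorm_clm_zero]
      · have hH : H x ≤ 0 := not_lt.1 fun hlt => hxU ((h.mem_iff x hxr).2 hlt)
        have hHε : H x / ε ≤ 0 := div_nonpos_of_nonpos_of_nonneg hH hε.le
        have h1 : fderiv ℝ (θ ε) x = 0 := by
          rw [hθd, deriv_smoothTransition_eq_zero (Or.inl hHε)]
          simp
        have h2 : θ ε x = 0 := Real.smoothTransition.zero_of_nonpos hHε
        refine hprod.trans ?_
        rw [h1, h2]
        simp [enorm_clm_zero]
    have hlay := h.lintegral_layer_le hU hf ε
    calc eLpNorm (fun x => (χ x * f x) * θ ε x) (sobExp n) (volume.restrict U)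
        ≤ eLpNorm (fun x => (χ x * f x) * θ ε x) (sobExp n) volume := eLpNorm_restrict_le _ _ _ _
      _ ≤ K * eLpNorm (fderiv ℝ fun x => (χ x * f x) * θ ε x) 1 volume :=
        eLpNorm_le_eLpNorm_fderiv_one volume (hgc ε) (hgs ε) (holderConjugate_sobExp hn)
      _ ≤ K * (D * sobNorm U f + ENNReal.ofReal (B * M / ε) * D *
          (ENNReal.ofReal (1 / (r / 4) + 1) * (ENNReal.ofReal ε * sobNorm U f))) := by
          gcongr
          rw [eLpNorm_one_eq_lintegral_enorm]
          refine (lintegral_mono hpt).trans ?_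
          rw [lintegral_add_left ((hkm.const_mul D).indicator hU.measurableSet),
            lintegral_indicator hU.measurableSet, lintegral_indicator hAm,
            lintegral_const_mul' _ _ hD, lintegral_const_mul' _ _ (by finiteness)]
          exact add_le_add le_rfl (mul_le_mul' le_rfl hlay)
      _ = _ := by
          have : ENNReal.ofReal (B * M) = ENNReal.ofReal (B * M / ε) * ENNReal.ofReal ε := by
            rw [← ENNReal.ofReal_mul (by positivity)]; congr 1; field_simp
          rw [this]; ring
  refine Lp.eLpNorm_le_of_ae_tendsto (u := 𝓝[>] (0 : ℝ)) (f := fun ε x => (χ x * f x) * θ ε x)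
    ?_ (fun ε => (hgc ε).continuous.aestronglyMeasurable) ?_
  · filter_upwards [self_mem_nhdsWithin] with ε hε using hbound ε hε
  · filter_upwards [ae_restrict_mem hU.measurableSet] with x hxU
    by_cases hxs : x ∈ tsupport χ
    · have hxr : x ∈ Metric.ball x₀ r := Metric.ball_subset_ball (by linarith) (hs hxs)
      have hH := (h.mem_iff x hxr).1 hxU
      refine tendsto_const_nhds.congr' ?_
      filter_upwards [Ioo_mem_nhdsGT hH] with ε hε
      have : θ ε x = 1 := Real.smoothTransition.one_of_one_le ((one_le_div hε.1).2 hε.2.le)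
      rw [this, mul_one]
    · simp [image_eq_zero_of_notMem_tsupport hxs]

variable {U : Set (Eu n)}

theorem sobNorm_one : sobNorm U (fun _ => (1 : ℝ)) = volume U := by
  have : ∀ x : Eu n, fderiv ℝ (fun _ : Eu n => (1 : ℝ)) x = 0 := fun x => fderiv_const_apply _
  simp only [sobNorm, this, ← ofReal_norm, norm_zero]
  simp

/-- The trace inequality for smooth functions. -/
theorem exists_trace_smooth (hn : 2 ≤ n) (hU : IsOpen U) (𝒜 : Atlas U) : ∃ C : ℝ≥0∞, C ≠ ⊤ ∧
    ∀ f : Eu n → ℝ, ContDiff ℝ 1 f → ∫⁻ x, ‖f x‖ₑ ∂(surfaceMeasure U) ≤ C * sobNorm U f := by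
  choose C hC hCb using fun i : 𝒜.ι => (𝒜.chart i i.2).exists_trace_le hn hU
  refine ⟨∑ i, C i, ENNReal.sum_ne_top.2 fun i _ => hC i, fun f hf => ?_⟩
  have hsub : frontier U ⊆ ⋃ i : 𝒜.ι, (frontier U ∩ Metric.ball i (𝒜.r i / 4)) := fun x hx => by
    obtain ⟨i, hi, hxi⟩ := mem_iUnion₂.1 (𝒜.cover hx)
    exact mem_iUnion.2 ⟨⟨i, hi⟩, hx, hxi⟩
  calc ∫⁻ x, ‖f x‖ₑ ∂(surfaceMeasure U)
      ≤ ∫⁻ x in ⋃ i : 𝒜.ι, (frontier U ∩ Metric.ball i (𝒜.r i / 4)), ‖f x‖ₑ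
          ∂(μHE[n - 1] : Measure (Eu n)) := lintegral_mono_set hsub
    _ ≤ ∑ i : 𝒜.ι, ∫⁻ x in frontier U ∩ Metric.ball i (𝒜.r i / 4), ‖f x‖ₑ
          ∂(μHE[n - 1] : Measure (Eu n)) := by
        refine (lintegral_iUnion_le _ _).trans_eq ?_
        rw [tsum_fintype]
    _ ≤ ∑ i : 𝒜.ι, C i * sobNorm U f := Finset.sum_le_sum fun i _ => hCb i f hf
    _ = _ := by rw [Finset.sum_mul]

/-- The trace inequality for the constant function `1` bounds the area of the boundary by a multiple
of the volume of `U`. -/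
theorem isFiniteMeasure_surfaceMeasure (hn : 2 ≤ n) (hU : IsOpen U) (hb : Bornology.IsBounded U)
    (𝒜 : Atlas U) : IsFiniteMeasure (surfaceMeasure U) := by
  obtain ⟨C, hC, h⟩ := exists_trace_smooth hn hU 𝒜
  refine ⟨lt_of_le_of_lt (b := C * volume U) ?_ ?_⟩
  · simpa [sobNorm_one] using h (fun _ => 1) contDiff_const
  · exact ENNReal.mul_lt_top hC.lt_top hb.measure_lt_top

/-- The Sobolev inequality `W^{1,1}(U) → L^{n/(n-1)}(U)` for smooth functions. -/
theorem exists_sobolev_smooth (hn : 2 ≤ n) (hU : IsOpen U) (𝒜 : Atlas U) : ∃ C : ℝ≥0∞, C ≠ ⊤ ∧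
    ∀ f : Eu n → ℝ, ContDiff ℝ 1 f →
      eLpNorm f (sobExp n) (volume.restrict U) ≤ C * sobNorm U f := by
  have key : ∀ o : Option 𝒜.ι, ∃ C : ℝ≥0∞, C ≠ ⊤ ∧ ∀ f : Eu n → ℝ, ContDiff ℝ 1 f →
      eLpNorm (fun x => 𝒜.bump o x * f x) (sobExp n) (volume.restrict U) ≤ C * sobNorm U f := by
    rintro (_ | i)
    · exact exists_sobolev_bump hn (𝒜.bump_contDiff _) (𝒜.bump_compact _) 𝒜.bump_none
    · exact (𝒜.chart i i.2).exists_sobolev_bump hU hn (𝒜.bump_contDiff _) (𝒜.bump_compact _)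
        (𝒜.bump_some i)
  choose C hC hCb using key
  refine ⟨∑ o, C o, ENNReal.sum_ne_top.2 fun o _ => hC o, fun f hf => ?_⟩
  have h1 : eLpNorm f (sobExp n) (volume.restrict U) =
      eLpNorm (∑ o, fun x => 𝒜.bump o x * f x) (sobExp n) (volume.restrict U) := by
    refine eLpNorm_congr_ae ?_
    filter_upwards [ae_restrict_mem hU.measurableSet] with x hx
    rw [Finset.sum_apply, ← Finset.sum_mul, 𝒜.bump_sum x (subset_closure hx), one_mul]
  rw [h1, Finset.sum_mul]
  refine (eLpNorm_sum_le (fun o _ => ?_) (one_le_sobExp hn)).trans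
    (Finset.sum_le_sum fun o _ => hCb o f hf)
  exact ((𝒜.bump_contDiff o).continuous.mul hf.continuous).aestronglyMeasurable

end ForchheimerGas

end

/-! ### Calculus for functions approximable up to the boundary. -/

noncomputable section

namespace ForchheimerGas

variable {n : ℕ}

/-! ### Gradients -/

theorem norm_gradient (f : Eu n → ℝ) (x : Eu n) : ‖gradient f x‖ = ‖fderiv ℝ f x‖ := by
  rw [gradient, LinearIsometryEquiv.norm_map]

theorem continuous_gradient {f : Eu n → ℝ} (hf : ContDiff ℝ 1 f) : Continuous (gradient f) :=
  (LinearIsometryEquiv.continuous _).comp (hf.continuous_fderiv one_ne_zero)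

theorem gradient_comp {Ψ : ℝ → ℝ} {f : Eu n → ℝ} {x : Eu n} (hΨ : DifferentiableAt ℝ Ψ (f x))
    (hf : DifferentiableAt ℝ f x) :
    gradient (fun y => Ψ (f y)) x = deriv Ψ (f x) • gradient f x := by
  have h := HasDerivAt.comp_hasFDerivAt (h₂ := Ψ) x hΨ.hasDerivAt hf.hasFDerivAt
  have h2 : fderiv ℝ (fun y => Ψ (f y)) x = deriv Ψ (f x) • fderiv ℝ f x := h.fderiv
  rw [gradient, gradient, h2]
  simp

theorem gradient_mul {f g : Eu n → ℝ} {x : Eu n} (hf : DifferentiableAt ℝ f x)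
    (hg : DifferentiableAt ℝ g x) :
    gradient (fun y => f y * g y) x = f x • gradient g x + g x • gradient f x := by
  rw [gradient, gradient, gradient, fderiv_fun_mul hf hg]
  simp

theorem gradient_sum {ι : Type*} (s : Finset ι) {f : ι → Eu n → ℝ} {x : Eu n}
    (hf : ∀ i ∈ s, DifferentiableAt ℝ (f i) x) :
    gradient (fun y => ∑ i ∈ s, f i y) x = ∑ i ∈ s, gradient (f i) x := by
  simp only [gradient]
  rw [fderiv_fun_sum hf, map_sum]

/-! ### Translations in `L^p` -/

/-- Translations are continuous in `L^p`. -/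
theorem tendsto_eLpNorm_translate {X V : Type*} [NormedAddCommGroup X] [NormedSpace ℝ X]
    [FiniteDimensional ℝ X] [SecondCountableTopology X] [MeasurableSpace X] [BorelSpace X]
    [NormedAddCommGroup V]
    {μ : Measure X} [μ.IsAddHaarMeasure] {p : ℝ≥0∞} (hp : 1 ≤ p) (hp' : p ≠ ⊤) {F : X → V}
    (hF : MemLp F p μ) :
    Tendsto (fun z => eLpNorm (fun x => F (x - z) - F x) p μ) (𝓝 0) (𝓝 0) := by
  have : Fact (1 ≤ p) := ⟨hp⟩
  have : Fact (p ≠ ⊤) := ⟨hp'⟩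
  have hc : Continuous fun z : X => DomAddAct.mk (-z) +ᵥ hF.toLp F :=
    (continuous_vadd : Continuous fun z : Xᵈᵃᵃ × Lp V p μ => z.1 +ᵥ z.2).comp
      ((DomAddAct.continuous_mk.comp continuous_neg).prodMk continuous_const)
  have h := hc.tendsto 0
  have h0 := tendsto_iff_edist_tendsto_0.1 h
  refine h0.congr fun z => ?_
  rw [DomAddAct.mk_vadd_toLp, DomAddAct.mk_vadd_toLp, Lp.edist_toLp_toLp]
  refine congrArg (fun g => eLpNorm g p μ) ?_
  funext x
  simp [sub_eq_neg_add]

/-- Averages of translations are controlled by the modulus of continuity in `L^p`. -/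
theorem eLpNorm_average_le {V : Type*} [NormedAddCommGroup V] [NormedSpace ℝ V] {F : Eu n → V}
    (hF : AEStronglyMeasurable F volume) {ρ : Measure (Eu n)} [IsProbabilityMeasure ρ]
    {p : ℝ} (hp : 1 ≤ p) {ε : ℝ≥0∞}
    (h : ∀ᵐ z ∂ρ, eLpNorm (fun x => F (x - z) - F x) (ENNReal.ofReal p) volume ≤ ε) :
    eLpNorm (fun x => ∫ z, (F (x - z) - F x) ∂ρ) (ENNReal.ofReal p) volume ≤ ε := by
  have hp0 : 0 < p := by linarith
  have hpz : ENNReal.ofReal p ≠ 0 := by simpa using hp0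
  have htr : (ENNReal.ofReal p).toReal = p := ENNReal.toReal_ofReal hp0.le
  have hq : Measure.QuasiMeasurePreserving (fun z : Eu n × Eu n => z.1 - z.2)
      ((volume : Measure (Eu n)).prod ρ) volume :=
    QuasiMeasurePreserving.prod_of_left (by fun_prop) (Eventually.of_forall fun z =>
      (measurePreserving_sub_right volume z).quasiMeasurePreserving)
  have hm : AEStronglyMeasurable (fun z : Eu n × Eu n => F (z.1 - z.2) - F z.1)
      ((volume : Measure (Eu n)).prod ρ) :=
    (hF.comp_quasiMeasurePreserving hq).sub hF.comp_fst
  have key : ∀ᵐ x, ‖∫ z, (F (x - z) - F x) ∂ρ‖ₑ ^ p ≤ ∫⁻ z, ‖F (x - z) - F x‖ₑ ^ p ∂ρ := by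
    filter_upwards [hm.prodMk_left] with x hx
    have h1 : ‖∫ z, (F (x - z) - F x) ∂ρ‖ₑ ≤ eLpNorm (fun z => F (x - z) - F x)
        (ENNReal.ofReal p) ρ := by
      refine (enorm_integral_le_lintegral_enorm _).trans ?_
      rw [← eLpNorm_one_eq_lintegral_enorm]
      exact eLpNorm_le_eLpNorm_of_exponent_le (by simpa using hp) hx
    rw [eLpNorm_eq_lintegral_rpow_enorm_toReal hpz ENNReal.ofReal_ne_top, htr] at h1
    calc _ ≤ _ := ENNReal.rpow_le_rpow h1 hp0.le
      _ = _ := by rw [← ENNReal.rpow_mul, one_div_mul_cancel hp0.ne', ENNReal.rpow_one]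
  rw [eLpNorm_eq_lintegral_rpow_enorm_toReal hpz ENNReal.ofReal_ne_top, htr]
  rw [← ENNReal.rpow_le_rpow_iff hp0, ← ENNReal.rpow_mul, one_div_mul_cancel hp0.ne',
    ENNReal.rpow_one]
  calc ∫⁻ x, ‖∫ z, (F (x - z) - F x) ∂ρ‖ₑ ^ p
      ≤ ∫⁻ x, ∫⁻ z, ‖F (x - z) - F x‖ₑ ^ p ∂ρ := lintegral_mono_ae key
    _ = ∫⁻ z, ∫⁻ x, ‖F (x - z) - F x‖ₑ ^ p ∂volume ∂ρ :=
        lintegral_lintegral_swap (hm.enorm.pow_const p)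
    _ ≤ ∫⁻ _, ε ^ p ∂ρ := by
        refine lintegral_mono_ae ?_
        filter_upwards [h] with z hz
        rw [eLpNorm_eq_lintegral_rpow_enorm_toReal hpz ENNReal.ofReal_ne_top, htr] at hz
        rwa [← ENNReal.rpow_le_rpow_iff hp0, ← ENNReal.rpow_mul, one_div_mul_cancel hp0.ne',
          ENNReal.rpow_one] at hz
    _ = ε ^ p := by simp

/-! ### Functions approximable by smooth functions up to the boundary -/

/-- `f` is continuous on `closure U`, and it is a limit of smooth functions, uniformly on
`closure U`, whose gradients converge to `F` in `L^p(U)`. -/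
structure StrongApprox (U : Set (Eu n)) (p : ℝ≥0∞) (f : Eu n → ℝ) (F : Eu n → Eu n) : Prop where
  continuousOn : ContinuousOn f (closure U)
  memLp : MemLp F p (volume.restrict U)
  approx : ∃ fk : ℕ → Eu n → ℝ, (∀ k, ContDiff ℝ 1 (fk k)) ∧
    TendstoUniformlyOn fk f atTop (closure U) ∧
    Tendsto (fun k => eLpNorm (fun x => gradient (fk k) x - F x) p (volume.restrict U)) atTop (𝓝 0)

/-- The splitting `gk Gk - g G = gk (Gk - G) + (gk - g) G` uses boundedness of `gk` in the first
term and smallness of `gk - g` in the second. It is the tool for passing to the limit in the chain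
and product rules. -/
theorem tendsto_eLpNorm_smul {α V : Type*} [MeasurableSpace α] [NormedAddCommGroup V]
    [NormedSpace ℝ V] {μ : Measure α} {p : ℝ≥0∞} (hp : 1 ≤ p) {g : α → ℝ} {gk : ℕ → α → ℝ}
    {G : α → V} {Gk : ℕ → α → V} (hg : AEStronglyMeasurable g μ)
    (hgk : ∀ k, AEStronglyMeasurable (gk k) μ) (hGm : MemLp G p μ)
    (hGk : ∀ k, AEStronglyMeasurable (Gk k) μ) {B : ℝ} (hB : ∀ᵐ x ∂μ, |g x| ≤ B)
    (hunif : ∀ ε > 0, ∀ᶠ k in atTop, ∀ᵐ x ∂μ, |gk k x - g x| ≤ ε)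
    (hG : Tendsto (fun k => eLpNorm (fun x => Gk k x - G x) p μ) atTop (𝓝 0)) :
    Tendsto (fun k => eLpNorm (fun x => gk k x • Gk k x - g x • G x) p μ) atTop (𝓝 0) := by
  rw [ENNReal.tendsto_nhds_zero]
  intro ε hε
  have hlim : Tendsto (fun t : ℝ≥0∞ => ENNReal.ofReal (B + 1) * t) (𝓝 0) (𝓝 0) := by
    simpa using ENNReal.Tendsto.const_mul (a := ENNReal.ofReal (B + 1))
      (tendsto_id (x := 𝓝 (0 : ℝ≥0∞))) (Or.inr ENNReal.ofReal_ne_top)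
  have h1 := (hlim.comp hG).eventually_le_const (ENNReal.half_pos hε.ne')
  have hlim2 : Tendsto (fun t : ℝ => ENNReal.ofReal t * eLpNorm G p μ) (𝓝[>] 0) (𝓝 0) := by
    have h2 : Tendsto (fun t : ℝ => ENNReal.ofReal t) (𝓝[>] 0) (𝓝 0) := by
      have := (ENNReal.continuous_ofReal.tendsto 0).mono_left (nhdsWithin_le_nhds (s := Ioi 0))
      simpa using this
    simpa using ENNReal.Tendsto.mul_const h2 (Or.inr hGm.2.ne)
  obtain ⟨t, ht, ht0⟩ :=
    ((hlim2.eventually_le_const (ENNReal.half_pos hε.ne')).and self_mem_nhdsWithin).exists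
  filter_upwards [h1, hunif t ht0, hunif 1 one_pos] with k hk1 hk2 hk3
  have e1 : (fun x => gk k x • Gk k x - g x • G x) =
      (fun x => gk k x • (Gk k x - G x)) + fun x => (gk k x - g x) • G x := by
    funext x; simp only [Pi.add_apply]; module
  rw [e1]
  have hm1 := (hgk k).smul ((hGk k).sub hGm.1)
  have hm2 := ((hgk k).sub hg).smul hGm.1
  calc _ ≤ eLpNorm (fun x => gk k x • (Gk k x - G x)) p μ +
        eLpNorm (fun x => (gk k x - g x) • G x) p μ := eLpNorm_add_le hm1 hm2 hp
    _ ≤ ENNReal.ofReal (B + 1) * eLpNorm (fun x => Gk k x - G x) p μ +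
        ENNReal.ofReal t * eLpNorm G p μ := by
        gcongr
        · refine eLpNorm_le_mul_eLpNorm_of_ae_le_mul ?_ p
          filter_upwards [hB, hk3] with x hx1 hx2
          rw [norm_smul]
          gcongr
          rw [Real.norm_eq_abs]
          calc |gk k x| = |g x + (gk k x - g x)| := by congr 1; ring
            _ ≤ |g x| + |gk k x - g x| := abs_add_le _ _
            _ ≤ _ := by linarith
        · refine eLpNorm_le_mul_eLpNorm_of_ae_le_mul ?_ p
          filter_upwards [hk2] with x hx1
          rw [norm_smul]
          gcongr
          exact hx1
    _ ≤ ε / 2 + ε / 2 := add_le_add hk1 ht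
    _ = ε := ENNReal.add_halves ε

namespace StrongApprox

variable {U : Set (Eu n)} {p : ℝ≥0∞} {f : Eu n → ℝ} {F : Eu n → Eu n}

theorem bounded (h : StrongApprox U p f F) (hb : Bornology.IsBounded U) :
    ∃ B : ℝ, 0 ≤ B ∧ ∀ x ∈ closure U, |f x| ≤ B := by
  obtain ⟨B, hB⟩ := hb.isCompact_closure.exists_bound_of_continuousOn h.continuousOn
  exact ⟨max B 0, le_max_right _ _, fun x hx => (hB x hx).trans (le_max_left _ _)⟩

/-- On the compact set `closure U` the values of `f`, and eventually those of the approximants, lie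
in one compact interval. There `Ψ` and its derivative are uniformly continuous, so the chain rule
for the smooth approximants passes to the limit. -/
theorem comp (h : StrongApprox U p f F) (hU : IsOpen U) (hb : Bornology.IsBounded U) (hp : 1 ≤ p)
    {Ψ : ℝ → ℝ} (hΨ : ContDiff ℝ 1 Ψ) :
    StrongApprox U p (fun x => Ψ (f x)) (fun x => deriv Ψ (f x) • F x) := by
  obtain ⟨B, hB0, hB⟩ := h.bounded hb
  obtain ⟨fk, hfk, hunif, hgrad⟩ := h.approx
  have hΨ' : Continuous (deriv Ψ) := hΨ.continuous_deriv le_rfl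
  have hmem : ∀ᶠ k in atTop, ∀ x ∈ closure U, fk k x ∈ Icc (-(B + 1)) (B + 1) := by
    filter_upwards [Metric.tendstoUniformlyOn_iff.1 hunif 1 one_pos] with k hk x hx
    have h1 := hk x hx
    rw [dist_comm, Real.dist_eq] at h1
    have h2 := hB x hx
    rw [abs_lt] at h1
    rw [abs_le] at h2
    constructor <;> linarith [h1.1, h1.2, h2.1, h2.2]
  have hmem' : ∀ x ∈ closure U, f x ∈ Icc (-(B + 1)) (B + 1) := fun x hx => by
    have h2 := abs_le.1 (hB x hx)
    constructor <;> linarith [h2.1, h2.2]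
  have hcomp : ∀ Θ : ℝ → ℝ, Continuous Θ →
      TendstoUniformlyOn (fun k x => Θ (fk k x)) (fun x => Θ (f x)) atTop (closure U) := by
    intro Θ hΘ
    exact UniformContinuousOn.comp_tendstoUniformlyOn_eventually hmem hmem'
      (isCompact_Icc.uniformContinuousOn_of_continuous hΘ.continuousOn) hunif
  have hcl : ContinuousOn (fun x => deriv Ψ (f x)) (closure U) := hΨ'.comp_continuousOn h.continuousOn
  obtain ⟨D, hD⟩ := hb.isCompact_closure.exists_bound_of_continuousOn hcl
  have hmeas : AEStronglyMeasurable (fun x => deriv Ψ (f x)) (volume.restrict U) :=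
    (hcl.mono subset_closure).aestronglyMeasurable hU.measurableSet
  refine ⟨hΨ.continuous.comp_continuousOn h.continuousOn, ?_, fun k x => Ψ (fk k x),
    fun k => hΨ.comp (hfk k), hcomp Ψ hΨ.continuous, ?_⟩
  · refine MemLp.of_le_mul (g := F) (c := D) h.memLp (hmeas.smul h.memLp.1) ?_
    filter_upwards [ae_restrict_mem hU.measurableSet] with x hx
    rw [norm_smul]
    exact mul_le_mul_of_nonneg_right (hD x (subset_closure hx)) (norm_nonneg _)
  · have : ∀ k x, gradient (fun y => Ψ (fk k y)) x = deriv Ψ (fk k x) • gradient (fk k) x :=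
      fun k x => gradient_comp (hΨ.differentiable one_ne_zero _)
        ((hfk k).differentiable one_ne_zero _)
    simp only [this]
    refine tendsto_eLpNorm_smul hp (B := D) hmeas
      (fun k => (hΨ'.comp (hfk k).continuous).aestronglyMeasurable)
      h.memLp (fun k => (continuous_gradient (hfk k)).aestronglyMeasurable) ?_ ?_ hgrad
    · filter_upwards [ae_restrict_mem hU.measurableSet] with x hx using hD x (subset_closure hx)
    · intro ε hε
      filter_upwards [Metric.tendstoUniformlyOn_iff.1 (hcomp _ hΨ') ε hε] with k hk
      filter_upwards [ae_restrict_mem hU.measurableSet] with x hx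
      have := hk x (subset_closure hx)
      rw [dist_comm, Real.dist_eq] at this
      exact this.le

theorem mul_smooth (h : StrongApprox U p f F) (hU : IsOpen U) (hb : Bornology.IsBounded U)
    (hp : 1 ≤ p) {ζ : Eu n → ℝ} (hζ : ContDiff ℝ 1 ζ) :
    StrongApprox U p (fun x => f x * ζ x) (fun x => ζ x • F x + f x • gradient ζ x) := by
  have hfin : IsFiniteMeasure (volume.restrict U) := ⟨by simpa using hb.measure_lt_top⟩
  obtain ⟨B, hB0, hB⟩ := h.bounded hb
  obtain ⟨fk, hfk, hunif, hgrad⟩ := h.approx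
  have hmf : AEStronglyMeasurable f (volume.restrict U) :=
    (h.continuousOn.mono subset_closure).aestronglyMeasurable hU.measurableSet
  obtain ⟨D, hD⟩ := hb.isCompact_closure.exists_bound_of_continuousOn hζ.continuous.continuousOn
  obtain ⟨D', hD'⟩ := hb.isCompact_closure.exists_bound_of_continuousOn
    (continuous_gradient hζ).continuousOn
  have hζm : MemLp (gradient ζ) p (volume.restrict U) := by
    refine MemLp.of_bound (continuous_gradient hζ).aestronglyMeasurable D' ?_
    filter_upwards [ae_restrict_mem hU.measurableSet] with x hx using hD' x (subset_closure hx)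
  have hae : ∀ᵐ x ∂(volume.restrict U), |ζ x| ≤ D := by
    filter_upwards [ae_restrict_mem hU.measurableSet] with x hx using hD x (subset_closure hx)
  have hae2 : ∀ᵐ x ∂(volume.restrict U), |f x| ≤ B := by
    filter_upwards [ae_restrict_mem hU.measurableSet] with x hx using hB x (subset_closure hx)
  have hm1 : MemLp (fun x => ζ x • F x) p (volume.restrict U) := by
    refine MemLp.of_le_mul (g := F) (c := D) h.memLp
      (hζ.continuous.aestronglyMeasurable.smul h.memLp.1) ?_
    filter_upwards [hae] with x hx
    rw [norm_smul]
    exact mul_le_mul_of_nonneg_right hx (norm_nonneg _)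
  have hm2 : MemLp (fun x => f x • gradient ζ x) p (volume.restrict U) := by
    refine MemLp.of_le_mul (g := gradient ζ) (c := B) hζm (hmf.smul hζm.1) ?_
    filter_upwards [hae2] with x hx
    rw [norm_smul]
    exact mul_le_mul_of_nonneg_right hx (norm_nonneg _)
  refine ⟨h.continuousOn.mul hζ.continuous.continuousOn, hm1.add hm2, fun k x => fk k x * ζ x,
    fun k => (hfk k).mul hζ, ?_, ?_⟩
  · rw [Metric.tendstoUniformlyOn_iff] at hunif ⊢
    intro ε hε
    filter_upwards [hunif (ε / (|D| + 1)) (by positivity)] with k hk x hx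
    have h1 := hk x hx
    have h2 := (hD x hx).trans (le_abs_self D)
    rw [Real.dist_eq] at h1 ⊢
    rw [← sub_mul, abs_mul]
    calc |f x - fk k x| * |ζ x| ≤ |f x - fk k x| * (|D| + 1) := by
          gcongr; exact h2.trans (by linarith)
      _ < ε / (|D| + 1) * (|D| + 1) := by gcongr
      _ = ε := by field_simp
  · have t1 := tendsto_eLpNorm_smul (μ := volume.restrict U) (gk := fun _ => ζ) hp
      hζ.continuous.aestronglyMeasurable
      (fun _ => hζ.continuous.aestronglyMeasurable) h.memLp
      (fun k => (continuous_gradient (hfk k)).aestronglyMeasurable) hae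
      (fun ε hε => Eventually.of_forall fun k => Eventually.of_forall fun x => by simpa using hε.le)
      hgrad
    have t2 := tendsto_eLpNorm_smul (μ := volume.restrict U) (gk := fk) (Gk := fun _ => gradient ζ)
      hp hmf (fun k => (hfk k).continuous.aestronglyMeasurable) hζm (fun _ => hζm.1) hae2
      (fun ε hε => by
        filter_upwards [Metric.tendstoUniformlyOn_iff.1 hunif ε hε] with k hk
        filter_upwards [ae_restrict_mem hU.measurableSet] with x hx
        have := hk x (subset_closure hx)
        rw [dist_comm, Real.dist_eq] at this
        exact this.le) (by simp)
    refine tendsto_of_tendsto_of_tendsto_of_le_of_le tendsto_const_nhds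
      (by simpa using t1.add t2) (fun k => bot_le) fun k => ?_
    have : (fun x => gradient (fun y => fk k y * ζ y) x - (ζ x • F x + f x • gradient ζ x)) =
        (fun x => ζ x • gradient (fk k) x - ζ x • F x) +
          fun x => fk k x • gradient ζ x - f x • gradient ζ x := by
      funext x
      rw [gradient_mul ((hfk k).differentiable one_ne_zero _) (hζ.differentiable one_ne_zero _)]
      simp only [Pi.add_apply]
      abel
    simp only [this]
    exact eLpNorm_add_le ((hζ.continuous.aestronglyMeasurable.smul
      (continuous_gradient (hfk k)).aestronglyMeasurable).sub hm1.1)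
      (((hfk k).continuous.aestronglyMeasurable.smul hζm.1).sub hm2.1) hp

end StrongApprox

end ForchheimerGas

end

/-! ### Approximation up to the boundary by mollification along cones. -/

noncomputable section

namespace ForchheimerGas

variable {n : ℕ} {U : Set (Eu n)}

/-- Near the boundary this is the cone property of the chart with opening `1/(2M)`. For the interior
piece the axis is `e = 0` and the cone degenerates to small balls, so that one mollification
argument serves all pieces. -/
theorem Atlas.exists_inner_cone (hU : IsOpen U) (𝒜 : Atlas U) (o : Option 𝒜.ι) :
    ∃ (e : Eu n) (c s₀ : ℝ), ‖e‖ ≤ 1 ∧ 0 < c ∧ c ≤ 1 ∧ 0 < s₀ ∧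
      ∀ x ∈ closure U ∩ tsupport (𝒜.bump o), ∀ s, 0 < s → s ≤ s₀ → ∀ z, ‖z - s • e‖ ≤ c * s →
        x - z ∈ U := by
  rcases o with (_ | i)
  · have hK : IsCompact (tsupport (𝒜.bump none)) := 𝒜.bump_compact none
    obtain ⟨δ, hδ, hsub⟩ := hK.exists_thickening_subset_open hU 𝒜.bump_none
    refine ⟨0, 1 / 2, δ, by simp, by norm_num, by norm_num, hδ, fun x hx s hs hs' z hz => ?_⟩
    refine hsub (Metric.mem_thickening_iff.2 ⟨x, hx.2, ?_⟩)
    rw [smul_zero, sub_zero] at hz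
    rw [dist_eq_norm, sub_sub_cancel_left, norm_neg]
    linarith
  · have h := 𝒜.chart i i.2
    have hM := h.one_le_M
    have hr := h.r_pos
    refine ⟨𝒜.e i, 1 / (2 * 𝒜.M i), 𝒜.r i / 4, h.norm_e.le, by positivity, ?_, by positivity,
      fun x hx s hs hs' z hz => ?_⟩
    · rw [div_le_one (by positivity)]; linarith
    · refine h.sub_mem (c := 1 / (2 * 𝒜.M i)) ?_ hx.1 hs hs' ?_ ?_ hz
      · exact Metric.ball_subset_ball (by linarith) (𝒜.bump_some i hx.2)
      · rw [div_le_one (by positivity)]; linarith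
      · have : 𝒜.M i * (1 / (2 * 𝒜.M i)) = 1 / 2 := by field_simp
        linarith

/-- Convolution with a smooth compactly supported kernel. -/
def conv (f φ : Eu n → ℝ) (x : Eu n) : ℝ := ∫ t, f t * φ (x - t)

theorem conv_eq_convolution (f φ : Eu n → ℝ) :
    conv f φ = convolution f φ (ContinuousLinearMap.lsmul ℝ ℝ) volume := by
  funext x
  rw [convolution_def]
  rfl

theorem contDiff_conv {f φ : Eu n → ℝ} (hf : Integrable f) (hφ : ContDiff ℝ 1 φ)
    (hc : HasCompactSupport φ) : ContDiff ℝ 1 (conv f φ) := by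
  rw [conv_eq_convolution]
  exact hc.contDiff_convolution_right (n := 1) _ hf.locallyIntegrable hφ

theorem gradient_conv {f φ : Eu n → ℝ} (hf : Integrable f) (hφ : ContDiff ℝ 1 φ)
    (hc : HasCompactSupport φ) (x : Eu n) :
    gradient (conv f φ) x = ∫ t, f t • gradient φ (x - t) := by
  have hd := (hc.hasFDerivAt_convolution_right (ContinuousLinearMap.lsmul ℝ ℝ)
    hf.locallyIntegrable hφ x).fderiv
  have hint := hc.fderiv (𝕜 := ℝ) |>.convolutionExists_right
    ((ContinuousLinearMap.lsmul ℝ ℝ).precompR (Eu n)) hf.locallyIntegrable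
    (hφ.continuous_fderiv one_ne_zero) (μ := volume) x
  let D : (Eu n →L[ℝ] ℝ) →L[ℝ] Eu n := LinearMap.toContinuousLinearMap
    { toFun := fun l => (InnerProductSpace.toDual ℝ (Eu n)).symm l
      map_add' := fun a b => map_add _ a b
      map_smul' := fun c a => by simp }
  have hD : ∀ l, (InnerProductSpace.toDual ℝ (Eu n)).symm l = D l := fun l => rfl
  rw [gradient, conv_eq_convolution, hd, convolution_def, hD, ← D.integral_comp_comm hint]
  refine integral_congr_ae (Eventually.of_forall fun t => ?_)
  have h1 : (((ContinuousLinearMap.lsmul ℝ ℝ).precompR (Eu n)) (f t)) (fderiv ℝ φ (x - t)) =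
      f t • fderiv ℝ φ (x - t) := by
    ext v
    simp [ContinuousLinearMap.precompR_apply]
  simp only [h1, map_smul]
  rfl

theorem gradient_comp_const_sub {φ : Eu n → ℝ} (hφ : Differentiable ℝ φ) (x t : Eu n) :
    gradient (fun y => φ (x - y)) t = - gradient φ (x - t) := by
  have h : HasFDerivAt (fun y => φ (x - y)) _ t :=
    (hφ (x - t)).hasFDerivAt.comp t ((hasFDerivAt_id t).const_sub x)
  rw [gradient, gradient, h.fderiv, ← map_neg]
  congr 1
  ext v
  simp

theorem conv_eq_swap (f φ : Eu n → ℝ) (x : Eu n) : conv f φ x = ∫ z, φ z * f (x - z) := by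
  rw [conv, ← integral_sub_left_eq_self _ volume x]
  simp only [sub_sub_cancel, mul_comm]

/-- Mollification along an inner cone. -/
theorem exists_cone_mollification (hU : IsOpen U) (hb : Bornology.IsBounded U) {p : ℝ}
    (hp : 1 ≤ p) {f : Eu n → ℝ} {F : Eu n → Eu n} (hf : ContinuousOn f (closure U))
    (hw : HasWeakGradient U f F) (hF : MemLp F (ENNReal.ofReal p) (volume.restrict U))
    {A : Set (Eu n)} {e : Eu n} {c s₀ : ℝ} (he : ‖e‖ ≤ 1) (hc : 0 < c) (hc1 : c ≤ 1)
    (hs₀ : 0 < s₀)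
    (hA : ∀ x ∈ closure U ∩ A, ∀ s, 0 < s → s ≤ s₀ → ∀ z, ‖z - s • e‖ ≤ c * s → x - z ∈ U) :
    ∃ g : ℕ → Eu n → ℝ, (∀ k, ContDiff ℝ 1 (g k)) ∧
      (∀ ε > 0, ∀ᶠ k in atTop, ∀ x ∈ closure U ∩ A, |g k x - f x| ≤ ε) ∧
      ∃ R : ℕ → Eu n → Eu n, (∀ k, ∀ x ∈ U ∩ A, gradient (g k) x - F x = R k x) ∧
        Tendsto (fun k => eLpNorm (R k) (ENNReal.ofReal p) volume) atTop (𝓝 0) := by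
  have hfin : IsFiniteMeasure (volume.restrict U) := ⟨by simpa using hb.measure_lt_top⟩
  have hp1 : 1 ≤ ENNReal.ofReal p := by simpa using hp
  have hpt : ENNReal.ofReal p ≠ ⊤ := ENNReal.ofReal_ne_top
  set s : ℕ → ℝ := fun k => s₀ / (k + 1) with hs
  have hsp : ∀ k, 0 < s k := fun k => by positivity
  have hsl : ∀ k, s k ≤ s₀ := fun k => div_le_self hs₀.le (by linarith [(k.cast_nonneg : (0 : ℝ) ≤ k)])
  have hst : Tendsto s atTop (𝓝 0) := by
    have := (tendsto_one_div_add_atTop_nhds_zero_nat (𝕜 := ℝ)).const_mul s₀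
    simpa [hs, div_eq_mul_inv] using this
  -- The kernel is centred at `s_k e`, not at `0`, with radius `c s_k`. Mollifying at `x` then
  -- samples only points `x - z` of the inner cone, which lie in `U` even when `x` is on the
  -- boundary.
  let b : ∀ k, ContDiffBump (s k • e) := fun k =>
    ⟨c * s k / 2, c * s k, by have := hsp k; positivity, by have := hsp k; nlinarith [mul_pos hc this]⟩
  set φ : ℕ → Eu n → ℝ := fun k => (b k).normed volume with hφ
  have hφ0 : ∀ k z, 0 ≤ φ k z := fun k z => (b k).nonneg_normed z
  have hφ1 : ∀ k, ∫ z, φ k z = 1 := fun k => (b k).integral_normed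
  have hφi : ∀ k, Integrable (φ k) := fun k => (b k).integrable_normed
  have hφc : ∀ k, HasCompactSupport (φ k) := fun k => (b k).hasCompactSupport_normed
  have hφs : ∀ k z, φ k z ≠ 0 → ‖z - s k • e‖ ≤ c * s k := fun k z hz => by
    have : z ∈ Function.support ((b k).normed volume) := hz
    rw [(b k).support_normed_eq, Metric.mem_ball, dist_eq_norm] at this
    exact this.le
  have hφcd : ∀ k (m : ℕ∞), ContDiff ℝ m (φ k) := fun k m => (b k).contDiff_normed
  have hzn : ∀ k z, ‖z - s k • e‖ ≤ c * s k → ‖z‖ ≤ 2 * s k := fun k z hz => by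
    have h1 : ‖s k • e‖ ≤ s k := by
      rw [norm_smul, Real.norm_of_nonneg (hsp k).le]
      exact mul_le_of_le_one_right (hsp k).le he
    calc ‖z‖ = ‖(z - s k • e) + s k • e‖ := by simp
      _ ≤ ‖z - s k • e‖ + ‖s k • e‖ := norm_add_le _ _
      _ ≤ 2 * s k := by nlinarith [hsp k]
  have hbdd : ∀ k {V : Type} [NormedAddCommGroup V] [NormedSpace ℝ V] {h : Eu n → V},
      Integrable h → Integrable fun z => φ k z • h z := fun k V _ _ h hh => by
    obtain ⟨C, hC⟩ := (hφcd k 1).continuous.bounded_above_of_compact_support (hφc k)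
    exact hh.bdd_smul C (hφcd k 1).continuous.aestronglyMeasurable (Eventually.of_forall hC)
  set f' := U.indicator f
  set F' := U.indicator F
  have hf'i : Integrable f' := by
    obtain ⟨B, hB⟩ := hb.isCompact_closure.exists_bound_of_continuousOn hf
    refine (integrable_indicator_iff hU.measurableSet).2 (Integrable.of_bound
      ((hf.mono subset_closure).aestronglyMeasurable hU.measurableSet) B ?_)
    filter_upwards [ae_restrict_mem hU.measurableSet] with x hx using hB x (subset_closure hx)
  have hF'm : MemLp F' (ENNReal.ofReal p) volume := (memLp_indicator_iff_restrict hU.measurableSet).2 hF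
  have hF'i : Integrable F' := (integrable_indicator_iff hU.measurableSet).2
    (hF.integrable hp1)
  set g : ℕ → Eu n → ℝ := fun k => conv f' (φ k) with hg
  have hgc : ∀ k, ContDiff ℝ 1 (g k) := fun k => contDiff_conv hf'i (hφcd k 1) (hφc k)
  have hgval : ∀ k x, g k x = ∫ z, φ k z * f' (x - z) := fun k x => conv_eq_swap _ _ _
  have hgrad : ∀ k, ∀ x ∈ closure U ∩ A, gradient (g k) x = ∫ z, φ k z • F' (x - z) := by
    intro k x hx
    have h1 : gradient (g k) x = ∫ t, f' t • gradient (φ k) (x - t) :=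
      gradient_conv hf'i (hφcd k 1) (hφc k) x
    have h2 : ∀ t, gradient (fun y => φ k (x - y)) t = - gradient (φ k) (x - t) := fun t =>
      gradient_comp_const_sub ((hφcd k 1).differentiable one_ne_zero) x t
    have hsupp : tsupport (fun y => φ k (x - y)) ⊆ (fun z => x - z) '' Metric.closedBall (s k • e) (c * s k) := by
      refine closure_minimal ?_ ?_
      · intro y hy
        refine ⟨x - y, ?_, by simp⟩
        rw [Metric.mem_closedBall, dist_eq_norm]
        exact hφs k _ hy
      · exact ((isCompact_closedBall _ _).image (by fun_prop)).isClosed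
    -- Seen from `x`, the kernel is supported in `U` by the cone condition, so it is an admissible
    -- test function for the weak gradient, and the gradient of the mollification is the
    -- mollification of `F`.
    have h3 := hw.2.2 (fun y => φ k (x - y)) ((hφcd k ⊤).comp (contDiff_const.sub contDiff_id))
      (HasCompactSupport.intro ((isCompact_closedBall (s k • e) (c * s k)).image
        (f := fun z => x - z) (by fun_prop)) fun y hy => by
          by_contra hne; exact hy (hsupp (subset_tsupport _ hne)))
      (hsupp.trans (by
        rintro _ ⟨z, hz, rfl⟩
        rw [Metric.mem_closedBall, dist_eq_norm] at hz
        exact hA x hx (s k) (hsp k) (hsl k) z hz))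
    simp only [h2, smul_neg, integral_neg, neg_inj] at h3
    rw [h1, ← integral_sub_left_eq_self (fun z => φ k z • F' (x - z)) volume x]
    simp only [sub_sub_cancel]
    have e1 : (fun t => f' t • gradient (φ k) (x - t)) =
        U.indicator fun t => f t • gradient (φ k) (x - t) := by
      funext t; by_cases ht : t ∈ U <;> simp [f', ht]
    have e2 : (fun t => φ k (x - t) • F' t) = U.indicator fun t => φ k (x - t) • F t := by
      funext t; by_cases ht : t ∈ U <;> simp [F', ht]
    rw [e1, e2, integral_indicator hU.measurableSet, integral_indicator hU.measurableSet, h3]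
  refine ⟨g, hgc, ?_, fun k x => ∫ z, φ k z • (F' (x - z) - F' x), ?_, ?_⟩
  · intro ε hε
    have huc := Metric.uniformContinuousOn_iff_le.1
      (hb.isCompact_closure.uniformContinuousOn_of_continuous hf) ε hε
    obtain ⟨δ, hδ, huc⟩ := huc
    have : ∀ᶠ k in atTop, s k < δ / 2 := hst.eventually_lt_const (by positivity)
    filter_upwards [this] with k hk x hx
    have h1 : g k x - f x = ∫ z, φ k z * (f' (x - z) - f x) := by
      simp_rw [mul_sub]
      rw [integral_sub, integral_mul_const, hφ1, one_mul, hgval]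
      · exact hbdd k (hf'i.comp_sub_left x)
      · exact (hφi k).mul_const _
    rw [h1, ← Real.norm_eq_abs]
    refine (norm_integral_le_of_norm_le ((hφi k).mul_const ε) (Eventually.of_forall fun z => ?_)).trans_eq
      (by rw [integral_mul_const, hφ1, one_mul])
    rw [norm_mul, Real.norm_of_nonneg (hφ0 k z)]
    by_cases hz : φ k z = 0
    · simp [hz]
    have hz' := hφs k z hz
    have hzU := hA x hx (s k) (hsp k) (hsl k) z hz'
    refine mul_le_mul_of_nonneg_left ?_ (hφ0 k z)
    have h2 := huc (x - z) (subset_closure hzU) x hx.1 (by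
      rw [dist_eq_norm, sub_sub_cancel_left, norm_neg]; linarith [hzn k z hz'])
    rw [Real.dist_eq] at h2
    simpa [f', hzU] using h2
  · intro k x hx
    rw [hgrad k x ⟨subset_closure hx.1, hx.2⟩]
    simp_rw [smul_sub]
    rw [integral_sub (hbdd k (hF'i.comp_sub_left x)) ((hφi k).smul_const _), integral_smul_const,
      hφ1, one_smul]
    simp [F', hx.1]
  · rw [ENNReal.tendsto_nhds_zero]
    intro ε hε
    have htr := (tendsto_eLpNorm_translate hp1 hpt hF'm).eventually_le_const hε
    obtain ⟨δ, hδ, hball⟩ := Metric.eventually_nhds_iff.1 htr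
    have : ∀ᶠ k in atTop, s k < δ / 2 := hst.eventually_lt_const (by positivity)
    filter_upwards [this] with k hk
    -- Integration against the kernel is an average over a probability measure concentrated on small
    -- shifts. The error is thus bounded by the modulus of continuity of translations of the
    -- extension of `F` by zero.
    set ρ : Measure (Eu n) := volume.withDensity fun z => ENNReal.ofReal (φ k z)
    have hφm : Measurable fun z => ENNReal.ofReal (φ k z) :=
      (hφcd k 1).continuous.measurable.ennreal_ofReal
    have hρ : IsProbabilityMeasure ρ := ⟨by
      rw [withDensity_apply _ MeasurableSet.univ, Measure.restrict_univ,
        ← ofReal_integral_eq_lintegral_ofReal (hφi k) (Eventually.of_forall (hφ0 k)), hφ1,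
        ENNReal.ofReal_one]⟩
    have heq : (fun x => ∫ z, φ k z • (F' (x - z) - F' x)) =
        fun x => ∫ z, (F' (x - z) - F' x) ∂ρ := by
      funext x
      rw [integral_withDensity_eq_integral_toReal_smul₀ hφm.aemeasurable
        (Eventually.of_forall fun z => ENNReal.ofReal_lt_top)]
      simp only [ENNReal.toReal_ofReal (hφ0 k _)]
    rw [heq]
    refine eLpNorm_average_le hF'm.1 hp ?_
    rw [ae_withDensity_iff hφm]
    refine Eventually.of_forall fun z hz => hball ?_
    have hz' : φ k z ≠ 0 := fun h0 => hz (by simp [h0])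
    rw [dist_zero_right]
    linarith [hzn k z (hφs k z hz')]

/-- Functions continuous up to the boundary with a weak gradient in `L^p` are limits of smooth
functions up to the boundary. -/
theorem strongApprox_of_hasWeakGradient (hU : IsOpen U) (hb : Bornology.IsBounded U)
    (𝒜 : Atlas U) {p : ℝ} (hp : 1 ≤ p) {f : Eu n → ℝ} {F : Eu n → Eu n}
    (hf : ContinuousOn f (closure U)) (hw : HasWeakGradient U f F)
    (hF : MemLp F (ENNReal.ofReal p) (volume.restrict U)) :
    StrongApprox U (ENNReal.ofReal p) f F := by
  have hfin : IsFiniteMeasure (volume.restrict U) := ⟨by simpa using hb.measure_lt_top⟩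
  have hp1 : 1 ≤ ENNReal.ofReal p := by simpa using hp
  have key : ∀ o : Option 𝒜.ι, ∃ g : ℕ → Eu n → ℝ, (∀ k, ContDiff ℝ 1 (g k)) ∧
      (∀ ε > 0, ∀ᶠ k in atTop, ∀ x ∈ closure U ∩ tsupport (𝒜.bump o), |g k x - f x| ≤ ε) ∧
      ∃ R : ℕ → Eu n → Eu n,
        (∀ k, ∀ x ∈ U ∩ tsupport (𝒜.bump o), gradient (g k) x - F x = R k x) ∧
        Tendsto (fun k => eLpNorm (R k) (ENNReal.ofReal p) volume) atTop (𝓝 0) := fun o => by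
    obtain ⟨e, c, s₀, he, hc, hc1, hs₀, hA⟩ := 𝒜.exists_inner_cone hU o
    exact exists_cone_mollification hU hb hp hf hw hF he hc hc1 hs₀ hA
  choose g hgc hgu R hR hRt using key
  have hbd : ∀ o, ∃ B : ℝ, 0 ≤ B ∧ ∀ x, |𝒜.bump o x| ≤ B ∧ ‖gradient (𝒜.bump o) x‖ ≤ B := by
    intro o
    obtain ⟨C1, h1⟩ := (𝒜.bump_contDiff o).continuous.bounded_above_of_compact_support
      (𝒜.bump_compact o)
    obtain ⟨C2, h2⟩ := ((𝒜.bump_contDiff o).continuous_fderiv one_ne_zero).bounded_above_of_compact_support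
      ((𝒜.bump_compact o).fderiv ℝ)
    exact ⟨max 0 (max C1 C2), le_max_left _ _, fun x =>
      ⟨(h1 x).trans ((le_max_left _ _).trans (le_max_right _ _)), by
        rw [norm_gradient]; exact (h2 x).trans ((le_max_right _ _).trans (le_max_right _ _))⟩⟩
  choose B hB0 hB using hbd
  have hsmall : ∀ o, ∀ ε > 0, ∀ᶠ k in atTop, ∀ x ∈ closure U,
      |𝒜.bump o x * (g o k x - f x)| ≤ ε ∧ ‖(g o k x - f x) • gradient (𝒜.bump o) x‖ ≤ ε := by
    intro o ε hε
    have hB1 : 0 < B o + 1 := by linarith [hB0 o]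
    filter_upwards [hgu o (ε / (B o + 1)) (by positivity)] with k hk x hx
    by_cases hxs : x ∈ tsupport (𝒜.bump o)
    · have h1 := hk x ⟨hx, hxs⟩
      have h2 : ε / (B o + 1) * (B o + 1) = ε := by field_simp
      rw [abs_mul, norm_smul, Real.norm_eq_abs, mul_comm]
      constructor
      · rw [← h2]
        exact mul_le_mul h1 (by linarith [(hB o x).1]) (abs_nonneg _) (by positivity)
      · rw [← h2]
        exact mul_le_mul h1 (by linarith [(hB o x).2]) (norm_nonneg _) (by positivity)
    · have h0 : gradient (𝒜.bump o) x = 0 := by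
        have : fderiv ℝ (𝒜.bump o) x = 0 := by
          by_contra hne
          exact hxs (support_fderiv_subset ℝ (Function.mem_support.2 hne))
        rw [gradient, this, map_zero]
      simp [h0, image_eq_zero_of_notMem_tsupport hxs, hε.le]
  -- The gradients of a partition of unity cancel. This allows `g ∇χ` to be replaced by `(g - f) ∇χ`
  -- in the product rule, and the latter is uniformly small.
  have hgrad0 : ∀ x ∈ U, ∑ o, gradient (𝒜.bump o) x = 0 := fun x hx => by
    rw [← gradient_sum _ fun o _ => (𝒜.bump_contDiff o).differentiable one_ne_zero x]
    have : (fun y => ∑ o, 𝒜.bump o y) =ᶠ[𝓝 x] fun _ => 1 := by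
      filter_upwards [hU.mem_nhds hx] with y hy using 𝒜.bump_sum y (subset_closure hy)
    rw [this.gradient_eq, gradient_fun_const]
  refine ⟨hf, hF, fun k x => ∑ o, 𝒜.bump o x * g o k x,
    fun k => ContDiff.sum fun o _ => (𝒜.bump_contDiff o).mul (hgc o k), ?_, ?_⟩
  · rw [Metric.tendstoUniformlyOn_iff]
    intro ε hε
    set N : ℝ := (Fintype.card (Option 𝒜.ι) : ℝ)
    have hN : 0 ≤ N := Nat.cast_nonneg _
    filter_upwards [eventually_all.2 fun o => hsmall o (ε / (N + 1)) (by positivity)] with k hk x hx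
    rw [dist_comm, Real.dist_eq]
    have h1 : ∑ o, 𝒜.bump o x * g o k x - f x = ∑ o, 𝒜.bump o x * (g o k x - f x) := by
      simp_rw [mul_sub]
      rw [Finset.sum_sub_distrib, ← Finset.sum_mul, 𝒜.bump_sum x hx, one_mul]
    rw [h1]
    calc |∑ o, 𝒜.bump o x * (g o k x - f x)| ≤ ∑ o, |𝒜.bump o x * (g o k x - f x)| :=
          Finset.abs_sum_le_sum_abs _ _
      _ ≤ ∑ _o : Option 𝒜.ι, ε / (N + 1) := Finset.sum_le_sum fun o _ => (hk o x hx).1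
      _ = N * (ε / (N + 1)) := by rw [Finset.sum_const, nsmul_eq_mul]; rfl
      _ < ε := by
        rw [mul_div_assoc', div_lt_iff₀ (by positivity)]
        nlinarith
  · set μ := volume.restrict U
    have hpt : ∀ k, (fun x => gradient (fun y => ∑ o, 𝒜.bump o y * g o k y) x - F x) =ᵐ[μ]
        ∑ o, ((fun x => 𝒜.bump o x • (gradient (g o k) x - F x)) +
          fun x => (g o k x - f x) • gradient (𝒜.bump o) x) := by
      intro k
      filter_upwards [ae_restrict_mem hU.measurableSet] with x hx
      rw [gradient_sum _ fun o _ => ((𝒜.bump_contDiff o).mul (hgc o k)).differentiable one_ne_zero x]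
      have h1 : ∀ o, gradient (fun y => 𝒜.bump o y * g o k y) x =
          𝒜.bump o x • gradient (g o k) x + g o k x • gradient (𝒜.bump o) x := fun o =>
        gradient_mul ((𝒜.bump_contDiff o).differentiable one_ne_zero x)
          ((hgc o k).differentiable one_ne_zero x)
      have h2 : F x = ∑ o, 𝒜.bump o x • F x := by
        rw [← Finset.sum_smul, 𝒜.bump_sum x (subset_closure hx), one_smul]
      have h3 : ∑ o, f x • gradient (𝒜.bump o) x = 0 := by
        rw [← Finset.smul_sum, hgrad0 x hx, smul_zero]
      simp only [h1, Finset.sum_apply, Pi.add_apply, smul_sub, sub_smul]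
      rw [Finset.sum_add_distrib, Finset.sum_add_distrib, Finset.sum_sub_distrib,
        Finset.sum_sub_distrib, ← h2, h3]
      abel
    have hm1 : ∀ o k, AEStronglyMeasurable (fun x => 𝒜.bump o x • (gradient (g o k) x - F x)) μ :=
      fun o k => (𝒜.bump_contDiff o).continuous.aestronglyMeasurable.smul
        ((continuous_gradient (hgc o k)).aestronglyMeasurable.sub hF.1)
    have hm2 : ∀ o k, AEStronglyMeasurable (fun x => (g o k x - f x) • gradient (𝒜.bump o) x) μ :=
      fun o k => ((hgc o k).continuous.aestronglyMeasurable.sub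
        ((hf.mono subset_closure).aestronglyMeasurable hU.measurableSet)).smul
        (continuous_gradient (𝒜.bump_contDiff o)).aestronglyMeasurable
    have ht1 : ∀ o, Tendsto (fun k => eLpNorm (fun x => 𝒜.bump o x • (gradient (g o k) x - F x))
        (ENNReal.ofReal p) μ) atTop (𝓝 0) := by
      intro o
      have hlim : Tendsto (fun k => ENNReal.ofReal (B o) * eLpNorm (R o k) (ENNReal.ofReal p) volume)
          atTop (𝓝 0) := by
        simpa using ENNReal.Tendsto.const_mul (hRt o) (Or.inr ENNReal.ofReal_ne_top)
      refine tendsto_of_tendsto_of_tendsto_of_le_of_le tendsto_const_nhds hlim (fun k => bot_le)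
        fun k => ?_
      refine (eLpNorm_le_mul_eLpNorm_of_ae_le_mul ?_ _).trans
        (mul_le_mul' le_rfl (eLpNorm_restrict_le (R o k) _ volume U))
      filter_upwards [ae_restrict_mem hU.measurableSet] with x hx
      by_cases hxs : x ∈ tsupport (𝒜.bump o)
      · rw [norm_smul, hR o k x ⟨hx, hxs⟩]
        exact mul_le_mul_of_nonneg_right (hB o x).1 (norm_nonneg _)
      · rw [image_eq_zero_of_notMem_tsupport hxs, zero_smul, norm_zero]
        exact mul_nonneg (hB0 o) (norm_nonneg _)
    have ht2 : ∀ o, Tendsto (fun k => eLpNorm (fun x => (g o k x - f x) • gradient (𝒜.bump o) x)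
        (ENNReal.ofReal p) μ) atTop (𝓝 0) := by
      intro o
      have := tendsto_eLpNorm_smul (μ := μ) (p := ENNReal.ofReal p) (B := 1) hp1
        (g := fun _ => (1 : ℝ)) (gk := fun _ _ => 1) (G := fun _ => (0 : Eu n))
        (Gk := fun k x => (g o k x - f x) • gradient (𝒜.bump o) x)
        aestronglyMeasurable_const (fun _ => aestronglyMeasurable_const) MemLp.zero (hm2 o)
        (by simp) (by
          intro ε hε; exact Eventually.of_forall fun k => Eventually.of_forall fun x => by
            simpa using hε.le) ?_
      · simpa using this
      · simp only [sub_zero]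
        rw [ENNReal.tendsto_nhds_zero]
        intro ε hε
        have hc : Tendsto (fun t : ℝ => μ univ ^ (ENNReal.ofReal p).toReal⁻¹ * ENNReal.ofReal t)
            (𝓝[>] 0) (𝓝 0) := by
          have h2 : Tendsto (fun t : ℝ => ENNReal.ofReal t) (𝓝[>] 0) (𝓝 0) := by
            have := (ENNReal.continuous_ofReal.tendsto 0).mono_left
              (nhdsWithin_le_nhds (s := Ioi 0))
            simpa using this
          have h3 : μ univ ^ (ENNReal.ofReal p).toReal⁻¹ ≠ ⊤ :=
            ENNReal.rpow_ne_top_of_nonneg (by positivity) (measure_ne_top _ _)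
          simpa using ENNReal.Tendsto.const_mul h2 (Or.inr h3)
        obtain ⟨t, ht, ht0⟩ := ((hc.eventually_le_const hε).and self_mem_nhdsWithin).exists
        filter_upwards [hsmall o t ht0] with k hk
        refine (eLpNorm_le_of_ae_bound (C := t) ?_).trans ht
        filter_upwards [ae_restrict_mem hU.measurableSet] with x hx
          using (hk x (subset_closure hx)).2
    have hsum : Tendsto (fun k => ∑ o, (eLpNorm (fun x => 𝒜.bump o x • (gradient (g o k) x - F x))
        (ENNReal.ofReal p) μ + eLpNorm (fun x => (g o k x - f x) • gradient (𝒜.bump o) x)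
        (ENNReal.ofReal p) μ)) atTop (𝓝 0) := by
      simpa using tendsto_finsetSum Finset.univ fun o _ => (ht1 o).add (ht2 o)
    refine tendsto_of_tendsto_of_tendsto_of_le_of_le tendsto_const_nhds hsum (fun k => bot_le)
      fun k => ?_
    simp only
    rw [eLpNorm_congr_ae (hpt k)]
    refine (eLpNorm_sum_le (fun o _ => (hm1 o k).add (hm2 o k)) hp1).trans
      (Finset.sum_le_sum fun o _ => eLpNorm_add_le (hm1 o k) (hm2 o k) hp1)

end ForchheimerGas

end

noncomputable section

namespace ForchheimerGas

/-! ### Trace and Sobolev inequalities for approximable functions -/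

variable {n : ℕ} {U : Set (Eu n)}

/-- Since `U` has finite measure, convergence of gradients in `L^p` implies convergence in `L¹`. The
sequence `d` bounds the uniform errors and `e` the excess of the `W^{1,1}` norms; this is what is
needed to extend the trace and Sobolev inequalities from smooth functions. -/
theorem StrongApprox.exists_approx_one {p : ℝ≥0∞} {f : Eu n → ℝ} {F : Eu n → Eu n}
    (h : StrongApprox U p f F) (hU : IsOpen U) (hb : Bornology.IsBounded U) (hp : 1 ≤ p) :
    ∃ fk : ℕ → Eu n → ℝ, (∀ k, ContDiff ℝ 1 (fk k)) ∧ ∃ d e : ℕ → ℝ≥0∞,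
      Tendsto d atTop (𝓝 0) ∧ Tendsto e atTop (𝓝 0) ∧
      (∀ k, ∀ x ∈ closure U, ‖f x - fk k x‖ₑ ≤ d k) ∧
      ∀ k, sobNorm U (fk k) ≤ (∫⁻ x in U, (‖f x‖ₑ + ‖F x‖ₑ)) + e k := by
  have hfin : IsFiniteMeasure (volume.restrict U) := ⟨by simpa using hb.measure_lt_top⟩
  obtain ⟨fk, hfk, hunif, hgrad⟩ := h.approx
  set μ := volume.restrict U
  have hmf : AEStronglyMeasurable f μ :=
    (h.continuousOn.mono subset_closure).aestronglyMeasurable hU.measurableSet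
  set d : ℕ → ℝ≥0∞ := fun k => ⨆ x ∈ closure U, ‖f x - fk k x‖ₑ
  have hd : ∀ k, ∀ x ∈ closure U, ‖f x - fk k x‖ₑ ≤ d k := fun k x hx =>
    le_iSup₂ (f := fun x (_ : x ∈ closure U) => ‖f x - fk k x‖ₑ) x hx
  have hdt : Tendsto d atTop (𝓝 0) := by
    rw [ENNReal.tendsto_nhds_zero]
    intro ε hε
    obtain ⟨t, ht0, ht⟩ : ∃ t : ℝ, 0 < t ∧ ENNReal.ofReal t ≤ ε := by
      rcases eq_or_ne ε ⊤ with rfl | hε'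
      · exact ⟨1, one_pos, le_top⟩
      · exact ⟨ε.toReal, ENNReal.toReal_pos hε.ne' hε', ENNReal.ofReal_toReal_le⟩
    filter_upwards [Metric.tendstoUniformlyOn_iff.1 hunif t ht0] with k hk
    refine iSup₂_le fun x hx => le_trans ?_ ht
    rw [← ofReal_norm, ← dist_eq_norm]
    exact ENNReal.ofReal_le_ofReal (hk x hx).le
  set c : ℝ≥0∞ := μ univ ^ (1 / (1 : ℝ≥0∞).toReal - 1 / p.toReal)
  have hc : c ≠ ⊤ := by
    refine ENNReal.rpow_ne_top_of_nonneg ?_ (measure_ne_top _ _)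
    rcases eq_or_ne p ⊤ with rfl | hpt
    · simp
    · have : 1 ≤ p.toReal := by simpa using (ENNReal.toReal_le_toReal ENNReal.one_ne_top hpt).2 hp
      simp only [ENNReal.toReal_one, div_one, one_div, sub_nonneg]
      exact inv_le_one_of_one_le₀ this
  refine ⟨fk, hfk, d, fun k => d k * μ univ +
    eLpNorm (fun x => gradient (fk k) x - F x) p μ * c, hdt, ?_, hd, fun k => ?_⟩
  · have h1 := ENNReal.Tendsto.mul_const (b := μ univ) hdt (Or.inr (measure_ne_top _ _))
    have h2 := ENNReal.Tendsto.mul_const (b := c) hgrad (Or.inr hc)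
    simpa using h1.add h2
  · have hm : AEStronglyMeasurable (fun x => gradient (fk k) x - F x) μ :=
      (continuous_gradient (hfk k)).aestronglyMeasurable.sub h.memLp.1
    calc sobNorm U (fk k)
        ≤ ∫⁻ x in U, ((‖f x‖ₑ + ‖F x‖ₑ) + (d k + ‖gradient (fk k) x - F x‖ₑ)) := by
          refine lintegral_mono_ae ?_
          filter_upwards [ae_restrict_mem hU.measurableSet] with x hx
          have e1 : ‖fk k x‖ₑ ≤ ‖f x‖ₑ + d k := by
            calc ‖fk k x‖ₑ = ‖f x - (f x - fk k x)‖ₑ := by congr 1; ring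
              _ ≤ ‖f x‖ₑ + ‖f x - fk k x‖ₑ := enorm_sub_le
              _ ≤ _ := by gcongr; exact hd k x (subset_closure hx)
          have e2 : ‖fderiv ℝ (fk k) x‖ₑ ≤ ‖F x‖ₑ + ‖gradient (fk k) x - F x‖ₑ := by
            rw [← ofReal_norm, ← norm_gradient, ofReal_norm]
            calc ‖gradient (fk k) x‖ₑ = ‖F x + (gradient (fk k) x - F x)‖ₑ := by congr 1; abel
              _ ≤ _ := enorm_add_le _ _
          calc _ ≤ (‖f x‖ₑ + d k) + (‖F x‖ₑ + ‖gradient (fk k) x - F x‖ₑ) := add_le_add e1 e2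
            _ = _ := by ring
      _ = (∫⁻ x in U, (‖f x‖ₑ + ‖F x‖ₑ)) + (d k * μ univ + eLpNorm
          (fun x => gradient (fk k) x - F x) 1 μ) := by
          have hm1 : AEMeasurable (fun x => ‖f x‖ₑ + ‖F x‖ₑ) μ := hmf.enorm.add h.memLp.1.enorm
          rw [lintegral_add_left' hm1, lintegral_add_left measurable_const, lintegral_const, eLpNorm_one_eq_lintegral_enorm]
      _ ≤ _ := by
          exact add_le_add le_rfl (add_le_add le_rfl
            (eLpNorm_le_eLpNorm_mul_rpow_measure_univ hp hm))

/-- The trace inequality. -/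
theorem exists_trace (hn : 2 ≤ n) (hU : IsOpen U) (hb : Bornology.IsBounded U) (𝒜 : Atlas U) :
    ∃ C : ℝ≥0∞, C ≠ ⊤ ∧ ∀ (p : ℝ≥0∞) (f : Eu n → ℝ) (F : Eu n → Eu n), 1 ≤ p →
      StrongApprox U p f F →
      ∫⁻ x, ‖f x‖ₑ ∂(surfaceMeasure U) ≤ C * ∫⁻ x in U, (‖f x‖ₑ + ‖F x‖ₑ) := by
  have hσ := isFiniteMeasure_surfaceMeasure hn hU hb 𝒜
  obtain ⟨C, hC, h⟩ := exists_trace_smooth hn hU 𝒜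
  refine ⟨C, hC, fun p f F hp hf => ?_⟩
  obtain ⟨fk, hfk, d, e, hd, he, hdk, hek⟩ := hf.exists_approx_one hU hb hp
  have hlim : Tendsto (fun k => C * ((∫⁻ x in U, (‖f x‖ₑ + ‖F x‖ₑ)) + e k) +
      d k * surfaceMeasure U univ) atTop (𝓝 (C * ((∫⁻ x in U, (‖f x‖ₑ + ‖F x‖ₑ)) + 0) +
        0 * surfaceMeasure U univ)) :=
    (ENNReal.Tendsto.const_mul (tendsto_const_nhds.add he) (Or.inr hC)).add
      (ENNReal.Tendsto.mul_const hd (Or.inr (measure_ne_top _ _)))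
  rw [add_zero, zero_mul, add_zero] at hlim
  refine ge_of_tendsto' hlim fun k => ?_
  calc ∫⁻ x, ‖f x‖ₑ ∂(surfaceMeasure U) ≤ ∫⁻ x, (‖fk k x‖ₑ + d k) ∂(surfaceMeasure U) := by
        refine lintegral_mono_ae ?_
        filter_upwards [ae_restrict_mem isClosed_frontier.measurableSet] with x hx
        calc ‖f x‖ₑ = ‖fk k x + (f x - fk k x)‖ₑ := by congr 1; ring
          _ ≤ ‖fk k x‖ₑ + ‖f x - fk k x‖ₑ := enorm_add_le _ _
          _ ≤ _ := by gcongr; exact hdk k x (frontier_subset_closure hx)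
    _ = (∫⁻ x, ‖fk k x‖ₑ ∂(surfaceMeasure U)) + d k * surfaceMeasure U univ := by
        rw [lintegral_add_right _ measurable_const, lintegral_const]
    _ ≤ _ := by gcongr; exact (h _ (hfk k)).trans (mul_le_mul' le_rfl (hek k))

theorem exists_sobolev_one (hn : 2 ≤ n) (hU : IsOpen U) (hb : Bornology.IsBounded U)
    (𝒜 : Atlas U) :
    ∃ C : ℝ≥0∞, C ≠ ⊤ ∧ ∀ (p : ℝ≥0∞) (f : Eu n → ℝ) (F : Eu n → Eu n), 1 ≤ p →
      StrongApprox U p f F →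
      eLpNorm f (sobExp n) (volume.restrict U) ≤ C * ∫⁻ x in U, (‖f x‖ₑ + ‖F x‖ₑ) := by
  have hfin : IsFiniteMeasure (volume.restrict U) := ⟨by simpa using hb.measure_lt_top⟩
  obtain ⟨C, hC, h⟩ := exists_sobolev_smooth hn hU 𝒜
  refine ⟨C, hC, fun p f F hp hf => ?_⟩
  obtain ⟨fk, hfk, d, e, hd, he, hdk, hek⟩ := hf.exists_approx_one hU hb hp
  set c : ℝ≥0∞ := eLpNorm (fun _ : Eu n => (1 : ℝ)) (sobExp n) (volume.restrict U)
  have hc : c ≠ ⊤ := (memLp_const (1 : ℝ)).2.ne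
  have hmf : AEStronglyMeasurable f (volume.restrict U) :=
    (hf.continuousOn.mono subset_closure).aestronglyMeasurable hU.measurableSet
  have hlim : Tendsto (fun k => C * ((∫⁻ x in U, (‖f x‖ₑ + ‖F x‖ₑ)) + e k) +
      d k * c) atTop (𝓝 (C * ((∫⁻ x in U, (‖f x‖ₑ + ‖F x‖ₑ)) + 0) + 0 * c)) :=
    (ENNReal.Tendsto.const_mul (tendsto_const_nhds.add he) (Or.inr hC)).add
      (ENNReal.Tendsto.mul_const hd (Or.inr hc))
  rw [add_zero, zero_mul, add_zero] at hlim
  refine ge_of_tendsto hlim ?_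
  filter_upwards [hd.eventually_lt_const ENNReal.zero_lt_top] with k hk
  have e1 : f = fk k + fun x => f x - fk k x := by funext x; simp
  calc eLpNorm f (sobExp n) (volume.restrict U)
      ≤ eLpNorm (fk k) (sobExp n) (volume.restrict U) +
        eLpNorm (fun x => f x - fk k x) (sobExp n) (volume.restrict U) := by
        nth_rw 1 [e1]
        exact eLpNorm_add_le (hfk k).continuous.aestronglyMeasurable
          (hmf.sub (hfk k).continuous.aestronglyMeasurable) (one_le_sobExp hn)
    _ ≤ C * ((∫⁻ x in U, (‖f x‖ₑ + ‖F x‖ₑ)) + e k) + d k * c := by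
        gcongr
        · exact (h _ (hfk k)).trans (mul_le_mul' le_rfl (hek k))
        · have := eLpNorm_le_mul_eLpNorm_of_ae_le_mul (μ := volume.restrict U) (c := (d k).toReal)
            (f := fun x => f x - fk k x) (g := fun _ => (1 : ℝ)) (by
              filter_upwards [ae_restrict_mem hU.measurableSet] with x hx
              rw [norm_one, mul_one, ← toReal_enorm]
              exact ENNReal.toReal_mono hk.ne (hdk k x (subset_closure hx))) (sobExp n)
          rwa [ENNReal.ofReal_toReal hk.ne] at this

/-- The Sobolev inequality `W^{1,p}(U) → L^{np/(n-p)}(U)` for non-negative functions. -/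
theorem exists_sobolev (hn : 2 ≤ n) (hU : IsOpen U) (hb : Bornology.IsBounded U) (𝒜 : Atlas U)
    {p : ℝ} (hp1 : 1 < p) (hpn : p < n) :
    ∃ C : ℝ≥0∞, C ≠ ⊤ ∧ ∀ (f : Eu n → ℝ) (F : Eu n → Eu n), (∀ x ∈ closure U, 0 ≤ f x) →
      StrongApprox U (ENNReal.ofReal p) f F →
      (∫⁻ x in U, ‖f x‖ₑ ^ (n * p / (n - p))) ^ ((n - p) / n : ℝ) ≤
        C * ∫⁻ x in U, (‖f x‖ₑ ^ p + ‖F x‖ₑ ^ p) := by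
  have hfin : IsFiniteMeasure (volume.restrict U) := ⟨by simpa using hb.measure_lt_top⟩
  obtain ⟨C, hC, h⟩ := exists_sobolev_one hn hU hb 𝒜
  have hn0 : (2 : ℝ) ≤ n := by exact_mod_cast hn
  -- The case `W^{1,1}` is applied to `f^s`. This `s` satisfies both `s n/(n-1) = q` and `(s - 1) p'
  -- = q`, with `q = np/(n-p)`, so after Hölder's inequality the same integral appears on both
  -- sides.
  set s : ℝ := p * (n - 1) / (n - p) with hs
  have hnp : 0 < n - p := by linarith
  have hs1 : 1 ≤ s := by rw [hs, le_div_iff₀ hnp]; nlinarith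
  set q : ℝ := n * p / (n - p) with hq
  have hq0 : 0 < q := by positivity
  refine ⟨(C * ENNReal.ofReal s) ^ p * 2 ^ (p - 1),
    ENNReal.mul_ne_top (ENNReal.rpow_ne_top_of_nonneg (by linarith)
      (ENNReal.mul_ne_top hC ENNReal.ofReal_ne_top))
      (ENNReal.rpow_ne_top_of_nonneg (by linarith) (by simp)), fun f F hf0 hf => ?_⟩
  obtain ⟨B, hB0, hB⟩ := hf.bounded hb
  have hp1' : 1 ≤ ENNReal.ofReal p := by simpa using hp1.le
  have hmf : AEMeasurable (fun x => ‖f x‖ₑ) (volume.restrict U) :=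
    ((hf.continuousOn.mono subset_closure).aestronglyMeasurable hU.measurableSet).enorm
  set Z : ℝ≥0∞ := ∫⁻ x in U, ‖f x‖ₑ ^ q with hZ
  have hZt : Z ≠ ⊤ := by
    refine ne_top_of_le_ne_top (b := ∫⁻ x in U, (ENNReal.ofReal B) ^ q) ?_ ?_
    · rw [lintegral_const]
      exact ENNReal.mul_ne_top (ENNReal.rpow_ne_top_of_nonneg hq0.le ENNReal.ofReal_ne_top)
        (measure_ne_top _ _)
    · refine lintegral_mono_ae ?_
      filter_upwards [ae_restrict_mem hU.measurableSet] with x hx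
      gcongr
      rw [← ofReal_norm]
      exact ENNReal.ofReal_le_ofReal (hB x (subset_closure hx))
  have hpq : p.HolderConjugate (p / (p - 1)) := Real.HolderConjugate.conjExponent hp1
  set p' := p / (p - 1) with hp'
  have h1 := h _ _ _ hp1' (hf.comp hU hb hp1' (Ψ := fun x => x ^ s)
    (Real.contDiff_rpow_const_of_le (by simpa using hs1)))
  have hsob : (sobExp n : ℝ) = n / (n - 1) := by
    have : (1 : NNReal) ≤ n := by exact_mod_cast (by omega : 1 ≤ n)
    simp [sobExp, NNReal.coe_sub this]
  have hL : eLpNorm (fun x => f x ^ s) (sobExp n) (volume.restrict U) =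
      Z ^ ((n - 1) / n : ℝ) := by
    have h0 : (sobExp n : ℝ≥0∞) ≠ 0 := (zero_lt_one.trans_le (one_le_sobExp hn)).ne'
    rw [eLpNorm_eq_lintegral_rpow_enorm_toReal h0 ENNReal.coe_ne_top, ENNReal.coe_toReal, hsob,
      one_div_div]
    congr 1
    refine lintegral_congr_ae ?_
    filter_upwards [ae_restrict_mem hU.measurableSet] with x hx
    rw [← ofReal_norm, ← ofReal_norm, Real.norm_of_nonneg (Real.rpow_nonneg (hf0 x (subset_closure hx)) _),
      Real.norm_of_nonneg (hf0 x (subset_closure hx)),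
      ← ENNReal.ofReal_rpow_of_nonneg (hf0 x (subset_closure hx)) (by linarith), ← ENNReal.rpow_mul]
    congr 1
    rw [hs, hq]
    have : (n : ℝ) - 1 ≠ 0 := by linarith
    field_simp
  have hR : ∫⁻ x in U, (‖f x ^ s‖ₑ + ‖deriv (fun x : ℝ => x ^ s) (f x) • F x‖ₑ) ≤
      ENNReal.ofReal s * (Z ^ (1 / p') *
        (∫⁻ x in U, (‖f x‖ₑ + ‖F x‖ₑ) ^ p) ^ (1 / p)) := by
    calc _ ≤ ∫⁻ x in U, ENNReal.ofReal s * (‖f x‖ₑ ^ (s - 1) * (‖f x‖ₑ + ‖F x‖ₑ)) := by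
          refine lintegral_mono_ae ?_
          filter_upwards [ae_restrict_mem hU.measurableSet] with x hx
          have hx0 := hf0 x (subset_closure hx)
          have e1 : ‖f x ^ s‖ₑ = ‖f x‖ₑ ^ (s - 1) * ‖f x‖ₑ := by
            rw [← ofReal_norm, ← ofReal_norm, Real.norm_of_nonneg hx0,
              Real.norm_of_nonneg (Real.rpow_nonneg hx0 _)]
            rw [ENNReal.ofReal_rpow_of_nonneg hx0 (by linarith), ← ENNReal.ofReal_mul
              (Real.rpow_nonneg hx0 _)]
            congr 1
            nth_rw 3 [← Real.rpow_one (f x)]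
            rw [← Real.rpow_add_of_nonneg hx0 (by linarith) zero_le_one]
            congr 1; ring
          have e2 : ‖deriv (fun x : ℝ => x ^ s) (f x) • F x‖ₑ =
              ENNReal.ofReal s * (‖f x‖ₑ ^ (s - 1) * ‖F x‖ₑ) := by
            rw [(Real.hasDerivAt_rpow_const (Or.inr hs1)).deriv, enorm_smul, enorm_mul, ← ofReal_norm s,
              Real.norm_of_nonneg (by linarith : 0 ≤ s), mul_assoc]
            congr 2
            rw [← ofReal_norm, ← ofReal_norm, Real.norm_of_nonneg hx0,
              Real.norm_of_nonneg (Real.rpow_nonneg hx0 _),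
              ENNReal.ofReal_rpow_of_nonneg hx0 (by linarith)]
          rw [e1, e2, mul_add, mul_add]
          refine add_le_add ?_ le_rfl
          exact le_mul_of_one_le_left bot_le (by simpa using hs1)
      _ = ENNReal.ofReal s * ∫⁻ x in U, ((fun x => ‖f x‖ₑ ^ (s - 1)) * (fun x => ‖f x‖ₑ + ‖F x‖ₑ)) x := by
          rw [lintegral_const_mul' _ _ ENNReal.ofReal_ne_top]; rfl
      _ ≤ _ := by
          gcongr
          refine (ENNReal.lintegral_mul_le_Lp_mul_Lq _ hpq.symm (hmf.pow_const _)
            (hmf.add hf.memLp.1.enorm)).trans_eq ?_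
          congr 2
          refine lintegral_congr fun x => ?_
          rw [← ENNReal.rpow_mul]
          congr 1
          rw [hs, hp', hq]
          have : p - 1 ≠ 0 := by linarith
          field_simp
          ring
  rw [hL] at h1
  have h2 := h1.trans (mul_le_mul' le_rfl hR)
  -- Dividing by `Z^{1/p'}` requires `0 < Z < ∞`; finiteness was obtained from the boundedness of
  -- `f`. What remains on the left is `Z` to the power `(n-1)/n - 1/p' = (n-p)/(np)`.
  rcases eq_or_ne Z 0 with hZ0 | hZ0
  · rw [hZ0, ENNReal.zero_rpow_of_pos (by positivity)]; exact bot_le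
  set W := ∫⁻ x in U, (‖f x‖ₑ + ‖F x‖ₑ) ^ p with hW
  have hp'0 : 0 < p' := hpq.symm.pos
  have h3 : Z ^ ((n - p) / (n * p) : ℝ) ≤ C * ENNReal.ofReal s * W ^ (1 / p) := by
    have h4 : Z ^ (1 / p') * Z ^ ((n - p) / (n * p) : ℝ) ≤
        Z ^ (1 / p') * (C * ENNReal.ofReal s * W ^ (1 / p)) := by
      have e1 : 1 / p' + (n - p) / (n * p) = ((n - 1) / n : ℝ) := by
        rw [hp']
        have : p - 1 ≠ 0 := by linarith
        field_simp
        ring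
      rw [← ENNReal.rpow_add _ _ hZ0 hZt, e1]
      exact h2.trans_eq (by ring)
    rwa [ENNReal.mul_le_mul_iff_right (by
        simp [ENNReal.rpow_eq_zero_iff, hZ0, hZt])
      (ENNReal.rpow_ne_top_of_nonneg (by positivity) hZt)] at h4
  calc Z ^ ((n - p) / n : ℝ) = (Z ^ ((n - p) / (n * p) : ℝ)) ^ p := by
        rw [← ENNReal.rpow_mul]; congr 1; field_simp
    _ ≤ (C * ENNReal.ofReal s * W ^ (1 / p)) ^ p := by gcongr
    _ = (C * ENNReal.ofReal s) ^ p * W := by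
        rw [ENNReal.mul_rpow_of_nonneg _ _ (by linarith), ← ENNReal.rpow_mul,
          one_div_mul_cancel (by linarith), ENNReal.rpow_one]
    _ ≤ (C * ENNReal.ofReal s) ^ p * (2 ^ (p - 1) * ∫⁻ x in U, (‖f x‖ₑ ^ p + ‖F x‖ₑ ^ p)) := by
        gcongr
        rw [← lintegral_const_mul' _ _ (ENNReal.rpow_ne_top_of_nonneg (by linarith) (by simp))]
        exact lintegral_mono fun x => ENNReal.rpow_add_le_mul_rpow_add_rpow _ _ hp1.le
    _ = _ := by ring

end ForchheimerGas

end

noncomputable section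

namespace ForchheimerGas

/-! ### Solutions with measurable data -/

variable {n : ℕ} {U : Set (Eu n)} {P : GenPoly} {lam T : ℝ}

/-- The flux `K(|F|) F`. -/
def GenPoly.flux (P : GenPoly) (v : Eu n) : Eu n := P.K ‖v‖ • v

theorem GenPoly.measurable_flux : Measurable (P.flux : Eu n → Eu n) :=
  P.measurable_K_norm.smul measurable_id

theorem GenPoly.norm_flux (v : Eu n) : ‖P.flux v‖ = P.K ‖v‖ * ‖v‖ := by
  rw [GenPoly.flux, norm_smul, Real.norm_of_nonneg (P.K_pos (norm_nonneg _)).le]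

theorem GenPoly.inner_flux_self (v : Eu n) : ⟪P.flux v, v⟫ = P.K ‖v‖ * ‖v‖ ^ 2 := by
  rw [GenPoly.flux, real_inner_smul_left, real_inner_self_eq_norm_sq]

/-- A solution together with Borel measurable versions `Du` of its gradient and `w` of `φ u^λ`,
tested with functions of the space variable only. -/
structure RegSol (P : GenPoly) (lam : ℝ) (U : Set (Eu n)) (T : ℝ) (u w : Eu n → ℝ → ℝ)
    (Du : Eu n → ℝ → Eu n) : Prop where
  nonneg : ∀ x t, 0 ≤ u x t
  measurable : Measurable (Function.uncurry u)
  measurable_grad : Measurable (Function.uncurry Du)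
  measurable_bdry : Measurable (Function.uncurry w)
  continuousOn : ContinuousOn (Function.uncurry u) (closure U ×ˢ Ioo 0 T)
  integrable_bdry : ∀ t₁ t₂ : ℝ, 0 < t₁ → t₁ < t₂ → t₂ < T →
    Integrable (Function.uncurry w) ((surfaceMeasure U).prod (volume.restrict (Ioo t₁ t₂)))
  weakGrad : ∀ᵐ t ∂(volume.restrict (Ioo 0 T)),
    HasWeakGradient U (fun x => u x t) (fun x => Du x t)
  memLp : ∀ t₁ t₂ : ℝ, 0 < t₁ → t₁ < t₂ → t₂ < T →
    MemLp (Function.uncurry Du) (ENNReal.ofReal (2 - P.a))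
      ((volume.restrict U).prod (volume.restrict (Ioo t₁ t₂)))
  weak_form : ∀ t₁ t₂ : ℝ, 0 < t₁ → t₁ < t₂ → t₂ < T → ∀ η : Eu n → ℝ, ContDiff ℝ 1 η →
    (∫ x in U, u x t₂ ^ lam * η x) - (∫ x in U, u x t₁ ^ lam * η x) =
      - (∫ t in Ioo t₁ t₂, ∫ x in U, ⟪P.flux (Du x t), gradient η x⟫)
      - ∫ t in Ioo t₁ t₂, ∫ x, w x t * η x ∂(surfaceMeasure U)

/-- Integrability is only assumed on compactly contained time intervals; countably many of them
exhaust `(0, T)`. -/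
theorem aestronglyMeasurable_prod_Ioo {X V : Type*} [MeasurableSpace X] [TopologicalSpace V]
    [TopologicalSpace.PseudoMetrizableSpace V] {μ : Measure X} [SFinite μ] {f : X × ℝ → V} {T : ℝ}
    (h : ∀ t₁ t₂ : ℝ, 0 < t₁ → t₁ < t₂ → t₂ < T →
      AEStronglyMeasurable f (μ.prod (volume.restrict (Ioo t₁ t₂)))) :
    AEStronglyMeasurable f (μ.prod (volume.restrict (Ioo 0 T))) := by
  rcases le_or_gt T 0 with hT | hT
  · rw [Ioo_eq_empty (by linarith)]; simp
  -- The offset `3` makes `T/(k+3) < T - T/(k+3)` already for `k = 0`.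
  have hU : Ioo 0 T = ⋃ k : ℕ, Ioo (T / (k + 3)) (T - T / (k + 3)) := by
    refine Subset.antisymm (fun t ht => ?_) (iUnion_subset fun k => Ioo_subset_Ioo (by positivity) ?_)
    · obtain ⟨k, hk⟩ := exists_nat_gt (max (T / t) (T / (T - t)))
      have h1 : 0 < T - t := by linarith [ht.2]
      have hk1 := (le_max_left _ _).trans_lt hk
      have hk2 := (le_max_right _ _).trans_lt hk
      rw [div_lt_iff₀ ht.1] at hk1
      rw [div_lt_iff₀ h1] at hk2
      refine mem_iUnion.2 ⟨k, ?_, ?_⟩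
      · rw [div_lt_iff₀ (by positivity)]; nlinarith [ht.1]
      · rw [lt_sub_comm, div_lt_iff₀ (by positivity)]; nlinarith
    · have : (0 : ℝ) ≤ T / (k + 3) := by positivity
      linarith
  have e : ∀ s : Set ℝ, μ.prod (volume.restrict s) = (μ.prod volume).restrict (univ ×ˢ s) :=
    fun s => by rw [← Measure.prod_restrict, Measure.restrict_univ]
  rw [e, hU, prod_iUnion, aestronglyMeasurable_iUnion_iff]
  intro k
  rw [← e]
  refine h _ _ (by positivity) ?_ ?_
  · have : T / (k + 3) ≤ T / 3 := div_le_div_of_nonneg_left hT.le (by norm_num)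
      (by have : (0 : ℝ) ≤ k := k.cast_nonneg
          linarith)
    linarith
  · have : (0 : ℝ) < T / (k + 3) := by positivity
    linarith

theorem ae_ae_swap_of_ae_prod {X Y : Type*} [MeasurableSpace X] [MeasurableSpace Y]
    {μ : Measure X} {ν : Measure Y} [SFinite μ] [SFinite ν] {p : X × Y → Prop}
    (h : ∀ᵐ z ∂μ.prod ν, p z) : ∀ᵐ y ∂ν, ∀ᵐ x ∂μ, p (x, y) := by
  have h2 : ∀ᵐ z ∂ν.prod μ, p z.swap := by
    rw [← Measure.prod_swap] at h
    exact ae_of_ae_map measurable_swap.aemeasurable h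
  exact Measure.ae_ae_of_ae_prod h2

/-- The gradient and the product `φ u^λ` are replaced by Borel versions and `u` by its extension by
zero. By Fubini the changes are null in space for almost every time, so they do not affect the weak
form. Only time-independent test functions are retained, which is all that the energy argument uses;
the term with `η_t` then disappears. -/
theorem IsSolution.exists_regSol {φ u : Eu n → ℝ → ℝ} (h : IsSolution P lam U T φ u)
    (hU : IsOpen U) [IsFiniteMeasure (surfaceMeasure U)] :
    ∃ v w Du, RegSol P lam U T v w Du ∧ (∀ x ∈ closure U, ∀ t ∈ Ioo 0 T, v x t = u x t) ∧
      Function.uncurry w =ᵐ[(surfaceMeasure U).prod (volume.restrict (Ioo 0 T))]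
        fun z => φ z.1 z.2 * u z.1 z.2 ^ lam := by
  obtain ⟨Du, hDu, hweak⟩ := h.weak_form
  set S : Set (Eu n × ℝ) := closure U ×ˢ Ioo 0 T
  have hS : MeasurableSet S := isClosed_closure.measurableSet.prod measurableSet_Ioo
  have hDm : AEStronglyMeasurable (Function.uncurry Du)
      ((volume.restrict U).prod (volume.restrict (Ioo 0 T))) :=
    aestronglyMeasurable_prod_Ioo fun t₁ t₂ h1 h2 h3 => by
      rw [Measure.prod_restrict]; exact (hweak t₁ t₂ h1 h2 h3).1.1
  have hwm : AEStronglyMeasurable (fun z : Eu n × ℝ => φ z.1 z.2 * u z.1 z.2 ^ lam)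
      ((surfaceMeasure U).prod (volume.restrict (Ioo 0 T))) :=
    aestronglyMeasurable_prod_Ioo fun t₁ t₂ h1 h2 h3 => (h.boundary_integrable t₁ t₂ h1 h2 h3).1
  have hmono : ∀ {t₁ t₂ : ℝ}, 0 < t₁ → t₂ < T → ∀ μ : Measure (Eu n), SFinite μ →
      μ.prod (volume.restrict (Ioo t₁ t₂)) ≤ μ.prod (volume.restrict (Ioo 0 T)) :=
    fun h1 h2 μ _ => Measure.prod_mono le_rfl (Measure.restrict_mono (Ioo_subset_Ioo h1.le h2.le) le_rfl)
  have hDae := hDm.ae_eq_mk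
  have hwae := hwm.ae_eq_mk
  set D' : Eu n → ℝ → Eu n := fun x t => hDm.mk _ (x, t)
  set w' : Eu n → ℝ → ℝ := fun x t => hwm.mk _ (x, t)
  set v : Eu n → ℝ → ℝ := fun x t => S.indicator (Function.uncurry u) (x, t)
  have hv : ∀ x ∈ closure U, ∀ t ∈ Ioo 0 T, v x t = u x t := fun x hx t ht =>
    indicator_of_mem (show (x, t) ∈ S from ⟨hx, ht⟩) _
  have hD2 : ∀ᵐ t ∂(volume.restrict (Ioo 0 T)), ∀ᵐ x ∂(volume.restrict U), Du x t = D' x t :=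
    ae_ae_swap_of_ae_prod hDae
  have hw2 : ∀ᵐ t ∂(volume.restrict (Ioo 0 T)), ∀ᵐ x ∂(surfaceMeasure U),
      φ x t * u x t ^ lam = w' x t := ae_ae_swap_of_ae_prod hwae
  refine ⟨v, w', D', ⟨?_, ?_, hDm.stronglyMeasurable_mk.measurable,
    hwm.stronglyMeasurable_mk.measurable, ?_, ?_, ?_, ?_, ?_⟩, hv, hwae.symm⟩
  · exact fun x t => indicator_apply_nonneg fun hz => h.nonneg x hz.1 t hz.2
  · classical
    have := h.continuousOn.measurable_piecewise (g := fun _ => (0 : ℝ)) continuousOn_const hS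
    have e : Function.uncurry v = S.piecewise (Function.uncurry u) fun _ => 0 :=
      (piecewise_eq_indicator (s := S) (f := Function.uncurry u)).symm
    rwa [e]
  · exact h.continuousOn.congr fun z hz => hv z.1 hz.1 z.2 hz.2
  · intro t₁ t₂ h1 h2 h3
    exact (h.boundary_integrable t₁ t₂ h1 h2 h3).congr
      (hwae.filter_mono (ae_mono (hmono h1 h3 _ inferInstance)))
  · filter_upwards [hDu, hD2, ae_restrict_mem measurableSet_Ioo] with t ht ht2 htT
    have hae : (fun x => u x t) =ᵐ[volume.restrict U] fun x => v x t := by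
      filter_upwards [ae_restrict_mem hU.measurableSet] with x hx
        using (hv x (subset_closure hx) t htT).symm
    refine ⟨ht.1.congr hae, ht.2.1.congr ht2, fun ψ h1 h2 h3 => ?_⟩
    have h4 := ht.2.2 ψ h1 h2 h3
    have e1 : ∫ x in U, u x t • gradient ψ x = ∫ x in U, v x t • gradient ψ x :=
      integral_congr_ae (hae.mono fun x hx => by simp only at hx ⊢; rw [hx])
    have e2 : ∫ x in U, ψ x • Du x t = ∫ x in U, ψ x • D' x t :=
      integral_congr_ae (ht2.mono fun x hx => by simp only at hx ⊢; rw [hx])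
    simp only at h4 ⊢
    rw [← e1, h4, e2]
  · intro t₁ t₂ h1 h2 h3
    have := (hweak t₁ t₂ h1 h2 h3).1
    rw [Measure.volume_eq_prod, ← Measure.prod_restrict] at this
    exact (memLp_congr_ae (hDae.filter_mono
      (ae_mono (hmono h1 h3 _ inferInstance)))).1 this
  · intro t₁ t₂ h1 h2 h3 η hη
    have hw := (hweak t₁ t₂ h1 h2 h3).2 (fun x _ => η x) (hη.comp contDiff_fst)
    have hsub : Ioo t₁ t₂ ⊆ Ioo 0 T := Ioo_subset_Ioo h1.le h3.le
    have e1 : ∀ t ∈ Ioo 0 T, ∫ x in U, u x t ^ lam * η x = ∫ x in U, v x t ^ lam * η x :=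
      fun t ht => setIntegral_congr_fun hU.measurableSet fun x hx => by
        simp only [hv x (subset_closure hx) t ht]
    simp only [deriv_const, mul_zero, integral_zero, intervalIntegral.integral_zero, zero_sub] at hw
    rw [e1 t₁ ⟨h1, h2.trans h3⟩, e1 t₂ ⟨h1.trans h2, h3⟩, intervalIntegral.integral_of_le h2.le,
      intervalIntegral.integral_of_le h2.le, ← restrict_Ioo_eq_restrict_Ioc] at hw
    rw [hw]
    congr 1
    · congr 1
      refine integral_congr_ae ?_
      filter_upwards [ae_restrict_of_ae_restrict_of_subset hsub hD2] with t ht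
      refine integral_congr_ae ?_
      filter_upwards [ht] with x hx
      rw [hx]; rfl
    · refine integral_congr_ae ?_
      filter_upwards [ae_restrict_of_ae_restrict_of_subset hsub hw2] with t ht
      refine integral_congr_ae ?_
      filter_upwards [ht] with x hx
      rw [hx]

end ForchheimerGas

end

/-! ### The weak formulation for approximable test functions. -/

noncomputable section

namespace ForchheimerGas

variable {n : ℕ} {U : Set (Eu n)} {P : GenPoly} {lam T : ℝ}

theorem lintegral_enorm_mul_le_eLpNorm {X V W : Type*} [MeasurableSpace X] [NormedAddCommGroup V]
    [NormedAddCommGroup W] {μ : Measure X} {p q : ℝ} (hpq : p.HolderConjugate q) {f : X → V}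
    {g : X → W} (hf : AEStronglyMeasurable f μ) (hg : AEStronglyMeasurable g μ) :
    ∫⁻ x, ‖f x‖ₑ * ‖g x‖ₑ ∂μ ≤ eLpNorm f (ENNReal.ofReal p) μ * eLpNorm g (ENNReal.ofReal q) μ := by
  have hp := hpq.pos
  have hq := hpq.symm.pos
  rw [eLpNorm_eq_lintegral_rpow_enorm_toReal (by simpa using hp) ENNReal.ofReal_ne_top,
    eLpNorm_eq_lintegral_rpow_enorm_toReal (by simpa using hq) ENNReal.ofReal_ne_top,
    ENNReal.toReal_ofReal hp.le, ENNReal.toReal_ofReal hq.le]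
  exact ENNReal.lintegral_mul_le_Lp_mul_Lq μ hpq hf.enorm hg.enorm

theorem eLpNorm_comp_fst_le {X Y V : Type*} [MeasurableSpace X] [MeasurableSpace Y]
    [NormedAddCommGroup V] {μ : Measure X} {ν : Measure Y} [SFinite μ] [SFinite ν] {f : X → V}
    (hf : AEStronglyMeasurable f μ) {p : ℝ≥0∞} (hp : p ≠ ⊤) :
    eLpNorm (fun z : X × Y => f z.1) p (μ.prod ν) = ν univ ^ (1 / p).toReal * eLpNorm f p μ := by
  have h1 : AEStronglyMeasurable f (Measure.map Prod.fst (μ.prod ν)) := by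
    rw [Measure.map_fst_prod]; exact hf.smul_measure _
  have h2 := eLpNorm_map_measure (p := p) h1 measurable_fst.aemeasurable
  rw [Measure.map_fst_prod, eLpNorm_smul_measure_of_ne_top hp, smul_eq_mul] at h2
  exact h2.symm

namespace GenPoly

variable (P)

/-- The exponent conjugate to `2 - a`. -/
def conjExp : ℝ := (2 - P.a) / (1 - P.a)

theorem one_lt_two_sub : 1 < 2 - P.a := by linarith [P.a_lt_one]

theorem holderConjugate : (2 - P.a).HolderConjugate P.conjExp := by
  have h := Real.HolderConjugate.conjExponent P.one_lt_two_sub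
  have e : (2 - P.a).conjExponent = P.conjExp := by
    rw [Real.conjExponent, conjExp]; congr 1; ring
  rwa [e] at h

theorem exists_norm_flux_le : ∃ C : ℝ, 0 < C ∧ ∀ {n : ℕ} (v : Eu n), ‖P.flux v‖ ≤ C * ‖v‖ ^ (1 - P.a) := by
  obtain ⟨C, hC, h⟩ := P.exists_K_mul_le
  exact ⟨C, hC, fun v => by rw [P.norm_flux]; exact h _ (norm_nonneg _)⟩

/-- The flux grows like the power `1 - a`, and `(2 - a)/(1 - a)` is the exponent dual to `2 - a`.
Flux and gradients of test functions are therefore paired by Hölder's inequality. -/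
theorem memLp_flux {X : Type*} [MeasurableSpace X] {μ : Measure X} {D : X → Eu n}
    (hD : MemLp D (ENNReal.ofReal (2 - P.a)) μ) :
    MemLp (fun z => P.flux (D z)) (ENNReal.ofReal P.conjExp) μ := by
  obtain ⟨C, hC, h⟩ := P.exists_norm_flux_le
  have ha := P.a_lt_one
  have h1 := hD.norm_rpow_div (ENNReal.ofReal (1 - P.a))
  rw [ENNReal.toReal_ofReal (by linarith), ← ENNReal.ofReal_div_of_pos (by linarith)] at h1
  refine h1.of_le_mul (c := C) (P.measurable_flux.comp_aemeasurable hD.1.aemeasurable).aestronglyMeasurable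
    (Eventually.of_forall fun z => ?_)
  rw [Real.norm_of_nonneg (Real.rpow_nonneg (norm_nonneg _) _)]
  exact h _

end GenPoly

namespace RegSol

variable {u w : Eu n → ℝ → ℝ} {Du : Eu n → ℝ → Eu n}

/-- Integrability of the flux against an `L^p` field. -/
theorem integrable_inner_flux (h : RegSol P lam U T u w Du) {t₁ t₂ : ℝ} (h1 : 0 < t₁)
    (h2 : t₁ < t₂) (h3 : t₂ < T) {G : Eu n × ℝ → Eu n}
    (hG : MemLp G (ENNReal.ofReal (2 - P.a)) ((volume.restrict U).prod (volume.restrict (Ioo t₁ t₂)))) :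
    Integrable (fun z : Eu n × ℝ => ⟪P.flux (Du z.1 z.2), G z⟫)
      ((volume.restrict U).prod (volume.restrict (Ioo t₁ t₂))) := by
  have hA := P.memLp_flux (h.memLp t₁ t₂ h1 h2 h3)
  refine ⟨hA.1.inner hG.1, ?_⟩
  refine lt_of_le_of_lt ?_ ((lintegral_enorm_mul_le_eLpNorm P.holderConjugate.symm hA.1 hG.1).trans_lt
    (ENNReal.mul_lt_top hA.2 hG.2))
  refine lintegral_mono fun z => ?_
  rw [← ofReal_norm, ← ofReal_norm, ← ofReal_norm, ← ENNReal.ofReal_mul (norm_nonneg _)]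
  exact ENNReal.ofReal_le_ofReal (norm_inner_le_norm _ _)

theorem memLp_slice (h : RegSol P lam U T u w Du) {t₁ t₂ : ℝ} (h1 : 0 < t₁)
    (h2 : t₁ < t₂) (h3 : t₂ < T) : ∀ᵐ t ∂(volume.restrict (Ioo t₁ t₂)),
      MemLp (fun x => Du x t) (ENNReal.ofReal (2 - P.a)) (volume.restrict U) := by
  have hp : 0 < 2 - P.a := by linarith [P.a_lt_one]
  have hm := (h.memLp t₁ t₂ h1 h2 h3).2
  have h0 : ENNReal.ofReal (2 - P.a) ≠ 0 := by simpa using hp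
  rw [eLpNorm_lt_top_iff_lintegral_rpow_enorm_lt_top h0 ENNReal.ofReal_ne_top,
    lintegral_prod_symm' _ (h.measurable_grad.enorm.pow_const _)] at hm
  filter_upwards [ae_lt_top (Measurable.lintegral_prod_left'
    (h.measurable_grad.enorm.pow_const _)) hm.ne] with t ht
  refine ⟨(h.measurable_grad.comp measurable_prodMk_right).aestronglyMeasurable, ?_⟩
  rw [eLpNorm_lt_top_iff_lintegral_rpow_enorm_lt_top h0 ENNReal.ofReal_ne_top]
  exact ht

theorem continuousOn_slice (h : RegSol P lam U T u w Du) {t : ℝ} (ht : t ∈ Ioo 0 T) :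
    ContinuousOn (fun x => u x t) (closure U) :=
  h.continuousOn.comp (continuousOn_id.prodMk continuousOn_const) fun _ hx => ⟨hx, ht⟩

theorem strongApprox (h : RegSol P lam U T u w Du) (hU : IsOpen U) (hb : Bornology.IsBounded U)
    (𝒜 : Atlas U) {t₁ t₂ : ℝ} (h1 : 0 < t₁) (h2 : t₁ < t₂) (h3 : t₂ < T) :
    ∀ᵐ t ∂(volume.restrict (Ioo t₁ t₂)),
      StrongApprox U (ENNReal.ofReal (2 - P.a)) (fun x => u x t) (fun x => Du x t) := by
  have hsub : Ioo t₁ t₂ ⊆ Ioo 0 T := Ioo_subset_Ioo h1.le h3.le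
  filter_upwards [h.memLp_slice h1 h2 h3, ae_restrict_of_ae_restrict_of_subset hsub h.weakGrad,
    ae_restrict_mem measurableSet_Ioo] with t ht ht2 ht3
  exact strongApprox_of_hasWeakGradient hU hb 𝒜 P.one_lt_two_sub.le
    (h.continuousOn_slice (hsub ht3)) ht2 ht

/-- Functions of space, uniformly convergent on `closure U`, can be passed to the limit under the
integral sign. -/
theorem tendsto_integral_mul_of_uniform {Z : Type*} [MeasurableSpace Z] {μ : Measure Z}
    (hb : Bornology.IsBounded U) {π : Z → Eu n} (hπm : Measurable π) (hπ : ∀ᵐ z ∂μ, π z ∈ closure U)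
    {g : Z → ℝ} (hg : Integrable g μ) {f : Eu n → ℝ} (hf : ContinuousOn f (closure U))
    {fk : ℕ → Eu n → ℝ} (hfk : ∀ k, Continuous (fk k))
    (hunif : TendstoUniformlyOn fk f atTop (closure U)) :
    Tendsto (fun k => ∫ z, g z * fk k (π z) ∂μ) atTop (𝓝 (∫ z, g z * f (π z) ∂μ)) := by
  obtain ⟨B, hB⟩ := hb.isCompact_closure.exists_bound_of_continuousOn hf
  refine tendsto_integral_filter_of_dominated_convergence (fun z => ‖g z‖ * (B + 1))
    (Eventually.of_forall fun k => hg.1.mul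
      ((hfk k).measurable.comp hπm).aestronglyMeasurable) ?_ (hg.norm.mul_const _) ?_
  · filter_upwards [Metric.tendstoUniformlyOn_iff.1 hunif 1 one_pos] with k hk
    filter_upwards [hπ] with z hz
    rw [norm_mul]
    gcongr
    have h1 := hk _ hz
    rw [dist_eq_norm] at h1
    calc ‖fk k (π z)‖ = ‖f (π z) - (f (π z) - fk k (π z))‖ := by congr 1; ring
      _ ≤ ‖f (π z)‖ + ‖f (π z) - fk k (π z)‖ := norm_sub_le _ _
      _ ≤ B + 1 := add_le_add (hB _ hz) h1.le
  · filter_upwards [hπ] with z hz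
    exact (hunif.tendsto_at hz).const_mul _

theorem integrableOn_slice (h : RegSol P lam U T u w Du)
    (hb : Bornology.IsBounded U) {t : ℝ} (ht : t ∈ Ioo 0 T) {Θ : ℝ → ℝ}
    (hΘ : ContinuousOn Θ (Ici 0)) {f : Eu n → ℝ} (hf : ContinuousOn f (closure U)) :
    Integrable (fun x => Θ (u x t) * f x) (volume.restrict U) := by
  have hc : ContinuousOn (fun x => Θ (u x t) * f x) (closure U) :=
    (hΘ.comp (h.continuousOn_slice ht) fun x _ => h.nonneg x t).mul hf
  exact (hc.integrableOn_compact hb.isCompact_closure).mono_set subset_closure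

/-- The weak formulation, tested with a time independent approximable function. -/
theorem weak_strong (h : RegSol P lam U T u w Du) (hlam : 0 < lam) (hU : IsOpen U)
    (hb : Bornology.IsBounded U) [IsFiniteMeasure (surfaceMeasure U)] {t₁ t₂ : ℝ} (h1 : 0 < t₁)
    (h2 : t₁ < t₂) (h3 : t₂ < T) {f : Eu n → ℝ} {F : Eu n → Eu n}
    (hf : StrongApprox U (ENNReal.ofReal (2 - P.a)) f F) :
    (∫ x in U, u x t₂ ^ lam * f x) - (∫ x in U, u x t₁ ^ lam * f x) =
      - (∫ t in Ioo t₁ t₂, ∫ x in U, ⟪P.flux (Du x t), F x⟫)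
      - ∫ t in Ioo t₁ t₂, ∫ x, w x t * f x ∂(surfaceMeasure U) := by
  have hfin : IsFiniteMeasure (volume.restrict U) := ⟨by simpa using hb.measure_lt_top⟩
  obtain ⟨fk, hfk, hunif, hgrad⟩ := hf.approx
  have hfkc := fun k => (hfk k).continuous
  set π := (volume.restrict U).prod (volume.restrict (Ioo t₁ t₂))
  set ϖ := (surfaceMeasure U).prod (volume.restrict (Ioo t₁ t₂))
  -- The terms pass to the limit separately: the time slices and the boundary integral by uniform
  -- convergence on `closure U`, the flux integral by duality between `L^{2-a}` and its conjugate
  -- space.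
  have hslice : ∀ t ∈ Ioo 0 T, Tendsto (fun k => ∫ x in U, u x t ^ lam * fk k x) atTop
      (𝓝 (∫ x in U, u x t ^ lam * f x)) := fun t ht => by
    refine tendsto_integral_mul_of_uniform hb measurable_id ?_ ?_ hf.continuousOn hfkc hunif
    · filter_upwards [ae_restrict_mem hU.measurableSet] with x hx using subset_closure hx
    · simpa using h.integrableOn_slice hb ht (Real.continuous_rpow_const hlam.le).continuousOn
        (f := fun _ => 1) continuousOn_const
  have hwi := h.integrable_bdry t₁ t₂ h1 h2 h3
  have hclϖ : ∀ᵐ z ∂ϖ, z.1 ∈ closure U := by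
    refine Measure.quasiMeasurePreserving_fst.ae (p := fun x => x ∈ closure U) ?_
    filter_upwards [ae_restrict_mem isClosed_frontier.measurableSet] with x hx
      using frontier_subset_closure hx
  have hbd : Tendsto (fun k => ∫ z, w z.1 z.2 * fk k z.1 ∂ϖ) atTop
      (𝓝 (∫ z, w z.1 z.2 * f z.1 ∂ϖ)) :=
    tendsto_integral_mul_of_uniform hb measurable_fst hclϖ hwi hf.continuousOn hfkc hunif
  have hbdk : ∀ g : Eu n → ℝ, ContinuousOn g (closure U) →
      ∫ z, w z.1 z.2 * g z.1 ∂ϖ = ∫ t in Ioo t₁ t₂, ∫ x, w x t * g x ∂(surfaceMeasure U) := by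
    intro g hg
    obtain ⟨B, hB⟩ := hb.isCompact_closure.exists_bound_of_continuousOn hg
    refine integral_prod_symm _ (hwi.mul_bdd (c := B) ?_ (hclϖ.mono fun z hz => hB _ hz))
    have : AEStronglyMeasurable g (surfaceMeasure U) :=
      (hg.mono frontier_subset_closure).aestronglyMeasurable isClosed_frontier.measurableSet
    exact this.comp_fst
  have hp : 0 < 2 - P.a := by linarith [P.a_lt_one]
  have hmem : ∀ G : Eu n → Eu n, MemLp G (ENNReal.ofReal (2 - P.a)) (volume.restrict U) →
      MemLp (fun z : Eu n × ℝ => G z.1) (ENNReal.ofReal (2 - P.a)) π := fun G hG =>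
    ⟨hG.1.comp_fst, by
      rw [eLpNorm_comp_fst_le hG.1 ENNReal.ofReal_ne_top]
      exact ENNReal.mul_lt_top (ENNReal.rpow_lt_top_of_nonneg ENNReal.toReal_nonneg
        (measure_ne_top _ _)) hG.2⟩
  have hgk : ∀ k, MemLp (gradient (fk k)) (ENNReal.ofReal (2 - P.a)) (volume.restrict U) := by
    intro k
    obtain ⟨D, hD⟩ := hb.isCompact_closure.exists_bound_of_continuousOn
      (continuous_gradient (hfk k)).continuousOn
    refine MemLp.of_bound (continuous_gradient (hfk k)).aestronglyMeasurable D ?_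
    filter_upwards [ae_restrict_mem hU.measurableSet] with x hx using hD x (subset_closure hx)
  have hfl : ∀ G : Eu n → Eu n, MemLp G (ENNReal.ofReal (2 - P.a)) (volume.restrict U) →
      ∫ z, ⟪P.flux (Du z.1 z.2), G z.1⟫ ∂π = ∫ t in Ioo t₁ t₂, ∫ x in U, ⟪P.flux (Du x t), G x⟫ :=
    fun G hG => integral_prod_symm _ (h.integrable_inner_flux h1 h2 h3 (hmem G hG))
  have hA : MemLp (fun z : Eu n × ℝ => P.flux (Du z.1 z.2)) (ENNReal.ofReal P.conjExp) π :=
    P.memLp_flux (h.memLp t₁ t₂ h1 h2 h3)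
  have hflt : Tendsto (fun k => ∫ z, ⟪P.flux (Du z.1 z.2), gradient (fk k) z.1⟫ ∂π) atTop
      (𝓝 (∫ z, ⟪P.flux (Du z.1 z.2), F z.1⟫ ∂π)) := by
    refine tendsto_integral_of_L1 _
      (h.integrable_inner_flux h1 h2 h3 (hmem F hf.memLp)).1
      (Eventually.of_forall fun k => h.integrable_inner_flux h1 h2 h3 (hmem _ (hgk k))) ?_
    have hlim : Tendsto (fun k => eLpNorm (fun z : Eu n × ℝ => P.flux (Du z.1 z.2))
        (ENNReal.ofReal P.conjExp) π * (volume.restrict (Ioo t₁ t₂) univ ^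
          (1 / ENNReal.ofReal (2 - P.a)).toReal * eLpNorm (fun x => gradient (fk k) x - F x)
          (ENNReal.ofReal (2 - P.a)) (volume.restrict U))) atTop (𝓝 0) := by
      have h4 := ENNReal.Tendsto.const_mul hgrad (a := volume.restrict (Ioo t₁ t₂) univ ^
          (1 / ENNReal.ofReal (2 - P.a)).toReal) (Or.inr (ENNReal.rpow_ne_top_of_nonneg
            ENNReal.toReal_nonneg (measure_ne_top _ _)))
      rw [mul_zero] at h4
      rw [← mul_zero (eLpNorm (fun z : Eu n × ℝ => P.flux (Du z.1 z.2))
        (ENNReal.ofReal P.conjExp) π)]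
      exact ENNReal.Tendsto.const_mul h4 (Or.inr hA.2.ne)
    refine tendsto_of_tendsto_of_tendsto_of_le_of_le tendsto_const_nhds hlim (fun k => bot_le)
      fun k => ?_
    have hd : MemLp (fun x => gradient (fk k) x - F x) (ENNReal.ofReal (2 - P.a))
      (volume.restrict U) := (hgk k).sub hf.memLp
    rw [← eLpNorm_comp_fst_le hd.1 ENNReal.ofReal_ne_top]
    refine le_trans ?_ (lintegral_enorm_mul_le_eLpNorm P.holderConjugate.symm hA.1 hd.1.comp_fst)
    refine lintegral_mono fun z => ?_
    rw [← inner_sub_right, ← ofReal_norm, ← ofReal_norm, ← ofReal_norm,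
      ← ENNReal.ofReal_mul (norm_nonneg _)]
    exact ENNReal.ofReal_le_ofReal (norm_inner_le_norm _ _)
  rw [← hfl F hf.memLp, ← hbdk f hf.continuousOn]
  refine tendsto_nhds_unique ((hslice t₂ ⟨h1.trans h2, h3⟩).sub (hslice t₁ ⟨h1, h2.trans h3⟩)) ?_
  refine (hflt.neg.sub hbd).congr fun k => ?_
  rw [hfl _ (hgk k), hbdk _ (hfkc k).continuousOn, h.weak_form t₁ t₂ h1 h2 h3 _ (hfk k)]

end RegSol

end ForchheimerGas

end

noncomputable section

namespace ForchheimerGas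

/-! ### Monotonicity from averaged backward differences -/

/-- The substitution `s = τ - σ` straightens the sheared strip into a product, where Tonelli's
theorem exchanges the integrals. -/
theorem lintegral_window {e : ℝ → ℝ → ℝ≥0∞} (he : Measurable (Function.uncurry e)) (S : Set ℝ)
    (h : ℝ) : ∫⁻ τ in S, ∫⁻ s in Ioo (τ - h) τ, e τ s =
      ∫⁻ σ in Ioo 0 h, ∫⁻ τ in S, e τ (τ - σ) := by
  have h1 : ∀ τ, ∫⁻ s in Ioo (τ - h) τ, e τ s = ∫⁻ σ in Ioo 0 h, e τ (τ - σ) := by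
    intro τ
    rw [← lintegral_indicator measurableSet_Ioo, ← lintegral_indicator measurableSet_Ioo,
      ← lintegral_sub_left_eq_self _ τ]
    refine lintegral_congr fun σ => ?_
    simp only [indicator, mem_Ioo]
    congr 1
    rw [eq_iff_iff]
    constructor <;> rintro ⟨h1, h2⟩ <;> constructor <;> linarith
  simp_rw [h1]
  refine lintegral_lintegral_swap ?_
  exact (he.comp (measurable_fst.prodMk (measurable_fst.sub measurable_snd))).aemeasurable

/-- Integrating `Y(τ) - Y(τ - h)` over `(t₁, t₂)` cancels the overlap and leaves the integral of `Y`
over `(t₂ - h, t₂)` minus that over `(t₁ - h, t₁)`, which is `h (Y(t₂) - Y(t₁))` up to a small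
multiple of `h`. The error term, written in the shift `σ ∈ (0, h)`, is also a small multiple of `h`.
Dividing by `h` gives the claim without differentiating `Y`, and a hypothesis for almost every `τ`
suffices. -/
theorem le_of_lintegral_window {Y : ℝ → ℝ} {t₀ t₁ t₂ : ℝ} (h01 : t₀ < t₁) (h12 : t₁ < t₂)
    (hY : ContinuousOn Y (Icc t₀ t₂)) {e : ℝ → ℝ → ℝ≥0∞} (he : Measurable (Function.uncurry e))
    (hε : Tendsto (fun σ => ∫⁻ τ in Ioo t₁ t₂, e τ (τ - σ)) (𝓝[>] 0) (𝓝 0))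
    (H : ∀ h ∈ Ioo 0 (t₁ - t₀), ∀ᵐ τ ∂(volume.restrict (Ioo t₁ t₂)),
      ENNReal.ofReal (Y τ - Y (τ - h)) ≤ ∫⁻ s in Ioo (τ - h) τ, e τ s) : Y t₂ ≤ Y t₁ := by
  refine le_of_forall_pos_le_add fun ε hε0 => ?_
  set ε' := ε / 3 with hε'
  have hε'0 : 0 < ε' := by positivity
  have hc : ∀ t ∈ Icc t₀ t₂, ∀ᶠ s in 𝓝[Icc t₀ t₂] t, |Y s - Y t| < ε' := fun t ht => by
    have := (hY t ht).eventually (Metric.ball_mem_nhds (Y t) hε'0)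
    filter_upwards [this] with s hs using by rwa [← Real.dist_eq]
  have m1 : t₁ ∈ Icc t₀ t₂ := ⟨h01.le, h12.le⟩
  have m2 : t₂ ∈ Icc t₀ t₂ := ⟨(h01.trans h12).le, le_rfl⟩
  obtain ⟨d1, hd1, hb1⟩ := Metric.mem_nhdsWithin_iff.1 (hc t₁ m1)
  obtain ⟨d2, hd2, hb2⟩ := Metric.mem_nhdsWithin_iff.1 (hc t₂ m2)
  obtain ⟨d3, hd3, hb3⟩ := Metric.mem_nhdsWithin_iff.1
    (hε.eventually_le_const (ENNReal.ofReal_pos.2 hε'0))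
  -- The window is smaller than the moduli of continuity at both ends, the threshold for the error,
  -- and the room before `t₁`. The bound `h ≤ t₂ - t₁` makes the two intervals overlap.
  set h := min (min (d1 / 2) (d2 / 2)) (min (d3 / 2) (min ((t₁ - t₀) / 2) (t₂ - t₁))) with hh
  have hh0 : 0 < h := by
    have : 0 < t₁ - t₀ := by linarith
    have : 0 < t₂ - t₁ := by linarith
    positivity
  have hhd1 : h < d1 := by
    have : h ≤ d1 / 2 := (min_le_left _ _).trans (min_le_left _ _)
    linarith
  have hhd2 : h < d2 := by
    have : h ≤ d2 / 2 := (min_le_left _ _).trans (min_le_right _ _)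
    linarith
  have hhd3 : h < d3 := by
    have : h ≤ d3 / 2 := (min_le_right _ _).trans (min_le_left _ _)
    linarith
  have hht : h < t₁ - t₀ := by
    have : h ≤ (t₁ - t₀) / 2 :=
      (min_le_right _ _).trans ((min_le_right _ _).trans (min_le_left _ _))
    linarith
  have hh12 : h ≤ t₂ - t₁ := (min_le_right _ _).trans ((min_le_right _ _).trans (min_le_right _ _))
  have hii : ∀ a b : ℝ, t₀ ≤ a → a ≤ b → b ≤ t₂ → IntervalIntegrable Y volume a b := fun a b ha hab hb =>
    (hY.mono (by rw [uIcc_of_le hab]; exact Icc_subset_Icc ha hb)).intervalIntegrable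
  have hyh : IntervalIntegrable (fun τ => Y (τ - h)) volume t₁ t₂ := by
    refine ContinuousOn.intervalIntegrable (hY.comp (by fun_prop) fun τ hτ => ?_)
    rw [uIcc_of_le h12.le] at hτ
    exact ⟨by linarith [hτ.1], by linarith [hτ.2]⟩
  have hI := hii t₁ t₂ h01.le h12.le le_rfl
  have key : ∫ τ in t₁..t₂, (Y τ - Y (τ - h)) ≤ h * ε' := by
    have h2 : ∫⁻ τ in Ioo t₁ t₂, ENNReal.ofReal (Y τ - Y (τ - h)) ≤ ENNReal.ofReal (h * ε') := by
      calc _ ≤ ∫⁻ τ in Ioo t₁ t₂, ∫⁻ s in Ioo (τ - h) τ, e τ s :=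
            lintegral_mono_ae (H h ⟨hh0, hht⟩)
        _ = ∫⁻ σ in Ioo 0 h, ∫⁻ τ in Ioo t₁ t₂, e τ (τ - σ) := lintegral_window he _ _
        _ ≤ ∫⁻ _σ in Ioo 0 h, ENNReal.ofReal ε' := by
            refine setLIntegral_mono measurable_const fun σ hσ => hb3 ⟨?_, hσ.1⟩
            rw [Metric.mem_ball, dist_zero_right, Real.norm_of_nonneg hσ.1.le]
            exact hσ.2.trans hhd3
        _ = ENNReal.ofReal (h * ε') := by
            rw [lintegral_const, Measure.restrict_apply_univ, Real.volume_Ioo, sub_zero, mul_comm,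
              ENNReal.ofReal_mul hh0.le]
    have h3 := hI.sub hyh
    rw [intervalIntegral.integral_of_le h12.le, ← restrict_Ioo_eq_restrict_Ioc]
    rw [intervalIntegrable_iff_integrableOn_Ioo_of_le h12.le] at h3
    rw [integral_eq_lintegral_pos_part_sub_lintegral_neg_part h3]
    have h4 := ENNReal.toReal_mono ENNReal.ofReal_ne_top h2
    rw [ENNReal.toReal_ofReal (by positivity)] at h4
    linarith [ENNReal.toReal_nonneg (a := ∫⁻ τ in Ioo t₁ t₂, ENNReal.ofReal (-(Y τ - Y (τ - h))))]
  rw [intervalIntegral.integral_sub hI hyh, intervalIntegral.integral_comp_sub_right] at key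
  have a1 : ∫ τ in t₁..t₂, Y τ = (∫ τ in t₁..(t₂ - h), Y τ) + ∫ τ in (t₂ - h)..t₂, Y τ :=
    (intervalIntegral.integral_add_adjacent_intervals (hii _ _ h01.le (by linarith) (by linarith))
      (hii _ _ (by linarith) (by linarith) le_rfl)).symm
  have a2 : ∫ τ in (t₁ - h)..(t₂ - h), Y τ = (∫ τ in (t₁ - h)..t₁, Y τ) + ∫ τ in t₁..(t₂ - h), Y τ :=
    (intervalIntegral.integral_add_adjacent_intervals (hii _ _ (by linarith) (by linarith) (by linarith))
      (hii _ _ (by linarith) (by linarith) (by linarith))).symm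
  have b1 : h * (Y t₂ - ε') ≤ ∫ τ in (t₂ - h)..t₂, Y τ := by
    have := intervalIntegral.integral_mono_on (a := t₂ - h) (b := t₂) (by linarith)
      (f := fun _ => Y t₂ - ε') (g := Y) (by simp) (hii _ _ (by linarith) (by linarith) le_rfl)
      (fun x hx => by
        have : |Y x - Y t₂| < ε' := hb2 (show x ∈ Metric.ball t₂ d2 ∩ Icc t₀ t₂ from
          ⟨by rw [Metric.mem_ball, Real.dist_eq, abs_lt]; constructor <;> linarith [hx.1, hx.2],
            by linarith [hx.1], hx.2⟩)
        linarith [(abs_lt.1 this).1])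
    rwa [intervalIntegral.integral_const, sub_sub_cancel, smul_eq_mul] at this
  have b2 : ∫ τ in (t₁ - h)..t₁, Y τ ≤ h * (Y t₁ + ε') := by
    have := intervalIntegral.integral_mono_on (a := t₁ - h) (b := t₁) (by linarith)
      (g := fun _ => Y t₁ + ε') (f := Y) (hii _ _ (by linarith) (by linarith) (by linarith)) (by simp)
      (fun x hx => by
        have : |Y x - Y t₁| < ε' := hb1 (show x ∈ Metric.ball t₁ d1 ∩ Icc t₀ t₂ from
          ⟨by rw [Metric.mem_ball, Real.dist_eq, abs_lt]; constructor <;> linarith [hx.1, hx.2],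
            by linarith [hx.1], by linarith [hx.2]⟩)
        linarith [(abs_lt.1 this).2])
    rwa [intervalIntegral.integral_const, sub_sub_cancel, smul_eq_mul] at this
  have : h * (Y t₂ - ε') ≤ h * (Y t₁ + ε') + h * ε' := by linarith
  have : h * (Y t₂) ≤ h * (Y t₁ + ε) := by rw [hε'] at this; linarith
  exact le_of_mul_le_mul_left this hh0

/-- The convexity inequality behind testing with a power of the solution. -/
theorem rpow_sub_rpow_le {lam β a b : ℝ} (hlam : 0 < lam) (hβ : 0 < β) (ha : 0 ≤ a) (hb : 0 ≤ b) :
    lam / (lam + β) * (a ^ (lam + β) - b ^ (lam + β)) ≤ (a ^ lam - b ^ lam) * a ^ β := by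
  have hs : 0 < lam + β := by linarith
  -- The weights are chosen so that the geometric mean is the mixed product `a^β b^λ`.
  have h := Real.geom_mean_le_arith_mean2_weighted (w₁ := β / (lam + β)) (w₂ := lam / (lam + β))
    (p₁ := a ^ (lam + β)) (p₂ := b ^ (lam + β)) (by positivity) (by positivity)
    (by positivity) (by positivity) (by field_simp; ring)
  rw [← Real.rpow_mul ha, ← Real.rpow_mul hb, mul_div_cancel₀ _ hs.ne', mul_div_cancel₀ _ hs.ne'] at h
  have e : a ^ (lam + β) = a ^ lam * a ^ β := Real.rpow_add_of_nonneg ha hlam.le hβ.le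
  have e2 : β / (lam + β) * a ^ (lam + β) = a ^ (lam + β) - lam / (lam + β) * a ^ (lam + β) := by
    field_simp; ring
  rw [e2] at h
  rw [sub_mul, ← e]
  linarith

end ForchheimerGas

end

/-! ### The test function `u^β χ` and its integrability. -/

noncomputable section

namespace ForchheimerGas

variable {n : ℕ} {U : Set (Eu n)} {P : GenPoly} {lam T : ℝ}

namespace RegSol

variable {u w : Eu n → ℝ → ℝ} {Du : Eu n → ℝ → Eu n} {β : ℝ} {χ : Eu n → ℝ}

/-- The gradient of `u^β χ`. -/
def testGrad (u : Eu n → ℝ → ℝ) (Du : Eu n → ℝ → Eu n) (β : ℝ) (χ : Eu n → ℝ) (x : Eu n) (t : ℝ) :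
    Eu n :=
  χ x • ((β * u x t ^ (β - 1)) • Du x t) + u x t ^ β • gradient χ x

/-- The density in time of the energy identity. -/
def energyRate (P : GenPoly) (U : Set (Eu n)) (u w : Eu n → ℝ → ℝ) (Du : Eu n → ℝ → Eu n) (β : ℝ)
    (χ : Eu n → ℝ) (t : ℝ) : ℝ :=
  (∫ x in U, ⟪P.flux (Du x t), testGrad u Du β χ x t⟫) +
    ∫ x, w x t * (u x t ^ β * χ x) ∂(surfaceMeasure U)

theorem exists_bound (h : RegSol P lam U T u w Du) (hb : Bornology.IsBounded U) {t₁ t₂ : ℝ}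
    (h1 : 0 < t₁) (h3 : t₂ < T) :
    ∃ B : ℝ, 0 ≤ B ∧ ∀ x ∈ closure U, ∀ t ∈ Icc t₁ t₂, u x t ≤ B := by
  have hc : IsCompact (closure U ×ˢ Icc t₁ t₂) := hb.isCompact_closure.prod isCompact_Icc
  obtain ⟨B, hB⟩ := hc.exists_bound_of_continuousOn (h.continuousOn.mono
    (prod_mono_right fun t ht => ⟨h1.trans_le ht.1, ht.2.trans_lt h3⟩))
  exact ⟨max B 0, le_max_right _ _, fun x hx t ht =>
    (le_abs_self _).trans ((hB (x, t) ⟨hx, ht⟩).trans (le_max_left _ _))⟩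

theorem measurable_testGrad (h : RegSol P lam U T u w Du) (hχ : ContDiff ℝ 1 χ) :
    Measurable (Function.uncurry (testGrad u Du β χ)) := by
  have m1 := h.measurable
  have m2 := h.measurable_grad
  have m3 : Measurable fun z : Eu n × ℝ => χ z.1 := hχ.continuous.measurable.comp measurable_fst
  have m4 : Measurable fun z : Eu n × ℝ => gradient χ z.1 :=
    (continuous_gradient hχ).measurable.comp measurable_fst
  exact (m3.smul ((measurable_const.mul (m1.pow_const _)).smul m2)).add ((m1.pow_const _).smul m4)

theorem continuousOn_test (h : RegSol P lam U T u w Du) (hβ : 0 ≤ β) (hχ : Continuous χ) :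
    ContinuousOn (fun z : Eu n × ℝ => u z.1 z.2 ^ β * χ z.1) (closure U ×ˢ Ioo 0 T) :=
  (h.continuousOn.rpow_const fun _ _ => Or.inr hβ).mul
    (hχ.comp continuous_fst).continuousOn

theorem memLp_testGrad (h : RegSol P lam U T u w Du) (hU : IsOpen U) (hb : Bornology.IsBounded U)
    (hβ : 1 ≤ β) (hχ : ContDiff ℝ 1 χ) {t₁ t₂ : ℝ} (h1 : 0 < t₁) (h2 : t₁ < t₂) (h3 : t₂ < T) :
    MemLp (Function.uncurry (testGrad u Du β χ)) (ENNReal.ofReal (2 - P.a))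
      ((volume.restrict U).prod (volume.restrict (Ioo t₁ t₂))) := by
  have hfin : IsFiniteMeasure (volume.restrict U) := ⟨by simpa using hb.measure_lt_top⟩
  obtain ⟨B, hB0, hB⟩ := h.exists_bound hb h1 h3
  obtain ⟨D, hD⟩ := hb.isCompact_closure.exists_bound_of_continuousOn hχ.continuous.continuousOn
  obtain ⟨E, hE⟩ := hb.isCompact_closure.exists_bound_of_continuousOn
    (continuous_gradient hχ).continuousOn
  have hae : ∀ᵐ z ∂((volume.restrict U).prod (volume.restrict (Ioo t₁ t₂))), z ∈ U ×ˢ Ioo t₁ t₂ := by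
    rw [Measure.prod_restrict]; exact ae_restrict_mem (hU.measurableSet.prod measurableSet_Ioo)
  have m1 := h.measurable
  have m3 : Measurable fun z : Eu n × ℝ => χ z.1 := hχ.continuous.measurable.comp measurable_fst
  have m4 : Measurable fun z : Eu n × ℝ => gradient χ z.1 :=
    (continuous_gradient hχ).measurable.comp measurable_fst
  refine MemLp.add (f := fun z : Eu n × ℝ => χ z.1 • ((β * u z.1 z.2 ^ (β - 1)) • Du z.1 z.2))
    (g := fun z : Eu n × ℝ => u z.1 z.2 ^ β • gradient χ z.1) ?_ ?_
  · refine (h.memLp t₁ t₂ h1 h2 h3).of_le_mul (c := D * (β * B ^ (β - 1)))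
      (m3.smul ((measurable_const.mul (m1.pow_const _)).smul h.measurable_grad)).aestronglyMeasurable ?_
    filter_upwards [hae] with z hz
    have hz1 := subset_closure hz.1
    rw [norm_smul, norm_smul, ← mul_assoc]
    refine mul_le_mul_of_nonneg_right (mul_le_mul (hD _ hz1) ?_ (norm_nonneg _)
      ((norm_nonneg _).trans (hD _ hz1))) (norm_nonneg _)
    rw [Real.norm_of_nonneg (mul_nonneg (by linarith) (Real.rpow_nonneg (h.nonneg _ _) _))]
    gcongr
    · exact h.nonneg _ _
    · exact hB _ hz1 _ ⟨hz.2.1.le, hz.2.2.le⟩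
  · refine MemLp.of_bound ((m1.pow_const _).smul m4).aestronglyMeasurable (B ^ β * E) ?_
    filter_upwards [hae] with z hz
    have hz1 := subset_closure hz.1
    rw [norm_smul, Real.norm_of_nonneg (Real.rpow_nonneg (h.nonneg _ _) _)]
    refine mul_le_mul ?_ (hE _ hz1) (norm_nonneg _) (by positivity)
    exact Real.rpow_le_rpow (h.nonneg _ _) (hB _ hz1 _ ⟨hz.2.1.le, hz.2.2.le⟩) (by linarith)

theorem ae_mem_closure_bdry (t₁ t₂ : ℝ) [IsFiniteMeasure (surfaceMeasure U)] :
    ∀ᵐ z ∂((surfaceMeasure U).prod (volume.restrict (Ioo t₁ t₂))), z ∈ closure U ×ˢ Ioo t₁ t₂ := by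
  have h1 : ∀ᵐ z ∂((surfaceMeasure U).prod (volume.restrict (Ioo t₁ t₂))), z.1 ∈ closure U := by
    refine Measure.quasiMeasurePreserving_fst.ae (p := fun x => x ∈ closure U) ?_
    filter_upwards [ae_restrict_mem isClosed_frontier.measurableSet] with x hx
      using frontier_subset_closure hx
  have h2 : ∀ᵐ z ∂((surfaceMeasure U).prod (volume.restrict (Ioo t₁ t₂))), z.2 ∈ Ioo t₁ t₂ :=
    Measure.quasiMeasurePreserving_snd.ae (p := fun x => x ∈ Ioo t₁ t₂)
      (ae_restrict_mem measurableSet_Ioo)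
  filter_upwards [h1, h2] with z hz1 hz2 using ⟨hz1, hz2⟩

theorem integrable_bdry_mul (h : RegSol P lam U T u w Du) [IsFiniteMeasure (surfaceMeasure U)]
    {t₁ t₂ : ℝ} (h1 : 0 < t₁) (h2 : t₁ < t₂) (h3 : t₂ < T)
    {G : Eu n × ℝ → ℝ} (hG : AEStronglyMeasurable G
      ((surfaceMeasure U).prod (volume.restrict (Ioo t₁ t₂)))) {B : ℝ}
    (hB : ∀ z ∈ closure U ×ˢ Ioo t₁ t₂, |G z| ≤ B) :
    Integrable (fun z : Eu n × ℝ => w z.1 z.2 * G z)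
      ((surfaceMeasure U).prod (volume.restrict (Ioo t₁ t₂))) :=
  (h.integrable_bdry t₁ t₂ h1 h2 h3).mul_bdd (c := B) hG
    ((ae_mem_closure_bdry t₁ t₂).mono fun z hz => hB z hz)

theorem exists_test_bound (h : RegSol P lam U T u w Du) (hb : Bornology.IsBounded U) (hβ : 0 ≤ β)
    (hχ : Continuous χ) {t₁ t₂ : ℝ} (h1 : 0 < t₁) (h3 : t₂ < T) :
    ∃ B : ℝ, ∀ z ∈ closure U ×ˢ Icc t₁ t₂, |u z.1 z.2 ^ β * χ z.1| ≤ B :=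
  (hb.isCompact_closure.prod isCompact_Icc).exists_bound_of_continuousOn
    ((h.continuousOn_test hβ hχ).mono
      (prod_mono_right fun _ ht => ⟨h1.trans_le ht.1, ht.2.trans_lt h3⟩))

theorem measurable_test (h : RegSol P lam U T u w Du) (hχ : Continuous χ) :
    Measurable fun z : Eu n × ℝ => u z.1 z.2 ^ β * χ z.1 :=
  (h.measurable.pow_const _).mul (hχ.measurable.comp measurable_fst)

theorem integrable_test_bdry (h : RegSol P lam U T u w Du) (hb : Bornology.IsBounded U)
    [IsFiniteMeasure (surfaceMeasure U)] (hβ : 0 ≤ β)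
    (hχ : Continuous χ) {t₁ t₂ : ℝ} (h1 : 0 < t₁) (h2 : t₁ < t₂) (h3 : t₂ < T) :
    Integrable (fun z : Eu n × ℝ => w z.1 z.2 * (u z.1 z.2 ^ β * χ z.1))
      ((surfaceMeasure U).prod (volume.restrict (Ioo t₁ t₂))) := by
  obtain ⟨B, hB⟩ := h.exists_test_bound hb hβ hχ h1 h3
  exact h.integrable_bdry_mul h1 h2 h3 (h.measurable_test hχ).aestronglyMeasurable
    fun z hz => hB z ⟨hz.1, hz.2.1.le, hz.2.2.le⟩

theorem integrableOn_energyRate (h : RegSol P lam U T u w Du) (hU : IsOpen U)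
    (hb : Bornology.IsBounded U) [IsFiniteMeasure (surfaceMeasure U)] (hβ : 1 ≤ β)
    (hχ : ContDiff ℝ 1 χ) {t₁ t₂ : ℝ} (h1 : 0 < t₁) (h2 : t₁ < t₂) (h3 : t₂ < T) :
    IntegrableOn (energyRate P U u w Du β χ) (Ioo t₁ t₂) := by
  have hfin : IsFiniteMeasure (volume.restrict U) := ⟨by simpa using hb.measure_lt_top⟩
  exact (h.integrable_inner_flux h1 h2 h3 (h.memLp_testGrad hU hb hβ hχ h1 h2 h3)).integral_prod_right.add
    (h.integrable_test_bdry hb (by linarith) hχ.continuous h1 h2 h3).integral_prod_right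

/-- The condition `β ≥ 1` makes the power `C¹` on the whole line, including at the zeros of the
solution, so the chain rule applies without regularizing the power. -/
theorem strongApprox_test (hU : IsOpen U) (hb : Bornology.IsBounded U) (hβ : 1 ≤ β)
    (hχ : ContDiff ℝ 1 χ) {t : ℝ} (hs : StrongApprox U (ENNReal.ofReal (2 - P.a)) (fun x => u x t) (fun x => Du x t)) :
    StrongApprox U (ENNReal.ofReal (2 - P.a)) (fun x => u x t ^ β * χ x)
      (fun x => testGrad u Du β χ x t) := by
  have hp : 1 ≤ ENNReal.ofReal (2 - P.a) := by simpa using P.one_lt_two_sub.le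
  have h1 := (hs.comp hU hb hp (Ψ := fun x => x ^ β)
    (Real.contDiff_rpow_const_of_le (by simpa using hβ))).mul_smooth hU hb hp hχ
  have e : ∀ x : ℝ, deriv (fun x : ℝ => x ^ β) x = β * x ^ (β - 1) := fun x =>
    (Real.hasDerivAt_rpow_const (Or.inr hβ)).deriv
  simp only [e] at h1
  exact h1

theorem continuousOn_energy (h : RegSol P lam U T u w Du) (hU : IsOpen U)
    (hb : Bornology.IsBounded U) {α : ℝ} (hα : 0 ≤ α) (hχ : Continuous χ) :
    ContinuousOn (fun t => ∫ x in U, u x t ^ α * χ x) (Ioo 0 T) := by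
  have hfin : IsFiniteMeasure (volume.restrict U) := ⟨by simpa using hb.measure_lt_top⟩
  intro t ht
  refine ContinuousAt.continuousWithinAt ?_
  obtain ⟨t₁, h1, ht1⟩ := exists_between ht.1
  obtain ⟨t₂, ht2, h3⟩ := exists_between ht.2
  obtain ⟨B, hB⟩ := h.exists_test_bound hb hα hχ h1 h3
  refine continuousAt_of_dominated (bound := fun _ => B) ?_ ?_ (integrable_const _) ?_
  · exact Eventually.of_forall fun s =>
      ((h.measurable_test hχ).comp measurable_prodMk_right).aestronglyMeasurable
  · filter_upwards [Ioo_mem_nhds ht1 ht2] with s hs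
    filter_upwards [ae_restrict_mem hU.measurableSet] with x hx
    exact hB (x, s) ⟨subset_closure hx, hs.1.le, hs.2.le⟩
  · filter_upwards [ae_restrict_mem hU.measurableSet] with x hx
    have hc := (h.continuousOn_test hα hχ).comp (f := fun s : ℝ => (x, s)) (s := Ioo 0 T)
      (by fun_prop) fun s hs => ⟨subset_closure hx, hs⟩
    exact hc.continuousAt (Ioo_mem_nhds ht.1 ht.2)

end RegSol

end ForchheimerGas

end

/-! ### The energy inequality. -/

noncomputable section

namespace ForchheimerGas

variable {n : ℕ} {U : Set (Eu n)} {P : GenPoly} {lam T : ℝ}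

namespace RegSol

variable {u w : Eu n → ℝ → ℝ} {Du : Eu n → ℝ → Eu n} {β : ℝ} {χ : Eu n → ℝ}

/-- The modulus controlling the replacement of the test function at time `τ` by that at time `s`. -/
def testError (P : GenPoly) (U : Set (Eu n)) (u w : Eu n → ℝ → ℝ) (Du : Eu n → ℝ → Eu n) (β : ℝ)
    (χ : Eu n → ℝ) (τ s : ℝ) : ℝ≥0∞ :=
  (∫⁻ x in U, ‖P.flux (Du x s)‖ₑ * ‖testGrad u Du β χ x s - testGrad u Du β χ x τ‖ₑ) +
    ∫⁻ x, ‖w x s‖ₑ * ‖u x s ^ β * χ x - u x τ ^ β * χ x‖ₑ ∂(surfaceMeasure U)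

theorem measurable_error_grad (h : RegSol P lam U T u w Du) (hχ : ContDiff ℝ 1 χ) :
    Measurable fun z : (ℝ × ℝ) × Eu n => ‖P.flux (Du z.2 z.1.2)‖ₑ *
      ‖testGrad u Du β χ z.2 z.1.2 - testGrad u Du β χ z.2 z.1.1‖ₑ := by
  have m1 : Measurable fun z : (ℝ × ℝ) × Eu n => (z.2, z.1.2) := by fun_prop
  have m2 : Measurable fun z : (ℝ × ℝ) × Eu n => (z.2, z.1.1) := by fun_prop
  have hT := h.measurable_testGrad (β := β) hχ
  exact (P.measurable_flux.comp (h.measurable_grad.comp m1)).enorm.mul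
    ((hT.comp m1).sub (hT.comp m2)).enorm

theorem measurable_error_bdry (h : RegSol P lam U T u w Du) (hχ : Continuous χ) :
    Measurable fun z : (ℝ × ℝ) × Eu n => ‖w z.2 z.1.2‖ₑ *
      ‖u z.2 z.1.2 ^ β * χ z.2 - u z.2 z.1.1 ^ β * χ z.2‖ₑ := by
  have m1 : Measurable fun z : (ℝ × ℝ) × Eu n => (z.2, z.1.2) := by fun_prop
  have m2 : Measurable fun z : (ℝ × ℝ) × Eu n => (z.2, z.1.1) := by fun_prop
  have hT := h.measurable_test (β := β) hχ
  exact (h.measurable_bdry.comp m1).enorm.mul ((hT.comp m1).sub (hT.comp m2)).enorm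

theorem measurable_testError (h : RegSol P lam U T u w Du) [IsFiniteMeasure (surfaceMeasure U)]
    (hχ : ContDiff ℝ 1 χ) : Measurable (Function.uncurry (testError P U u w Du β χ)) :=
  (h.measurable_error_grad hχ).lintegral_prod_right'.add
    (h.measurable_error_bdry hχ.continuous).lintegral_prod_right'

/-- Both the flux and the test gradient are extended by zero outside `U × (t₀, t₂)`. Hölder's
inequality pairs a translate of the flux, whose norm is constant, with an increment of the test
gradient in time, which is small by continuity of translations in `L^{2-a}`. The margin `t₁ - t₀`
keeps the shifted times inside the cylinder. -/
theorem tendsto_error_grad (h : RegSol P lam U T u w Du) (hU : IsOpen U)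
    (hb : Bornology.IsBounded U) (hβ : 1 ≤ β) (hχ : ContDiff ℝ 1 χ) {t₀ t₁ t₂ : ℝ} (h0 : 0 < t₀)
    (h01 : t₀ < t₁) (h12 : t₁ < t₂) (h3 : t₂ < T) :
    Tendsto (fun σ => ∫⁻ τ in Ioo t₁ t₂, ∫⁻ x in U, ‖P.flux (Du x (τ - σ))‖ₑ *
      ‖testGrad u Du β χ x (τ - σ) - testGrad u Du β χ x τ‖ₑ) (𝓝[>] 0) (𝓝 0) := by
  have hp1 : 1 ≤ ENNReal.ofReal (2 - P.a) := by simpa using P.one_lt_two_sub.le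
  have hHaar : (volume : Measure (Eu n × ℝ)).IsAddHaarMeasure := by
    rw [Measure.volume_eq_prod]; infer_instance
  set S : Set (Eu n × ℝ) := U ×ˢ Ioo t₀ t₂ with hSdef
  have hS : MeasurableSet S := hU.measurableSet.prod measurableSet_Ioo
  set A : Eu n × ℝ → Eu n := S.indicator fun z => P.flux (Du z.1 z.2)
  set H : Eu n × ℝ → Eu n := S.indicator (Function.uncurry (testGrad u Du β χ))
  have hA : MemLp A (ENNReal.ofReal P.conjExp) volume := by
    rw [memLp_indicator_iff_restrict hS, hSdef, Measure.volume_eq_prod, ← Measure.prod_restrict]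
    exact P.memLp_flux (h.memLp t₀ t₂ h0 (h01.trans h12) h3)
  have hH : MemLp H (ENNReal.ofReal (2 - P.a)) volume := by
    rw [memLp_indicator_iff_restrict hS, hSdef, Measure.volume_eq_prod, ← Measure.prod_restrict]
    exact h.memLp_testGrad hU hb hβ hχ h0 (h01.trans h12) h3
  have htr := tendsto_eLpNorm_translate hp1 ENNReal.ofReal_ne_top hH
  have hline : Tendsto (fun σ : ℝ => ((0 : Eu n), σ)) (𝓝[>] 0) (𝓝 0) :=
    tendsto_nhdsWithin_of_tendsto_nhds
      (Continuous.tendsto' (by fun_prop) _ _ rfl)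
  have hlim : Tendsto (fun σ : ℝ => eLpNorm A (ENNReal.ofReal P.conjExp) volume *
      eLpNorm (fun z => H (z - ((0 : Eu n), σ)) - H z) (ENNReal.ofReal (2 - P.a)) volume)
      (𝓝[>] 0) (𝓝 0) := by
    rw [← mul_zero (eLpNorm A (ENNReal.ofReal P.conjExp) volume)]
    exact ENNReal.Tendsto.const_mul (htr.comp hline) (Or.inr hA.2.ne)
  refine tendsto_of_tendsto_of_tendsto_of_le_of_le' tendsto_const_nhds hlim
    (Eventually.of_forall fun _ => bot_le) ?_
  filter_upwards [Ioo_mem_nhdsGT (show (0 : ℝ) < t₁ - t₀ by linarith)] with σ hσ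
  have hmp : MeasurePreserving (fun z : Eu n × ℝ => z - ((0 : Eu n), σ)) volume volume :=
    measurePreserving_sub_right volume _
  have hm : Measurable fun z : Eu n × ℝ => ‖P.flux (Du z.1 (z.2 - σ))‖ₑ *
      ‖testGrad u Du β χ z.1 (z.2 - σ) - testGrad u Du β χ z.1 z.2‖ₑ := by
    have m : Measurable fun z : Eu n × ℝ => ((z.2, z.2 - σ), z.1) := by fun_prop
    have m2 := (h.measurable_error_grad (β := β) hχ).comp m
    simp only [Function.comp_def] at m2
    exact m2
  have hAσ := hA.1.comp_measurePreserving hmp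
  have hHσ := hH.1.comp_measurePreserving hmp
  simp only [Function.comp_def] at hAσ hHσ
  calc ∫⁻ τ in Ioo t₁ t₂, ∫⁻ x in U, ‖P.flux (Du x (τ - σ))‖ₑ *
        ‖testGrad u Du β χ x (τ - σ) - testGrad u Du β χ x τ‖ₑ
      = ∫⁻ z in U ×ˢ Ioo t₁ t₂, ‖P.flux (Du z.1 (z.2 - σ))‖ₑ *
        ‖testGrad u Du β χ z.1 (z.2 - σ) - testGrad u Du β χ z.1 z.2‖ₑ := by
        rw [Measure.volume_eq_prod, ← Measure.prod_restrict, lintegral_prod_symm' _ hm]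
    _ ≤ ∫⁻ z in U ×ˢ Ioo t₁ t₂, ‖A (z - ((0 : Eu n), σ))‖ₑ * ‖H (z - ((0 : Eu n), σ)) - H z‖ₑ := by
        refine setLIntegral_mono_ae' (hU.measurableSet.prod measurableSet_Ioo)
          (Eventually.of_forall fun z hz => le_of_eq ?_)
        have hz1 : z ∈ S := ⟨hz.1, h01.trans hz.2.1, hz.2.2⟩
        have hz2 : z - ((0 : Eu n), σ) ∈ S := by
          refine ⟨by simpa using hz.1, ?_, ?_⟩
          · simp only [Prod.snd_sub]; linarith [hz.2.1, hσ.2]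
          · simp only [Prod.snd_sub]; linarith [hz.2.2, hσ.1]
        simp only [A, H, indicator_of_mem hz1, indicator_of_mem hz2]
        simp [Function.uncurry]
    _ ≤ ∫⁻ z, ‖A (z - ((0 : Eu n), σ))‖ₑ * ‖H (z - ((0 : Eu n), σ)) - H z‖ₑ :=
        setLIntegral_le_lintegral _ _
    _ ≤ eLpNorm (fun z => A (z - ((0 : Eu n), σ))) (ENNReal.ofReal P.conjExp) volume *
        eLpNorm (fun z => H (z - ((0 : Eu n), σ)) - H z) (ENNReal.ofReal (2 - P.a)) volume :=
        lintegral_enorm_mul_le_eLpNorm P.holderConjugate.symm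
          hAσ (hHσ.sub hH.1)
    _ = _ := by
        have := eLpNorm_comp_measurePreserving (p := ENNReal.ofReal P.conjExp) hA.1 hmp
        simp only [Function.comp_def] at this
        rw [this]

/-- On the boundary only the integrability of `w` is available. This is enough, since `u^β χ` is
uniformly continuous on the compact set `closure U × [t₀, t₂]`. -/
theorem tendsto_error_bdry (h : RegSol P lam U T u w Du)
    (hb : Bornology.IsBounded U) [IsFiniteMeasure (surfaceMeasure U)] (hβ : 0 ≤ β)
    (hχ : Continuous χ) {t₀ t₁ t₂ : ℝ} (h0 : 0 < t₀)
    (h01 : t₀ < t₁) (h12 : t₁ < t₂) (h3 : t₂ < T) :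
    Tendsto (fun σ => ∫⁻ τ in Ioo t₁ t₂, ∫⁻ x, ‖w x (τ - σ)‖ₑ *
      ‖u x (τ - σ) ^ β * χ x - u x τ ^ β * χ x‖ₑ ∂(surfaceMeasure U)) (𝓝[>] 0) (𝓝 0) := by
  set K : Set (Eu n × ℝ) := closure U ×ˢ Icc t₀ t₂
  have hK : IsCompact K := hb.isCompact_closure.prod isCompact_Icc
  have huc := hK.uniformContinuousOn_of_continuous ((h.continuousOn_test hβ hχ).mono
      (prod_mono_right fun t ht => ⟨h0.trans_le ht.1, ht.2.trans_lt h3⟩))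
  rw [Metric.uniformContinuousOn_iff_le] at huc
  set W : ℝ≥0∞ := ∫⁻ s in Ioo t₀ t₂, ∫⁻ x, ‖w x s‖ₑ ∂(surfaceMeasure U)
  have hW : W ≠ ⊤ := by
    have := (h.integrable_bdry t₀ t₂ h0 (h01.trans h12) h3).2.ne
    rwa [lintegral_prod_symm' _ h.measurable_bdry.enorm] at this
  rw [ENNReal.tendsto_nhds_zero]
  intro ε hε
  have hlim : Tendsto (fun d : ℝ => ENNReal.ofReal d * W) (𝓝[>] 0) (𝓝 0) := by
    have h2 : Tendsto (fun t : ℝ => ENNReal.ofReal t) (𝓝[>] 0) (𝓝 0) := by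
      have := (ENNReal.continuous_ofReal.tendsto 0).mono_left (nhdsWithin_le_nhds (s := Ioi 0))
      simpa using this
    simpa using ENNReal.Tendsto.mul_const h2 (Or.inr hW)
  obtain ⟨d, hd, hd0⟩ := ((hlim.eventually_le_const hε).and self_mem_nhdsWithin).exists
  obtain ⟨δ, hδ, hδ2⟩ := huc d hd0
  filter_upwards [Ioo_mem_nhdsGT (show (0 : ℝ) < min δ (t₁ - t₀) from
    lt_min hδ (by linarith))] with σ hσ
  have hσ1 : σ < δ := hσ.2.trans_le (min_le_left _ _)
  have hσ2 : σ < t₁ - t₀ := hσ.2.trans_le (min_le_right _ _)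
  have hm : Measurable fun s => ∫⁻ x, ‖w x s‖ₑ ∂(surfaceMeasure U) :=
    h.measurable_bdry.enorm.lintegral_prod_left'
  calc _ ≤ ∫⁻ τ in Ioo t₁ t₂, ENNReal.ofReal d * ∫⁻ x, ‖w x (τ - σ)‖ₑ ∂(surfaceMeasure U) := by
        refine setLIntegral_mono_ae' measurableSet_Ioo (Eventually.of_forall fun τ hτ => ?_)
        rw [← lintegral_const_mul' _ _ ENNReal.ofReal_ne_top]
        refine lintegral_mono_ae ?_
        filter_upwards [ae_restrict_mem isClosed_frontier.measurableSet] with x hx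
        rw [mul_comm]
        refine mul_le_mul' ?_ le_rfl
        have hx' := frontier_subset_closure hx
        have := hδ2 (x, τ - σ) ⟨hx', by simp only; linarith [hτ.1], by simp only; linarith [hτ.2, hσ.1]⟩
          (x, τ) ⟨hx', (h01.trans hτ.1).le, hτ.2.le⟩ (by
            rw [Prod.dist_eq, dist_self, Real.dist_eq, sub_sub_cancel_left, abs_neg,
              abs_of_pos hσ.1]
            exact max_le hδ.le hσ1.le)
        rw [Real.dist_eq] at this
        rw [← ofReal_norm]
        exact ENNReal.ofReal_le_ofReal this
    _ = ENNReal.ofReal d * ∫⁻ τ in Ioo t₁ t₂, ∫⁻ x, ‖w x (τ - σ)‖ₑ ∂(surfaceMeasure U) :=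
        lintegral_const_mul' _ _ ENNReal.ofReal_ne_top
    _ ≤ ENNReal.ofReal d * W := by
        refine mul_le_mul' le_rfl ?_
        simp only [W]
        rw [← lintegral_indicator measurableSet_Ioo, ← lintegral_indicator measurableSet_Ioo]
        rw [← lintegral_sub_right_eq_self (fun s => (Ioo t₀ t₂).indicator
          (fun s => ∫⁻ x, ‖w x s‖ₑ ∂(surfaceMeasure U)) s) σ]
        refine lintegral_mono fun τ => ?_
        by_cases hτ : τ ∈ Ioo t₁ t₂
        swap
        · rw [indicator_of_notMem hτ]; exact bot_le
        rw [indicator_of_mem hτ, indicator_of_mem (show τ - σ ∈ Ioo t₀ t₂ from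
          ⟨by linarith [hτ.1], by linarith [hτ.2, hσ.1]⟩)]
    _ ≤ ε := hd

theorem tendsto_testError (h : RegSol P lam U T u w Du) (hU : IsOpen U)
    (hb : Bornology.IsBounded U) [IsFiniteMeasure (surfaceMeasure U)] (hβ : 1 ≤ β)
    (hχ : ContDiff ℝ 1 χ) {t₀ t₁ t₂ : ℝ} (h0 : 0 < t₀)
    (h01 : t₀ < t₁) (h12 : t₁ < t₂) (h3 : t₂ < T) :
    Tendsto (fun σ => ∫⁻ τ in Ioo t₁ t₂, testError P U u w Du β χ τ (τ - σ)) (𝓝[>] 0) (𝓝 0) := by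
  have := (h.tendsto_error_grad hU hb hβ hχ h0 h01 h12 h3).add
    (h.tendsto_error_bdry hb (by linarith) hχ.continuous h0 h01 h12 h3 (β := β))
  rw [add_zero] at this
  have hm : ∀ σ : ℝ, Measurable fun τ => ∫⁻ x in U, ‖P.flux (Du x (τ - σ))‖ₑ *
      ‖testGrad u Du β χ x (τ - σ) - testGrad u Du β χ x τ‖ₑ := fun σ => by
    have m : Measurable fun τ : ℝ => (τ, τ - σ) := by fun_prop
    have m2 := ((h.measurable_error_grad (β := β) hχ).lintegral_prod_right'
      (ν := volume.restrict U)).comp m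
    simp only [Function.comp_def] at m2
    exact m2
  simp only [testError]
  simp_rw [lintegral_add_left (hm _)]
  exact this

/-- The backward difference of the energy. -/
theorem energy_sub_le (h : RegSol P lam U T u w Du) (hlam : 0 < lam) (hU : IsOpen U)
    (hb : Bornology.IsBounded U) [IsFiniteMeasure (surfaceMeasure U)] (hβ : 1 ≤ β)
    (hχ : ContDiff ℝ 1 χ) (hχ0 : ∀ x, 0 ≤ χ x) {s τ : ℝ} (h0 : 0 < s) (hsτ : s < τ) (h3 : τ < T)
    (hs : StrongApprox U (ENNReal.ofReal (2 - P.a)) (fun x => u x τ) (fun x => Du x τ)) :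
    ENNReal.ofReal (lam / (lam + β) * (∫ x in U, u x τ ^ (lam + β) * χ x) -
      lam / (lam + β) * (∫ x in U, u x s ^ (lam + β) * χ x) +
      ∫ t in Ioo s τ, energyRate P U u w Du β χ t) ≤
      ∫⁻ t in Ioo s τ, testError P U u w Du β χ τ t := by
  have hfin : IsFiniteMeasure (volume.restrict U) := ⟨by simpa using hb.measure_lt_top⟩
  have hβ0 : 0 < β := by linarith
  have hst := strongApprox_test hU hb hβ hχ hs
  have hweak := h.weak_strong hlam hU hb h0 hsτ h3 hst
  have hsm : s ∈ Ioo 0 T := ⟨h0, hsτ.trans h3⟩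
  have hτm : τ ∈ Ioo 0 T := ⟨h0.trans hsτ, h3⟩
  set π := (volume.restrict U).prod (volume.restrict (Ioo s τ))
  set ϖ := (surfaceMeasure U).prod (volume.restrict (Ioo s τ))
  have hcont : ∀ r : ℝ, 0 ≤ r → ContinuousOn (fun y : ℝ => y ^ r) (Ici 0) := fun r hr =>
    (Real.continuous_rpow_const hr).continuousOn
  have i1 := fun t ht => h.integrableOn_slice hb (t := t) ht (hcont (lam + β) (by linarith))
    hχ.continuous.continuousOn
  have i2 := fun t ht => h.integrableOn_slice hb (t := t) ht (hcont lam hlam.le) hst.continuousOn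
  -- The convexity inequality, with `a = u(τ)` and `b = u(s)`, compares the energies with the
  -- increment of `u^λ` tested against the frozen function `u(τ)^β χ`.
  have hconv : lam / (lam + β) * (∫ x in U, u x τ ^ (lam + β) * χ x) -
      lam / (lam + β) * (∫ x in U, u x s ^ (lam + β) * χ x) ≤
      (∫ x in U, u x τ ^ lam * (u x τ ^ β * χ x)) - ∫ x in U, u x s ^ lam * (u x τ ^ β * χ x) := by
    rw [← mul_sub, ← integral_sub (i1 τ hτm) (i1 s hsm), ← integral_const_mul,
      ← integral_sub (i2 τ hτm) (i2 s hsm)]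
    refine integral_mono (((i1 τ hτm).sub (i1 s hsm)).const_mul _) ((i2 τ hτm).sub (i2 s hsm))
      fun x => ?_
    have := mul_le_mul_of_nonneg_right (rpow_sub_rpow_le hlam hβ0 (h.nonneg x τ) (h.nonneg x s))
      (hχ0 x)
    simp only
    linarith
  have j1 : Integrable (fun z : Eu n × ℝ => ⟪P.flux (Du z.1 z.2), testGrad u Du β χ z.1 z.2⟫) π :=
    h.integrable_inner_flux h0 hsτ h3 (h.memLp_testGrad hU hb hβ hχ h0 hsτ h3)
  have hGm : MemLp (fun z : Eu n × ℝ => testGrad u Du β χ z.1 τ) (ENNReal.ofReal (2 - P.a)) π :=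
    ⟨hst.memLp.1.comp_fst, by
      rw [eLpNorm_comp_fst_le hst.memLp.1 ENNReal.ofReal_ne_top]
      exact ENNReal.mul_lt_top (ENNReal.rpow_lt_top_of_nonneg ENNReal.toReal_nonneg
        (measure_ne_top _ _)) hst.memLp.2⟩
  have j2 : Integrable (fun z : Eu n × ℝ => ⟪P.flux (Du z.1 z.2), testGrad u Du β χ z.1 τ⟫) π :=
    h.integrable_inner_flux h0 hsτ h3 hGm
  have k1 : Integrable (fun z : Eu n × ℝ => w z.1 z.2 * (u z.1 z.2 ^ β * χ z.1)) ϖ :=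
    h.integrable_test_bdry hb hβ0.le hχ.continuous h0 hsτ h3
  obtain ⟨B, hB⟩ := hb.isCompact_closure.exists_bound_of_continuousOn hst.continuousOn
  have k2 : Integrable (fun z : Eu n × ℝ => w z.1 z.2 * (u z.1 τ ^ β * χ z.1)) ϖ :=
    h.integrable_bdry_mul h0 hsτ h3
      (((h.measurable_test hχ.continuous).comp measurable_prodMk_right).comp
        measurable_fst).aestronglyMeasurable fun z hz => hB _ hz.1
  have hrate : ∫ t in Ioo s τ, energyRate P U u w Du β χ t =
      (∫ z, ⟪P.flux (Du z.1 z.2), testGrad u Du β χ z.1 z.2⟫ ∂π) +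
        ∫ z, w z.1 z.2 * (u z.1 z.2 ^ β * χ z.1) ∂ϖ := by
    rw [integral_prod_symm _ j1, integral_prod_symm _ k1]
    exact integral_add j1.integral_prod_right k1.integral_prod_right
  -- The rate of energy uses the test function at the running time, the weak form the one frozen at
  -- `τ`. Their difference is what `testError` measures.
  have hle : lam / (lam + β) * (∫ x in U, u x τ ^ (lam + β) * χ x) -
      lam / (lam + β) * (∫ x in U, u x s ^ (lam + β) * χ x) +
      ∫ t in Ioo s τ, energyRate P U u w Du β χ t ≤
      (∫ z, ⟪P.flux (Du z.1 z.2), testGrad u Du β χ z.1 z.2 - testGrad u Du β χ z.1 τ⟫ ∂π) +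
        ∫ z, w z.1 z.2 * (u z.1 z.2 ^ β * χ z.1 - u z.1 τ ^ β * χ z.1) ∂ϖ := by
    simp_rw [inner_sub_right, mul_sub]
    rw [integral_sub j1 j2, integral_sub k1 k2, hrate, integral_prod_symm _ j2,
      integral_prod_symm _ k2]
    linarith
  refine (ENNReal.ofReal_le_ofReal hle).trans (ENNReal.ofReal_add_le.trans ?_)
  have m1 : Measurable fun t => ∫⁻ x in U, ‖P.flux (Du x t)‖ₑ *
      ‖testGrad u Du β χ x t - testGrad u Du β χ x τ‖ₑ := by
    have m : Measurable fun t : ℝ => (τ, t) := by fun_prop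
    have m2 := ((h.measurable_error_grad (β := β) hχ).lintegral_prod_right'
      (ν := volume.restrict U)).comp m
    simp only [Function.comp_def] at m2
    exact m2
  simp only [testError]
  rw [lintegral_add_left m1]
  refine add_le_add ?_ ?_
  · refine (Real.ofReal_le_enorm _).trans ((enorm_integral_le_lintegral_enorm _).trans ?_)
    have m : Measurable fun z : Eu n × ℝ => ((τ, z.2), z.1) := by fun_prop
    have := lintegral_prod_symm' (μ := volume.restrict U) (ν := volume.restrict (Ioo s τ)) _
      ((h.measurable_error_grad (β := β) hχ).comp m)
    simp only [Function.comp_def] at this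
    rw [← this]
    refine lintegral_mono fun z => ?_
    rw [← ofReal_norm, ← ofReal_norm, ← ofReal_norm, ← ENNReal.ofReal_mul (norm_nonneg _)]
    exact ENNReal.ofReal_le_ofReal (norm_inner_le_norm _ _)
  · refine (Real.ofReal_le_enorm _).trans ((enorm_integral_le_lintegral_enorm _).trans ?_)
    have m : Measurable fun z : Eu n × ℝ => ((τ, z.2), z.1) := by fun_prop
    have := lintegral_prod_symm' (μ := surfaceMeasure U) (ν := volume.restrict (Ioo s τ)) _
      ((h.measurable_error_bdry (β := β) hχ.continuous).comp m)
    simp only [Function.comp_def] at this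
    rw [← this]
    refine lintegral_mono fun z => ?_
    rw [enorm_mul]

/-- The energy inequality. -/
theorem energy_le (h : RegSol P lam U T u w Du) (hlam : 0 < lam) (hU : IsOpen U)
    (hb : Bornology.IsBounded U) (𝒜 : Atlas U) [IsFiniteMeasure (surfaceMeasure U)] (hβ : 1 ≤ β)
    (hχ : ContDiff ℝ 1 χ) (hχ0 : ∀ x, 0 ≤ χ x) {t₁ t₂ : ℝ} (h1 : 0 < t₁) (h2 : t₁ < t₂)
    (h3 : t₂ < T) :
    lam / (lam + β) * (∫ x in U, u x t₂ ^ (lam + β) * χ x) +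
      (∫ t in Ioo t₁ t₂, energyRate P U u w Du β χ t) ≤
      lam / (lam + β) * (∫ x in U, u x t₁ ^ (lam + β) * χ x) := by
  obtain ⟨t₀, h0, h01⟩ := exists_between h1
  have hint := h.integrableOn_energyRate hU hb hβ hχ h0 (h01.trans h2) h3
  set b := energyRate P U u w Du β χ
  set X : ℝ → ℝ := fun t => lam / (lam + β) * ∫ x in U, u x t ^ (lam + β) * χ x
  have hsub : Icc t₀ t₂ ⊆ Ioo 0 T := fun t ht => ⟨h0.trans_le ht.1, ht.2.trans_lt h3⟩
  have hXc : ContinuousOn X (Icc t₀ t₂) :=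
    continuousOn_const.mul ((h.continuousOn_energy hU hb (by linarith) hχ.continuous).mono hsub)
  have hint' : IntegrableOn b (uIcc t₀ t₂) := by
    rw [uIcc_of_le (h01.trans h2).le, integrableOn_Icc_iff_integrableOn_Ioo]; exact hint
  have hPc : ContinuousOn (fun t => ∫ s in t₀..t, b s) (Icc t₀ t₂) := by
    have := intervalIntegral.continuousOn_primitive_interval hint'
    rwa [uIcc_of_le (h01.trans h2).le] at this
  have hii : ∀ a c, t₀ ≤ a → a ≤ c → c ≤ t₂ → IntervalIntegrable b volume a c :=
    fun a c ha hac hc => by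
      rw [intervalIntegrable_iff_integrableOn_Ioo_of_le hac]
      exact hint.mono_set (Ioo_subset_Ioo ha hc)
  have hdiff : ∀ a c, t₀ ≤ a → a ≤ c → c ≤ t₂ →
      (∫ s in t₀..c, b s) - (∫ s in t₀..a, b s) = ∫ s in Ioo a c, b s := fun a c ha hac hc => by
    rw [intervalIntegral.integral_interval_sub_left (hii _ _ le_rfl (ha.trans hac) hc)
      (hii _ _ le_rfl ha (hac.trans hc)), intervalIntegral.integral_of_le hac,
      restrict_Ioo_eq_restrict_Ioc]
  -- Energy plus accumulated rate is shown to be non-increasing. The time `t₀ < t₁` provides the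
  -- room needed by the backward differences.
  have hmain := le_of_lintegral_window (Y := fun t => X t + ∫ s in t₀..t, b s) h01 h2
    (hXc.add hPc) (h.measurable_testError (β := β) hχ)
    (h.tendsto_testError hU hb hβ hχ h0 h01 h2 h3) fun d hd => by
      filter_upwards [h.strongApprox hU hb 𝒜 h1 h2 h3, ae_restrict_mem measurableSet_Ioo]
        with τ hτ hτm
      have hd1 : 0 < τ - d := by linarith [hd.2, hτm.1]
      refine le_trans (le_of_eq ?_) (h.energy_sub_le hlam hU hb hβ hχ hχ0 hd1
        (by linarith [hd.1]) (hτm.2.trans h3) hτ)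
      rw [← hdiff (τ - d) τ (by linarith [hd.2, hτm.1]) (by linarith [hd.1]) hτm.2.le]
      congr 1
      simp only [X]
      ring
  have := hdiff t₁ t₂ h01.le h2.le le_rfl
  simp only [X] at hmain ⊢
  linarith

end RegSol

end ForchheimerGas

end

noncomputable section

namespace ForchheimerGas

variable {n : ℕ} {U : Set (Eu n)} {P : GenPoly} {lam T : ℝ}

/-! ### The Caccioppoli inequality -/

/-- One of the two terms already dominates: which one depends on whether `b ≤ ε^{1/t} a`. No
normalization of the exponents is needed, and `s = 0` is allowed. -/
theorem young_split {s t ε a b : ℝ} (hs : 0 ≤ s) (ht : 0 < t) (hε : 0 < ε) (ha : 0 ≤ a)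
    (hb : 0 ≤ b) : a ^ s * b ^ t ≤ ε * a ^ (s + t) + ε ^ (-(s / t)) * b ^ (s + t) := by
  have hk : 0 < ε ^ (1 / t) := Real.rpow_pos_of_pos hε _
  have h1 : 0 ≤ ε * a ^ (s + t) := by positivity
  have h2 : 0 ≤ ε ^ (-(s / t)) * b ^ (s + t) := by positivity
  rcases le_total b (ε ^ (1 / t) * a) with h | h
  · refine le_trans ?_ (le_add_of_nonneg_right h2)
    calc a ^ s * b ^ t ≤ a ^ s * (ε ^ (1 / t) * a) ^ t := by gcongr
      _ = ε * a ^ (s + t) := by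
        rw [Real.mul_rpow hk.le ha, ← Real.rpow_mul hε.le, one_div_mul_cancel ht.ne', Real.rpow_one,
          Real.rpow_add_of_nonneg ha hs ht.le]
        ring
  · refine le_trans ?_ (le_add_of_nonneg_left h1)
    have h3 : a ≤ ε ^ (-(1 / t)) * b := by
      rw [Real.rpow_neg hε.le, inv_mul_eq_div, le_div_iff₀ hk]; linarith
    calc a ^ s * b ^ t ≤ (ε ^ (-(1 / t)) * b) ^ s * b ^ t := by gcongr
      _ = ε ^ (-(s / t)) * b ^ (s + t) := by
        rw [Real.mul_rpow (by positivity) hb, ← Real.rpow_mul hε.le,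
          Real.rpow_add_of_nonneg hb hs ht.le]
        rw [show -(1 / t) * s = -(s / t) by ring]
        ring

/-- Lower bound for the flux tested against the gradient of `u^β ζ²`. -/
theorem GenPoly.exists_flux_lower (P : GenPoly) : ∃ c C : ℝ, 0 < c ∧ 0 < C ∧
    ∀ {n : ℕ} {β u z G : ℝ} {D v : Eu n}, 1 ≤ β → 0 ≤ u → 0 ≤ z → z ≤ 1 → 0 ≤ G →
      ‖v‖ ≤ 2 * z * G →
      c * (z ^ 2 * (u ^ (β - 1) * ‖D‖ ^ (2 - P.a))) -
        C * (β * (z ^ 2 * u ^ (β - 1)) + G ^ (2 - P.a) * u ^ (β + (1 - P.a))) ≤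
        ⟪P.flux D, z ^ 2 • ((β * u ^ (β - 1)) • D) + u ^ β • v⟫ := by
  obtain ⟨c, C1, hc, hC1, hl⟩ := P.exists_le_K_mul_sq
  obtain ⟨C2, hC2, hu⟩ := P.exists_norm_flux_le
  have ha := P.a_lt_one
  have ha0 := P.a_pos
  -- Young's inequality is used with the parameter `c/(4 C2)`. Multiplied by the prefactor `2 C2`,
  -- it costs exactly half of the coercivity constant `c`.
  set E : ℝ := (c / (4 * C2)) ^ (-((1 - P.a) / 1)) with hE
  have hE0 : 0 < E := by positivity
  refine ⟨c / 2, C1 + 2 * C2 * E, by positivity, by positivity,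
    fun {n β u z G D v} hβ hu0 hz0 hz1 hG hv => ?_⟩
  have hD0 := norm_nonneg D
  have hub : 0 ≤ u ^ (β - 1) := Real.rpow_nonneg hu0 _
  have e1 : ⟪P.flux D, z ^ 2 • ((β * u ^ (β - 1)) • D) + u ^ β • v⟫ =
      z ^ 2 * (β * u ^ (β - 1)) * (P.K ‖D‖ * ‖D‖ ^ 2) + u ^ β * ⟪P.flux D, v⟫ := by
    rw [inner_add_right, real_inner_smul_right, real_inner_smul_right, real_inner_smul_right,
      P.inner_flux_self]
    ring
  have e2 : -(‖P.flux D‖ * ‖v‖) ≤ ⟪P.flux D, v⟫ := by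
    have := abs_real_inner_le_norm (P.flux D) v
    linarith [neg_abs_le ⟪P.flux D, v⟫]
  have e3 : ‖P.flux D‖ * ‖v‖ ≤ C2 * ‖D‖ ^ (1 - P.a) * (2 * z * G) :=
    mul_le_mul (hu D) hv (norm_nonneg _) (by positivity)
  have e4 : u ^ β * (C2 * ‖D‖ ^ (1 - P.a) * (2 * z * G)) ≤
      c / 2 * (z ^ 2 * (u ^ (β - 1) * ‖D‖ ^ (2 - P.a))) +
        2 * C2 * E * (G ^ (2 - P.a) * u ^ (β + (1 - P.a))) := by
    rcases hz0.eq_or_lt with rfl | hz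
    · have : 0 ≤ u ^ (β + (1 - P.a)) := Real.rpow_nonneg hu0 _
      simp only [mul_zero, zero_mul, ne_eq, OfNat.ofNat_ne_zero, not_false_eq_true, zero_pow, zero_add]
      positivity
    -- The factor `z²` is pulled out so that the gradient term carries the same weight as the
    -- dissipation. The other term then contains `z² z^{-(2-a)} ≤ 1`, because `2 - a ≤ 2`; this is
    -- the reason for squaring the cut-off.
    have hy := young_split (s := 1 - P.a) (t := 1) (ε := c / (4 * C2)) (a := ‖D‖) (b := u * G / z)
      (by linarith) one_pos (by positivity) hD0 (by positivity)
    rw [Real.rpow_one, show 1 - P.a + 1 = 2 - P.a by ring, ← hE] at hy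
    have hub2 : u ^ β = u ^ (β - 1) * u := by
      nth_rw 3 [← Real.rpow_one u]
      rw [← Real.rpow_add_of_nonneg hu0 (by linarith) zero_le_one]; congr 1; ring
    have hug : u ^ (β + (1 - P.a)) = u ^ (β - 1) * u ^ (2 - P.a) := by
      rw [← Real.rpow_add_of_nonneg hu0 (by linarith) (by linarith)]; congr 1; ring
    have hzz : z ^ 2 * (u * G / z) ^ (2 - P.a) ≤ u ^ (2 - P.a) * G ^ (2 - P.a) := by
      rw [Real.div_rpow (by positivity) hz0, Real.mul_rpow hu0 hG, mul_div_assoc', div_le_iff₀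
        (by positivity), mul_comm]
      gcongr
      rw [← Real.rpow_two]
      exact Real.rpow_le_rpow_of_exponent_ge hz hz1 (by linarith)
    calc u ^ β * (C2 * ‖D‖ ^ (1 - P.a) * (2 * z * G))
        = 2 * C2 * u ^ (β - 1) * z ^ 2 * (‖D‖ ^ (1 - P.a) * (u * G / z)) := by
          rw [hub2]; field_simp
      _ ≤ 2 * C2 * u ^ (β - 1) * z ^ 2 * (c / (4 * C2) * ‖D‖ ^ (2 - P.a) +
            E * (u * G / z) ^ (2 - P.a)) := by gcongr
      _ = c / 2 * (z ^ 2 * (u ^ (β - 1) * ‖D‖ ^ (2 - P.a))) +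
            2 * C2 * E * u ^ (β - 1) * (z ^ 2 * (u * G / z) ^ (2 - P.a)) := by
          field_simp; ring
      _ ≤ c / 2 * (z ^ 2 * (u ^ (β - 1) * ‖D‖ ^ (2 - P.a))) +
            2 * C2 * E * u ^ (β - 1) * (u ^ (2 - P.a) * G ^ (2 - P.a)) := by gcongr
      _ = _ := by rw [hug]; ring
  have e5 : z ^ 2 * (β * u ^ (β - 1)) * (c * ‖D‖ ^ (2 - P.a) - C1) ≤
      z ^ 2 * (β * u ^ (β - 1)) * (P.K ‖D‖ * ‖D‖ ^ 2) := by
    gcongr; exact hl _ hD0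
  have e6 : c * (z ^ 2 * (u ^ (β - 1) * ‖D‖ ^ (2 - P.a))) ≤
      z ^ 2 * (β * u ^ (β - 1)) * (c * ‖D‖ ^ (2 - P.a)) := by
    have h0 : 0 ≤ c * (z ^ 2 * (u ^ (β - 1) * ‖D‖ ^ (2 - P.a))) := by positivity
    calc _ ≤ β * (c * (z ^ 2 * (u ^ (β - 1) * ‖D‖ ^ (2 - P.a)))) := le_mul_of_one_le_left h0 hβ
      _ = _ := by ring
  have hub3 : 0 ≤ u ^ β := Real.rpow_nonneg hu0 _
  have e7 : -(u ^ β * (C2 * ‖D‖ ^ (1 - P.a) * (2 * z * G))) ≤ u ^ β * ⟪P.flux D, v⟫ := by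
    have := mul_le_mul_of_nonneg_left (e2.trans' (neg_le_neg e3)) hub3
    linarith
  have h8 : 0 ≤ C1 * (G ^ (2 - P.a) * u ^ (β + (1 - P.a))) := by
    have : 0 ≤ u ^ (β + (1 - P.a)) := Real.rpow_nonneg hu0 _
    positivity
  have h9 : 0 ≤ 2 * C2 * E * (β * (z ^ 2 * u ^ (β - 1))) := by positivity
  rw [e1]
  nlinarith

theorem gradient_sq {ζ : Eu n → ℝ} (hζ : ContDiff ℝ 1 ζ) (x : Eu n) :
    gradient (fun y => ζ y ^ 2) x = (2 * ζ x) • gradient ζ x := by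
  have h := hζ.differentiable one_ne_zero x
  have := gradient_mul h h
  simp only [← sq] at this
  rw [this]
  module

namespace RegSol

variable {u w : Eu n → ℝ → ℝ} {Du : Eu n → ℝ → Eu n} {β : ℝ} {ζ : Eu n → ℝ}

/-- The dissipation density. -/
def dissip (P : GenPoly) (u : Eu n → ℝ → ℝ) (Du : Eu n → ℝ → Eu n) (β : ℝ) (ζ : Eu n → ℝ)
    (x : Eu n) (t : ℝ) : ℝ := ζ x ^ 2 * (u x t ^ (β - 1) * ‖Du x t‖ ^ (2 - P.a))

theorem dissip_nonneg (h : RegSol P lam U T u w Du) (x : Eu n) (t : ℝ) :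
    0 ≤ dissip P u Du β ζ x t :=
  mul_nonneg (sq_nonneg _) (mul_nonneg (Real.rpow_nonneg (h.nonneg x t) _)
    (Real.rpow_nonneg (norm_nonneg _) _))

theorem measurable_dissip (h : RegSol P lam U T u w Du) (hζ : Continuous ζ) :
    Measurable (Function.uncurry (dissip P u Du β ζ)) :=
  ((hζ.measurable.comp measurable_fst).pow_const 2).mul
    ((h.measurable.pow_const _).mul (h.measurable_grad.norm.pow_const _))

theorem integrable_pow (h : RegSol P lam U T u w Du) (hU : IsOpen U) (hb : Bornology.IsBounded U)
    {r : ℝ} (hr : 0 ≤ r) {t₁ t₂ : ℝ} (h1 : 0 < t₁) (h3 : t₂ < T) :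
    Integrable (fun z : Eu n × ℝ => u z.1 z.2 ^ r)
      ((volume.restrict U).prod (volume.restrict (Ioo t₁ t₂))) := by
  have hfin : IsFiniteMeasure (volume.restrict U) := ⟨by simpa using hb.measure_lt_top⟩
  obtain ⟨B, hB0, hB⟩ := h.exists_bound hb h1 h3
  refine Integrable.of_bound (h.measurable.pow_const r).aestronglyMeasurable (B ^ r) ?_
  have hae : ∀ᵐ z ∂((volume.restrict U).prod (volume.restrict (Ioo t₁ t₂))), z ∈ U ×ˢ Ioo t₁ t₂ := by
    rw [Measure.prod_restrict]; exact ae_restrict_mem (hU.measurableSet.prod measurableSet_Ioo)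
  filter_upwards [hae] with z hz
  have h0 := h.nonneg z.1 z.2
  change ‖u z.1 z.2 ^ r‖ ≤ _
  rw [Real.norm_of_nonneg (Real.rpow_nonneg h0 _)]
  exact Real.rpow_le_rpow h0 (hB _ (subset_closure hz.1) _ ⟨hz.2.1.le, hz.2.2.le⟩) hr

theorem integrable_dissip (h : RegSol P lam U T u w Du) (hU : IsOpen U) (hb : Bornology.IsBounded U)
    (hβ : 1 ≤ β) (hζ : Continuous ζ) {t₁ t₂ : ℝ} (h1 : 0 < t₁) (h2 : t₁ < t₂) (h3 : t₂ < T) :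
    Integrable (Function.uncurry (dissip P u Du β ζ))
      ((volume.restrict U).prod (volume.restrict (Ioo t₁ t₂))) := by
  obtain ⟨B, hB0, hB⟩ := h.exists_bound hb h1 h3
  obtain ⟨D, hD⟩ := hb.isCompact_closure.exists_bound_of_continuousOn hζ.continuousOn
  have hp : 0 < 2 - P.a := by linarith [P.a_lt_one]
  have hm := (h.memLp t₁ t₂ h1 h2 h3).integrable_norm_rpow (by simpa using hp) ENNReal.ofReal_ne_top
  rw [ENNReal.toReal_ofReal hp.le] at hm
  refine (hm.const_mul (D ^ 2 * B ^ (β - 1))).mono' (h.measurable_dissip hζ).aestronglyMeasurable ?_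
  have hae : ∀ᵐ z ∂((volume.restrict U).prod (volume.restrict (Ioo t₁ t₂))), z ∈ U ×ˢ Ioo t₁ t₂ := by
    rw [Measure.prod_restrict]; exact ae_restrict_mem (hU.measurableSet.prod measurableSet_Ioo)
  filter_upwards [hae] with z hz
  have h0 := h.nonneg z.1 z.2
  have hz1 := subset_closure hz.1
  change ‖dissip P u Du β ζ z.1 z.2‖ ≤ _
  rw [Real.norm_of_nonneg (h.dissip_nonneg _ _), dissip, ← mul_assoc]
  refine mul_le_mul_of_nonneg_right (mul_le_mul ?_ ?_ (Real.rpow_nonneg h0 _) (by positivity))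
    (Real.rpow_nonneg (norm_nonneg _) _)
  · rw [← sq_abs]; exact pow_le_pow_left₀ (abs_nonneg _) (hD _ hz1) 2
  · exact Real.rpow_le_rpow h0 (hB _ hz1 _ ⟨hz.2.1.le, hz.2.2.le⟩) (by linarith)

end RegSol

end ForchheimerGas

end

/-! ### The Caccioppoli inequality between two times. -/

noncomputable section

namespace ForchheimerGas

variable {n : ℕ} {U : Set (Eu n)} {P : GenPoly} {lam T : ℝ}

namespace RegSol

/-- The Caccioppoli inequality in differential form. -/
theorem exists_energy_dissip (P : GenPoly) (hlam : 0 < lam) : ∃ c C : ℝ, 0 < c ∧ 0 < C ∧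
    ∀ {n : ℕ} {U : Set (Eu n)} {T : ℝ} {u w : Eu n → ℝ → ℝ} {Du : Eu n → ℝ → Eu n},
      RegSol P lam U T u w Du → IsOpen U → Bornology.IsBounded U → Atlas U →
      IsFiniteMeasure (surfaceMeasure U) → ∀ {B : Set (Eu n)}, MeasurableSet B → B ⊆ U →
      ∀ {ζ : Eu n → ℝ} {β G : ℝ}, 1 ≤ β → 1 ≤ G → ContDiff ℝ 1 ζ → (∀ x, 0 ≤ ζ x) → (∀ x, ζ x ≤ 1) →
      (∀ x, ‖gradient ζ x‖ ≤ G) → (∀ x, x ∉ B → ζ x = 0) →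
      ∀ {t₁ t₂ : ℝ}, 0 < t₁ → t₁ < t₂ → t₂ < T →
      (∫⁻ x in U, ENNReal.ofReal (u x t₂ ^ (lam + β) * ζ x ^ 2)) +
        ENNReal.ofReal c * (∫⁻ z in U ×ˢ Ioo t₁ t₂, ENNReal.ofReal (dissip P u Du β ζ z.1 z.2)) ≤
      (∫⁻ x in U, ENNReal.ofReal (u x t₁ ^ (lam + β) * ζ x ^ 2)) +
        ENNReal.ofReal (C * (lam + β) ^ 2 * G ^ (2 - P.a)) * ∫⁻ z in B ×ˢ Ioo t₁ t₂,
          ENNReal.ofReal (u z.1 z.2 ^ (β - 1) + u z.1 z.2 ^ (β + (1 - P.a))) := by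
  obtain ⟨c, C, hc, hC, hlow⟩ := P.exists_flux_lower
  refine ⟨c, C / lam, hc, by positivity, fun {n U T u w Du} h hU hb 𝒜 hσ {B} hBm hBU {ζ β G} hβ hG hζ
    hζ0 hζ1 hζG hζB {t₁ t₂} h1 h2 h3 => ?_⟩
  have ha := P.a_lt_one
  have hfin : IsFiniteMeasure (volume.restrict U) := ⟨by simpa using hb.measure_lt_top⟩
  have hβ0 : 0 < lam + β := by linarith
  set χ : Eu n → ℝ := fun x => ζ x ^ 2 with hχdef
  have hχ : ContDiff ℝ 1 χ := hζ.pow 2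
  have hχg : ∀ x, gradient χ x = (2 * ζ x) • gradient ζ x := gradient_sq hζ
  set π := (volume.restrict U).prod (volume.restrict (Ioo t₁ t₂)) with hπ
  set γ := β + (1 - P.a)
  have hen := h.energy_le hlam hU hb 𝒜 hβ hχ (fun x => sq_nonneg _) h1 h2 h3
  -- The cut-off vanishes off `B ⊆ U`, and the open set `U` is disjoint from its frontier, so the
  -- boundary data do not enter the interior estimate.
  have hbdry0 : ∀ t, ∫ x, w x t * (u x t ^ β * χ x) ∂(surfaceMeasure U) = 0 := fun t => by
    rw [surfaceMeasure]
    refine setIntegral_eq_zero_of_forall_eq_zero fun x hx => ?_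
    have : x ∉ B := fun hxB => by
      rw [hU.frontier_eq] at hx; exact hx.2 (hBU hxB)
    simp [hχdef, hζB x this]
  have j1 : Integrable (fun z : Eu n × ℝ => ⟪P.flux (Du z.1 z.2), testGrad u Du β χ z.1 z.2⟫) π :=
    h.integrable_inner_flux h1 h2 h3 (h.memLp_testGrad hU hb hβ hχ h1 h2 h3)
  have hrate : ∫ t in Ioo t₁ t₂, energyRate P U u w Du β χ t =
      ∫ z, ⟪P.flux (Du z.1 z.2), testGrad u Du β χ z.1 z.2⟫ ∂π := by
    rw [integral_prod_symm _ j1]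
    simp only [energyRate, hbdry0, add_zero]
  have hdi : Integrable (fun z : Eu n × ℝ => dissip P u Du β ζ z.1 z.2) π :=
    h.integrable_dissip hU hb hβ hζ.continuous h1 h2 h3
  set S : Set (Eu n × ℝ) := B ×ˢ Ioo t₁ t₂
  have hSm : MeasurableSet S := hBm.prod measurableSet_Ioo
  have hpw : ∀ r : ℝ, 0 ≤ r → Integrable (fun z : Eu n × ℝ => S.indicator (fun z => u z.1 z.2 ^ r) z) π :=
    fun r hr => (h.integrable_pow hU hb hr h1 h3).indicator hSm
  have i1 := hpw (β - 1) (by linarith)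
  have i2 := hpw γ (by simp only [γ]; linarith)
  have hlower : c * (∫ z, dissip P u Du β ζ z.1 z.2 ∂π) -
      C * (β * (∫ z, S.indicator (fun z => u z.1 z.2 ^ (β - 1)) z ∂π) +
        G ^ (2 - P.a) * ∫ z, S.indicator (fun z => u z.1 z.2 ^ γ) z ∂π) ≤
      ∫ t in Ioo t₁ t₂, energyRate P U u w Du β χ t := by
    have i3 : Integrable (fun z => C * (β * S.indicator (fun z => u z.1 z.2 ^ (β - 1)) z +
        G ^ (2 - P.a) * S.indicator (fun z => u z.1 z.2 ^ γ) z)) π :=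
      ((i1.const_mul _).add (i2.const_mul _)).const_mul _
    rw [hrate, ← integral_const_mul, ← integral_const_mul, ← integral_const_mul,
      ← integral_add (i1.const_mul _) (i2.const_mul _), ← integral_const_mul,
      ← integral_sub (hdi.const_mul _) i3]
    refine integral_mono_ae ((hdi.const_mul _).sub i3) j1 ?_
    have hae : ∀ᵐ z ∂π, z ∈ U ×ˢ Ioo t₁ t₂ := by
      rw [hπ, Measure.prod_restrict]; exact ae_restrict_mem (hU.measurableSet.prod measurableSet_Ioo)
    filter_upwards [hae] with z hz
    have h0 := h.nonneg z.1 z.2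
    have hul : 0 ≤ u z.1 z.2 ^ (β - 1) := Real.rpow_nonneg h0 _
    by_cases hzB : z.1 ∈ B
    · have hzS : z ∈ S := ⟨hzB, hz.2⟩
      simp only [indicator_of_mem hzS]
      have := hlow (n := n) (β := β) (u := u z.1 z.2) (z := ζ z.1) (G := G) (D := Du z.1 z.2)
        (v := gradient χ z.1) hβ h0 (hζ0 _) (hζ1 _) (by linarith) (by
          rw [hχg, norm_smul, Real.norm_of_nonneg (by linarith [hζ0 z.1])]
          exact mul_le_mul_of_nonneg_left (hζG _) (by linarith [hζ0 z.1]))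
      refine le_trans ?_ this
      have e1 : ζ z.1 ^ 2 * u z.1 z.2 ^ (β - 1) ≤ u z.1 z.2 ^ (β - 1) :=
        mul_le_of_le_one_left hul (pow_le_one₀ (hζ0 _) (hζ1 _))
      have e2 : β * (ζ z.1 ^ 2 * u z.1 z.2 ^ (β - 1)) ≤ β * u z.1 z.2 ^ (β - 1) := by gcongr
      have e3 := mul_le_mul_of_nonneg_left e2 hC.le
      simp only [dissip]
      linarith
    · have hzS : z ∉ S := fun hz => hzB hz.1
      simp only [indicator_of_notMem hzS]
      have hz0 := hζB _ hzB
      have : testGrad u Du β χ z.1 z.2 = 0 := by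
        rw [testGrad, hχg]; simp [hχdef, hz0]
      rw [this, inner_zero_right]
      simp [dissip, hz0]
  have hX : ∀ t ∈ Ioo 0 T, Integrable (fun x => u x t ^ (lam + β) * ζ x ^ 2) (volume.restrict U) :=
    fun t ht => h.integrableOn_slice hb ht (Real.continuous_rpow_const hβ0.le).continuousOn
      hχ.continuous.continuousOn
  have hX0 : ∀ t, 0 ≤ᵐ[volume.restrict U] fun x => u x t ^ (lam + β) * ζ x ^ 2 := fun t =>
    Eventually.of_forall fun x => mul_nonneg (Real.rpow_nonneg (h.nonneg _ _) _) (sq_nonneg _)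
  have hI0 : ∀ r : ℝ, 0 ≤ᵐ[π] fun z : Eu n × ℝ => S.indicator (fun z => u z.1 z.2 ^ r) z := fun r =>
    Eventually.of_forall fun z => indicator_nonneg (fun z _ => Real.rpow_nonneg (h.nonneg _ _) _) _
  set M : ℝ := C / lam * (lam + β) ^ 2 * G ^ (2 - P.a)
  have hGp : 1 ≤ G ^ (2 - P.a) := Real.one_le_rpow hG (by linarith)
  set I₁ := ∫ z, S.indicator (fun z => u z.1 z.2 ^ (β - 1)) z ∂π
  set I₂ := ∫ z, S.indicator (fun z => u z.1 z.2 ^ γ) z ∂π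
  have hI1 : 0 ≤ I₁ := integral_nonneg_of_ae (hI0 _)
  have hI2 : 0 ≤ I₂ := integral_nonneg_of_ae (hI0 _)
  set J := ∫ z, dissip P u Du β ζ z.1 z.2 ∂π
  have hJ : 0 ≤ J := integral_nonneg fun z => h.dissip_nonneg _ _
  have hreal : (∫ x in U, u x t₂ ^ (lam + β) * ζ x ^ 2) + c * J ≤
      (∫ x in U, u x t₁ ^ (lam + β) * ζ x ^ 2) + M * (I₁ + I₂) := by
    -- Multiplying by `(λ + β)/λ` normalizes the energy. This gives one of the two factors `λ + β`
    -- in the constant; the other bounds the factor `β` in the gradient of `u^β`.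
    have hk : 0 < (lam + β) / lam := by positivity
    have e1 : (lam + β) / lam * (lam / (lam + β)) = 1 := by field_simp
    have h4 := mul_le_mul_of_nonneg_left (add_le_add_right hlower
      (lam / (lam + β) * ∫ x in U, u x t₂ ^ (lam + β) * χ x) |>.trans hen) hk.le
    rw [mul_add, ← mul_assoc, e1, one_mul, ← mul_assoc, e1, one_mul] at h4
    have h5 : c * J ≤ (lam + β) / lam * (c * J) := by
      refine le_mul_of_one_le_left (by positivity) ?_
      rw [le_div_iff₀ hlam]; linarith
    have h6 : (lam + β) / lam * (C * (β * I₁ + G ^ (2 - P.a) * I₂)) ≤ M * (I₁ + I₂) := by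
      have e2 : β * I₁ ≤ (lam + β) * G ^ (2 - P.a) * I₁ := by
        gcongr
        nlinarith
      have e3 : G ^ (2 - P.a) * I₂ ≤ (lam + β) * G ^ (2 - P.a) * I₂ := by
        gcongr
        nlinarith
      calc _ ≤ (lam + β) / lam * (C * ((lam + β) * G ^ (2 - P.a) * I₁ +
            (lam + β) * G ^ (2 - P.a) * I₂)) := by gcongr
        _ = _ := by simp only [M]; ring
    rw [mul_sub] at h4
    linarith
  have hconv := ENNReal.ofReal_le_ofReal hreal
  have i12 : Integrable (fun z => S.indicator (fun z => u z.1 z.2 ^ (β - 1)) z +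
      S.indicator (fun z => u z.1 z.2 ^ γ) z) π := i1.add i2
  have hM : 0 ≤ M := by positivity
  rw [ENNReal.ofReal_add (integral_nonneg_of_ae (hX0 _)) (by positivity),
    ENNReal.ofReal_add (integral_nonneg_of_ae (hX0 _)) (by positivity),
    ENNReal.ofReal_mul hc.le, ENNReal.ofReal_mul hM, ← integral_add i1 i2,
    ofReal_integral_eq_lintegral_ofReal (hX t₂ ⟨h1.trans h2, h3⟩) (hX0 _),
    ofReal_integral_eq_lintegral_ofReal (hX t₁ ⟨h1, h2.trans h3⟩) (hX0 _),
    ofReal_integral_eq_lintegral_ofReal hdi (Eventually.of_forall fun z => h.dissip_nonneg _ _),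
    ofReal_integral_eq_lintegral_ofReal i12 (by
      filter_upwards [hI0 (β - 1), hI0 γ] with z hz1 hz2 using add_nonneg hz1 hz2)] at hconv
  rw [hπ, Measure.prod_restrict, ← Measure.volume_eq_prod] at hconv
  refine hconv.trans (add_le_add le_rfl (mul_le_mul' le_rfl ?_))
  rw [← lintegral_indicator hSm]
  refine (setLIntegral_le_lintegral _ _).trans (lintegral_mono fun z => ?_)
  by_cases hz : z ∈ S
  · simp [indicator_of_mem hz, γ]
  · simp [indicator_of_notMem hz]

end RegSol

end ForchheimerGas

end

noncomputable section

namespace ForchheimerGas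

variable {n : ℕ} {U : Set (Eu n)} {P : GenPoly} {lam T : ℝ}

/-! ### The parabolic Sobolev step -/

theorem add_rpow_le_four {a b p : ℝ} (ha : 0 ≤ a) (hb : 0 ≤ b) (hp0 : 0 ≤ p) (hp : p ≤ 2) :
    (a + b) ^ p ≤ 4 * (a ^ p + b ^ p) := by
  have h2 : (2 : ℝ) ^ p ≤ 4 := by
    calc (2 : ℝ) ^ p ≤ 2 ^ (2 : ℝ) := Real.rpow_le_rpow_of_exponent_le (by norm_num) hp
      _ = 4 := by norm_num
  have ha' := Real.rpow_nonneg ha p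
  have hb' := Real.rpow_nonneg hb p
  have key : ∀ c : ℝ, 0 ≤ c → a + b ≤ 2 * c → (a + b) ^ p ≤ 4 * c ^ p := fun c hc h => by
    calc (a + b) ^ p ≤ (2 * c) ^ p := Real.rpow_le_rpow (by positivity) h hp0
      _ = 2 ^ p * c ^ p := Real.mul_rpow (by norm_num) hc
      _ ≤ 4 * c ^ p := by gcongr
  rcases le_total a b with h | h
  · exact (key b hb (by linarith)).trans (by linarith)
  · exact (key a ha (by linarith)).trans (by linarith)

namespace RegSol

variable {u w : Eu n → ℝ → ℝ} {Du : Eu n → ℝ → Eu n} {β : ℝ} {ζ : Eu n → ℝ}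

/-- The power `m = (β + 1 - a)/(2 - a)` satisfies `(m - 1)(2 - a) = β - 1`. Hence the `(2 - a)`-th
power of `|∇(u^m ζ²)|` is controlled by the dissipation, up to the term where the cut-off is
differentiated. -/
theorem norm_testGrad_rpow_le (h : RegSol P lam U T u w Du) (hlam : 0 < lam) (hβ : 1 ≤ β) {G : ℝ}
    (hG : 0 ≤ G) (hζ : ContDiff ℝ 1 ζ) (hζ0 : ∀ x, 0 ≤ ζ x) (hζ1 : ∀ x, ζ x ≤ 1)
    (hζG : ∀ x, ‖gradient ζ x‖ ≤ G) (x : Eu n) (t : ℝ) :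
    ‖testGrad u Du ((β + (1 - P.a)) / (2 - P.a)) (fun x => ζ x ^ 2) x t‖ ^ (2 - P.a) ≤
      16 * (lam + β) ^ 2 * dissip P u Du β ζ x t +
        16 * G ^ (2 - P.a) * u x t ^ (β + (1 - P.a)) := by
  have ha := P.a_lt_one
  have ha0 := P.a_pos
  set p := 2 - P.a with hp
  have hp0 : 0 < p := by linarith
  have hp2 : p ≤ 2 := by linarith
  set m := (β + (1 - P.a)) / p with hm
  have hmp : m * p = β + (1 - P.a) := by rw [hm]; field_simp
  have hm1 : 1 ≤ m := by rw [hm, le_div_iff₀ hp0]; linarith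
  have hm2 : m ≤ 2 * (lam + β) := by rw [hm, div_le_iff₀ hp0]; nlinarith
  have h0 := h.nonneg x t
  set v := u x t
  have hz0 := hζ0 x
  have hz1 := hζ1 x
  set z := ζ x
  set d := ‖Du x t‖
  have hd : 0 ≤ d := norm_nonneg _
  have hzz : (z ^ 2) ^ p ≤ z ^ 2 := by
    rw [← Real.rpow_two, ← Real.rpow_mul hz0]
    rcases hz0.eq_or_lt with h' | h'
    · rw [← h', Real.zero_rpow (by positivity), Real.zero_rpow two_ne_zero]
    · exact Real.rpow_le_rpow_of_exponent_ge h' hz1 (by linarith)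
  have hn1 : ‖testGrad u Du m (fun x => ζ x ^ 2) x t‖ ≤
      z ^ 2 * (m * v ^ (m - 1) * d) + v ^ m * (2 * G) := by
    rw [testGrad, gradient_sq hζ]
    refine (norm_add_le _ _).trans (add_le_add ?_ ?_)
    · rw [norm_smul, norm_smul, Real.norm_of_nonneg (sq_nonneg _),
        Real.norm_of_nonneg (mul_nonneg (by linarith) (Real.rpow_nonneg h0 _))]
    · rw [norm_smul, norm_smul, Real.norm_of_nonneg (Real.rpow_nonneg h0 _),
        Real.norm_of_nonneg (by linarith [hz0])]
      refine mul_le_mul_of_nonneg_left ?_ (Real.rpow_nonneg h0 _)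
      exact mul_le_mul (by linarith) (hζG x) (norm_nonneg _) (by norm_num)
  have hvm : 0 ≤ v ^ m := Real.rpow_nonneg h0 _
  have hvm1 : 0 ≤ v ^ (m - 1) := Real.rpow_nonneg h0 _
  have e1 : (z ^ 2 * (m * v ^ (m - 1) * d)) ^ p ≤ 4 * (lam + β) ^ 2 * dissip P u Du β ζ x t := by
    rw [Real.mul_rpow (sq_nonneg _) (by positivity), Real.mul_rpow (by positivity) hd,
      Real.mul_rpow (by linarith) hvm1, ← Real.rpow_mul h0,
      show (m - 1) * p = β - 1 by rw [sub_mul, hmp]; linarith]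
    have e2 : m ^ p ≤ 4 * (lam + β) ^ 2 := by
      calc m ^ p ≤ m ^ (2 : ℝ) := Real.rpow_le_rpow_of_exponent_le hm1 hp2
        _ = m ^ 2 := Real.rpow_two m
        _ ≤ (2 * (lam + β)) ^ 2 := by gcongr
        _ = _ := by ring
    have hvb : 0 ≤ v ^ (β - 1) := Real.rpow_nonneg h0 _
    calc (z ^ 2) ^ p * (m ^ p * v ^ (β - 1) * d ^ p)
        ≤ z ^ 2 * ((4 * (lam + β) ^ 2) * v ^ (β - 1) * d ^ p) := by gcongr
      _ = _ := by simp only [dissip, v, z, d, hp]; ring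
  have e3 : (v ^ m * (2 * G)) ^ p ≤ 4 * G ^ p * v ^ (β + (1 - P.a)) := by
    rw [Real.mul_rpow hvm (by positivity), Real.mul_rpow (by norm_num) hG, ← Real.rpow_mul h0, hmp]
    have h2 : (2 : ℝ) ^ p ≤ 4 := by
      calc (2 : ℝ) ^ p ≤ 2 ^ (2 : ℝ) := Real.rpow_le_rpow_of_exponent_le (by norm_num) hp2
        _ = 4 := by norm_num
    have hvb : 0 ≤ v ^ (β + (1 - P.a)) := Real.rpow_nonneg h0 _
    have hGp : 0 ≤ G ^ p := Real.rpow_nonneg hG _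
    calc _ ≤ v ^ (β + (1 - P.a)) * (4 * G ^ p) := by gcongr
      _ = _ := by ring
  calc _ ≤ (z ^ 2 * (m * v ^ (m - 1) * d) + v ^ m * (2 * G)) ^ p :=
        Real.rpow_le_rpow (norm_nonneg _) hn1 hp0.le
    _ ≤ 4 * ((z ^ 2 * (m * v ^ (m - 1) * d)) ^ p + (v ^ m * (2 * G)) ^ p) :=
        add_rpow_le_four (by positivity) (by positivity) hp0.le hp2
    _ ≤ 4 * (4 * (lam + β) ^ 2 * dissip P u Du β ζ x t + 4 * G ^ p * v ^ (β + (1 - P.a))) := by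
        gcongr
    _ = _ := by ring

/-- Averaging the Caccioppoli inequality over the initial time. -/
theorem exists_caccioppoli (P : GenPoly) (hlam : 0 < lam) : ∃ c K : ℝ, 0 < c ∧ 1 ≤ K ∧
    ∀ {n : ℕ} {U : Set (Eu n)} {T : ℝ} {u w : Eu n → ℝ → ℝ} {Du : Eu n → ℝ → Eu n},
      RegSol P lam U T u w Du → IsOpen U → Bornology.IsBounded U → Atlas U →
      IsFiniteMeasure (surfaceMeasure U) → ∀ {B : Set (Eu n)}, MeasurableSet B → B ⊆ U →
      ∀ {ζ : Eu n → ℝ} {β G : ℝ}, 1 ≤ β → 1 ≤ G → ContDiff ℝ 1 ζ → (∀ x, 0 ≤ ζ x) → (∀ x, ζ x ≤ 1) →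
      (∀ x, ‖gradient ζ x‖ ≤ G) → (∀ x, x ∉ B → ζ x = 0) →
      ∀ {τ₀ τ₁ t : ℝ}, 0 < τ₀ → τ₀ < τ₁ → τ₁ ≤ τ₀ + 1 → τ₁ < t → t < T → ∀ s ∈ Ioc τ₁ t,
      (∫⁻ x in U, ENNReal.ofReal (u x s ^ (lam + β) * ζ x ^ 2)) +
        ENNReal.ofReal c * (∫⁻ z in U ×ˢ Ioo τ₁ s, ENNReal.ofReal (dissip P u Du β ζ z.1 z.2)) ≤
      ENNReal.ofReal (K * (lam + β) ^ 2 * G ^ (2 - P.a) / (τ₁ - τ₀)) *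
        ∫⁻ z in B ×ˢ Ioo τ₀ t, ENNReal.ofReal (u z.1 z.2 ^ (lam + β) + u z.1 z.2 ^ (β - 1) +
          u z.1 z.2 ^ (β + (1 - P.a))) := by
  obtain ⟨c, C, hc, hC, hE⟩ := exists_energy_dissip P hlam
  refine ⟨c, max C 1, hc, le_max_right _ _, fun {n U T u w Du} h hU hb 𝒜 hσ {B} hBm hBU {ζ β G} hβ hG
    hζ hζ0 hζ1 hζG hζB {τ₀ τ₁ t} h0 h01 h01' h1t htT s hs => ?_⟩
  have ha := P.a_lt_one
  set ℓ := τ₁ - τ₀ with hℓ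
  have hℓ0 : 0 < ℓ := by linarith
  have hℓ1 : ℓ ≤ 1 := by linarith
  set L := (∫⁻ x in U, ENNReal.ofReal (u x s ^ (lam + β) * ζ x ^ 2)) +
        ENNReal.ofReal c * (∫⁻ z in U ×ˢ Ioo τ₁ s, ENNReal.ofReal (dissip P u Du β ζ z.1 z.2))
  set γ := β + (1 - P.a)
  set M := C * (lam + β) ^ 2 * G ^ (2 - P.a) with hM
  set R := ∫⁻ z in B ×ˢ Ioo τ₀ t, ENNReal.ofReal (u z.1 z.2 ^ (β - 1) + u z.1 z.2 ^ γ)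
  set A := ∫⁻ z in B ×ˢ Ioo τ₀ t, ENNReal.ofReal (u z.1 z.2 ^ (lam + β))
  have hGp : 1 ≤ G ^ (2 - P.a) := Real.one_le_rpow hG (by linarith)
  have hlb : 1 ≤ (lam + β) ^ 2 := one_le_pow₀ (by linarith)
  have hum : Measurable fun z : Eu n × ℝ => ENNReal.ofReal (u z.1 z.2 ^ (lam + β)) :=
    (h.measurable.pow_const _).ennreal_ofReal
  -- The dissipation on the left is restricted to times after `τ₁`, so that `L` does not depend on
  -- the starting time `r`. Averaging over `r` then removes the initial energy without a cut-off in
  -- time.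
  have hstep : ∀ r ∈ Ioo τ₀ τ₁, L ≤ (∫⁻ x in U, ENNReal.ofReal (u x r ^ (lam + β) * ζ x ^ 2)) +
      ENNReal.ofReal M * R := fun r hr => by
    refine le_trans ?_ ((hE h hU hb 𝒜 hσ hBm hBU hβ hG hζ hζ0 hζ1 hζG hζB (h0.trans hr.1)
      (hr.2.trans hs.1) (hs.2.trans_lt htT)).trans ?_)
    · exact add_le_add le_rfl (mul_le_mul' le_rfl (lintegral_mono_set
        (prod_mono_right (Ioo_subset_Ioo hr.2.le le_rfl))))
    · exact add_le_add le_rfl (mul_le_mul' le_rfl (lintegral_mono_set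
        (prod_mono_right (Ioo_subset_Ioo hr.1.le hs.2))))
  have havg : ENNReal.ofReal ℓ * L ≤ A + ENNReal.ofReal ℓ * (ENNReal.ofReal M * R) := by
    calc ENNReal.ofReal ℓ * L = ∫⁻ _r in Ioo τ₀ τ₁, L := by
          rw [setLIntegral_const, Real.volume_Ioo, mul_comm]
      _ ≤ ∫⁻ r in Ioo τ₀ τ₁, ((∫⁻ x in U, ENNReal.ofReal (u x r ^ (lam + β) * ζ x ^ 2)) +
          ENNReal.ofReal M * R) :=
          setLIntegral_mono_ae' measurableSet_Ioo (Eventually.of_forall hstep)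
      _ = (∫⁻ r in Ioo τ₀ τ₁, ∫⁻ x in U, ENNReal.ofReal (u x r ^ (lam + β) * ζ x ^ 2)) +
          ENNReal.ofReal ℓ * (ENNReal.ofReal M * R) := by
          rw [lintegral_add_right _ measurable_const, setLIntegral_const, Real.volume_Ioo, mul_comm _
            (ENNReal.ofReal (τ₁ - τ₀))]
      _ ≤ _ := by
          refine add_le_add ?_ le_rfl
          simp only [A]
          rw [Measure.volume_eq_prod, ← Measure.prod_restrict, lintegral_prod_symm' _ hum]
          refine le_trans (lintegral_mono_set (Ioo_subset_Ioo le_rfl h1t.le)) (lintegral_mono fun r => ?_)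
          rw [← lintegral_indicator hBm]
          refine (setLIntegral_le_lintegral _ _).trans (lintegral_mono fun x => ?_)
          by_cases hx : x ∈ B
          · rw [indicator_of_mem hx]
            exact ENNReal.ofReal_le_ofReal (mul_le_of_le_one_right (Real.rpow_nonneg (h.nonneg _ _) _)
              (pow_le_one₀ (hζ0 _) (hζ1 _)))
          · simp [hζB x hx]
  have hL : L ≤ ENNReal.ofReal (1 / ℓ) * A + ENNReal.ofReal M * R := by
    have e : ENNReal.ofReal (1 / ℓ) * ENNReal.ofReal ℓ = 1 := by
      rw [← ENNReal.ofReal_mul (by positivity), one_div_mul_cancel hℓ0.ne', ENNReal.ofReal_one]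
    have h2 := mul_le_mul' (le_refl (ENNReal.ofReal (1 / ℓ))) havg
    clear_value L A R M
    rwa [mul_add, ← mul_assoc, ← mul_assoc, e, one_mul, one_mul] at h2
  have hsum : ∫⁻ z in B ×ˢ Ioo τ₀ t, ENNReal.ofReal (u z.1 z.2 ^ (lam + β) + u z.1 z.2 ^ (β - 1) +
          u z.1 z.2 ^ γ) = A + R := by
    simp only [A, R]
    rw [← lintegral_add_left hum]
    refine lintegral_congr fun z => ?_
    have h0 := fun r => Real.rpow_nonneg (h.nonneg z.1 z.2) r
    rw [← ENNReal.ofReal_add (h0 _) (add_nonneg (h0 _) (h0 _)), add_assoc]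
  rw [hsum, mul_add]
  refine hL.trans (add_le_add (mul_le_mul' (ENNReal.ofReal_le_ofReal ?_) le_rfl)
    (mul_le_mul' (ENNReal.ofReal_le_ofReal ?_) le_rfl))
  · gcongr
    have h1 : 1 ≤ max C 1 := le_max_right _ _
    calc (1 : ℝ) = 1 * 1 * 1 := by norm_num
      _ ≤ _ := by gcongr
  · rw [le_div_iff₀ hℓ0]
    calc M * ℓ ≤ M * 1 := by gcongr
      _ ≤ _ := by rw [mul_one, hM]; gcongr; exact le_max_left _ _

end RegSol

end ForchheimerGas

end

/-! ### Gain of integrability on a smaller cylinder. -/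

noncomputable section

namespace ForchheimerGas

variable {n : ℕ} {U : Set (Eu n)} {P : GenPoly} {lam T : ℝ}

theorem lintegral_mul_rpow_le {X : Type*} [MeasurableSpace X] {μ : Measure X} {p N : ℝ} (hp : 0 < p)
    (hpN : p < N) {f g : X → ℝ≥0∞} (hf : AEMeasurable f μ) (hg : AEMeasurable g μ) :
    ∫⁻ x, f x * g x ^ (p / N) ∂μ ≤
      (∫⁻ x, f x ^ (N / (N - p)) ∂μ) ^ ((N - p) / N) * (∫⁻ x, g x ∂μ) ^ (p / N) := by
  have hN : 0 < N := hp.trans hpN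
  have hNp : 0 < N - p := by linarith
  have hc : Real.HolderConjugate (N / (N - p)) (N / p) := by
    rw [Real.holderConjugate_iff]
    refine ⟨by rw [lt_div_iff₀ hNp]; linarith, by field_simp; ring⟩
  have h := ENNReal.lintegral_mul_le_Lp_mul_Lq μ hc hf (hg.pow_const (p / N))
  have e : ∀ x, (g x ^ (p / N)) ^ (N / p) = g x := fun x => by
    rw [← ENNReal.rpow_mul, div_mul_div_cancel₀ hN.ne', div_self hp.ne', ENNReal.rpow_one]
  simp only [Pi.mul_apply, e, one_div_div] at h
  exact h

namespace RegSol

/-- At almost every time, Hölder's inequality bounds `∫ (u^m ζ²)^p (u^α ζ²)^{p/n}` by a Sobolev norm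
of `u^m ζ²` times the power `p/n` of the energy. Caccioppoli's inequality bounds the time integral
of the first factor and the supremum in time of the second by the same quantity, whence the power `1
+ p/n`. Where `ζ = 1` the integrand is the displayed power of `u`. The dependence of the constant on
`λ + β` is polynomial, which the iteration can afford. -/
theorem exists_sobolev_step (hn : 2 ≤ n) (hU : IsOpen U) (hb : Bornology.IsBounded U)
    (𝒜 : Atlas U) [IsFiniteMeasure (surfaceMeasure U)] (P : GenPoly) (hlam : 0 < lam) :
    ∃ C : ℝ, 1 ≤ C ∧ ∀ {T : ℝ} {u w : Eu n → ℝ → ℝ} {Du : Eu n → ℝ → Eu n},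
      RegSol P lam U T u w Du → ∀ {B B' : Set (Eu n)}, MeasurableSet B → MeasurableSet B' → B' ⊆ B →
      B ⊆ U → ∀ {ζ : Eu n → ℝ} {β G : ℝ}, 1 ≤ β → 1 ≤ G → ContDiff ℝ 1 ζ → (∀ x, 0 ≤ ζ x) →
      (∀ x, ζ x ≤ 1) → (∀ x, ‖gradient ζ x‖ ≤ G) → (∀ x, x ∉ B → ζ x = 0) →
      (∀ x ∈ B', ζ x = 1) →
      ∀ {τ₀ τ₁ t : ℝ}, 0 < τ₀ → τ₀ < τ₁ → τ₁ ≤ τ₀ + 1 → τ₁ < t → t < T →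
      ∫⁻ z in B' ×ˢ Ioo τ₁ t,
          ENNReal.ofReal (u z.1 z.2 ^ (β + (1 - P.a) + (lam + β) * ((2 - P.a) / n))) ≤
        (ENNReal.ofReal (C * (lam + β) ^ 4 * G ^ (2 - P.a) / (τ₁ - τ₀)) *
        ∫⁻ z in B ×ˢ Ioo τ₀ t, ENNReal.ofReal (u z.1 z.2 ^ (lam + β) + u z.1 z.2 ^ (β - 1) +
          u z.1 z.2 ^ (β + (1 - P.a)))) ^ (1 + (2 - P.a) / n) := by
  have hn0 : (2 : ℝ) ≤ n := by exact_mod_cast hn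
  have ha := P.a_lt_one
  have ha0 := P.a_pos
  obtain ⟨c, K, hc, hK, hcac⟩ := exists_caccioppoli P hlam
  set p := 2 - P.a with hp
  have hp0 : 0 < p := by linarith
  have hpn : p < n := by linarith
  obtain ⟨CS, hCS, hsob⟩ := exists_sobolev hn hU hb 𝒜 (p := p) (by linarith) hpn
  set CS' := max 1 CS.toReal with hCS'
  have hCS1 : CS ≤ ENNReal.ofReal CS' := by
    rw [← ENNReal.ofReal_toReal hCS]; exact ENNReal.ofReal_le_ofReal (le_max_right _ _)
  set A := CS' * (16 / c + 17) with hA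
  have hA1 : 1 ≤ A := by
    have h1 : (1 : ℝ) ≤ CS' := le_max_left _ _
    have h2 : 0 < 16 / c := by positivity
    rw [hA]; nlinarith
  refine ⟨A * K, one_le_mul_of_one_le_of_one_le hA1 hK, fun {T u w Du} h {B B'} hBm hBm' hBB hBU {ζ β G}
    hβ hG hζ hζ0 hζ1 hζG hζB hζB' {τ₀ τ₁ t} h0 h01 h01' h1t htT => ?_⟩
  have hlb : 1 ≤ (lam + β) ^ 2 := one_le_pow₀ (by linarith)
  have hGp : 1 ≤ G ^ p := Real.one_le_rpow hG (by linarith)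
  set α := lam + β with hα
  set γ := β + (1 - P.a) with hγ
  set ℓ := τ₁ - τ₀ with hℓ
  have hℓ0 : 0 < ℓ := by linarith
  have hℓ1 : ℓ ≤ 1 := by linarith
  set I := ∫⁻ z in B ×ˢ Ioo τ₀ t, ENNReal.ofReal (u z.1 z.2 ^ α + u z.1 z.2 ^ (β - 1) +
          u z.1 z.2 ^ γ) with hI
  set Φ := ENNReal.ofReal (K * α ^ 2 * G ^ p / ℓ) * I with hΦ
  have hcs : ∀ s ∈ Ioc τ₁ t, (∫⁻ x in U, ENNReal.ofReal (u x s ^ α * ζ x ^ 2)) +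
        ENNReal.ofReal c * (∫⁻ z in U ×ˢ Ioo τ₁ s, ENNReal.ofReal (dissip P u Du β ζ z.1 z.2)) ≤ Φ :=
    hcac h hU hb 𝒜 inferInstance hBm hBU hβ hG hζ hζ0 hζ1 hζG hζB h0 h01 h01' h1t htT
  set J := ∫⁻ z in U ×ˢ Ioo τ₁ t, ENNReal.ofReal (dissip P u Du β ζ z.1 z.2) with hJ
  have hcJ : J ≤ ENNReal.ofReal (1 / c) * Φ := by
    have h1 : ENNReal.ofReal c * J ≤ Φ := le_add_self.trans (hcs t ⟨h1t, le_rfl⟩)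
    have h2 := mul_le_mul' (le_refl (ENNReal.ofReal (1 / c))) h1
    rwa [← mul_assoc, ← ENNReal.ofReal_mul (by positivity), one_div_mul_cancel hc.ne',
      ENNReal.ofReal_one, one_mul] at h2
  set m := γ / p with hm
  have hmp : m * p = γ := by rw [hm]; field_simp
  have hm1 : 1 ≤ m := by rw [hm, le_div_iff₀ hp0, hγ]; linarith
  have hχ : ContDiff ℝ 1 (fun x => ζ x ^ 2) := hζ.pow 2
  set W : Eu n → ℝ → Eu n := testGrad u Du m (fun x => ζ x ^ 2) with hW
  set f : Eu n → ℝ → ℝ := fun x τ => u x τ ^ m * ζ x ^ 2 with hf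
  have hζm := hζ.continuous.measurable
  have hfm : Measurable (Function.uncurry f) :=
    (h.measurable.pow_const _).mul ((hζm.comp measurable_fst).pow_const 2)
  have hWm : Measurable (Function.uncurry W) := h.measurable_testGrad hχ
  have hf0 : ∀ x τ, 0 ≤ f x τ := fun x τ =>
    mul_nonneg (Real.rpow_nonneg (h.nonneg _ _) _) (sq_nonneg _)
  have hslice : ∀ᵐ τ ∂(volume.restrict (Ioo τ₁ t)),
      ∫⁻ x in B', ENNReal.ofReal (u x τ ^ (γ + α * (p / n))) ≤
      (CS * ∫⁻ x in U, (‖f x τ‖ₑ ^ p + ‖W x τ‖ₑ ^ p)) * Φ ^ (p / n) := by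
    filter_upwards [h.strongApprox hU hb 𝒜 (h0.trans h01) h1t htT, ae_restrict_mem measurableSet_Ioo]
      with τ hτ hτm
    have hs := hsob (fun x => f x τ) (fun x => W x τ) (fun x _ => hf0 x τ)
      (strongApprox_test hU hb hm1 hχ hτ)
    have hfs : Measurable fun x => f x τ := hfm.comp (measurable_id.prodMk measurable_const)
    have hus : Measurable fun x => u x τ := h.measurable.comp (measurable_id.prodMk measurable_const)
    have hgm : Measurable fun x => ENNReal.ofReal (u x τ ^ α * ζ x ^ 2) :=
      ((hus.pow_const _).mul (hζm.pow_const 2)).ennreal_ofReal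
    calc ∫⁻ x in B', ENNReal.ofReal (u x τ ^ (γ + α * (p / n)))
        ≤ ∫⁻ x in B', ‖f x τ‖ₑ ^ p * ENNReal.ofReal (u x τ ^ α * ζ x ^ 2) ^ (p / n) := by
          refine setLIntegral_mono_ae' hBm' (Eventually.of_forall fun x hx => ?_)
          have h1 := h.nonneg x τ
          rw [← ofReal_norm, Real.norm_of_nonneg (hf0 x τ), ENNReal.ofReal_rpow_of_nonneg (hf0 x τ) hp0.le,
            ENNReal.ofReal_rpow_of_nonneg (mul_nonneg (Real.rpow_nonneg h1 _) (sq_nonneg _))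
              (by positivity), ← ENNReal.ofReal_mul (Real.rpow_nonneg (hf0 x τ) _)]
          simp only [f, hζB' x hx, one_pow, mul_one]
          rw [← Real.rpow_mul h1, ← Real.rpow_mul h1, hmp,
            Real.rpow_add_of_nonneg h1 (by linarith) (by positivity)]
      _ ≤ ∫⁻ x in U, ‖f x τ‖ₑ ^ p * ENNReal.ofReal (u x τ ^ α * ζ x ^ 2) ^ (p / n) :=
          lintegral_mono_set (hBB.trans hBU)
      _ ≤ (∫⁻ x in U, (‖f x τ‖ₑ ^ p) ^ ((n : ℝ) / (n - p))) ^ ((n - p) / (n : ℝ)) *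
            (∫⁻ x in U, ENNReal.ofReal (u x τ ^ α * ζ x ^ 2)) ^ (p / n) :=
          lintegral_mul_rpow_le hp0 hpn (hfs.enorm.pow_const p).aemeasurable hgm.aemeasurable
      _ ≤ _ := by
          refine mul_le_mul' ?_ (ENNReal.rpow_le_rpow
            (le_self_add.trans (hcs τ ⟨hτm.1, hτm.2.le⟩)) (by positivity))
          simp only [← ENNReal.rpow_mul]
          rw [show p * ((n : ℝ) / (n - p)) = n * p / (n - p) by ring]
          exact hs
  have hAm : Measurable fun z : Eu n × ℝ => ‖f z.1 z.2‖ₑ ^ p + ‖W z.1 z.2‖ₑ ^ p :=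
    (hfm.enorm.pow_const p).add (hWm.enorm.pow_const p)
  set Q := B ×ˢ Ioo τ₀ t with hQ
  have hQm : MeasurableSet Q := hBm.prod measurableSet_Ioo
  have hI1 : ENNReal.ofReal (17 * G ^ p) * I ≤ ENNReal.ofReal 17 * Φ := by
    rw [hΦ, ← mul_assoc, ← ENNReal.ofReal_mul (by norm_num)]
    refine mul_le_mul' (ENNReal.ofReal_le_ofReal ?_) le_rfl
    have : G ^ p ≤ K * α ^ 2 * G ^ p / ℓ := by
      rw [le_div_iff₀ hℓ0]
      calc G ^ p * ℓ ≤ G ^ p * 1 := by gcongr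
        _ = 1 * 1 * G ^ p := by ring
        _ ≤ _ := by gcongr
    linarith
  have htot : ∫⁻ τ in Ioo τ₁ t, ∫⁻ x in U, (‖f x τ‖ₑ ^ p + ‖W x τ‖ₑ ^ p) ≤
      ENNReal.ofReal ((16 / c + 17) * α ^ 2) * Φ := by
    calc ∫⁻ τ in Ioo τ₁ t, ∫⁻ x in U, (‖f x τ‖ₑ ^ p + ‖W x τ‖ₑ ^ p)
        = ∫⁻ z in U ×ˢ Ioo τ₁ t, (‖f z.1 z.2‖ₑ ^ p + ‖W z.1 z.2‖ₑ ^ p) := by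
          rw [Measure.volume_eq_prod, ← Measure.prod_restrict, lintegral_prod_symm' _ hAm]
      _ ≤ ∫⁻ z in U ×ˢ Ioo τ₁ t, (ENNReal.ofReal (16 * α ^ 2) *
            ENNReal.ofReal (dissip P u Du β ζ z.1 z.2) + ENNReal.ofReal (17 * G ^ p) *
              Q.indicator (fun z => ENNReal.ofReal (u z.1 z.2 ^ γ)) z) := by
          refine setLIntegral_mono_ae' (hU.measurableSet.prod measurableSet_Ioo)
            (Eventually.of_forall fun z hz => ?_)
          have h1 := h.nonneg z.1 z.2
          have hd := h.dissip_nonneg (β := β) (ζ := ζ) z.1 z.2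
          rw [← ofReal_norm, ← ofReal_norm, ENNReal.ofReal_rpow_of_nonneg (norm_nonneg _) hp0.le,
            ENNReal.ofReal_rpow_of_nonneg (norm_nonneg _) hp0.le, Real.norm_of_nonneg (hf0 _ _)]
          by_cases hzB : z.1 ∈ B
          · have hzQ : z ∈ Q := ⟨hzB, h01.trans hz.2.1, hz.2.2⟩
            rw [indicator_of_mem hzQ, ← ENNReal.ofReal_mul (by positivity), ← ENNReal.ofReal_mul
              (by positivity), ← ENNReal.ofReal_add (Real.rpow_nonneg (hf0 _ _) _)
              (Real.rpow_nonneg (norm_nonneg _) _), ← ENNReal.ofReal_add (by positivity)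
              (mul_nonneg (by positivity) (Real.rpow_nonneg h1 _))]
            refine ENNReal.ofReal_le_ofReal ?_
            have e1 := h.norm_testGrad_rpow_le hlam hβ (by linarith : 0 ≤ G) hζ hζ0 hζ1 hζG z.1 z.2
            have e2 : f z.1 z.2 ^ p ≤ G ^ p * u z.1 z.2 ^ γ := by
              have hz1 : ζ z.1 ^ 2 ≤ 1 := pow_le_one₀ (hζ0 _) (hζ1 _)
              calc f z.1 z.2 ^ p ≤ (u z.1 z.2 ^ m) ^ p :=
                    Real.rpow_le_rpow (hf0 _ _) (mul_le_of_le_one_right (Real.rpow_nonneg h1 _) hz1) hp0.le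
                _ = 1 * u z.1 z.2 ^ γ := by rw [← Real.rpow_mul h1, hmp, one_mul]
                _ ≤ _ := mul_le_mul_of_nonneg_right hGp (Real.rpow_nonneg h1 _)
            simp only [← hp, ← hγ, ← hα, ← hm] at e1
            linarith
          · have hz0 := hζB _ hzB
            have e1 : f z.1 z.2 = 0 := by simp [f, hz0]
            have e2 : W z.1 z.2 = 0 := by
              rw [hW, testGrad, gradient_sq hζ]; simp [hz0]
            rw [e1, e2, norm_zero, Real.zero_rpow hp0.ne']
            simp
      _ = ENNReal.ofReal (16 * α ^ 2) * J + ENNReal.ofReal (17 * G ^ p) *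
            ∫⁻ z in U ×ˢ Ioo τ₁ t, Q.indicator (fun z => ENNReal.ofReal (u z.1 z.2 ^ γ)) z := by
          have m1 : Measurable fun z : Eu n × ℝ => ENNReal.ofReal (dissip P u Du β ζ z.1 z.2) :=
            (h.measurable_dissip hζ.continuous).ennreal_ofReal
          have m2 : Measurable fun z : Eu n × ℝ => ENNReal.ofReal (u z.1 z.2 ^ γ) :=
            (h.measurable.pow_const _).ennreal_ofReal
          rw [lintegral_add_left (m1.const_mul _), lintegral_const_mul _ m1,
            lintegral_const_mul _ (m2.indicator hQm)]
      _ ≤ ENNReal.ofReal (16 * α ^ 2) * (ENNReal.ofReal (1 / c) * Φ) + ENNReal.ofReal 17 * Φ := by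
          refine add_le_add (mul_le_mul' le_rfl hcJ) ((mul_le_mul' le_rfl ?_).trans hI1)
          refine (setLIntegral_le_lintegral _ _).trans ?_
          rw [lintegral_indicator hQm]
          refine lintegral_mono fun z => ENNReal.ofReal_le_ofReal ?_
          have h0 := fun r => Real.rpow_nonneg (h.nonneg z.1 z.2) r
          linarith [h0 α, h0 (β - 1)]
      _ ≤ _ := by
          rw [← mul_assoc, ← ENNReal.ofReal_mul (by positivity), ← add_mul, ← ENNReal.ofReal_add
            (by positivity) (by norm_num)]
          refine mul_le_mul' (ENNReal.ofReal_le_ofReal ?_) le_rfl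
          rw [add_mul]
          refine add_le_add (le_of_eq (by ring)) ?_
          nlinarith
  have hLm : Measurable fun z : Eu n × ℝ => ENNReal.ofReal (u z.1 z.2 ^ (γ + α * (p / n))) :=
    (h.measurable.pow_const _).ennreal_ofReal
  have hAm' : Measurable fun τ => ∫⁻ x in U, (‖f x τ‖ₑ ^ p + ‖W x τ‖ₑ ^ p) :=
    Measurable.lintegral_prod_left' (f := fun z : Eu n × ℝ => ‖f z.1 z.2‖ₑ ^ p + ‖W z.1 z.2‖ₑ ^ p) hAm
  have hpn0 : 0 < p / n := by positivity
  calc ∫⁻ z in B' ×ˢ Ioo τ₁ t, ENNReal.ofReal (u z.1 z.2 ^ (γ + α * (p / n)))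
      = ∫⁻ τ in Ioo τ₁ t, ∫⁻ x in B', ENNReal.ofReal (u x τ ^ (γ + α * (p / n))) := by
        rw [Measure.volume_eq_prod, ← Measure.prod_restrict, lintegral_prod_symm' _ hLm]
    _ ≤ ∫⁻ τ in Ioo τ₁ t, (CS * ∫⁻ x in U, (‖f x τ‖ₑ ^ p + ‖W x τ‖ₑ ^ p)) * Φ ^ (p / n) :=
        lintegral_mono_ae hslice
    _ = CS * (∫⁻ τ in Ioo τ₁ t, ∫⁻ x in U, (‖f x τ‖ₑ ^ p + ‖W x τ‖ₑ ^ p)) * Φ ^ (p / n) := by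
        rw [lintegral_mul_const _ (hAm'.const_mul _), lintegral_const_mul _ hAm']
    _ ≤ ENNReal.ofReal CS' * (ENNReal.ofReal ((16 / c + 17) * α ^ 2) * Φ) * Φ ^ (p / n) :=
        mul_le_mul' (mul_le_mul' hCS1 htot) le_rfl
    _ = ENNReal.ofReal (A * α ^ 2) * Φ ^ (1 + p / n) := by
        rw [ENNReal.rpow_add_of_nonneg _ _ zero_le_one hpn0.le, ENNReal.rpow_one, ← mul_assoc,
          ← ENNReal.ofReal_mul (by positivity), hA]
        ring_nf
    _ ≤ ENNReal.ofReal (A * α ^ 2) ^ (1 + p / n) * Φ ^ (1 + p / n) := by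
        refine mul_le_mul' ?_ le_rfl
        have h1 : 1 ≤ ENNReal.ofReal (A * α ^ 2) := by
          rw [← ENNReal.ofReal_one]; exact ENNReal.ofReal_le_ofReal (by nlinarith)
        calc ENNReal.ofReal (A * α ^ 2) = ENNReal.ofReal (A * α ^ 2) ^ (1 : ℝ) := by simp
          _ ≤ _ := ENNReal.rpow_le_rpow_of_exponent_le h1 (by linarith)
    _ = _ := by
        rw [← ENNReal.mul_rpow_of_nonneg _ _ (by positivity), hΦ, ← mul_assoc, ← ENNReal.ofReal_mul
          (by positivity)]
        congr 3
        ring_nf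

end RegSol

end ForchheimerGas

end

noncomputable section

namespace ForchheimerGas

/-! ### Moser iteration: the abstract scheme -/

theorem ENNReal_rpow_le_max (y : ℝ≥0∞) {a b c : ℝ} (hab : a ≤ b) (hbc : b ≤ c) :
    y ^ b ≤ max (y ^ a) (y ^ c) := by
  rcases le_total y 1 with h | h
  · exact le_max_of_le_left (ENNReal.rpow_le_rpow_of_exponent_ge h hab)
  · exact le_max_of_le_right (ENNReal.rpow_le_rpow_of_exponent_le h hbc)

theorem max_rpow (x y : ℝ≥0∞) {r : ℝ} (hr : 0 ≤ r) : max x y ^ r = max (x ^ r) (y ^ r) :=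
  (ENNReal.monotone_rpow_of_nonneg hr).map_max

theorem max_rpow_rpow_le (y : ℝ≥0∞) {a b c d e : ℝ} (ha : a ≤ b * e) (hbc : b ≤ c) (he : 0 ≤ e)
    (hd : c * e ≤ d) : max (y ^ b) (y ^ c) ^ e ≤ max (y ^ a) (y ^ d) := by
  have := mul_le_mul_of_nonneg_right hbc he
  rw [max_rpow _ _ he, ← ENNReal.rpow_mul, ← ENNReal.rpow_mul]
  exact max_le (ENNReal_rpow_le_max y ha (by linarith)) (ENNReal_rpow_le_max y (by linarith) hd)

/-- Hölder's inequality against the constant `1`. Since `V ≥ 1` exceeds the total mass, the power of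
the mass is bounded by `V` itself, uniformly in the exponents. -/
theorem lintegral_rpow_le {X : Type*} [MeasurableSpace X] {μ : Measure X} {g : X → ℝ≥0∞}
    (hg : Measurable g) {V : ℝ≥0∞} (hV : 1 ≤ V) (hμ : μ univ ≤ V) {s α : ℝ} (hs : 0 ≤ s)
    (hsα : s ≤ α) (hα : 0 < α) : ∫⁻ x, g x ^ s ∂μ ≤ V * (∫⁻ x, g x ^ α ∂μ) ^ (s / α) := by
  rcases hs.eq_or_lt with rfl | hs0
  · simpa using hμ
  rcases hsα.eq_or_lt with rfl | hlt
  · rw [div_self hs0.ne', ENNReal.rpow_one]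
    exact le_mul_of_one_le_left bot_le hV
  have h := lintegral_mul_rpow_le (μ := μ) hs0 hlt (f := fun _ => 1) aemeasurable_const
    (hg.pow_const α).aemeasurable
  simp only [← ENNReal.rpow_mul, mul_div_cancel₀ _ hα.ne', one_mul, ENNReal.one_rpow,
    lintegral_const] at h
  refine h.trans (mul_le_mul' ?_ le_rfl)
  have h1 : (α - s) / α ≤ 1 := by rw [div_le_one hα]; linarith
  have h2 : 0 ≤ (α - s) / α := div_nonneg (by linarith) hα.le
  calc μ univ ^ ((α - s) / α) ≤ V ^ ((α - s) / α) := ENNReal.rpow_le_rpow hμ h2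
    _ ≤ V ^ (1 : ℝ) := ENNReal.rpow_le_rpow_of_exponent_le hV h1
    _ = V := ENNReal.rpow_one V

/-- The three powers of `g` lie between `b` and `α`, so their integrals are at most `V max(Y^b,
Y^α)`. Taking the root of order `ρ = γ + ασ` raises this to the power `e = (1 + σ)/ρ`, and `1/α ≤ e
≤ 1/γ`. All resulting exponents therefore lie between `b/α` and `α/γ`. -/
theorem moser_step {X : Type*} [MeasurableSpace X] {μ μ' : Measure X} {g : X → ℝ≥0∞}
    (hg : Measurable g) {V D : ℝ≥0∞} (hV : 1 ≤ V) (hμ : μ univ ≤ V) (hμ' : μ' univ ≤ V) (hD : 1 ≤ D)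
    {α α' b γ σ : ℝ} (hb : 0 ≤ b) (hbγ : b ≤ γ) (hγ : 0 < γ) (hγα : γ ≤ α) (hαα : α ≤ α')
    (hσ : 0 ≤ σ) (hα' : α' ≤ γ + α * σ)
    (h : ∫⁻ x, g x ^ (γ + α * σ) ∂μ' ≤ (D * ∫⁻ x, (g x ^ α + g x ^ b + g x ^ γ) ∂μ) ^ (1 + σ)) :
    (∫⁻ x, g x ^ α' ∂μ') ^ (1 / α') ≤ (3 * V ^ 2 * D) ^ (1 / γ) *
      max (((∫⁻ x, g x ^ α ∂μ) ^ (1 / α)) ^ (b / α)) (((∫⁻ x, g x ^ α ∂μ) ^ (1 / α)) ^ (α / γ)) := by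
  have hα : 0 < α := hγ.trans_le hγα
  have hα'0 : 0 < α' := hα.trans_le hαα
  set ρ := γ + α * σ with hρ
  have hρ0 : 0 < ρ := by positivity
  set Y := (∫⁻ x, g x ^ α ∂μ) ^ (1 / α) with hY
  set e := (1 + σ) / ρ with he
  have he0 : 0 ≤ e := by positivity
  have he1 : e ≤ 1 / γ := by rw [he, div_le_div_iff₀ hρ0 hγ, hρ]; nlinarith
  have he2 : 1 / α ≤ e := by rw [he, div_le_div_iff₀ hα hρ0, hρ]; nlinarith
  have hI : ∀ s, b ≤ s → s ≤ α → ∫⁻ x, g x ^ s ∂μ ≤ V * max (Y ^ b) (Y ^ α) := fun s h1 h2 => by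
    refine (lintegral_rpow_le hg hV hμ (hb.trans h1) h2 hα).trans (mul_le_mul' le_rfl ?_)
    rw [show s / α = 1 / α * s by ring, ENNReal.rpow_mul]
    exact ENNReal_rpow_le_max _ h1 h2
  have hI3 : ∫⁻ x, (g x ^ α + g x ^ b + g x ^ γ) ∂μ ≤ 3 * V * max (Y ^ b) (Y ^ α) := by
    rw [lintegral_add_right _ (hg.pow_const γ), lintegral_add_right _ (hg.pow_const b)]
    refine (add_le_add (add_le_add (hI α (hbγ.trans hγα) le_rfl) (hI b le_rfl (hbγ.trans hγα)))
      (hI γ hbγ hγα)).trans (le_of_eq ?_)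
    ring
  have hVD : 1 ≤ 3 * V * D := by
    calc (1 : ℝ≥0∞) = 1 * 1 * 1 := by norm_num
      _ ≤ _ := mul_le_mul' (mul_le_mul' (by norm_num) hV) hD
  calc (∫⁻ x, g x ^ α' ∂μ') ^ (1 / α')
      ≤ (V * (∫⁻ x, g x ^ ρ ∂μ') ^ (α' / ρ)) ^ (1 / α') :=
        ENNReal.rpow_le_rpow (lintegral_rpow_le hg hV hμ' hα'0.le hα' hρ0) (by positivity)
    _ = V ^ (1 / α') * (∫⁻ x, g x ^ ρ ∂μ') ^ (1 / ρ) := by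
        rw [ENNReal.mul_rpow_of_nonneg _ _ (by positivity), ← ENNReal.rpow_mul]
        congr 2; field_simp
    _ ≤ V ^ (1 / γ) * ((D * (3 * V * max (Y ^ b) (Y ^ α))) ^ (1 + σ)) ^ (1 / ρ) := by
        refine mul_le_mul' (ENNReal.rpow_le_rpow_of_exponent_le hV
          (one_div_le_one_div_of_le hγ (hγα.trans hαα))) (ENNReal.rpow_le_rpow (h.trans
          (ENNReal.rpow_le_rpow (mul_le_mul' le_rfl hI3) (by positivity))) (by positivity))
    _ = V ^ (1 / γ) * ((3 * V * D) ^ e * max (Y ^ b) (Y ^ α) ^ e) := by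
        rw [← ENNReal.rpow_mul, ← ENNReal.mul_rpow_of_nonneg _ _ he0, he]
        congr 2
        · ring
        · ring
    _ ≤ V ^ (1 / γ) * ((3 * V * D) ^ (1 / γ) * max (Y ^ (b / α)) (Y ^ (α / γ))) := by
        refine mul_le_mul' le_rfl (mul_le_mul' (ENNReal.rpow_le_rpow_of_exponent_le hVD he1)
          (max_rpow_rpow_le Y ?_ (hbγ.trans hγα) he0 ?_))
        · calc b / α = b * (1 / α) := by ring
            _ ≤ _ := by gcongr
        · calc α * e ≤ α * (1 / γ) := by gcongr
            _ = _ := by ring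
    _ = _ := by
        rw [← mul_assoc, ← ENNReal.mul_rpow_of_nonneg _ _ (by positivity)]
        congr 2; ring

/-- The exponents `r_j ≤ 1` matter when the norm is small, the exponents `s_j ≥ 1` when it is large;
any mixture of them lies between the two pure products, so a maximum of two powers suffices. Since
the constants are at least `1`, all of them may be raised to the full product of the `s_j`. -/
theorem moser_iterate {Y E : ℕ → ℝ≥0∞} {r s : ℕ → ℝ} (hr0 : ∀ j, 0 ≤ r j) (hr1 : ∀ j, r j ≤ 1)
    (hs : ∀ j, 1 ≤ s j) (hE : ∀ j, 1 ≤ E j)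
    (hstep : ∀ j, Y (j + 1) ≤ E j * max (Y j ^ r j) (Y j ^ s j)) (j : ℕ) :
    Y j ≤ (∏ i ∈ Finset.range j, E i) ^ (∏ i ∈ Finset.range j, s i) *
      max (Y 0 ^ ∏ i ∈ Finset.range j, r i) (Y 0 ^ ∏ i ∈ Finset.range j, s i) := by
  induction j with
  | zero => simp
  | succ j ih =>
    rw [Finset.prod_range_succ, Finset.prod_range_succ _ j, Finset.prod_range_succ _ j]
    set M := ∏ i ∈ Finset.range j, E i
    set S := ∏ i ∈ Finset.range j, s i
    set R := ∏ i ∈ Finset.range j, r i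
    have hM : 1 ≤ M := Finset.one_le_prod' fun i _ => hE i
    have hS : 1 ≤ S := Finset.prod_induction _ (fun x => 1 ≤ x)
      (fun _ _ h1 h2 => one_le_mul_of_one_le_of_one_le h1 h2) le_rfl fun i _ => hs i
    have hR0 : 0 ≤ R := Finset.prod_nonneg fun i _ => hr0 i
    have hR1 : R ≤ 1 := Finset.prod_le_one (fun i _ => hr0 i) fun i _ => hr1 i
    have hSs : 1 ≤ S * s j := one_le_mul_of_one_le_of_one_le hS (hs j)
    have hs0 : 0 ≤ s j := zero_le_one.trans (hs j)
    have hS0 : 0 ≤ S := zero_le_one.trans hS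
    have key : ∀ e, r j ≤ e → e ≤ s j → Y j ^ e ≤ M ^ (S * s j) *
        max (Y 0 ^ (R * r j)) (Y 0 ^ (S * s j)) := fun e h1 h2 => by
      have he : 0 ≤ e := (hr0 j).trans h1
      refine (ENNReal.rpow_le_rpow ih he).trans ?_
      rw [ENNReal.mul_rpow_of_nonneg _ _ he, ← ENNReal.rpow_mul]
      exact mul_le_mul' (ENNReal.rpow_le_rpow_of_exponent_le hM (by gcongr))
        (max_rpow_rpow_le _ (by gcongr) (hR1.trans hS) he (by gcongr))
    have hrs : r j ≤ s j := (hr1 j).trans (hs j)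
    calc Y (j + 1) ≤ E j * max (Y j ^ r j) (Y j ^ s j) := hstep j
      _ ≤ E j ^ (S * s j) * (M ^ (S * s j) * max (Y 0 ^ (R * r j)) (Y 0 ^ (S * s j))) := by
          refine mul_le_mul' ?_ (max_le (key _ le_rfl hrs) (key _ hrs le_rfl))
          calc E j = E j ^ (1 : ℝ) := by simp
            _ ≤ _ := ENNReal.rpow_le_rpow_of_exponent_le (hE j) hSs
      _ = _ := by
          rw [← mul_assoc, ← ENNReal.mul_rpow_of_nonneg _ _ (by positivity), mul_comm (E j)]

theorem tprod_le_prod_range {f : ℕ → ℝ} (hf : Multipliable f) (h0 : ∀ j, 0 ≤ f j) (h1 : ∀ j, f j ≤ 1)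
    (k : ℕ) : ∏' j, f j ≤ ∏ j ∈ Finset.range k, f j :=
  Antitone.le_of_tendsto (antitone_nat_of_succ_le fun j => by
    rw [Finset.prod_range_succ]
    exact mul_le_of_le_one_right (Finset.prod_nonneg fun i _ => h0 i) (h1 j))
    hf.hasProd.tendsto_prod_nat k

theorem prod_range_le_tprod {f : ℕ → ℝ} (hf : Multipliable f) (h1 : ∀ j, 1 ≤ f j) (k : ℕ) :
    ∏ j ∈ Finset.range k, f j ≤ ∏' j, f j :=
  Monotone.ge_of_tendsto (monotone_nat_of_le_succ fun j => by
    rw [Finset.prod_range_succ]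
    exact le_mul_of_one_le_right (Finset.prod_nonneg fun i _ => zero_le_one.trans (h1 i)) (h1 j))
    hf.hasProd.tendsto_prod_nat k

theorem tprod_nonneg_of_nonneg {f : ℕ → ℝ} (hf : Multipliable f) (h0 : ∀ j, 0 ≤ f j) :
    0 ≤ ∏' j, f j :=
  ge_of_tendsto' hf.hasProd.tendsto_prod_nat fun _ => Finset.prod_nonneg fun i _ => h0 i

/-- The product of the constants of the iteration, when they grow geometrically. -/
theorem exists_prod_le {α k b : ℝ} (hα : 0 < α) (hk : 1 < k) (hb : 1 ≤ b) :
    ∃ s₀ s₁ : ℝ, 0 < s₀ ∧ ∀ A : ℝ, 1 ≤ A → ∀ j : ℕ,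
      ∏ i ∈ Finset.range j, ENNReal.ofReal (A * b ^ i) ^ (2 / (α * k ^ i)) ≤
        ENNReal.ofReal (A ^ s₀ * b ^ s₁) := by
  have hk0 : 0 < k := by linarith
  have hki : ‖k⁻¹‖ < 1 := by
    rw [Real.norm_of_nonneg (by positivity)]; exact inv_lt_one_of_one_lt₀ hk
  have h0 : Summable fun i : ℕ => 2 / (α * k ^ i) := by
    refine ((summable_geometric_of_norm_lt_one hki).mul_left (2 / α)).congr fun i => ?_
    rw [inv_pow]; field_simp
  have h1 : Summable fun i : ℕ => (i : ℝ) * (2 / (α * k ^ i)) := by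
    have := (summable_pow_mul_geometric_of_norm_lt_one 1 hki).mul_left (2 / α)
    refine this.congr fun i => ?_
    rw [inv_pow, pow_one]; field_simp
  have hp0 : ∀ i : ℕ, 0 < 2 / (α * k ^ i) := fun i => by positivity
  refine ⟨∑' i : ℕ, 2 / (α * k ^ i), ∑' i : ℕ, (i : ℝ) * (2 / (α * k ^ i)),
    h0.tsum_pos (fun i => (hp0 i).le) 0 (hp0 0), fun A hA j => ?_⟩
  have hA0 : 0 < A := by linarith
  have hb0 : 0 < b := by linarith
  calc ∏ i ∈ Finset.range j, ENNReal.ofReal (A * b ^ i) ^ (2 / (α * k ^ i))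
      = ENNReal.ofReal (∏ i ∈ Finset.range j, (A * b ^ i) ^ (2 / (α * k ^ i))) := by
        rw [ENNReal.ofReal_prod_of_nonneg fun i _ => by positivity]
        exact Finset.prod_congr rfl fun i _ =>
          ENNReal.ofReal_rpow_of_nonneg (by positivity) (hp0 i).le
    _ = ENNReal.ofReal (A ^ (∑ i ∈ Finset.range j, 2 / (α * k ^ i)) *
          b ^ (∑ i ∈ Finset.range j, (i : ℝ) * (2 / (α * k ^ i)))) := by
        rw [Real.rpow_sum_of_pos hA0, Real.rpow_sum_of_pos hb0, ← Finset.prod_mul_distrib]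
        congr 1
        refine Finset.prod_congr rfl fun i _ => ?_
        rw [Real.mul_rpow hA0.le (by positivity), Real.rpow_mul hb0.le, Real.rpow_natCast]
    _ ≤ _ := by
        refine ENNReal.ofReal_le_ofReal (mul_le_mul ?_ ?_ (by positivity) (by positivity))
        · exact Real.rpow_le_rpow_of_exponent_le hA (h0.sum_le_tsum _ fun i _ => (hp0 i).le)
        · exact Real.rpow_le_rpow_of_exponent_le hb (h1.sum_le_tsum _ fun i _ => by positivity)

end ForchheimerGas

end

noncomputable section

namespace ForchheimerGas

variable {n : ℕ} {U : Set (Eu n)} {P : GenPoly} {lam T : ℝ}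

/-! ### The local bound -/

/-- The transition is composed with the quadratic `(r² - |x - x₀|²)/(r² - r'²)`, which is smooth at
the centre. Where the derivative of the transition is non-zero one has `|x - x₀| ≤ r`, so the
quadratic has gradient at most `2/(r - r')`. -/
theorem exists_radial_cutoff : ∃ C : ℝ, 0 < C ∧ ∀ {n : ℕ} (x₀ : Eu n) {r' r : ℝ}, 0 < r' → r' < r →
    ∃ ζ : Eu n → ℝ, ContDiff ℝ 1 ζ ∧ (∀ x, 0 ≤ ζ x) ∧ (∀ x, ζ x ≤ 1) ∧
      (∀ x, ‖gradient ζ x‖ ≤ C / (r - r')) ∧ (∀ x, x ∉ Metric.ball x₀ r → ζ x = 0) ∧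
      ∀ x ∈ Metric.ball x₀ r', ζ x = 1 := by
  obtain ⟨C, hC, hS⟩ := exists_smoothTransition_deriv_le
  refine ⟨2 * C, by positivity, fun {n} x₀ {r' r} h0 hr => ?_⟩
  have hr0 : 0 < r := h0.trans hr
  have hd : 0 < r ^ 2 - r' ^ 2 := by nlinarith
  set q : Eu n → ℝ := fun x => (r ^ 2 - ‖x - x₀‖ ^ 2) / (r ^ 2 - r' ^ 2) with hq
  have hqc : ContDiff ℝ 1 q :=
    (contDiff_const.sub ((contDiff_id.sub contDiff_const).norm_sq ℝ)).div_const _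
  have hgq : ∀ x, ‖gradient q x‖ ≤ 2 * ‖x - x₀‖ / (r ^ 2 - r' ^ 2) := fun x => by
    have h1 : HasFDerivAt (fun x : Eu n => ‖x - x₀‖ ^ 2) _ x :=
      ((hasFDerivAt_id x).sub_const x₀).norm_sq
    have h2 := (h1.const_sub (r ^ 2)).mul_const (r ^ 2 - r' ^ 2)⁻¹
    have h3 : HasFDerivAt q _ x := h2
    rw [norm_gradient, h3.fderiv, norm_smul, norm_inv, Real.norm_of_nonneg hd.le, norm_neg,
      inv_mul_eq_div]
    gcongr
    refine ContinuousLinearMap.opNorm_le_bound _ (by positivity) fun v => ?_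
    have := abs_real_inner_le_norm (x - x₀) v
    simp only [id, _root_.smul_apply, ContinuousLinearMap.comp_apply,
      ContinuousLinearMap.id_apply, innerSL_apply_apply, Real.norm_eq_abs, nsmul_eq_mul, abs_mul]
    simp only [Nat.cast_ofNat, Nat.abs_ofNat]
    linarith
  refine ⟨fun x => Real.smoothTransition (q x), Real.smoothTransition.contDiff.comp hqc,
    fun x => Real.smoothTransition.nonneg _, fun x => Real.smoothTransition.le_one _, fun x => ?_,
    fun x hx => ?_, fun x hx => ?_⟩
  · rw [gradient_comp ((Real.smoothTransition.contDiff (n := 1)).differentiable one_ne_zero _)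
      (hqc.differentiable one_ne_zero x), norm_smul]
    have hrr : 0 < r - r' := by linarith
    rcases le_or_gt ‖x - x₀‖ r with h | h
    · calc _ ≤ C * (2 * ‖x - x₀‖ / (r ^ 2 - r' ^ 2)) :=
            mul_le_mul (hS _) (hgq x) (norm_nonneg _) hC.le
        _ ≤ C * (2 / (r - r')) := by
            refine mul_le_mul_of_nonneg_left ?_ hC.le
            rw [div_le_div_iff₀ hd hrr]
            nlinarith [norm_nonneg (x - x₀)]
        _ = _ := by ring
    · have : q x ≤ 0 := div_nonpos_of_nonpos_of_nonneg (by nlinarith) hd.le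
      rw [deriv_smoothTransition_eq_zero (Or.inl this), norm_zero, zero_mul]
      positivity
  · rw [Metric.mem_ball, dist_eq_norm, not_lt] at hx
    exact Real.smoothTransition.zero_of_nonpos
      (div_nonpos_of_nonpos_of_nonneg (by nlinarith) hd.le)
  · rw [Metric.mem_ball, dist_eq_norm] at hx
    refine Real.smoothTransition.one_of_one_le ?_
    rw [le_div_iff₀ hd]
    nlinarith [norm_nonneg (x - x₀)]

/-- If `g ≥ c` on `S`, its `L^{α_j}` norm is at least `c μ(S)^{1/α_j}`, which tends to `c` because
`μ(S)` is positive and finite. This replaces convergence of the norms to the essential supremum. -/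
theorem le_of_forall_lintegral_rpow_le {X : Type*} [MeasurableSpace X] {μ : Measure X} {g : X → ℝ≥0∞}
    {Q : ℕ → Set X} {S : Set X} {α : ℕ → ℝ} (hα0 : ∀ j, 0 < α j) (hα : Tendsto α atTop atTop)
    {c L : ℝ≥0∞} (hSm : MeasurableSet S) (hS0 : μ S ≠ 0) (hS1 : μ S ≠ ∞) (hSQ : ∀ j, S ⊆ Q j)
    (hc : ∀ x ∈ S, c ≤ g x) (h : ∀ j, (∫⁻ x in Q j, g x ^ α j ∂μ) ^ (1 / α j) ≤ L) : c ≤ L := by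
  have h1 : ∀ j, c * μ S ^ (1 / α j) ≤ L := fun j => by
    refine le_trans ?_ (h j)
    have h2 : c ^ α j * μ S ≤ ∫⁻ x in Q j, g x ^ α j ∂μ := by
      rw [← setLIntegral_const]
      refine (setLIntegral_mono_ae' hSm (Eventually.of_forall fun x hx =>
        ENNReal.rpow_le_rpow (hc x hx) (hα0 j).le)).trans (lintegral_mono_set (hSQ j))
    have h3 := ENNReal.rpow_le_rpow h2 (one_div_pos.2 (hα0 j)).le
    rwa [ENNReal.mul_rpow_of_nonneg _ _ (one_div_pos.2 (hα0 j)).le, ← ENNReal.rpow_mul,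
      mul_one_div_cancel (hα0 j).ne', ENNReal.rpow_one] at h3
  have h4 : Tendsto (fun j => 1 / α j) atTop (𝓝 0) := by
    simpa [Function.comp_def] using tendsto_inv_atTop_zero.comp hα
  have h5 : Tendsto (fun j => μ S ^ (1 / α j)) atTop (𝓝 1) := by
    have hpos : 0 < (μ S).toReal := ENNReal.toReal_pos hS0 hS1
    have h6 : Tendsto (fun j => ENNReal.ofReal ((μ S).toReal ^ (1 / α j))) atTop
        (𝓝 (ENNReal.ofReal ((μ S).toReal ^ (0 : ℝ)))) :=
      (ENNReal.continuous_ofReal.tendsto _).comp ((Real.continuousAt_const_rpow hpos.ne').tendsto.comp h4)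
    rw [Real.rpow_zero, ENNReal.ofReal_one] at h6
    refine h6.congr fun j => ?_
    rw [← ENNReal.ofReal_rpow_of_pos hpos, ENNReal.ofReal_toReal hS1]
  have h7 := ENNReal.Tendsto.const_mul (a := c) h5 (Or.inl one_ne_zero)
  rw [mul_one] at h7
  exact le_of_tendsto' h7 h1

end ForchheimerGas

end

/-! ### Moser iteration on shrinking cylinders. -/

noncomputable section

namespace ForchheimerGas

variable {n : ℕ} {U : Set (Eu n)} {P : GenPoly} {lam T : ℝ}

namespace RegSol

/-- The Sobolev step is used with `β = α - λ`; the condition `α ≥ 1 + λ` gives both `β ≥ 1` and a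
non-negative lowest power. Cylinders of duration at most `1` inside `U` have measure at most that of
`U`, so the constant depends neither on the cylinder nor on `T`. -/
theorem exists_moser_step (hn : 2 ≤ n) (hU : IsOpen U) (hb : Bornology.IsBounded U)
    (𝒜 : Atlas U) [IsFiniteMeasure (surfaceMeasure U)] (P : GenPoly) (hlam : 0 < lam)
    (ha : 1 - lam < P.a) :
    ∃ A : ℝ, 1 ≤ A ∧ ∀ {T : ℝ} {u w : Eu n → ℝ → ℝ} {Du : Eu n → ℝ → Eu n},
      RegSol P lam U T u w Du → ∀ {x₀ : Eu n} {r' r τ₀ τ₁ t α α' : ℝ}, 0 < r' → r' < r → r ≤ r' + 1 →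
      Metric.ball x₀ r ⊆ U → 0 < τ₀ → τ₀ < τ₁ → τ₁ < t → t ≤ τ₀ + 1 → t < T →
      1 + lam ≤ α → α ≤ α' → α' ≤ α + (1 - lam) - P.a + α * ((2 - P.a) / n) →
      (∫⁻ z in Metric.ball x₀ r' ×ˢ Ioo τ₁ t, ENNReal.ofReal (u z.1 z.2) ^ α') ^ (1 / α') ≤
        ENNReal.ofReal (A * α ^ 4 / ((r - r') ^ 2 * (τ₁ - τ₀))) ^ (1 / (α + (1 - lam) - P.a)) *
        max (((∫⁻ z in Metric.ball x₀ r ×ˢ Ioo τ₀ t, ENNReal.ofReal (u z.1 z.2) ^ α) ^ (1 / α)) ^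
            ((α - 2 + (1 - lam)) / α))
          (((∫⁻ z in Metric.ball x₀ r ×ˢ Ioo τ₀ t, ENNReal.ofReal (u z.1 z.2) ^ α) ^ (1 / α)) ^
            (α / (α + (1 - lam) - P.a))) := by
  obtain ⟨C, hC, hstep⟩ := exists_sobolev_step hn hU hb 𝒜 P hlam
  obtain ⟨Cζ, hCζ, hcut⟩ := exists_radial_cutoff
  have ha1 := P.a_lt_one
  set v : ℝ := 1 + (volume U).toReal with hv
  have hv1 : 1 ≤ v := le_add_of_nonneg_right ENNReal.toReal_nonneg
  have hvU : volume U ≤ ENNReal.ofReal v := by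
    rw [hv, ENNReal.ofReal_add zero_le_one ENNReal.toReal_nonneg,
      ENNReal.ofReal_toReal hb.measure_lt_top.ne]
    exact le_add_self
  -- The factor `3 v²` comes from the abstract step. Using `1 + Cζ` in place of `Cζ` ensures that
  -- the gradient bound `G` is at least `1`.
  set A := 3 * v ^ 2 * C * (1 + Cζ) ^ 2 with hA
  refine ⟨A, ?_, fun {T u w Du} h {x₀ r' r τ₀ τ₁ t α α'} hr0 hr hr1 hB h0 h01 h1t ht1 htT hα hαα hα' => ?_⟩
  · have h2 : 1 ≤ v ^ 2 := one_le_pow₀ hv1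
    have h3 : 1 ≤ (1 + Cζ) ^ 2 := one_le_pow₀ (by linarith)
    calc (1 : ℝ) = 1 * 1 * 1 * 1 := by norm_num
      _ ≤ _ := by rw [hA]; gcongr; norm_num
  have hr2 : 0 < r - r' := by linarith
  have hℓ : 0 < τ₁ - τ₀ := by linarith
  set G := (1 + Cζ) / (r - r') with hG
  have hG1 : 1 ≤ G := by rw [hG, le_div_iff₀ hr2]; linarith
  obtain ⟨ζ, hζ, hζ0, hζ1, hζG, hζB, hζB'⟩ := hcut x₀ hr0 hr
  have hs := hstep h (B := Metric.ball x₀ r) (B' := Metric.ball x₀ r') measurableSet_ball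
    measurableSet_ball (Metric.ball_subset_ball hr.le) hB (ζ := ζ) (β := α - lam) (G := G) (by linarith)
    hG1 hζ hζ0 hζ1 (fun x => (hζG x).trans (by rw [hG]; gcongr; linarith)) hζB hζB' h0 h01 (by linarith)
    h1t htT
  rw [add_sub_cancel] at hs
  set g : Eu n × ℝ → ℝ≥0∞ := fun z => ENNReal.ofReal (u z.1 z.2) with hg
  have hgm : Measurable g := h.measurable.ennreal_ofReal
  set γ := α + (1 - lam) - P.a with hγ
  set b := α - 2 + (1 - lam) with hbdef
  have e1 : α - lam + (1 - P.a) = γ := by rw [hγ]; ring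
  have e2 : α - lam - 1 = b := by rw [hbdef]; ring
  have hγ0 : 0 < γ := by linarith
  have hb0 : 0 ≤ b := by linarith
  have hα0 : 0 < α := by linarith
  have hp0 : 0 < 2 - P.a := by linarith
  rw [e1, e2] at hs
  have hpow : ∀ (z : Eu n × ℝ) (s : ℝ), 0 ≤ s → ENNReal.ofReal (u z.1 z.2 ^ s) = g z ^ s := fun z s hs =>
    (ENNReal.ofReal_rpow_of_nonneg (h.nonneg _ _) hs).symm
  have hsum : ∀ z : Eu n × ℝ, ENNReal.ofReal (u z.1 z.2 ^ α + u z.1 z.2 ^ b + u z.1 z.2 ^ γ) =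
      g z ^ α + g z ^ b + g z ^ γ := fun z => by
    have hnn := fun s => Real.rpow_nonneg (h.nonneg z.1 z.2) s
    rw [ENNReal.ofReal_add (add_nonneg (hnn _) (hnn _)) (hnn _), ENNReal.ofReal_add (hnn _) (hnn _),
      hpow _ _ hα0.le, hpow _ _ hb0, hpow _ _ hγ0.le]
  have hσ : 0 ≤ (2 - P.a) / n := by positivity
  simp only [hsum] at hs
  simp only [hpow _ _ (add_nonneg hγ0.le (mul_nonneg hα0.le hσ))] at hs
  set D := C * α ^ 4 * G ^ (2 - P.a) / (τ₁ - τ₀) with hD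
  have hGp : 1 ≤ G ^ (2 - P.a) := Real.one_le_rpow hG1 (by linarith)
  have hα4 : 1 ≤ α ^ 4 := one_le_pow₀ (by linarith)
  have hD1 : 1 ≤ D := by
    rw [hD, le_div_iff₀ hℓ]
    calc 1 * (τ₁ - τ₀) ≤ 1 := by linarith
      _ = 1 * 1 * 1 := by norm_num
      _ ≤ _ := by gcongr
  have hvol : ∀ (ρ τ : ℝ), ρ ≤ r → τ₀ ≤ τ →
      (volume.restrict (Metric.ball x₀ ρ ×ˢ Ioo τ t)) univ ≤ ENNReal.ofReal v := fun ρ τ h1 h2 => by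
    rw [Measure.restrict_apply_univ, Measure.volume_eq_prod, Measure.prod_prod, Real.volume_Ioo]
    calc _ ≤ volume U * 1 := by
          refine mul_le_mul' (measure_mono ((Metric.ball_subset_ball h1).trans hB)) ?_
          rw [← ENNReal.ofReal_one]
          exact ENNReal.ofReal_le_ofReal (by linarith)
      _ ≤ _ := by rwa [mul_one]
  have key := moser_step hgm (V := ENNReal.ofReal v) (D := ENNReal.ofReal D)
    (ENNReal.one_le_ofReal.2 hv1) (hvol r τ₀ le_rfl le_rfl)
    (hvol r' τ₁ hr.le h01.le) (ENNReal.one_le_ofReal.2 hD1)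
    hb0 (by linarith) hγ0 (by linarith) hαα hσ hα' hs
  refine key.trans (mul_le_mul' (ENNReal.rpow_le_rpow ?_ (by positivity)) le_rfl)
  rw [← ENNReal.ofReal_pow (by linarith), show (3 : ℝ≥0∞) = ENNReal.ofReal 3 by norm_num,
    ← ENNReal.ofReal_mul (by norm_num), ← ENNReal.ofReal_mul (by positivity)]
  refine ENNReal.ofReal_le_ofReal ?_
  have hG2 : G ^ (2 - P.a) ≤ (1 + Cζ) ^ 2 / (r - r') ^ 2 := by
    calc G ^ (2 - P.a) ≤ G ^ (2 : ℝ) := Real.rpow_le_rpow_of_exponent_le hG1 (by linarith [P.a_pos])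
      _ = _ := by rw [Real.rpow_two, hG, div_pow]
  calc 3 * v ^ 2 * D ≤ 3 * v ^ 2 * (C * α ^ 4 * ((1 + Cζ) ^ 2 / (r - r') ^ 2) / (τ₁ - τ₀)) := by
        rw [hD]; gcongr
    _ = _ := by rw [hA]; field_simp

/-- The interior bound, in terms of the `L^{α₀}` norm. -/
theorem exists_interior_bound (hn : 2 ≤ n) (P : GenPoly) (hlam0 : 0 < lam) (hlam1 : lam ≤ 1)
    (ha : 1 - lam < P.a) {α₀ : ℝ} (hα₁ : 2 - (1 - lam) ≤ α₀) (hα₂ : alphaStar n P lam < α₀) :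
    ∃ ω : ℝ, 0 < ω ∧ ∀ {U : Set (Eu n)}, IsOpen U → Bornology.IsBounded U → Atlas U →
      IsFiniteMeasure (surfaceMeasure U) → ∀ {d : ℝ}, 0 < d → d ≤ 1 → ∃ C : ℝ, 0 < C ∧
      ∀ {T ε : ℝ} {u w : Eu n → ℝ → ℝ} {Du : Eu n → ℝ → Eu n}, RegSol P lam U T u w Du →
      0 < ε → ε < 1 → ∀ x₀ : Eu n, Metric.ball x₀ d ⊆ U → ∀ t₀ ∈ Ioo ε T,
      ENNReal.ofReal (u x₀ t₀) ≤ ENNReal.ofReal (C * ε ^ (-(2 * ω))) *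
        max (((∫⁻ z in U ×ˢ Ioo 0 T, ENNReal.ofReal (u z.1 z.2) ^ α₀) ^ (1 / α₀)) ^ muInf n P lam α₀)
          (((∫⁻ z in U ×ˢ Ioo 0 T, ENNReal.ofReal (u z.1 z.2) ^ α₀) ^ (1 / α₀)) ^ nuInf n P lam α₀) := by
  have ha1 := P.a_lt_one
  have hn0 : (2 : ℝ) ≤ n := by exact_mod_cast hn
  have hk := one_lt_kappa hn P hlam0 hα₁ hα₂
  obtain ⟨hmμ, hmν⟩ := multipliable_mu_nu P hlam0 hlam1 hα₁ hk
  have hκ : kappa n P lam α₀ = 1 + (2 - P.a) / n - (P.a - (1 - lam)) / α₀ := rfl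
  unfold muInf nuInf
  set k := kappa n P lam α₀
  have hα0 : 0 < α₀ := by linarith
  set α : ℕ → ℝ := fun j => α₀ * k ^ j with hαdef
  have hk1 : ∀ j : ℕ, 1 ≤ k ^ j := fun j => one_le_pow₀ hk.le
  have hαj : ∀ j, α₀ ≤ α j := fun j => le_mul_of_one_le_right hα0.le (hk1 j)
  have hαj0 : ∀ j, 0 < α j := fun j => hα0.trans_le (hαj j)
  set r : ℕ → ℝ := fun j => (α j - 2 + (1 - lam)) / α j with hr
  set s : ℕ → ℝ := fun j => α j / (α j + (1 - lam) - P.a) with hs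
  have hγ0 : ∀ j, 0 < α j + (1 - lam) - P.a := fun j => by linarith [hαj j]
  have hr0 : ∀ j, 0 ≤ r j := fun j => div_nonneg (by linarith [hαj j]) (hαj0 j).le
  have hr1 : ∀ j, r j ≤ 1 := fun j => by rw [hr, div_le_one (hαj0 j)]; linarith
  have hs1 : ∀ j, 1 ≤ s j := fun j => by rw [hs, one_le_div (hγ0 j)]; linarith
  change Multipliable r at hmμ
  change Multipliable s at hmν
  change ∃ ω : ℝ, 0 < ω ∧ ∀ {U : Set (Eu n)}, IsOpen U → Bornology.IsBounded U → Atlas U →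
      IsFiniteMeasure (surfaceMeasure U) → ∀ {d : ℝ}, 0 < d → d ≤ 1 → ∃ C : ℝ, 0 < C ∧
      ∀ {T ε : ℝ} {u w : Eu n → ℝ → ℝ} {Du : Eu n → ℝ → Eu n}, RegSol P lam U T u w Du →
      0 < ε → ε < 1 → ∀ x₀ : Eu n, Metric.ball x₀ d ⊆ U → ∀ t₀ ∈ Ioo ε T,
      ENNReal.ofReal (u x₀ t₀) ≤ ENNReal.ofReal (C * ε ^ (-(2 * ω))) *
        max (((∫⁻ z in U ×ˢ Ioo 0 T, ENNReal.ofReal (u z.1 z.2) ^ α₀) ^ (1 / α₀)) ^ (∏' j, r j))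
          (((∫⁻ z in U ×ˢ Ioo 0 T, ENNReal.ofReal (u z.1 z.2) ^ α₀) ^ (1 / α₀)) ^ (∏' j, s j))
  set μ := ∏' j, r j
  set ν := ∏' j, s j
  have hν1 : 1 ≤ ν := by simpa using prod_range_le_tprod hmν hs1 0
  have hμ1 : μ ≤ 1 := by simpa using tprod_le_prod_range hmμ hr0 hr1 0
  have hμ0 : 0 ≤ μ := tprod_nonneg_of_nonneg hmμ hr0
  have hν0 : 0 < ν := by linarith
  have hb1 : 1 ≤ 8 * k ^ 4 := by linarith [hk1 4]
  obtain ⟨s₀, s₁, hs₀, hprod⟩ := exists_prod_le hα0 hk hb1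
  -- Each step costs a factor `1/ε`. The exponents of these factors sum to at most `s₀` and are
  -- amplified by at most `ν`, so the total is `ε^{-s₀ν} = ε^{-2ω}`. Neither `s₀` nor `ν` depends on
  -- `U`.
  refine ⟨s₀ * ν / 2, by positivity, fun {U} hU hb 𝒜 hσ {d} hd hd1 => ?_⟩
  obtain ⟨A, hA, hstep⟩ := exists_moser_step hn hU hb 𝒜 P hlam0 ha
  -- The number `64 = 4³` comes from the increments `2^{-j}/4`, squared for the radii and once for
  -- the times.
  set A₀ : ℝ := A * α₀ ^ 4 * 64 / d ^ 2 with hA₀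
  have hA₀1 : 1 ≤ A₀ := by
    rw [hA₀, le_div_iff₀ (by positivity)]
    have h1 : 1 ≤ α₀ ^ 4 := one_le_pow₀ (by linarith)
    calc 1 * d ^ 2 ≤ 1 := by nlinarith
      _ = 1 * 1 * 1 := by norm_num
      _ ≤ _ := by gcongr; norm_num
  refine ⟨A₀ ^ (s₀ * ν) * (8 * k ^ 4) ^ (s₁ * ν), by positivity,
    fun {T ε u w Du} h hε hε1 x₀ hB t₀ ht₀ => ?_⟩
  set g : Eu n × ℝ → ℝ≥0∞ := fun z => ENNReal.ofReal (u z.1 z.2) with hg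
  -- Radii and durations decrease from their full size to one half. The increments are of order
  -- `2^{-j}`; with two powers in space and one in time this produces `8^j`, and `α_j⁴` produces
  -- `k^{4j}`.
  set ρ : ℕ → ℝ := fun j => (1 + (1 / 2 : ℝ) ^ j) / 2 with hρ
  have hhalf : ∀ j : ℕ, 0 < (1 / 2 : ℝ) ^ j := fun j => by positivity
  have hhalf1 : ∀ j : ℕ, (1 / 2 : ℝ) ^ j ≤ 1 := fun j => pow_le_one₀ (by norm_num) (by norm_num)
  have hρ1 : ∀ j, ρ j ≤ 1 := fun j => by simp only [ρ]; linarith [hhalf1 j]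
  have hρ0 : ∀ j, 1 / 2 < ρ j := fun j => by simp only [ρ]; linarith [hhalf j]
  have hρs : ∀ j, ρ j - ρ (j + 1) = (1 / 2 : ℝ) ^ j / 4 := fun j => by
    simp only [ρ, pow_succ]; ring
  set Q : ℕ → Set (Eu n × ℝ) := fun j =>
    Metric.ball x₀ (d * ρ j) ×ˢ Ioo (t₀ - ε * ρ j) t₀ with hQ
  set Y : ℕ → ℝ≥0∞ := fun j => (∫⁻ z in Q j, g z ^ α j) ^ (1 / α j) with hY
  set E : ℕ → ℝ≥0∞ := fun i => ENNReal.ofReal (A₀ / ε * (8 * k ^ 4) ^ i) ^ (2 / (α₀ * k ^ i)) with hE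
  have hAε : 1 ≤ A₀ / ε := by rw [le_div_iff₀ hε]; linarith
  have hAi : ∀ i : ℕ, 1 ≤ A₀ / ε * (8 * k ^ 4) ^ i := fun i =>
    one_le_mul_of_one_le_of_one_le hAε (one_le_pow₀ hb1)
  have hE1 : ∀ i, 1 ≤ E i := fun i =>
    ENNReal.one_le_rpow (ENNReal.one_le_ofReal.2 (hAi i)) (div_pos two_pos (hαj0 i))
  have hYs : ∀ j, Y (j + 1) ≤ E j * max (Y j ^ r j) (Y j ^ s j) := fun j => by
    have hpj := hhalf j
    have hρj := hρs j
    have hd1' : d * ρ j - d * ρ (j + 1) = d * ((1 / 2 : ℝ) ^ j / 4) := by rw [← hρj]; ring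
    have he1' : t₀ - ε * ρ (j + 1) - (t₀ - ε * ρ j) = ε * ((1 / 2 : ℝ) ^ j / 4) := by rw [← hρj]; ring
    have hd2 : 0 < d * ((1 / 2 : ℝ) ^ j / 4) := by positivity
    have he2 : 0 < ε * ((1 / 2 : ℝ) ^ j / 4) := by positivity
    have hr01 := hρ0 (j + 1)
    have h3 : d * ρ j ≤ 1 := mul_le_one₀ hd1 (by linarith [hρ0 j]) (hρ1 j)
    have h4 : ε * ρ j ≤ ε := mul_le_of_le_one_right hε.le (hρ1 j)
    have h5 : 0 < d * ρ (j + 1) := by positivity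
    have h6 : 0 < ε * ρ (j + 1) := by positivity
    have hst := hstep h (x₀ := x₀) (r' := d * ρ (j + 1)) (r := d * ρ j) (τ₀ := t₀ - ε * ρ j)
      (τ₁ := t₀ - ε * ρ (j + 1)) (t := t₀) (α := α j) (α' := α (j + 1)) h5 (by linarith)
      (by linarith) ((Metric.ball_subset_ball (mul_le_of_le_one_right hd.le (hρ1 j))).trans hB)
      (by linarith [ht₀.1]) (by linarith) (by linarith) (by linarith) ht₀.2 (by linarith [hαj j])
      (by
        simp only [α, pow_succ]
        have := hαj0 j
        simp only [α] at this
        nlinarith)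
      (by
        -- The fixed ratio `κ_*` is the one admissible at `α₀`. For `j ≥ 1` it asks for less than
        -- the step provides, since the loss `a - δ` is multiplied by `α_j/α₀ ≥ 1`.
        have e1 : α (j + 1) = α j * (1 + (2 - P.a) / n) - α j / α₀ * (P.a - (1 - lam)) := by
          simp only [α, pow_succ]
          rw [← mul_assoc, show α₀ * k ^ j * k = α₀ * k ^ j *
            (1 + (2 - P.a) / n - (P.a - (1 - lam)) / α₀) by rw [← hκ]]
          ring
        have e2 : 1 ≤ α j / α₀ := by rw [one_le_div hα0]; exact hαj j
        rw [e1]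
        nlinarith)
    rw [hd1', he1'] at hst
    refine hst.trans (mul_le_mul' ?_ le_rfl)
    have hx : A * α j ^ 4 / ((d * ((1 / 2 : ℝ) ^ j / 4)) ^ 2 * (ε * ((1 / 2 : ℝ) ^ j / 4))) =
        A₀ / ε * (8 * k ^ 4) ^ j := by
      simp only [hA₀, α, mul_pow, one_div, inv_pow, ← pow_mul]
      rw [show (8 : ℝ) = 2 ^ 3 by norm_num, ← pow_mul, mul_comm j 4, mul_comm 4 j, mul_comm 3 j]
      field_simp
      ring
    rw [hx]
    -- The exponent `1/(α_j + δ - a)` is at most `2/α_j`, because `2(a - δ) ≤ 1 + λ ≤ α_j`; the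
    -- latter form is summable geometrically.
    refine ENNReal.rpow_le_rpow_of_exponent_le (ENNReal.one_le_ofReal.2 (hAi j)) ?_
    rw [div_le_div_iff₀ (hγ0 j) (hαj0 j)]
    linarith [hαj j]
  have hit := moser_iterate hr0 hr1 hs1 hE1 hYs
  set Z := (∫⁻ z in U ×ˢ Ioo 0 T, g z ^ α₀) ^ (1 / α₀) with hZ
  have hY0 : Y 0 ≤ Z := by
    have e0 : α 0 = α₀ := by simp [α]
    simp only [Y, e0]
    refine ENNReal.rpow_le_rpow (lintegral_mono_set (prod_mono ?_ ?_)) (by positivity)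
    · exact (Metric.ball_subset_ball (mul_le_of_le_one_right hd.le (hρ1 0))).trans hB
    · refine Ioo_subset_Ioo ?_ ht₀.2.le
      have : ε * ρ 0 ≤ ε := mul_le_of_le_one_right hε.le (hρ1 0)
      linarith [ht₀.1]
  set L := ENNReal.ofReal (A₀ ^ (s₀ * ν) * (8 * k ^ 4) ^ (s₁ * ν) * ε ^ (-(2 * (s₀ * ν / 2)))) *
        max (Z ^ μ) (Z ^ ν) with hL
  have hYL : ∀ j, Y j ≤ L := fun j => by
    have hSν := prod_range_le_tprod hmν hs1 j
    have hRμ := tprod_le_prod_range hmμ hr0 hr1 j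
    have hR1 : ∏ i ∈ Finset.range j, r i ≤ 1 := Finset.prod_le_one (fun i _ => hr0 i) fun i _ => hr1 i
    have hR0 : 0 ≤ ∏ i ∈ Finset.range j, r i := Finset.prod_nonneg fun i _ => hr0 i
    have hS1 : 1 ≤ ∏ i ∈ Finset.range j, s i := Finset.prod_induction _ (fun x => 1 ≤ x)
      (fun _ _ h1 h2 => one_le_mul_of_one_le_of_one_le h1 h2) le_rfl fun i _ => hs1 i
    refine (hit j).trans (mul_le_mul' ?_ ?_)
    · have hEp : 1 ≤ ∏ i ∈ Finset.range j, E i := Finset.one_le_prod' fun i _ => hE1 i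
      refine (ENNReal.rpow_le_rpow_of_exponent_le hEp hSν).trans ?_
      refine (ENNReal.rpow_le_rpow (hprod _ hAε j) hν0.le).trans (le_of_eq ?_)
      rw [ENNReal.ofReal_rpow_of_nonneg (by positivity) hν0.le, Real.mul_rpow (by positivity)
        (by positivity), ← Real.rpow_mul (by positivity), ← Real.rpow_mul (by positivity),
        Real.div_rpow (by positivity) hε.le, show -(2 * (s₀ * ν / 2)) = -(s₀ * ν) by ring,
        Real.rpow_neg hε.le]
      congr 1
      ring
    · refine max_le ?_ ?_
      · refine (ENNReal_rpow_le_max _ hRμ (hR1.trans hν1)).trans (max_le_max ?_ ?_)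
        exacts [ENNReal.rpow_le_rpow hY0 hμ0, ENNReal.rpow_le_rpow hY0 hν0.le]
      · refine (ENNReal_rpow_le_max _ (hμ1.trans hS1) hSν).trans (max_le_max ?_ ?_)
        exacts [ENNReal.rpow_le_rpow hY0 hμ0, ENNReal.rpow_le_rpow hY0 hν0.le]
  have hαt : Tendsto α atTop atTop := (tendsto_pow_atTop_atTop_of_one_lt hk).const_mul_atTop hα0
  have ht₀T : t₀ ∈ Ioo 0 T := ⟨hε.trans ht₀.1, ht₀.2⟩
  -- By continuity `u` exceeds any smaller value `c'` on a small backward cylinder at `(x₀, t₀)`.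
  -- With half-size bounds this cylinder lies in every `Q j`, so the limit of the norms controls the
  -- value at the point.
  refine le_of_forall_lt fun c hc => ?_
  obtain ⟨c', hcc, hc'⟩ := exists_between hc
  refine hcc.trans_le ?_
  have hcont : ContinuousAt (Function.uncurry u) (x₀, t₀) :=
    (h.continuousOn.mono (prod_mono_left subset_closure)).continuousAt
      ((hU.prod isOpen_Ioo).mem_nhds ⟨hB (Metric.mem_ball_self hd), ht₀T⟩)
  have hev : ∀ᶠ z in 𝓝 (x₀, t₀), c' < g z :=
    (ENNReal.continuous_ofReal.continuousAt.comp hcont).eventually_const_lt hc'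
  obtain ⟨η, hη, hball⟩ := Metric.eventually_nhds_iff_ball.1 hev
  set S : Set (Eu n × ℝ) := Metric.ball x₀ (min η (d / 2)) ×ˢ Ioo (t₀ - min η (ε / 2)) t₀ with hSdef
  have hη1 : 0 < min η (d / 2) := lt_min hη (by positivity)
  have hη2 : 0 < min η (ε / 2) := lt_min hη (by positivity)
  have hvolS : volume S = volume (Metric.ball x₀ (min η (d / 2))) *
      ENNReal.ofReal (min η (ε / 2)) := by
    rw [hSdef, Measure.volume_eq_prod, Measure.prod_prod, Real.volume_Ioo, sub_sub_cancel]
  refine le_of_forall_lintegral_rpow_le (μ := volume) (g := g) (Q := Q) (S := S) hαj0 hαt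
    (measurableSet_ball.prod measurableSet_Ioo) ?_ ?_ (fun j => prod_mono ?_ ?_) (fun z hz => ?_) hYL
  · rw [hvolS]
    exact mul_ne_zero (Metric.measure_ball_pos _ _ hη1).ne' (ENNReal.ofReal_pos.2 hη2).ne'
  · rw [hvolS]
    exact ENNReal.mul_ne_top measure_ball_lt_top.ne ENNReal.ofReal_ne_top
  · refine Metric.ball_subset_ball ((min_le_right _ _).trans ?_)
    nlinarith [hρ0 j]
  · refine Ioo_subset_Ioo ?_ le_rfl
    have := min_le_right η (ε / 2)
    nlinarith [hρ0 j]
  · refine (hball z ?_).le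
    rw [Metric.mem_ball, Prod.dist_eq, max_lt_iff]
    refine ⟨(Metric.mem_ball.1 hz.1).trans_le (min_le_left _ _), ?_⟩
    rw [Real.dist_eq, abs_lt]
    have := min_le_left η (ε / 2)
    exact ⟨by linarith [hz.2.1], by linarith [hz.2.2]⟩

end RegSol

end ForchheimerGas

end

noncomputable section

namespace ForchheimerGas

variable {n : ℕ} {U : Set (Eu n)} {P : GenPoly} {lam T α : ℝ}

/-! ### The exponents of the global estimate -/

theorem mu0_pos (ha : 1 - lam < P.a) : 0 < mu0 P lam :=
  div_pos (by linarith) (by linarith [P.a_lt_one])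

theorem mu0_mul (P : GenPoly) (lam : ℝ) : mu0 P lam * (1 - P.a) = P.a - (1 - lam) := by
  have := P.a_lt_one
  have h : 1 - P.a ≠ 0 := by linarith
  rw [mu0, div_mul_cancel₀ _ h]

theorem theta_denom_pos (hα : n * mu0 P lam < α) :
    n * mu0 P lam * (2 - P.a) < α * (2 - P.a) := by
  have := P.a_lt_one
  gcongr
  linarith

/-- In this form `θ < 1` is visibly equivalent to `n μ₀ (2 - a) < α (2 - a)`, which is how the
condition `α > n μ₀` enters. -/
theorem theta_eq (hn : 2 ≤ n) (ha : 1 - lam < P.a) (α : ℝ) :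
    theta n P lam α = n * mu0 P lam / (α * (2 - P.a) - n * mu0 P lam * (1 - P.a)) := by
  have h1 := P.a_lt_one
  have hn0 : (0 : ℝ) < n := by positivity
  have hμ := mu0_pos ha
  have h2 : 0 < 1 - P.a := by linarith
  have h3 : 0 < 2 - P.a := by linarith
  have h4 : 0 < n * (mu0 P lam * (1 - P.a)) := by positivity
  have h5 : alphaStar n P lam = n * (mu0 P lam * (1 - P.a)) / (2 - P.a) := by
    rw [mu0_mul, alphaStar]
  have h6 : (1 - P.a) * (α / alphaStar n P lam - 1) =
      (α * (2 - P.a) - n * mu0 P lam * (1 - P.a)) / (n * mu0 P lam) := by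
    rw [h5]; field_simp
  rw [theta, h6, one_div_div]

theorem theta_pos (hn : 2 ≤ n) (ha : 1 - lam < P.a) (hα : n * mu0 P lam < α) :
    0 < theta n P lam α := by
  have hn0 : (0 : ℝ) < n := by positivity
  have hμ := mu0_pos ha
  have h3 := theta_denom_pos hα
  have : 0 < n * mu0 P lam := by positivity
  rw [theta_eq hn ha]
  exact div_pos this (by linarith)

theorem theta_lt_one (hn : 2 ≤ n) (ha : 1 - lam < P.a) (hα : n * mu0 P lam < α) :
    theta n P lam α < 1 := by
  have hn0 : (0 : ℝ) < n := by positivity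
  have hμ := mu0_pos ha
  have h3 := theta_denom_pos hα
  have : 0 < n * mu0 P lam := by positivity
  rw [theta_eq hn ha, div_lt_one (by linarith)]
  linarith

/-- This rewrites `μ₁/α` as the excess over `1` of `(1 - θ (n-p)/n)/(1 - θ)`, the exponent that
Young's inequality produces when the dissipation is absorbed. -/
theorem mu1_div (hn : 2 ≤ n) (ha : 1 - lam < P.a) (hα0 : 0 < α) (hα : n * mu0 P lam < α) :
    mu1 n P lam α / α =
      theta n P lam α * (2 - P.a) / (n * (1 - theta n P lam α)) := by
  have hn0 : (0 : ℝ) < n := by positivity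
  have hμ := mu0_pos ha
  have h1 : 0 < 1 - theta n P lam α := by linarith [theta_lt_one hn ha hα]
  have h3 := theta_denom_pos hα
  have h4 : 0 < n * mu0 P lam := by positivity
  have h5 : 0 < α * (2 - P.a) - n * mu0 P lam * (1 - P.a) := by linarith
  have h6 : mu0 P lam * (1 + theta n P lam α * (1 - P.a)) * n = theta n P lam α * (2 - P.a) * α := by
    rw [theta_eq hn ha]
    obtain ⟨E, hE⟩ : ∃ E, E = α * (2 - P.a) - n * mu0 P lam * (1 - P.a) := ⟨_, rfl⟩
    rw [← hE] at h5 ⊢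
    field_simp
    linear_combination hE
  rw [mu1]
  field_simp
  linear_combination h6

theorem mu1_pos (hn : 2 ≤ n) (ha : 1 - lam < P.a) (hα : n * mu0 P lam < α) :
    0 < mu1 n P lam α := by
  have h1 := theta_lt_one hn ha hα
  have h2 := theta_pos hn ha hα
  have := P.a_lt_one
  exact div_pos (mul_pos (mu0_pos ha) (by nlinarith)) (by linarith)

theorem phiExp_eq (P : GenPoly) (lam α : ℝ) :
    phiExp n P lam α = P.conjExp / (1 - theta n P lam α) := by
  rw [phiExp, GenPoly.conjExp, div_div]

/-- The interpolation exponent between `α` and the Sobolev exponent. -/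
theorem theta_interpolation (hn : 2 ≤ n) (ha : 1 - lam < P.a) (hα : n * mu0 P lam < α) :
    α * (1 - theta n P lam α * ((n - (2 - P.a)) / n)) +
      (α + (1 - lam) - P.a) * theta n P lam α = α + mu0 P lam := by
  have hn0 : (0 : ℝ) < n := by positivity
  have h3 := theta_denom_pos hα
  have hμ := mu0_pos ha
  have h4 : 0 < n * mu0 P lam := by positivity
  have h5 : 0 < α * (2 - P.a) - n * mu0 P lam * (1 - P.a) := by linarith
  have h6 := mu0_mul P lam
  have h7 : α + (1 - lam) - P.a = α - mu0 P lam * (1 - P.a) := by rw [h6]; ring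
  rw [h7, theta_eq hn ha]
  field_simp
  ring

end ForchheimerGas

end

noncomputable section

namespace ForchheimerGas

variable {n : ℕ} {U : Set (Eu n)} {P : GenPoly} {lam T α : ℝ} {f : Eu n → ℝ} {F : Eu n → Eu n}

/-! ### Estimates at a fixed time, up to the boundary -/

theorem StrongApprox.rpow {p : ℝ≥0∞} (h : StrongApprox U p f F) (hU : IsOpen U)
    (hb : Bornology.IsBounded U) (hp : 1 ≤ p) {m : ℝ} (hm : 1 ≤ m) :
    StrongApprox U p (fun x => f x ^ m) (fun x => (m * f x ^ (m - 1)) • F x) := by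
  have h1 := h.comp hU hb hp (Ψ := fun x => x ^ m) (Real.contDiff_rpow_const_of_le (by simpa using hm))
  have e : ∀ x : ℝ, deriv (fun x : ℝ => x ^ m) x = m * x ^ (m - 1) := fun x =>
    (Real.hasDerivAt_rpow_const (Or.inr hm)).deriv
  simp only [e] at h1
  exact h1

theorem StrongApprox.integrable_rpow {p : ℝ≥0∞} (h : StrongApprox U p f F)
    (hb : Bornology.IsBounded U) {r : ℝ} (hr : 0 ≤ r) :
    Integrable (fun x => f x ^ r) (volume.restrict U) :=
  ((h.continuousOn.rpow_const fun _ _ => Or.inr hr).integrableOn_compact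
    hb.isCompact_closure).mono_set subset_closure

theorem StrongApprox.integrable_mul_norm {p : ℝ} (h : StrongApprox U (ENNReal.ofReal p) f F)
    (hU : IsOpen U) (hb : Bornology.IsBounded U) (hp : 0 < p) {r : ℝ} (hr : 0 ≤ r) :
    Integrable (fun x => f x ^ r * ‖F x‖ ^ p) (volume.restrict U) := by
  have hc : ContinuousOn (fun x => f x ^ r) (closure U) :=
    h.continuousOn.rpow_const fun _ _ => Or.inr hr
  obtain ⟨B, hB⟩ := hb.isCompact_closure.exists_bound_of_continuousOn hc
  have hi := h.memLp.integrable_norm_rpow (ENNReal.ofReal_pos.2 hp).ne' ENNReal.ofReal_ne_top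
  rw [ENNReal.toReal_ofReal hp.le] at hi
  refine hi.bdd_mul (c := B) ((hc.mono subset_closure).aestronglyMeasurable hU.measurableSet) ?_
  filter_upwards [ae_restrict_mem hU.measurableSet] with x hx using hB x (subset_closure hx)

theorem one_add_rpow_le {y r : ℝ} (hy : 0 ≤ y) (hr : 0 ≤ r) : (1 + y) ^ r ≤ 2 ^ r * (1 + y ^ r) := by
  have hy' := Real.rpow_nonneg hy r
  have h2 : 0 < (2 : ℝ) ^ r := by positivity
  rcases le_total y 1 with h | h
  · calc (1 + y) ^ r ≤ 2 ^ r := Real.rpow_le_rpow (by positivity) (by linarith) hr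
      _ ≤ _ := by nlinarith
  · calc (1 + y) ^ r ≤ (2 * y) ^ r := Real.rpow_le_rpow (by positivity) (by linarith) hr
      _ = 2 ^ r * y ^ r := Real.mul_rpow (by norm_num) hy
      _ ≤ _ := by nlinarith

theorem rpow_le_one_add_rpow {y r s : ℝ} (hy : 0 ≤ y) (hr : 0 ≤ r) (hrs : r ≤ s) :
    y ^ r ≤ 1 + y ^ s := by
  have hy' := Real.rpow_nonneg hy s
  rcases le_total y 1 with h | h
  · linarith [Real.rpow_le_one hy h hr]
  · linarith [Real.rpow_le_rpow_of_exponent_le h hrs]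

/-- Hölder's inequality interpolates the exponent `α + μ₀` between `α` and the Sobolev exponent
attained by `u^m`, with `m p = α + δ - a`. The weight on the Sobolev side is `θ (n-p)/n`, so that
after the Sobolev inequality the `W^{1,p}` integral appears to the power `θ`. -/
theorem exists_interpolation_bound (hn : 2 ≤ n) (hU : IsOpen U) (hb : Bornology.IsBounded U)
    (𝒜 : Atlas U) (hlam : 0 < lam) (ha : 1 - lam < P.a) (hα : n * mu0 P lam < α)
    (hα1 : 1 + lam ≤ α) : ∃ K : ℝ, 1 ≤ K ∧ ∀ {f : Eu n → ℝ} {F : Eu n → Eu n}, (∀ x, 0 ≤ f x) →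
      Measurable f → Measurable F → StrongApprox U (ENNReal.ofReal (2 - P.a)) f F →
      ∫ x in U, f x ^ (α + mu0 P lam) ≤
        K * (1 + ∫ x in U, f x ^ α) ^ (1 - theta n P lam α * ((n - (2 - P.a)) / n)) *
          (1 + (∫ x in U, f x ^ α) + ∫ x in U, f x ^ (α - lam - 1) * ‖F x‖ ^ (2 - P.a)) ^
            theta n P lam α := by
  have hn0 : (2 : ℝ) ≤ n := by exact_mod_cast hn
  have ha1 := P.a_lt_one
  have ha0 := P.a_pos
  have hθ0 := theta_pos hn ha hα
  have hθ1 := theta_lt_one hn ha hα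
  have hint := theta_interpolation hn ha hα
  have hμ := mu0_pos ha
  set θ := theta n P lam α
  set p := 2 - P.a with hp
  have hp0 : 0 < p := by linarith
  have hpn : p < n := by linarith
  have hnp : 0 < n - p := by linarith
  set τ := θ * ((n - p) / n) with hτ
  have hτ0 : 0 ≤ τ := by positivity
  have hτ1 : τ ≤ 1 := by
    have : (n - p) / n ≤ 1 := by rw [div_le_one (by linarith)]; linarith
    nlinarith
  set γ := α + (1 - lam) - P.a with hγ
  set m := γ / p with hm
  have hmp : m * p = γ := by rw [hm]; field_simp
  have hm1 : 1 ≤ m := by rw [hm, le_div_iff₀ hp0, hγ]; linarith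
  have hfin : IsFiniteMeasure (volume.restrict U) := ⟨by simpa using hb.measure_lt_top⟩
  obtain ⟨CS, hCS, hsob⟩ := exists_sobolev hn hU hb 𝒜 (p := p) (by linarith) hpn
  set v : ℝ := (volume.restrict U).real univ with hv
  have hv0 : 0 ≤ v := measureReal_nonneg
  set A := (1 + CS.toReal) * (1 + v + m ^ p) with hA
  have hCS0 : 0 ≤ CS.toReal := ENNReal.toReal_nonneg
  have hmp1 : 1 ≤ m ^ p := Real.one_le_rpow hm1 hp0.le
  have hA1 : 1 ≤ A := one_le_mul_of_one_le_of_one_le (by linarith) (by linarith)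
  refine ⟨A ^ θ, Real.one_le_rpow hA1 hθ0.le, fun {f F} hf0 hfm hFm hs => ?_⟩
  have hα0 : 0 < α := by linarith
  set X := ∫ x in U, f x ^ α with hX
  set D := ∫ x in U, f x ^ (α - lam - 1) * ‖F x‖ ^ p with hD
  have hX0 : 0 ≤ X := integral_nonneg fun x => Real.rpow_nonneg (hf0 x) _
  have hD0 : 0 ≤ D := integral_nonneg fun x =>
    mul_nonneg (Real.rpow_nonneg (hf0 x) _) (Real.rpow_nonneg (norm_nonneg _) _)
  have iX := hs.integrable_rpow hb hα0.le
  have iD := hs.integrable_mul_norm hU hb hp0 (r := α - lam - 1) (by linarith)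
  have iZ := hs.integrable_rpow hb (r := α + mu0 P lam) (by linarith)
  have hsm := hs.rpow hU hb (by simpa [hp] using P.one_lt_two_sub.le) hm1
  have hS := hsob _ _ (fun x _ => Real.rpow_nonneg (hf0 x) m) hsm
  have hE : ∫⁻ x in U, (‖f x ^ m‖ₑ ^ p + ‖(m * f x ^ (m - 1)) • F x‖ₑ ^ p) ≤
      ENNReal.ofReal (v + X + m ^ p * D) := by
    have i1 : Integrable (fun x => 1 + f x ^ α) (volume.restrict U) := (integrable_const 1).add iX
    have i2 : Integrable (fun x => m ^ p * (f x ^ (α - lam - 1) * ‖F x‖ ^ p)) (volume.restrict U) :=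
      iD.const_mul _
    have e1 : v + X + m ^ p * D =
        ∫ x in U, (1 + f x ^ α + m ^ p * (f x ^ (α - lam - 1) * ‖F x‖ ^ p)) := by
      rw [integral_add i1 i2, integral_add (integrable_const 1) iX, integral_const_mul,
        integral_const]
      simp [hv, hX, hD]
    have i12 : Integrable (fun x => 1 + f x ^ α + m ^ p * (f x ^ (α - lam - 1) * ‖F x‖ ^ p))
      (volume.restrict U) := i1.add i2
    rw [e1, ofReal_integral_eq_lintegral_ofReal i12 (Eventually.of_forall fun x => ?_)]
    · refine lintegral_mono fun x => ?_
      have h0 := hf0 x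
      have hm0 : 0 ≤ m * f x ^ (m - 1) := mul_nonneg (by linarith) (Real.rpow_nonneg h0 _)
      rw [← ofReal_norm, ← ofReal_norm, Real.norm_of_nonneg (Real.rpow_nonneg h0 m), norm_smul,
        Real.norm_of_nonneg hm0, ENNReal.ofReal_rpow_of_nonneg (Real.rpow_nonneg h0 m) hp0.le,
        ENNReal.ofReal_rpow_of_nonneg (by positivity) hp0.le, ← ENNReal.ofReal_add (by positivity)
        (by positivity)]
      refine ENNReal.ofReal_le_ofReal (add_le_add ?_ (le_of_eq ?_))
      · rw [← Real.rpow_mul h0, hmp]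
        exact rpow_le_one_add_rpow h0 (by linarith) (by linarith)
      · rw [Real.mul_rpow hm0 (norm_nonneg _), Real.mul_rpow (by linarith) (Real.rpow_nonneg h0 _),
          ← Real.rpow_mul h0, show (m - 1) * p = α - lam - 1 by rw [sub_mul, hmp]; linarith]
        ring
    · have h1 := hf0 x
      positivity
  have hvXD : 0 ≤ v + X + m ^ p * D := by positivity
  have hfE : Measurable fun x => ENNReal.ofReal (f x) := hfm.ennreal_ofReal
  have key : ENNReal.ofReal (∫ x in U, f x ^ (α + mu0 P lam)) ≤
      ENNReal.ofReal (X ^ (1 - τ) * (CS.toReal * (v + X + m ^ p * D)) ^ θ) := by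
    rw [ofReal_integral_eq_lintegral_ofReal iZ (Eventually.of_forall fun x => Real.rpow_nonneg (hf0 x) _)]
    calc ∫⁻ x in U, ENNReal.ofReal (f x ^ (α + mu0 P lam))
        = ∫⁻ x in U, (ENNReal.ofReal (f x) ^ α) ^ (1 - τ) *
            (ENNReal.ofReal (f x) ^ (γ * (n / (n - p)))) ^ τ := by
          refine lintegral_congr fun x => ?_
          have h4 : 0 ≤ γ * (n / (n - p)) := mul_nonneg (by linarith) (by positivity)
          rw [← ENNReal.rpow_mul, ← ENNReal.rpow_mul, ← ENNReal.rpow_add_of_nonneg _ _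
            (mul_nonneg hα0.le (by linarith)) (mul_nonneg h4 hτ0), ENNReal.ofReal_rpow_of_nonneg (hf0 x)
            (by rw [hτ] at *; nlinarith [mul_nonneg hα0.le (sub_nonneg.2 hτ1), mul_nonneg h4 hτ0])]
          congr 2
          rw [← hint, hτ]
          field_simp
      _ ≤ (∫⁻ x in U, ENNReal.ofReal (f x) ^ α) ^ (1 - τ) *
            (∫⁻ x in U, ENNReal.ofReal (f x) ^ (γ * (n / (n - p)))) ^ τ :=
          ENNReal.lintegral_mul_norm_pow_le (hfE.pow_const _).aemeasurable
            (hfE.pow_const _).aemeasurable (by linarith) hτ0 (by ring)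
      _ ≤ ENNReal.ofReal X ^ (1 - τ) * (CS * ENNReal.ofReal (v + X + m ^ p * D)) ^ θ := by
          refine mul_le_mul' (le_of_eq ?_) ?_
          · rw [hX, ofReal_integral_eq_lintegral_ofReal iX
              (Eventually.of_forall fun x => Real.rpow_nonneg (hf0 x) _)]
            congr 1
            exact lintegral_congr fun x => ENNReal.ofReal_rpow_of_nonneg (hf0 x) hα0.le
          · rw [hτ, mul_comm θ, ENNReal.rpow_mul]
            refine ENNReal.rpow_le_rpow ?_ hθ0.le
            refine le_trans (le_of_eq ?_) (hS.trans (mul_le_mul' le_rfl hE))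
            congr 1
            refine lintegral_congr fun x => ?_
            have h0 := hf0 x
            rw [← ofReal_norm, Real.norm_of_nonneg (Real.rpow_nonneg h0 m),
              ← ENNReal.ofReal_rpow_of_nonneg h0 (by linarith), ← ENNReal.rpow_mul, ← hmp]
            congr 1
            ring
      _ = _ := by
          nth_rw 1 [← ENNReal.ofReal_toReal hCS]
          rw [← ENNReal.ofReal_mul hCS0, ENNReal.ofReal_rpow_of_nonneg hX0 (by linarith),
            ENNReal.ofReal_rpow_of_nonneg (by positivity) hθ0.le, ← ENNReal.ofReal_mul (by positivity)]
  have key2 := (ENNReal.ofReal_le_ofReal_iff (by positivity)).1 key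
  have h5 : CS.toReal * (v + X + m ^ p * D) ≤ A * (1 + X + D) := by
    have e : v + X + m ^ p * D ≤ (1 + v + m ^ p) * (1 + X + D) := by
      have h1 : 0 ≤ m ^ p := by linarith
      nlinarith [mul_nonneg hv0 hX0, mul_nonneg hv0 hD0, mul_nonneg h1 hX0]
    calc CS.toReal * (v + X + m ^ p * D) ≤ (1 + CS.toReal) * ((1 + v + m ^ p) * (1 + X + D)) := by
          gcongr; linarith
      _ = _ := by rw [hA]; ring
  calc _ ≤ X ^ (1 - τ) * (CS.toReal * (v + X + m ^ p * D)) ^ θ := key2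
    _ ≤ (1 + X) ^ (1 - τ) * (A * (1 + X + D)) ^ θ := by
        have : 0 ≤ 1 - τ := by linarith
        gcongr
        linarith
    _ = _ := by
        rw [Real.mul_rpow (by linarith) (by positivity)]
        ring

/-- The `W^{1,1}` trace inequality is applied to `f^α`. Young's inequality splits `N f^{α-1} |F|`
into the dissipation density and `N^{p'}` times a power of `f` with exponent `α - λ - 1 + λ p'`.
This exponent equals `α + μ₀`, which explains `μ₀`. -/
theorem exists_trace_bound (hn : 2 ≤ n) (hU : IsOpen U) (hb : Bornology.IsBounded U)
    (𝒜 : Atlas U) (hlam : 0 < lam) (ha : 1 - lam < P.a) (hα1 : 1 + lam ≤ α) {e : ℝ} (he : 0 < e) :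
    ∃ K : ℝ, 1 ≤ K ∧ ∀ {f : Eu n → ℝ} {F : Eu n → Eu n}, (∀ x, 0 ≤ f x) →
      Measurable f → Measurable F → StrongApprox U (ENNReal.ofReal (2 - P.a)) f F → ∀ N : ℝ, 0 ≤ N →
      N * ∫ x, f x ^ α ∂(surfaceMeasure U) ≤
        e * (∫ x in U, f x ^ (α - lam - 1) * ‖F x‖ ^ (2 - P.a)) +
          K * (1 + N ^ P.conjExp) * (1 + ∫ x in U, f x ^ (α + mu0 P lam)) := by
  have ha1 := P.a_lt_one
  have ha0 := P.a_pos
  have hμ := mu0_pos ha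
  set p := 2 - P.a with hp
  have hp0 : 0 < p := by linarith
  have hfin : IsFiniteMeasure (volume.restrict U) := ⟨by simpa using hb.measure_lt_top⟩
  have hσ := isFiniteMeasure_surfaceMeasure hn hU hb 𝒜
  obtain ⟨CT, hCT, htr⟩ := exists_trace hn hU hb 𝒜
  set C := 1 + CT.toReal with hC
  have hC1 : 1 ≤ C := le_add_of_nonneg_right ENNReal.toReal_nonneg
  have hCC : CT ≤ ENNReal.ofReal C := by
    rw [← ENNReal.ofReal_toReal hCT]; exact ENNReal.ofReal_le_ofReal (by linarith)
  have hα0 : 0 < α := by linarith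
  -- With this choice the dissipation, after multiplication by the trace constant and by `α`,
  -- carries exactly the prescribed coefficient `e`.
  set ε := e / (C * α) with hε
  have hε0 : 0 < ε := by positivity
  set E := ε ^ (-(1 / (1 - P.a))) with hE
  have hE0 : 0 ≤ E := by positivity
  set v : ℝ := (volume.restrict U).real univ with hv
  have hv0 : 0 ≤ v := measureReal_nonneg
  have hq1 : 1 ≤ P.conjExp := P.holderConjugate.symm.lt.le
  have hq0 : 0 < P.conjExp := by linarith
  refine ⟨C * (1 + α * E) * (1 + v), ?_, fun {f F} hf0 hfm hFm hs N hN => ?_⟩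
  · have : 0 ≤ α * E := by positivity
    exact one_le_mul_of_one_le_of_one_le (one_le_mul_of_one_le_of_one_le hC1 (by linarith))
      (by linarith)
  set D := ∫ x in U, f x ^ (α - lam - 1) * ‖F x‖ ^ p with hD
  set Z := ∫ x in U, f x ^ (α + mu0 P lam) with hZ
  have hZ0 : 0 ≤ Z := integral_nonneg fun x => Real.rpow_nonneg (hf0 x) _
  have hD0 : 0 ≤ D := integral_nonneg fun x =>
    mul_nonneg (Real.rpow_nonneg (hf0 x) _) (Real.rpow_nonneg (norm_nonneg _) _)
  have iD := hs.integrable_mul_norm hU hb hp0 (r := α - lam - 1) (by linarith)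
  have iZ := hs.integrable_rpow hb (r := α + mu0 P lam) (by linarith)
  have hsα := hs.rpow hU hb (by simpa [hp] using P.one_lt_two_sub.le) (m := α) (by linarith)
  have htr1 := htr _ _ _ (by simpa [hp] using P.one_lt_two_sub.le) hsα
  have hNq : 0 ≤ N ^ P.conjExp := Real.rpow_nonneg hN _
  have hpt : ∀ x, N * (f x ^ α + α * f x ^ (α - 1) * ‖F x‖) ≤
      α * ε * (f x ^ (α - lam - 1) * ‖F x‖ ^ p) +
        (1 + α * E) * (1 + N ^ P.conjExp) * (1 + f x ^ (α + mu0 P lam)) := fun x => by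
    have h0 := hf0 x
    have hd := norm_nonneg (F x)
    have h1 : N ≤ 1 + N ^ P.conjExp := by
      simpa using rpow_le_one_add_rpow hN zero_le_one hq1
    have h2 : f x ^ α ≤ 1 + f x ^ (α + mu0 P lam) := rpow_le_one_add_rpow h0 hα0.le (by linarith)
    have hfm0 : 0 ≤ f x ^ (α + mu0 P lam) := Real.rpow_nonneg h0 _
    have hfb : 0 ≤ f x ^ (α - lam - 1) := Real.rpow_nonneg h0 _
    have hNf : 0 ≤ N * f x ^ lam := mul_nonneg hN (Real.rpow_nonneg h0 _)
    have h3 : N * f x ^ α ≤ (1 + N ^ P.conjExp) * (1 + f x ^ (α + mu0 P lam)) :=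
      mul_le_mul h1 h2 (Real.rpow_nonneg h0 _) (by linarith)
    have hy := young_split (s := 1) (t := 1 - P.a) (ε := ε) (a := ‖F x‖)
      (b := (N * f x ^ lam) ^ (1 / (1 - P.a))) zero_le_one (by linarith) hε0 hd (by positivity)
    rw [← Real.rpow_mul hNf, ← Real.rpow_mul hNf, one_div_mul_cancel (by linarith), Real.rpow_one,
      Real.rpow_one, show 1 + (1 - P.a) = p by rw [hp]; ring,
      show 1 / (1 - P.a) * p = P.conjExp by rw [GenPoly.conjExp]; ring, ← hE,
      Real.mul_rpow hN (Real.rpow_nonneg h0 _), ← Real.rpow_mul h0] at hy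
    have e1 : f x ^ (α - 1) = f x ^ (α - lam - 1) * f x ^ lam := by
      rw [← Real.rpow_add_of_nonneg h0 (by linarith) hlam.le]; congr 1; ring
    have e2 : f x ^ (α + mu0 P lam) = f x ^ (α - lam - 1) * f x ^ (lam * P.conjExp) := by
      rw [← Real.rpow_add_of_nonneg h0 (by linarith) (by positivity)]; congr 1
      have : 1 - P.a ≠ 0 := by linarith
      rw [mu0, GenPoly.conjExp]; field_simp; ring
    have h4 : N * (α * f x ^ (α - 1) * ‖F x‖) ≤ α * ε * (f x ^ (α - lam - 1) * ‖F x‖ ^ p) +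
        α * E * (N ^ P.conjExp * f x ^ (α + mu0 P lam)) := by
      calc N * (α * f x ^ (α - 1) * ‖F x‖) =
            α * f x ^ (α - lam - 1) * (‖F x‖ * (N * f x ^ lam)) := by rw [e1]; ring
        _ ≤ α * f x ^ (α - lam - 1) *
            (ε * ‖F x‖ ^ p + E * (N ^ P.conjExp * f x ^ (lam * P.conjExp))) := by gcongr
        _ = _ := by rw [e2]; ring
    have h5 : α * E * (N ^ P.conjExp * f x ^ (α + mu0 P lam)) ≤
        α * E * ((1 + N ^ P.conjExp) * (1 + f x ^ (α + mu0 P lam))) := by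
      gcongr <;> linarith
    linarith
  have iR : Integrable (fun x => α * ε * (f x ^ (α - lam - 1) * ‖F x‖ ^ p) +
        (1 + α * E) * (1 + N ^ P.conjExp) * (1 + f x ^ (α + mu0 P lam))) (volume.restrict U) :=
    (iD.const_mul _).add (((integrable_const 1).add iZ).const_mul _)
  have i1Z : Integrable (fun x => 1 + f x ^ (α + mu0 P lam)) (volume.restrict U) :=
    (integrable_const 1).add iZ
  have eR : ∫ x in U, (α * ε * (f x ^ (α - lam - 1) * ‖F x‖ ^ p) +
        (1 + α * E) * (1 + N ^ P.conjExp) * (1 + f x ^ (α + mu0 P lam))) =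
        α * ε * D + (1 + α * E) * (1 + N ^ P.conjExp) * (v + Z) := by
    rw [integral_add (iD.const_mul _) (i1Z.const_mul _), integral_const_mul, integral_const_mul,
      integral_add (integrable_const 1) iZ, integral_const]
    simp [hv, hD, hZ]
  have iΓ : Integrable (fun x => f x ^ α) (surfaceMeasure U) := by
    have hc : ContinuousOn (fun x => f x ^ α) (closure U) :=
      hs.continuousOn.rpow_const fun _ _ => Or.inr hα0.le
    obtain ⟨B, hB⟩ := hb.isCompact_closure.exists_bound_of_continuousOn hc
    refine Integrable.of_bound (hfm.pow_const _).aestronglyMeasurable B ?_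
    filter_upwards [ae_restrict_mem isClosed_frontier.measurableSet] with x hx
      using hB x (frontier_subset_closure hx)
  have key : ENNReal.ofReal (N * ∫ x, f x ^ α ∂(surfaceMeasure U)) ≤
      ENNReal.ofReal (C * (α * ε * D + (1 + α * E) * (1 + N ^ P.conjExp) * (v + Z))) := by
    have e1 : ∫⁻ x, ENNReal.ofReal (f x ^ α) ∂(surfaceMeasure U) =
        ∫⁻ x, ‖f x ^ α‖ₑ ∂(surfaceMeasure U) := lintegral_congr fun x => by
      rw [← ofReal_norm, Real.norm_of_nonneg (Real.rpow_nonneg (hf0 x) _)]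
    rw [ENNReal.ofReal_mul hN, ofReal_integral_eq_lintegral_ofReal iΓ
      (Eventually.of_forall fun x => Real.rpow_nonneg (hf0 x) _), ENNReal.ofReal_mul (by linarith), ← eR,
      ofReal_integral_eq_lintegral_ofReal iR (Eventually.of_forall fun x => ?_), e1]
    · calc _ ≤ ENNReal.ofReal N * (ENNReal.ofReal C *
            ∫⁻ x in U, (‖f x ^ α‖ₑ + ‖(α * f x ^ (α - 1)) • F x‖ₑ)) :=
            mul_le_mul' le_rfl (htr1.trans (mul_le_mul' hCC le_rfl))
        _ = ENNReal.ofReal C * ∫⁻ x in U, ENNReal.ofReal N *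
            (‖f x ^ α‖ₑ + ‖(α * f x ^ (α - 1)) • F x‖ₑ) := by
            rw [lintegral_const_mul' _ _ ENNReal.ofReal_ne_top]; ring
        _ ≤ _ := by
            refine mul_le_mul' le_rfl (lintegral_mono fun x => ?_)
            have h0 := hf0 x
            have h1 : 0 ≤ α * f x ^ (α - 1) := mul_nonneg hα0.le (Real.rpow_nonneg h0 _)
            rw [← ofReal_norm, ← ofReal_norm, Real.norm_of_nonneg (Real.rpow_nonneg h0 α), norm_smul,
              Real.norm_of_nonneg h1, ← ENNReal.ofReal_add (Real.rpow_nonneg h0 α)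
              (mul_nonneg h1 (norm_nonneg _)), ← ENNReal.ofReal_mul hN]
            exact ENNReal.ofReal_le_ofReal (hpt x)
    · have h0 := hf0 x
      positivity
  have key2 := (ENNReal.ofReal_le_ofReal_iff (by positivity)).1 key
  refine key2.trans ?_
  have e1 : C * (α * ε * D) = e * D := by rw [hε]; field_simp
  rw [mul_add, e1]
  refine add_le_add le_rfl ?_
  have : v + Z ≤ (1 + v) * (1 + Z) := by nlinarith
  calc C * ((1 + α * E) * (1 + N ^ P.conjExp) * (v + Z)) ≤
        C * ((1 + α * E) * (1 + N ^ P.conjExp) * ((1 + v) * (1 + Z))) := by gcongr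
    _ = _ := by ring

end ForchheimerGas

end

/-! ### The differential inequality for `∫ u^α`. -/

noncomputable section

namespace ForchheimerGas

variable {n : ℕ} {U : Set (Eu n)} {P : GenPoly} {lam T α : ℝ} {f : Eu n → ℝ} {F : Eu n → Eu n}

theorem StrongApprox.integrable_flux (hs : StrongApprox U (ENNReal.ofReal (2 - P.a)) f F)
    (hU : IsOpen U) (hb : Bornology.IsBounded U) (hfm : Measurable f) (hFm : Measurable F) {r c : ℝ}
    (hr : 0 ≤ r) : Integrable (fun x => ⟪P.flux (F x), (c * f x ^ r) • F x⟫) (volume.restrict U) := by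
  have ha1 := P.a_lt_one
  obtain ⟨C, hC, hfl⟩ := P.exists_norm_flux_le
  have hi := ((hs.integrable_mul_norm hU hb (by linarith) hr).norm).const_mul (C * |c|)
  refine hi.mono' ?_ (Eventually.of_forall fun x => ?_)
  · have m1 : Measurable fun x => P.flux (F x) := P.measurable_flux.comp hFm
    have m2 : Measurable fun x => (c * f x ^ r) • F x := ((hfm.pow_const r).const_mul c).smul hFm
    exact (m1.inner m2).aestronglyMeasurable
  · calc ‖⟪P.flux (F x), (c * f x ^ r) • F x⟫‖ ≤ ‖P.flux (F x)‖ * ‖(c * f x ^ r) • F x‖ :=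
          norm_inner_le_norm _ _
      _ ≤ C * ‖F x‖ ^ (1 - P.a) * (|c| * ‖f x ^ r‖ * ‖F x‖) := by
          rw [norm_smul, norm_mul, Real.norm_eq_abs c]
          gcongr
          exact hfl _
      _ = _ := by
          rw [norm_mul, Real.norm_of_nonneg (Real.rpow_nonneg (norm_nonneg (F x)) _),
            show 2 - P.a = (1 - P.a) + 1 by ring,
            Real.rpow_add_of_nonneg (norm_nonneg _) (by linarith) zero_le_one, Real.rpow_one]
          ring

/-- Young's inequality with weights `θ` and `1 - θ` separates `(1 + X + D)^θ` from the rest, with an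
arbitrarily small coefficient on `D`. The remaining factors are raised to `1/(1 - θ)`, which turns
`e₁` into `1 + s` and `q'` into `q`. -/
theorem young_absorb {c θ e₁ s q q' KA KB X D Z N : ℝ} (hc : 0 < c) (hθ0 : 0 < θ) (hθ1 : θ < 1)
    (hKA : 0 ≤ KA) (hKB : 0 ≤ KB) (hX : 0 ≤ X) (hD : 0 ≤ D) (hN : 0 ≤ N)
    (he : e₁ * (1 / (1 - θ)) = 1 + s) (hq : q = q' / (1 - θ))
    (h : 1 + Z ≤ 2 * KA * (1 + X) ^ e₁ * (1 + X + D) ^ θ) :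
    KB * (1 + N ^ q') * (1 + Z) ≤ c * (1 + X + D) +
      c ^ (-(θ / (1 - θ))) * ((2 * KA * KB) ^ (1 / (1 - θ)) * 2 ^ (1 / (1 - θ))) *
        ((1 + N ^ q) * (1 + X) ^ (1 + s)) := by
  have h1θ : 0 < 1 - θ := by linarith
  have hNq : 0 ≤ N ^ q' := Real.rpow_nonneg hN _
  have hW0 : 0 ≤ (2 * KA * KB) * (1 + N ^ q') * (1 + X) ^ e₁ := by positivity
  have hy := young_split (s := θ) (t := 1 - θ) (ε := c) (a := 1 + X + D)
    (b := ((2 * KA * KB) * (1 + N ^ q') * (1 + X) ^ e₁) ^ (1 / (1 - θ)))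
    hθ0.le h1θ hc (by linarith) (by positivity)
  rw [← Real.rpow_mul hW0, one_div_mul_cancel h1θ.ne', Real.rpow_one, add_sub_cancel, Real.rpow_one,
    Real.rpow_one] at hy
  have e3 : (1 + N ^ q') ^ (1 / (1 - θ)) ≤ 2 ^ (1 / (1 - θ)) * (1 + N ^ q) := by
    have := one_add_rpow_le hNq (one_div_pos.2 h1θ).le
    rwa [← Real.rpow_mul hN, mul_one_div, ← hq] at this
  calc KB * (1 + N ^ q') * (1 + Z)
      ≤ KB * (1 + N ^ q') * (2 * KA * (1 + X) ^ e₁ * (1 + X + D) ^ θ) := by gcongr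
    _ = (1 + X + D) ^ θ * ((2 * KA * KB) * (1 + N ^ q') * (1 + X) ^ e₁) := by ring
    _ ≤ _ := hy
    _ ≤ _ := by
      refine add_le_add le_rfl ?_
      rw [mul_assoc (c ^ (-(θ / (1 - θ))))]
      refine mul_le_mul_of_nonneg_left ?_ (by positivity)
      rw [Real.mul_rpow (by positivity) (by positivity), Real.mul_rpow (by positivity)
        (by positivity), ← Real.rpow_mul (by positivity), he]
      calc _ ≤ (2 * KA * KB) ^ (1 / (1 - θ)) * (2 ^ (1 / (1 - θ)) * (1 + N ^ q)) *
            (1 + X) ^ (1 + s) := by gcongr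
        _ = _ := by ring

/-- The flux provides `c D` of dissipation. Half of it absorbs the gradient part of the trace
inequality, the other half the gradient part of the interpolation. Everything left is at most a
multiple of `(1 + N^q)(1 + X)^{1+s}`. -/
theorem exists_slice_bound (hn : 2 ≤ n) (hU : IsOpen U) (hb : Bornology.IsBounded U)
    (𝒜 : Atlas U) (hlam : 0 < lam) (ha : 1 - lam < P.a) (hα : n * mu0 P lam < α)
    (hα1 : 1 + lam ≤ α) : ∃ K : ℝ, 1 ≤ K ∧ ∀ {f : Eu n → ℝ} {F : Eu n → Eu n}, (∀ x, 0 ≤ f x) →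
      Measurable f → Measurable F → StrongApprox U (ENNReal.ofReal (2 - P.a)) f F → ∀ N : ℝ, 0 ≤ N →
      N * (∫ x, f x ^ α ∂(surfaceMeasure U)) -
          (∫ x in U, ⟪P.flux (F x), ((α - lam) * f x ^ (α - lam - 1)) • F x⟫) ≤
        K * (1 + N ^ phiExp n P lam α) * (1 + ∫ x in U, f x ^ α) ^ (1 + mu1 n P lam α / α) := by
  have hn0 : (2 : ℝ) ≤ n := by exact_mod_cast hn
  have ha1 := P.a_lt_one
  have hα0 : 0 < α := by linarith
  have hθ0 := theta_pos hn ha hα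
  have hθ1 := theta_lt_one hn ha hα
  have hμ := mu0_pos ha
  have hs0 : 0 < mu1 n P lam α / α := div_pos (mu1_pos hn ha hα) hα0
  have hsdef := mu1_div hn ha hα0 hα
  obtain ⟨c, C, hc, hC, hlow⟩ := P.exists_flux_lower
  obtain ⟨KA, hKA, hA⟩ := exists_interpolation_bound hn hU hb 𝒜 hlam ha hα hα1
  obtain ⟨KB, hKB, hB⟩ := exists_trace_bound hn hU hb 𝒜 hlam ha hα1 (half_pos hc)
  have hfin : IsFiniteMeasure (volume.restrict U) := ⟨by simpa using hb.measure_lt_top⟩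
  set v : ℝ := (volume.restrict U).real univ with hv
  have hv0 : 0 ≤ v := measureReal_nonneg
  have hqdef := phiExp_eq (n := n) P lam α
  set s := mu1 n P lam α / α
  set q := phiExp n P lam α
  set θ := theta n P lam α
  set p := 2 - P.a with hp
  set E : ℝ := (c / 2) ^ (-(θ / (1 - θ))) * ((2 * KA * KB) ^ (1 / (1 - θ)) * 2 ^ (1 / (1 - θ))) with hE
  have hE0 : 0 ≤ E := by positivity
  have h1θ : 0 < 1 - θ := by linarith
  refine ⟨1 + C * (α - lam) * (1 + v) + c / 2 + E, ?_, fun {f F} hf0 hfm hFm hs N hN => ?_⟩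
  · have : 0 ≤ C * (α - lam) * (1 + v) := mul_nonneg (mul_nonneg hC.le (by linarith)) (by linarith)
    linarith
  have hA' := hA hf0 hfm hFm hs
  have hB' := hB hf0 hfm hFm hs N hN
  have hp0 : 0 < p := by linarith
  have iX := hs.integrable_rpow hb hα0.le
  have iD := hs.integrable_mul_norm hU hb hp0 (r := α - lam - 1) (by linarith)
  have iβ := hs.integrable_rpow hb (r := α - lam - 1) (by linarith)
  have iF := hs.integrable_flux hU hb hfm hFm (r := α - lam - 1) (c := α - lam) (by linarith)
  set X := ∫ x in U, f x ^ α with hX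
  set D := ∫ x in U, f x ^ (α - lam - 1) * ‖F x‖ ^ p with hD
  set Z := ∫ x in U, f x ^ (α + mu0 P lam) with hZ
  set Y := ∫ x in U, f x ^ (α - lam - 1) with hY
  have hX0 : 0 ≤ X := integral_nonneg fun x => Real.rpow_nonneg (hf0 x) _
  have hD0 : 0 ≤ D := integral_nonneg fun x =>
    mul_nonneg (Real.rpow_nonneg (hf0 x) _) (Real.rpow_nonneg (norm_nonneg _) _)
  have hYX : Y ≤ v + X := by
    have : v + X = ∫ x in U, (1 + f x ^ α) := by
      rw [integral_add (integrable_const 1) iX, integral_const]; simp [hv, hX]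
    rw [this]
    exact integral_mono iβ ((integrable_const 1).add iX) fun x =>
      rpow_le_one_add_rpow (hf0 x) (by linarith) (by linarith)
  have hflux : c * D - C * ((α - lam) * Y) ≤
      ∫ x in U, ⟪P.flux (F x), ((α - lam) * f x ^ (α - lam - 1)) • F x⟫ := by
    have i1 : Integrable (fun x => C * ((α - lam) * f x ^ (α - lam - 1))) (volume.restrict U) :=
      (iβ.const_mul _).const_mul _
    rw [hD, hY, ← integral_const_mul, ← integral_const_mul, ← integral_const_mul,
      ← integral_sub (iD.const_mul _) i1]
    refine integral_mono ((iD.const_mul _).sub i1) iF fun x => ?_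
    -- No cut-off is present: `z = 1`, and the term with its gradient disappears because `0^{2-a} =
    -- 0`.
    have := hlow (β := α - lam) (u := f x) (z := 1) (G := 0) (D := F x) (v := 0) (by linarith) (hf0 x)
      zero_le_one le_rfl le_rfl (by simp)
    have e0 : (0 : ℝ) ^ (2 - P.a) = 0 := Real.zero_rpow hp0.ne'
    simpa [e0, hp] using this
  have hXs : 1 + X ≤ (1 + X) ^ (1 + s) := by
    calc 1 + X = (1 + X) ^ (1 : ℝ) := (Real.rpow_one _).symm
      _ ≤ _ := Real.rpow_le_rpow_of_exponent_le (by linarith) (by linarith)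
  set e₁ := 1 - θ * ((n - p) / n) with he₁
  have he₁0 : 0 ≤ e₁ := by
    have : (n - p) / n ≤ 1 := by rw [div_le_one (by linarith)]; linarith
    have h2 : θ * ((n - p) / n) ≤ θ * 1 := by gcongr
    linarith
  have hNq : 0 ≤ N ^ P.conjExp := Real.rpow_nonneg hN _
  have hX1 : 1 ≤ (1 + X) ^ e₁ := Real.one_le_rpow (by linarith) he₁0
  have hXD1 : 1 ≤ (1 + X + D) ^ θ := Real.one_le_rpow (by linarith) hθ0.le
  have h1Z : 1 + Z ≤ 2 * KA * (1 + X) ^ e₁ * (1 + X + D) ^ θ := by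
    have h1 : 1 ≤ KA * (1 + X) ^ e₁ * (1 + X + D) ^ θ :=
      one_le_mul_of_one_le_of_one_le (one_le_mul_of_one_le_of_one_le hKA hX1) hXD1
    linarith
  have hyoung : KB * (1 + N ^ P.conjExp) * (1 + Z) ≤
      c / 2 * (1 + X + D) + E * ((1 + N ^ q) * (1 + X) ^ (1 + s)) :=
    young_absorb (half_pos hc) hθ0 hθ1 (by linarith) (by linarith) hX0 hD0 hN
      (by rw [hsdef, he₁]; field_simp; ring) hqdef h1Z
  have hNq2 : 0 ≤ N ^ q := Real.rpow_nonneg hN _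
  have hR : (1 + X) ≤ (1 + N ^ q) * (1 + X) ^ (1 + s) :=
    hXs.trans (le_mul_of_one_le_left (by positivity) (le_add_of_nonneg_right hNq2))
  set R := (1 + N ^ q) * (1 + X) ^ (1 + s) with hRdef
  have hCY : C * ((α - lam) * Y) ≤ C * (α - lam) * (1 + v) * R := by
    have h1 : Y ≤ (1 + v) * (1 + X) := hYX.trans (by linarith only [mul_nonneg hv0 hX0])
    have h2 : 0 ≤ α - lam := by linarith only [hα1]
    calc C * ((α - lam) * Y) ≤ C * ((α - lam) * ((1 + v) * R)) := by
          gcongr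
          exact h1.trans (by gcongr)
      _ = _ := by ring
  have hR0 : 0 ≤ R := by linarith only [hR, hX0]
  calc _ ≤ (c / 2 * D + KB * (1 + N ^ P.conjExp) * (1 + Z)) - (c * D - C * ((α - lam) * Y)) := by
        linarith only [hflux, hB']
    _ ≤ C * (α - lam) * (1 + v) * R + c / 2 * R + E * R := by
        have : c / 2 * (1 + X) ≤ c / 2 * R := by gcongr
        linarith only [this, hyoung, hCY]
    _ ≤ _ := by
        rw [mul_assoc _ (1 + N ^ q), ← hRdef]; linarith only [hR0]

namespace RegSol

/-- The lower bound for the rate of change of `∫ u^α`. -/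
theorem exists_rate_bound (hn : 2 ≤ n) (hU : IsOpen U) (hb : Bornology.IsBounded U)
    (𝒜 : Atlas U) [IsFiniteMeasure (surfaceMeasure U)] (hlam : 0 < lam) (ha : 1 - lam < P.a)
    (hα : n * mu0 P lam < α) (hα1 : 1 + lam ≤ α) :
    ∃ K : ℝ, 1 ≤ K ∧ ∀ {T : ℝ} {u w φ : Eu n → ℝ → ℝ} {Du : Eu n → ℝ → Eu n},
      RegSol P lam U T u w Du →
      Function.uncurry w =ᵐ[(surfaceMeasure U).prod (volume.restrict (Ioo 0 T))]
        (fun z => φ z.1 z.2 * u z.1 z.2 ^ lam) →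
      ∀ {t₁ t₂ : ℝ}, 0 < t₁ → t₁ < t₂ → t₂ < T → ∀ᵐ t ∂(volume.restrict (Ioo t₁ t₂)),
        ENNReal.ofReal (-energyRate P U u w Du (α - lam) (fun _ => 1) t /
          (1 + ∫ x in U, u x t ^ α) ^ (1 + mu1 n P lam α / α)) ≤
        ENNReal.ofReal K * (1 + negNorm U φ t ^ phiExp n P lam α) := by
  obtain ⟨K, hK, hbd⟩ := exists_slice_bound hn hU hb 𝒜 hlam ha hα hα1
  refine ⟨K, hK, fun {T u w φ Du} h hw {t₁ t₂} h1 h2 h3 => ?_⟩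
  have hα0 : 0 < α := by linarith
  have hθ1 := theta_lt_one hn ha hα
  have hq0 : 0 < phiExp n P lam α := by
    rw [phiExp_eq]; exact div_pos P.holderConjugate.symm.pos (by linarith)
  have hsub : Ioo t₁ t₂ ⊆ Ioo 0 T := Ioo_subset_Ioo h1.le h3.le
  have hw' : ∀ᵐ t ∂(volume.restrict (Ioo 0 T)), ∀ᵐ x ∂(surfaceMeasure U),
      w x t = φ x t * u x t ^ lam := ae_ae_swap_of_ae_prod hw
  have hit : ∀ᵐ t ∂(volume.restrict (Ioo t₁ t₂)),
      Integrable (fun x => w x t * (u x t ^ (α - lam) * 1)) (surfaceMeasure U) :=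
    (h.integrable_test_bdry hb (β := α - lam) (χ := fun _ => 1) (by linarith) continuous_const h1 h2
      h3).prod_left_ae
  filter_upwards [h.strongApprox hU hb 𝒜 h1 h2 h3, ae_restrict_of_ae_restrict_of_subset hsub hw', hit,
    ae_restrict_mem measurableSet_Ioo] with t hs hwt hi ht
  -- When the norm of `φ⁻` is infinite so is the right-hand side, since its exponent is positive;
  -- the estimate is only needed for finite norms.
  rcases eq_or_ne (negNorm U φ t) ∞ with hN | hN
  · rw [hN, ENNReal.top_rpow_of_pos hq0, add_top, ENNReal.mul_top]
    · exact le_top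
    · rw [ENNReal.ofReal_ne_zero_iff]; linarith
  set N := (negNorm U φ t).toReal with hNdef
  have hN0 : 0 ≤ N := ENNReal.toReal_nonneg
  have hφ : ∀ᵐ x ∂(surfaceMeasure U), -N ≤ φ x t := by
    have h4 := ae_le_eLpNormEssSup (f := fun x => max (-φ x t) 0) (μ := surfaceMeasure U)
    filter_upwards [h4] with x hx
    have h5 : ‖max (-φ x t) 0‖ₑ ≤ negNorm U φ t := by rwa [negNorm, eLpNorm_exponent_top]
    rw [← ofReal_norm, Real.norm_of_nonneg (le_max_right _ _)] at h5
    have h6 := ENNReal.toReal_mono hN h5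
    rw [ENNReal.toReal_ofReal (le_max_right _ _)] at h6
    linarith [le_max_left (-φ x t) 0]
  have hum : Measurable fun x => u x t := h.measurable.comp (measurable_id.prodMk measurable_const)
  have hDm : Measurable fun x => Du x t := h.measurable_grad.comp (measurable_id.prodMk measurable_const)
  have iΓ : Integrable (fun x => u x t ^ α) (surfaceMeasure U) := by
    have hc : ContinuousOn (fun x => u x t ^ α) (closure U) :=
      hs.continuousOn.rpow_const fun _ _ => Or.inr hα0.le
    obtain ⟨B, hB⟩ := hb.isCompact_closure.exists_bound_of_continuousOn hc
    refine Integrable.of_bound (hum.pow_const _).aestronglyMeasurable B ?_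
    filter_upwards [ae_restrict_mem isClosed_frontier.measurableSet] with x hx
      using hB x (frontier_subset_closure hx)
  have hΓ : -(N * ∫ x, u x t ^ α ∂(surfaceMeasure U)) ≤
      ∫ x, w x t * (u x t ^ (α - lam) * 1) ∂(surfaceMeasure U) := by
    rw [← neg_mul, ← integral_const_mul]
    refine integral_mono_ae (iΓ.const_mul _) hi ?_
    filter_upwards [hwt, hφ] with x hx hx2
    have h0 := h.nonneg x t
    have e1 : u x t ^ α = u x t ^ lam * u x t ^ (α - lam) := by
      rw [← Real.rpow_add_of_nonneg h0 hlam.le (by linarith)]; congr 1; ring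
    simp only [hx, mul_one]
    rw [mul_assoc, ← e1]
    exact mul_le_mul_of_nonneg_right hx2 (Real.rpow_nonneg h0 _)
  have hg : ∀ x, testGrad u Du (α - lam) (fun _ => 1) x t =
      ((α - lam) * u x t ^ (α - lam - 1)) • Du x t := fun x => by
    rw [testGrad]
    simp [gradient]
  have hrate : -energyRate P U u w Du (α - lam) (fun _ => 1) t ≤
      K * (1 + N ^ phiExp n P lam α) * (1 + ∫ x in U, u x t ^ α) ^ (1 + mu1 n P lam α / α) := by
    have := hbd (fun x => h.nonneg x t) hum hDm hs N hN0
    simp only [energyRate, hg]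
    linarith
  have hX0 : 0 ≤ ∫ x in U, u x t ^ α := integral_nonneg fun x => Real.rpow_nonneg (h.nonneg x t) _
  have e2 : 1 + negNorm U φ t ^ phiExp n P lam α = ENNReal.ofReal (1 + N ^ phiExp n P lam α) := by
    rw [ENNReal.ofReal_add zero_le_one (by positivity), ENNReal.ofReal_one,
      ← ENNReal.ofReal_rpow_of_nonneg hN0 hq0.le, hNdef, ENNReal.ofReal_toReal hN]
  rw [e2, ← ENNReal.ofReal_mul (by linarith)]
  refine ENNReal.ofReal_le_ofReal ?_
  rw [div_le_iff₀ (by positivity)]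
  exact hrate

end RegSol

end ForchheimerGas

end

noncomputable section

namespace ForchheimerGas

variable {n : ℕ} {U : Set (Eu n)} {P : GenPoly} {lam T α : ℝ}

/-! ### A nonlinear Gronwall inequality -/

/-- The tangent line at `x` lies below the convex function `y ↦ y^{-s}`. -/
theorem rpow_neg_sub_rpow_neg_le {x y s : ℝ} (hx : 0 < x) (hy : 0 < y) (hs : 0 ≤ s) :
    x ^ (-s) - y ^ (-s) ≤ s * x ^ (-(1 + s)) * (y - x) := by
  have h1 : 1 - s * (y / x - 1) ≤ (y / x) ^ (-s) := by
    rw [Real.rpow_def_of_pos (by positivity)]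
    have h2 := Real.add_one_le_exp (Real.log (y / x) * -s)
    have h3 := Real.log_le_sub_one_of_pos (div_pos hy hx)
    nlinarith
  rw [Real.div_rpow hy.le hx.le, le_div_iff₀ (by positivity)] at h1
  have h4 : x ^ (-(1 + s)) * x = x ^ (-s) := by
    nth_rw 2 [← Real.rpow_one x]
    rw [← Real.rpow_add hx]; congr 1; ring
  have h5 : s * x ^ (-(1 + s)) * (y - x) = s * (y / x - 1) * x ^ (-s) := by
    rw [← h4]; field_simp
  rw [h5]
  linarith

/-- If `z' ≤ M z^{1+s}` in integrated form, then `(z^{-s})' ≥ - s M` in integrated form. -/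
theorem rpow_neg_sub_le_integral {z M : ℝ → ℝ} {a b s : ℝ} (hab : a ≤ b) (hs : 0 ≤ s)
    (hz : ContinuousOn z (Icc a b)) (hz1 : ∀ t ∈ Icc a b, 0 < z t)
    (hM : IntegrableOn M (Icc a b)) (hM0 : ∀ t, 0 ≤ M t)
    (h : ∀ c d, a ≤ c → c < d → d ≤ b → z d - z c ≤ ∫ t in Ioo c d, M t * z t ^ (1 + s)) :
    z a ^ (-s) - z b ^ (-s) ≤ s * ∫ t in Ioo a b, M t := by
  have hII : ∀ c d, a ≤ c → c ≤ d → d ≤ b → IntegrableOn M (Ioo c d) := fun c d h1 _ h3 =>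
    hM.mono_set (Ioo_subset_Icc_self.trans (Icc_subset_Icc h1 h3))
  have heI : ∀ c d, c ≤ d → ∫ t in Ioo c d, M t = ∫ t in c..d, M t := fun c d hcd => by
    rw [intervalIntegral.integral_of_le hcd, restrict_Ioo_eq_restrict_Ioc]
  have hivl : ∀ c d, a ≤ c → c ≤ d → d ≤ b → IntervalIntegrable M volume c d := fun c d h1 h2 h3 => by
    rw [intervalIntegrable_iff_integrableOn_Ioo_of_le h2]; exact hII c d h1 h2 h3
  -- Continuous induction along `[a, b]`. The slack `η > 1` allows `z` to be replaced by `η z(x)` on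
  -- a short interval to the right of `x`, where the tangent inequality at `x` then applies; `η → 1`
  -- at the end. This avoids differentiating `z`, which is only continuous.
  have key : ∀ η : ℝ, 1 < η → ∀ t ∈ Icc a b,
      z a ^ (-s) - z t ^ (-s) ≤ s * η ^ (1 + s) * ∫ τ in a..t, M τ := fun η hη => by
    have hclosed : IsClosed ({t | z a ^ (-s) - z t ^ (-s) ≤ s * η ^ (1 + s) * ∫ τ in a..t, M τ} ∩
        Icc a b) := by
      rw [inter_comm]
      refine isClosed_Icc.isClosed_le (f := fun t => z a ^ (-s) - z t ^ (-s)) ?_ ?_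
      · exact continuousOn_const.sub (hz.rpow_const fun t ht => Or.inl (hz1 t ht).ne')
      · refine continuousOn_const.mul ?_
        have := intervalIntegral.continuousOn_primitive_interval (μ := volume) (f := M) (a := a) (b := b)
          (by rwa [uIcc_of_le hab])
        rwa [uIcc_of_le hab] at this
    refine fun t ht => hclosed.Icc_subset_of_forall_exists_gt (by simp) (fun x hx y hy => ?_) ht
    obtain ⟨hx1, hx2⟩ := hx
    have hzx := hz1 x (Ico_subset_Icc_self hx2)
    have hlt : z x < η * z x := lt_mul_of_one_lt_left hzx hη
    have hev : ∀ᶠ r in 𝓝[Icc a b] x, z r < η * z x :=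
      (hz x (Ico_subset_Icc_self hx2)).eventually_lt_const hlt
    obtain ⟨ρ, hρ, hball⟩ := Metric.mem_nhdsWithin_iff.1 hev
    set d := min (min y b) (x + ρ / 2) with hd
    have hxd : x < d := lt_min (lt_min hy hx2.2) (by linarith)
    have hdb : d ≤ b := (min_le_left _ _).trans (min_le_right _ _)
    have hdy : d ≤ y := (min_le_left _ _).trans (min_le_left _ _)
    have hdρ : d ≤ x + ρ / 2 := min_le_right _ _
    refine ⟨d, ?_, hxd, hdy⟩
    have hzd := hz1 d ⟨hx2.1.trans hxd.le, hdb⟩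
    have hle : ∫ t in Ioo x d, M t * z t ^ (1 + s) ≤ (η * z x) ^ (1 + s) * ∫ t in Ioo x d, M t := by
      rw [← integral_const_mul]
      refine setIntegral_mono_on ?_ ((hII x d hx2.1 hxd.le hdb).const_mul _) measurableSet_Ioo
        fun t ht => ?_
      · have hsub : Ioo x d ⊆ Icc a b := Ioo_subset_Icc_self.trans (Icc_subset_Icc hx2.1 hdb)
        have hc : ContinuousOn (fun t => z t ^ (1 + s)) (Icc a b) :=
          hz.rpow_const fun t ht => Or.inl (hz1 t ht).ne'
        exact (hM.mul_continuousOn hc isCompact_Icc).mono_set hsub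
      · rw [mul_comm]
        have htI : t ∈ Icc a b := ⟨hx2.1.trans ht.1.le, ht.2.le.trans hdb⟩
        have h1 : z t < η * z x := hball ⟨by
          rw [Metric.mem_ball, Real.dist_eq, abs_of_pos (by linarith [ht.1])]
          linarith [ht.2], htI⟩
        exact mul_le_mul_of_nonneg_right (Real.rpow_le_rpow (hz1 t htI).le h1.le (by linarith)) (hM0 t)
    have h2 := rpow_neg_sub_rpow_neg_le hzx hzd hs
    have h3 : s * z x ^ (-(1 + s)) * (z d - z x) ≤
        s * z x ^ (-(1 + s)) * ((η * z x) ^ (1 + s) * ∫ t in Ioo x d, M t) :=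
      mul_le_mul_of_nonneg_left ((h x d hx2.1 hxd hdb).trans hle) (by positivity)
    have h4 : z x ^ (-(1 + s)) * (η * z x) ^ (1 + s) = η ^ (1 + s) := by
      rw [Real.mul_rpow (by linarith) hzx.le, Real.rpow_neg hzx.le]
      field_simp
    have h5 : ∫ τ in a..d, M τ = (∫ τ in a..x, M τ) + ∫ τ in Ioo x d, M τ := by
      rw [heI x d hxd.le, intervalIntegral.integral_add_adjacent_intervals
        (hivl a x le_rfl hx2.1 hx2.2.le) (hivl x d hx2.1 hxd.le hdb)]
    have hx1' : z a ^ (-s) - z x ^ (-s) ≤ s * η ^ (1 + s) * ∫ τ in a..x, M τ := hx1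
    change z a ^ (-s) - z d ^ (-s) ≤ s * η ^ (1 + s) * ∫ τ in a..d, M τ
    rw [h5, mul_add]
    have h6 : s * z x ^ (-(1 + s)) * ((η * z x) ^ (1 + s) * ∫ t in Ioo x d, M t) =
        s * η ^ (1 + s) * ∫ τ in Ioo x d, M τ := by rw [← h4]; ring
    linarith
  rw [heI a b hab]
  have hlim : Tendsto (fun η : ℝ => s * η ^ (1 + s) * ∫ τ in a..b, M τ) (𝓝[>] 1)
      (𝓝 (s * (1 : ℝ) ^ (1 + s) * ∫ τ in a..b, M τ)) := by
    have hc : ContinuousAt (fun η : ℝ => η ^ (1 + s)) 1 :=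
      Real.continuousAt_rpow_const _ _ (Or.inl one_ne_zero)
    exact ((hc.tendsto.mono_left nhdsWithin_le_nhds).const_mul s).mul_const _
  rw [Real.one_rpow, mul_one] at hlim
  exact ge_of_tendsto hlim (by
    filter_upwards [self_mem_nhdsWithin] with η hη using key η hη b ⟨hab, le_rfl⟩)

/-! ### The initial datum -/

/-- The negative part of `u₀` is at most `|u(t) - u₀|` for every small `t`, so its `L^q` norm
vanishes. Non-negativity of the datum thus need not be assumed. -/
theorem HasInitialDatum.ae_nonneg {u : Eu n → ℝ → ℝ} {u₀ : Eu n → ℝ} {q : ℝ} (hq : 1 ≤ q) (hT : 0 < T)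
    (h : HasInitialDatum U q u u₀) (hU : IsOpen U)
    (h0 : ∀ t ∈ Ioo 0 T, ∀ x ∈ U, 0 ≤ u x t) : ∀ᵐ x ∂(volume.restrict U), 0 ≤ u₀ x := by
  have hq' : ENNReal.ofReal q ≠ 0 := by simpa using by linarith
  have hle : ∀ᶠ t in 𝓝[>] (0 : ℝ), eLpNorm (fun x => max (-u₀ x) 0) (ENNReal.ofReal q)
      (volume.restrict U) ≤
      eLpNorm (fun x => u x t - u₀ x) (ENNReal.ofReal q) (volume.restrict U) := by
    filter_upwards [Ioo_mem_nhdsGT hT] with t ht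
    refine eLpNorm_mono_ae ?_
    filter_upwards [ae_restrict_mem hU.measurableSet] with x hx
    rw [Real.norm_of_nonneg (le_max_right _ _), Real.norm_eq_abs]
    have := h0 t ht x hx
    exact max_le ((by linarith : -u₀ x ≤ u x t - u₀ x).trans (le_abs_self _)) (abs_nonneg _)
  have hz := ge_of_tendsto h.2 hle
  have hm : AEStronglyMeasurable (fun x => max (-u₀ x) 0) (volume.restrict U) :=
    (h.1.1.neg).sup aestronglyMeasurable_const
  have := (eLpNorm_eq_zero_iff hm hq').1 (le_antisymm hz bot_le)
  filter_upwards [this] with x hx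
  have h1 : max (-u₀ x) 0 = 0 := hx
  linarith [le_max_left (-u₀ x) 0]

theorem integral_rpow_eq_eLpNorm {X : Type*} [MeasurableSpace X] {μ : Measure X} {f : X → ℝ} {q : ℝ}
    (hq : 0 < q) (hf : MemLp f (ENNReal.ofReal q) μ) (h0 : ∀ᵐ x ∂μ, 0 ≤ f x) :
    ∫ x, f x ^ q ∂μ = (eLpNorm f (ENNReal.ofReal q) μ).toReal ^ q := by
  rw [hf.eLpNorm_eq_integral_rpow_norm (ENNReal.ofReal_pos.2 hq).ne' ENNReal.ofReal_ne_top,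
    ENNReal.toReal_ofReal hq.le]
  have e : ∫ x, ‖f x‖ ^ q ∂μ = ∫ x, f x ^ q ∂μ := integral_congr_ae (by
    filter_upwards [h0] with x hx; rw [Real.norm_of_nonneg hx])
  have hn : 0 ≤ ∫ x, ‖f x‖ ^ q ∂μ := integral_nonneg fun x => Real.rpow_nonneg (norm_nonneg _) _
  rw [ENNReal.toReal_ofReal (Real.rpow_nonneg hn _), ← Real.rpow_mul hn, inv_mul_cancel₀ hq.ne',
    Real.rpow_one, e]

/-- The triangle inequality gives convergence of the norms, and the integrals are powers of the
norms because both functions are non-negative almost everywhere. -/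
theorem HasInitialDatum.tendsto_integral {u : Eu n → ℝ → ℝ} {u₀ : Eu n → ℝ} {q : ℝ} (hq : 1 ≤ q)
    (hT : 0 < T) (h : HasInitialDatum U q u u₀) (hU : IsOpen U)
    (h0 : ∀ t ∈ Ioo 0 T, ∀ x ∈ U, 0 ≤ u x t)
    (hm : ∀ t ∈ Ioo 0 T, MemLp (fun x => u x t) (ENNReal.ofReal q) (volume.restrict U)) :
    Tendsto (fun t => ∫ x in U, u x t ^ q) (𝓝[>] 0) (𝓝 (∫ x in U, u₀ x ^ q)) := by
  have hq0 : 0 < q := by linarith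
  have hq1 : 1 ≤ ENNReal.ofReal q := by simpa using hq
  have hN : Tendsto (fun t => (eLpNorm (fun x => u x t) (ENNReal.ofReal q)
      (volume.restrict U)).toReal) (𝓝[>] 0)
      (𝓝 (eLpNorm u₀ (ENNReal.ofReal q) (volume.restrict U)).toReal) := by
    rw [tendsto_iff_dist_tendsto_zero]
    have hlim : Tendsto (fun t => (eLpNorm (fun x => u x t - u₀ x) (ENNReal.ofReal q)
        (volume.restrict U)).toReal) (𝓝[>] 0) (𝓝 0) :=
      (ENNReal.tendsto_toReal ENNReal.zero_ne_top).comp h.2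
    refine squeeze_zero' (Eventually.of_forall fun t => dist_nonneg) ?_ hlim
    filter_upwards [Ioo_mem_nhdsGT hT] with t ht
    have hmt := hm t ht
    have hd : MemLp (fun x => u x t - u₀ x) (ENNReal.ofReal q) (volume.restrict U) := hmt.sub h.1
    have h1 : eLpNorm (fun x => u x t) (ENNReal.ofReal q) (volume.restrict U) ≤
        eLpNorm (fun x => u x t - u₀ x) (ENNReal.ofReal q) (volume.restrict U) +
        eLpNorm u₀ (ENNReal.ofReal q) (volume.restrict U) := by
      have := eLpNorm_add_le hd.1 h.1.1 hq1
      have e : (fun x => u x t - u₀ x) + u₀ = fun x => u x t := by ext x; simp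
      rwa [e] at this
    have h2 : eLpNorm u₀ (ENNReal.ofReal q) (volume.restrict U) ≤
        eLpNorm (fun x => u x t) (ENNReal.ofReal q) (volume.restrict U) +
        eLpNorm (fun x => u x t - u₀ x) (ENNReal.ofReal q) (volume.restrict U) := by
      have := eLpNorm_sub_le hmt.1 hd.1 hq1
      have e : (fun x => u x t) - (fun x => u x t - u₀ x) = u₀ := by ext x; simp
      rwa [e] at this
    have h1' := ENNReal.toReal_mono (ENNReal.add_ne_top.2 ⟨hd.2.ne, h.1.2.ne⟩) h1
    have h2' := ENNReal.toReal_mono (ENNReal.add_ne_top.2 ⟨hmt.2.ne, hd.2.ne⟩) h2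
    rw [ENNReal.toReal_add hd.2.ne h.1.2.ne] at h1'
    rw [ENNReal.toReal_add hmt.2.ne hd.2.ne] at h2'
    rw [Real.dist_eq, abs_le]
    constructor <;> linarith
  rw [integral_rpow_eq_eLpNorm hq0 h.1 (h.ae_nonneg hq hT hU h0)]
  refine (hN.rpow_const (Or.inr hq0.le)).congr' ?_
  filter_upwards [Ioo_mem_nhdsGT hT] with t ht
  rw [integral_rpow_eq_eLpNorm hq0 (hm t ht)]
  filter_upwards [ae_restrict_mem hU.measurableSet] with x hx using h0 t ht x hx

end ForchheimerGas

end

/-! ### The global bound for `∫ u^α` in terms of the data. -/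

noncomputable section

namespace ForchheimerGas

variable {n : ℕ} {U : Set (Eu n)} {P : GenPoly} {lam T α : ℝ}

namespace RegSol

theorem memLp_of_mem {u w : Eu n → ℝ → ℝ} {Du : Eu n → ℝ → Eu n} (h : RegSol P lam U T u w Du) (hb : Bornology.IsBounded U) {t : ℝ}
    (ht : t ∈ Ioo 0 T) (q : ℝ≥0∞) : MemLp (fun x => u x t) q (volume.restrict U) := by
  have hfin : IsFiniteMeasure (volume.restrict U) := ⟨by simpa using hb.measure_lt_top⟩
  obtain ⟨B, hB⟩ := hb.isCompact_closure.exists_bound_of_continuousOn (h.continuousOn_slice ht)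
  have hum : Measurable fun x => u x t := h.measurable.comp (measurable_id.prodMk measurable_const)
  refine (memLp_top_of_bound hum.aestronglyMeasurable B ?_).mono_exponent le_top
  have hc : volume.restrict U ≤ volume.restrict (closure U) := Measure.restrict_mono subset_closure le_rfl
  exact ae_mono hc ((ae_restrict_iff' isClosed_closure.measurableSet).2 (Eventually.of_forall hB))

/-- The bound for the `L^α` norm of the solution in terms of the data. -/
theorem exists_integral_le_bigU (hn : 2 ≤ n) (hU : IsOpen U) (hb : Bornology.IsBounded U)
    (𝒜 : Atlas U) [IsFiniteMeasure (surfaceMeasure U)] (hlam : 0 < lam) (ha : 1 - lam < P.a)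
    (hα : n * mu0 P lam < α) (hα1 : 1 + lam ≤ α) :
    ∃ C₃ : ℝ, 0 < C₃ ∧ ∀ {T : ℝ} {u w φ : Eu n → ℝ → ℝ} {Du : Eu n → ℝ → Eu n} {u₀ : Eu n → ℝ},
      RegSol P lam U T u w Du →
      Function.uncurry w =ᵐ[(surfaceMeasure U).prod (volume.restrict (Ioo 0 T))]
        (fun z => φ z.1 z.2 * u z.1 z.2 ^ lam) →
      HasInitialDatum U α u u₀ → ∀ t ∈ Ioo 0 T, dataInt P lam α U φ t ≠ ∞ →
      C₃ * (dataInt P lam α U φ t).toReal < initTerm P lam α U u₀ →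
      ∫ x in U, u x t ^ α ≤ bigU P lam α C₃ U φ u₀ t := by
  obtain ⟨K, hK, hrate⟩ := exists_rate_bound hn hU hb 𝒜 hlam ha hα hα1
  have hα0 : 0 < α := by linarith
  have hs0 : 0 < mu1 n P lam α / α := div_pos (mu1_pos hn ha hα) hα0
  set s := mu1 n P lam α / α with hs
  -- The constant is the product of `K` from the rate bound, `α/λ` from normalizing the energy, and
  -- `s` from Gronwall's inequality.
  refine ⟨s * (α / lam * K), by positivity, fun {T u w φ Du u₀} h hw h₀ t ht hfin hlt => ?_⟩
  have hT : 0 < T := ht.1.trans ht.2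
  set z : ℝ → ℝ := fun r => 1 + ∫ x in U, u x r ^ α with hz
  have hX0 : ∀ r, 0 ≤ ∫ x in U, u x r ^ α := fun r =>
    integral_nonneg fun x => Real.rpow_nonneg (h.nonneg x r) _
  have hz1 : ∀ r, 1 ≤ z r := fun r => le_add_of_nonneg_right (hX0 r)
  have hz0 : ∀ r, 0 < z r := fun r => zero_lt_one.trans_le (hz1 r)
  have hzc : ContinuousOn z (Ioo 0 T) := by
    have := h.continuousOn_energy hU hb hα0.le (χ := fun _ => 1) continuous_const
    simp only [mul_one] at this
    exact continuousOn_const.add this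
  set ρ := energyRate P U u w Du (α - lam) (fun _ => 1) with hρ
  -- Gronwall's inequality is applied with this integrable coefficient, not with the norm of `φ⁻`;
  -- the latter is compared with `M` only under lower integrals, so no measurability of the norm in
  -- time is required.
  set M : ℝ → ℝ := fun r => α / lam * max (-ρ r / z r ^ (1 + s)) 0 with hM
  have hM0 : ∀ r, 0 ≤ M r := fun r => mul_nonneg (by positivity) (le_max_right _ _)
  have hstep : ∀ a ∈ Ioo 0 t, z a ^ (-s) - z t ^ (-s) ≤
      s * (α / lam * K) * (dataInt P lam α U φ t).toReal := fun a hat => by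
    have hsub : Icc a t ⊆ Ioo 0 T := fun r hr => ⟨hat.1.trans_le hr.1, hr.2.trans_lt ht.2⟩
    obtain ⟨a', ha'0, ha'a⟩ := exists_between hat.1
    obtain ⟨t', ht't, ht'T⟩ := exists_between ht.2
    have hρI : IntegrableOn ρ (Icc a t) :=
      (h.integrableOn_energyRate hU hb (by linarith) contDiff_const ha'0
        ((ha'a.trans hat.2).trans ht't) ht'T).mono_set
        fun r hr => ⟨ha'a.trans_le hr.1, hr.2.trans_lt ht't⟩
    have hMI : IntegrableOn M (Icc a t) := by
      have hc : ContinuousOn (fun r => (z r ^ (1 + s))⁻¹) (Icc a t) :=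
        ((hzc.mono hsub).rpow_const fun r _ => Or.inl (hz0 r).ne').inv₀
          fun r _ => (Real.rpow_pos_of_pos (hz0 r) _).ne'
      have h1 : IntegrableOn (fun r => -ρ r / z r ^ (1 + s)) (Icc a t) :=
        hρI.neg.mul_continuousOn hc isCompact_Icc
      exact (h1.pos_part).const_mul _
    have hgr := rpow_neg_sub_le_integral (z := z) (M := M) hat.2.le hs0.le (hzc.mono hsub)
      (fun r _ => hz0 r) hMI hM0 (fun c d hac hcd hdt => by
        have hen := h.energy_le hlam hU hb 𝒜 (β := α - lam) (χ := fun _ => 1) (by linarith)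
          contDiff_const (fun _ => zero_le_one) (hat.1.trans_le hac) hcd (hdt.trans_lt ht.2)
        simp only [add_sub_cancel, mul_one] at hen
        have hsub2 : Ioo c d ⊆ Icc a t := Ioo_subset_Icc_self.trans (Icc_subset_Icc hac hdt)
        have h1 : ∫ r in Ioo c d, α / lam * -ρ r ≤ ∫ r in Ioo c d, M r * z r ^ (1 + s) := by
          have hc : ContinuousOn (fun r => z r ^ (1 + s)) (Icc a t) :=
            (hzc.mono hsub).rpow_const fun r _ => Or.inl (hz0 r).ne'
          have i1 : IntegrableOn (fun r => M r * z r ^ (1 + s)) (Icc a t) :=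
            hMI.mul_continuousOn hc isCompact_Icc
          refine setIntegral_mono_on ((hρI.mono_set hsub2).neg.const_mul _) (i1.mono_set hsub2)
            measurableSet_Ioo fun r _ => ?_
          have hp : 0 < z r ^ (1 + s) := Real.rpow_pos_of_pos (hz0 r) _
          simp only [M]
          rw [mul_assoc]
          refine mul_le_mul_of_nonneg_left ?_ (by positivity)
          calc -ρ r = -ρ r / z r ^ (1 + s) * z r ^ (1 + s) := (div_mul_cancel₀ _ hp.ne').symm
            _ ≤ _ := by gcongr; exact le_max_left _ _
        rw [integral_const_mul, integral_neg] at h1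
        refine le_trans ?_ h1
        have e1 : α / lam * (lam / α) = 1 := by field_simp
        have h2 := mul_le_mul_of_nonneg_left hen (div_pos hα0 hlam).le
        rw [mul_add, ← mul_assoc, ← mul_assoc, e1, one_mul, one_mul] at h2
        simp only [z]
        linarith)
    refine hgr.trans ?_
    rw [mul_assoc]
    refine mul_le_mul_of_nonneg_left ?_ hs0.le
    have hMI' : IntegrableOn M (Ioo a t) := hMI.mono_set Ioo_subset_Icc_self
    have hle : ENNReal.ofReal (∫ r in Ioo a t, M r) ≤
        ENNReal.ofReal (α / lam * K) * dataInt P lam α U φ t := by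
      rw [ofReal_integral_eq_lintegral_ofReal hMI' (Eventually.of_forall hM0)]
      calc ∫⁻ r in Ioo a t, ENNReal.ofReal (M r)
          ≤ ∫⁻ r in Ioo a t, ENNReal.ofReal (α / lam * K) *
              (1 + negNorm U φ r ^ phiExp n P lam α) := by
            refine lintegral_mono_ae ?_
            filter_upwards [hrate h hw hat.1 hat.2 ht.2] with r hr
            simp only [M]
            rw [ENNReal.ofReal_mul (by positivity), ENNReal.ofReal_mul (by positivity), mul_assoc]
            refine mul_le_mul' le_rfl ?_
            rw [ENNReal.ofReal_max, ENNReal.ofReal_zero, max_eq_left (zero_le)]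
            exact hr
        _ = ENNReal.ofReal (α / lam * K) *
              ∫⁻ r in Ioo a t, (1 + negNorm U φ r ^ phiExp n P lam α) :=
            lintegral_const_mul' _ _ ENNReal.ofReal_ne_top
        _ ≤ _ := mul_le_mul' le_rfl (lintegral_mono_set (Ioo_subset_Ioo hat.1.le le_rfl))
    have h2 := ENNReal.toReal_mono (ENNReal.mul_ne_top ENNReal.ofReal_ne_top hfin) hle
    rwa [ENNReal.toReal_ofReal (integral_nonneg hM0), ENNReal.toReal_mul, ENNReal.toReal_ofReal
      (by positivity)] at h2
  -- The solution lives on open time intervals only, so the initial time is reached as the limit `a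
  -- → 0` of the estimate on `[a, t]`.
  have htend : Tendsto (fun a => ∫ x in U, u x a ^ α) (𝓝[>] 0) (𝓝 (∫ x in U, u₀ x ^ α)) :=
    h₀.tendsto_integral (by linarith) hT hU (fun r _ x _ => h.nonneg x r)
      fun r hr => h.memLp_of_mem hb hr _
  have hX₀ : 0 ≤ ∫ x in U, u₀ x ^ α := ge_of_tendsto' htend hX0
  have hzt : Tendsto (fun a => z a ^ (-s) - z t ^ (-s)) (𝓝[>] 0)
      (𝓝 ((1 + ∫ x in U, u₀ x ^ α) ^ (-s) - z t ^ (-s))) :=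
    ((htend.const_add 1).rpow_const (Or.inl (by positivity))).sub_const _
  have hfinal := le_of_tendsto hzt (by
    filter_upwards [Ioo_mem_nhdsGT ht.1] with a ha using hstep a ha)
  have e1 : initTerm P lam α U u₀ = (1 + ∫ x in U, u₀ x ^ α) ^ (-s) := by
    rw [initTerm, hs, neg_div]
  -- The smallness assumption makes `B` positive, so the inequality `B ≤ z(t)^{-s}` can be inverted
  -- with the negative power `-1/s`.
  set B := initTerm P lam α U u₀ - s * (α / lam * K) * (dataInt P lam α U φ t).toReal with hB
  have hB0 : 0 < B := by linarith
  have hBz : B ≤ z t ^ (-s) := by rw [hB, e1]; linarith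
  have e2 : bigU P lam α (s * (α / lam * K)) U φ u₀ t = B ^ (-(1 / s)) := by
    rw [bigU, ← hB, hs, one_div_div, neg_div]
  rw [e2]
  have h3 := Real.rpow_le_rpow_of_nonpos hB0 hBz (z := -(1 / s))
    (neg_nonpos.2 (one_div_pos.2 hs0).le)
  rw [← Real.rpow_mul (hz0 t).le, neg_mul_neg, mul_one_div_cancel hs0.ne', Real.rpow_one] at h3
  refine le_trans ?_ h3
  simp only [z]
  linarith

end RegSol

end ForchheimerGas

end

/-! ### Properties of `𝒰`, of the exponents and of the norms. -/

noncomputable section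

namespace ForchheimerGas

variable {n : ℕ} {U : Set (Eu n)} {P : GenPoly} {lam T α C₃ : ℝ} {φ : Eu n → ℝ → ℝ} {u₀ : Eu n → ℝ}

theorem exists_ball_subset {U' : Set (Eu n)} (hU : IsOpen U) (hc : IsCompact (closure U'))
    (hsub : closure U' ⊆ U) : ∃ d : ℝ, 0 < d ∧ d ≤ 1 ∧ ∀ x ∈ U', Metric.ball x d ⊆ U := by
  obtain ⟨d, hd, h⟩ := hc.exists_thickening_subset_open hU hsub
  refine ⟨min d 1, lt_min hd one_pos, min_le_right _ _, fun x hx => ?_⟩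
  exact ((Metric.ball_subset_ball (min_le_left _ _)).trans
    (Metric.ball_subset_thickening (subset_closure hx) d)).trans h

theorem RegSol.lintegral_rpow_eq {u w : Eu n → ℝ → ℝ} {Du : Eu n → ℝ → Eu n}
    (h : RegSol P lam U T u w Du) (hb : Bornology.IsBounded U) (hα : 0 < α) :
    ∫⁻ z in U ×ˢ Ioo 0 T, ENNReal.ofReal (u z.1 z.2) ^ α =
      ∫⁻ t in Ioo 0 T, ENNReal.ofReal (∫ x in U, u x t ^ α) := by
  have hm : Measurable fun z : Eu n × ℝ => ENNReal.ofReal (u z.1 z.2) ^ α :=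
    h.measurable.ennreal_ofReal.pow_const _
  rw [Measure.volume_eq_prod, ← Measure.prod_restrict, lintegral_prod_symm' _ hm]
  refine setLIntegral_congr_fun measurableSet_Ioo fun t ht => ?_
  have hi := h.integrableOn_slice hb ht (Θ := fun y => y ^ α) (f := fun _ => 1)
    (Real.continuous_rpow_const hα.le).continuousOn continuousOn_const
  simp only [mul_one] at hi
  rw [ofReal_integral_eq_lintegral_ofReal hi
    (Eventually.of_forall fun x => Real.rpow_nonneg (h.nonneg x t) _)]
  exact lintegral_congr fun x => ENNReal.ofReal_rpow_of_nonneg (h.nonneg x t) hα.le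

theorem dataInt_mono (P : GenPoly) (lam α : ℝ) (U : Set (Eu n)) (φ : Eu n → ℝ → ℝ) :
    Monotone (dataInt P lam α U φ) :=
  fun _ _ h => lintegral_mono_set (Ioo_subset_Ioo le_rfl h)

/-- The integral of the data increases with time and the outer power is negative, so `𝒰` is largest
at the final time. -/
theorem bigU_le (hμ : 0 < mu1 n P lam α / α) (hC₃ : 0 < C₃) (hfin : dataInt P lam α U φ T ≠ ∞) {b : ℝ}
    (hb : 0 < b) (hlt : b ≤ initTerm P lam α U u₀ - C₃ * (dataInt P lam α U φ T).toReal) {t : ℝ}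
    (ht : t ≤ T) :
    0 ≤ bigU P lam α C₃ U φ u₀ t ∧ bigU P lam α C₃ U φ u₀ t ≤ b ^ (-α / mu1 n P lam α) := by
  have h1 := ENNReal.toReal_mono hfin (dataInt_mono P lam α U φ ht)
  have h2 : b ≤ initTerm P lam α U u₀ - C₃ * (dataInt P lam α U φ t).toReal := by nlinarith
  refine ⟨Real.rpow_nonneg (hb.le.trans h2) _, Real.rpow_le_rpow_of_nonpos hb h2 ?_⟩
  rw [neg_div, ← one_div_div]
  exact neg_nonpos.2 (one_div_pos.2 hμ).le

theorem lintegral_le_integral_bigU (hμ : 0 < mu1 n P lam α / α) (hC₃ : 0 < C₃) (hT : 0 ≤ T)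
    (hfin : dataInt P lam α U φ T ≠ ∞)
    (hlt : C₃ * (dataInt P lam α U φ T).toReal < initTerm P lam α U u₀) {X : ℝ → ℝ}
    (hX : ∀ t ∈ Ioo 0 T, X t ≤ bigU P lam α C₃ U φ u₀ t) :
    0 ≤ ∫ t in 0..T, bigU P lam α C₃ U φ u₀ t ∧
    ∫⁻ t in Ioo 0 T, ENNReal.ofReal (X t) ≤
      ENNReal.ofReal (∫ t in 0..T, bigU P lam α C₃ U φ u₀ t) := by
  have hbd := fun t (ht : t ≤ T) => bigU_le hμ hC₃ hfin (sub_pos.2 hlt) le_rfl ht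
  have hm : Measurable (bigU P lam α C₃ U φ u₀) :=
    (measurable_const.sub (((dataInt_mono P lam α U φ).measurable.ennreal_toReal).const_mul _)).pow_const _
  have hae : ∀ᵐ t ∂(volume.restrict (Ioo 0 T)), 0 ≤ bigU P lam α C₃ U φ u₀ t := by
    filter_upwards [ae_restrict_mem measurableSet_Ioo] with t ht using (hbd t ht.2.le).1
  have hint : Integrable (bigU P lam α C₃ U φ u₀) (volume.restrict (Ioo 0 T)) := by
    refine Integrable.of_bound hm.aestronglyMeasurable
      ((initTerm P lam α U u₀ - C₃ * (dataInt P lam α U φ T).toReal) ^ (-α / mu1 n P lam α)) ?_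
    filter_upwards [ae_restrict_mem measurableSet_Ioo] with t ht
    rw [Real.norm_of_nonneg (hbd t ht.2.le).1]
    exact (hbd t ht.2.le).2
  rw [intervalIntegral.integral_of_le hT, ← restrict_Ioo_eq_restrict_Ioc]
  refine ⟨integral_nonneg_of_ae hae, ?_⟩
  rw [ofReal_integral_eq_lintegral_ofReal hint hae]
  exact setLIntegral_mono_ae' measurableSet_Ioo
    (Eventually.of_forall fun t ht => ENNReal.ofReal_le_ofReal (hX t ht))

/-- The hypothesis keeps the base of `𝒰` above `2^{-μ₁/α}` times its initial value, that is, above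
the power `-μ₁/α` of `2(1 + ∫ u₀^α)`. -/
theorem bigU_le_two_mul (hμ : 0 < mu1 n P lam α / α) (hC₃ : 0 < C₃)
    (h₀ : 0 ≤ ∫ x in U, u₀ x ^ α) (hfin : dataInt P lam α U φ T ≠ ∞)
    (hle : C₃ * (dataInt P lam α U φ T).toReal ≤
      (1 - 2 ^ (-(mu1 n P lam α) / α)) * initTerm P lam α U u₀) {t : ℝ} (ht : t ≤ T) :
    bigU P lam α C₃ U φ u₀ t ≤ 2 * (1 + ∫ x in U, u₀ x ^ α) := by
  have hI : 0 < 1 + ∫ x in U, u₀ x ^ α := by linarith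
  have e : (2 : ℝ) ^ (-(mu1 n P lam α) / α) * initTerm P lam α U u₀ =
      (2 * (1 + ∫ x in U, u₀ x ^ α)) ^ (-(mu1 n P lam α) / α) := by
    rw [initTerm, Real.mul_rpow (by norm_num) hI.le]
  have hpos : 0 < (2 * (1 + ∫ x in U, u₀ x ^ α)) ^ (-(mu1 n P lam α) / α) := by positivity
  refine (bigU_le hμ hC₃ hfin hpos (by rw [← e]; linarith) ht).2.trans (le_of_eq ?_)
  have h1 : mu1 n P lam α ≠ 0 := fun h => by simp [h] at hμ
  have h2 : α ≠ 0 := fun h => by simp [h] at hμ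
  rw [← Real.rpow_mul (by positivity), show -(mu1 n P lam α) / α * (-α / mu1 n P lam α) = 1 by
    field_simp, Real.rpow_one]

theorem initTerm_pos (h₀ : 0 ≤ ∫ x in U, u₀ x ^ α) : 0 < initTerm P lam α U u₀ :=
  Real.rpow_pos_of_pos (by linarith) _

/-- Every factor of `μ` lies in `[0, 1]` and every factor of `ν` is at least `1`; comparison with
the empty product gives the bounds. -/
theorem muInf_nuInf_bounds {α₀ : ℝ} (hn : 2 ≤ n) (P : GenPoly) (hlam0 : 0 < lam) (hlam1 : lam ≤ 1)
    (ha : 1 - lam < P.a) (hα₁ : 2 - (1 - lam) ≤ α₀) (hα₂ : alphaStar n P lam < α₀) :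
    0 ≤ muInf n P lam α₀ ∧ muInf n P lam α₀ ≤ 1 ∧ 1 ≤ nuInf n P lam α₀ := by
  have hk := one_lt_kappa hn P hlam0 hα₁ hα₂
  obtain ⟨hmμ, hmν⟩ := multipliable_mu_nu P hlam0 hlam1 hα₁ hk
  have ha1 := P.a_lt_one
  have hαj : ∀ j : ℕ, α₀ ≤ α₀ * kappa n P lam α₀ ^ j := fun j =>
    le_mul_of_one_le_right (by linarith) (one_le_pow₀ hk.le)
  have h0 : ∀ j : ℕ, 0 ≤
      (α₀ * kappa n P lam α₀ ^ j - 2 + (1 - lam)) / (α₀ * kappa n P lam α₀ ^ j) := fun j =>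
    div_nonneg (by linarith [hαj j]) (by linarith [hαj j])
  have h1 : ∀ j : ℕ, (α₀ * kappa n P lam α₀ ^ j - 2 + (1 - lam)) /
      (α₀ * kappa n P lam α₀ ^ j) ≤ 1 := fun j => by
    rw [div_le_one (by linarith [hαj j])]; linarith
  have h2 : ∀ j : ℕ, 1 ≤ (α₀ * kappa n P lam α₀ ^ j) /
      (α₀ * kappa n P lam α₀ ^ j + (1 - lam) - P.a) := fun j => by
    rw [one_le_div (by linarith [hαj j])]; linarith
  exact ⟨tprod_nonneg_of_nonneg hmμ h0, by simpa [muInf] using tprod_le_prod_range hmμ h0 h1 0,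
    by simpa [nuInf] using prod_range_le_tprod hmν h2 0⟩

theorem HasInitialDatum.congr {u v : Eu n → ℝ → ℝ} {q : ℝ} (h : HasInitialDatum U q u u₀)
    (hU : IsOpen U) (hT : 0 < T) (huv : ∀ x ∈ U, ∀ t ∈ Ioo 0 T, v x t = u x t) :
    HasInitialDatum U q v u₀ := by
  refine ⟨h.1, h.2.congr' ?_⟩
  filter_upwards [Ioo_mem_nhdsGT hT] with t ht
  refine eLpNorm_congr_ae ?_
  filter_upwards [ae_restrict_mem hU.measurableSet] with x hx
  rw [huv x hx t ht]

end ForchheimerGas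

end

/-! ### Proof of the main theorem. -/

open ForchheimerGas in
theorem theorem4p6 (n : ℕ) (hn : 2 ≤ n) (P : GenPoly) (lam : ℝ) (hlam0 : 0 < lam)
    (hlam1 : lam ≤ 1) (ha : 1 - lam < P.a)
    (α₀ : ℝ) (hα₁ : 2 - (1 - lam) ≤ α₀) (hα₂ : alphaStar n P lam < α₀) :
    ∃ ω : ℝ, 0 < ω ∧
    ∀ U : Set (EuclideanSpace ℝ (Fin n)), IsOpen U → Bornology.IsBounded U → HasC1Boundary U →
    ∃ C₃ : ℝ, 0 < C₃ ∧
    ∀ U' : Set (EuclideanSpace ℝ (Fin n)), IsOpen U' → IsCompact (closure U') → closure U' ⊆ U →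
    ∃ C : ℝ, 0 < C ∧
    ∀ (T ε : ℝ), 0 < T → 0 < ε → ε < min 1 T →
    ∀ φ u : EuclideanSpace ℝ (Fin n) → ℝ → ℝ,
      AEStronglyMeasurable (Function.uncurry φ)
        ((surfaceMeasure U).prod (volume.restrict (Ioo 0 T))) →
      IsSolution P lam U T φ u →
      (eLpNorm (Function.uncurry u) ∞ (volume.restrict (U' ×ˢ Ioo ε T))
        ≤ ENNReal.ofReal (C * ε ^ (-(2 * ω)) * (1 + T) ^ (3 * ω)) *
          max (eLpNorm (Function.uncurry u) (ENNReal.ofReal α₀)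
                (volume.restrict (U ×ˢ Ioo 0 T)) ^ muInf n P lam α₀)
              (eLpNorm (Function.uncurry u) (ENNReal.ofReal α₀)
                (volume.restrict (U ×ˢ Ioo 0 T)) ^ nuInf n P lam α₀)) ∧
      (n * mu0 P lam < α₀ →
        ∀ u₀ : EuclideanSpace ℝ (Fin n) → ℝ, HasInitialDatum U α₀ u u₀ →
        (dataInt P lam α₀ U φ T < ENNReal.ofReal (1 / C₃ * initTerm P lam α₀ U u₀) →
          eLpNorm (Function.uncurry u) ∞ (volume.restrict (U' ×ˢ Ioo ε T))
            ≤ ENNReal.ofReal (C * ε ^ (-(2 * ω)) * (1 + T) ^ (3 * ω) *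
              max ((∫ t in 0..T, bigU P lam α₀ C₃ U φ u₀ t) ^ (muInf n P lam α₀ / α₀))
                  ((∫ t in 0..T, bigU P lam α₀ C₃ U φ u₀ t) ^ (nuInf n P lam α₀ / α₀)))) ∧
        (dataInt P lam α₀ U φ T ≤
            ENNReal.ofReal ((1 - 2 ^ (-(mu1 n P lam α₀) / α₀)) / C₃ * initTerm P lam α₀ U u₀) →
          eLpNorm (Function.uncurry u) ∞ (volume.restrict (U' ×ˢ Ioo ε T))
            ≤ ENNReal.ofReal (C * ε ^ (-(2 * ω)) * (1 + T) ^ (3 * ω + nuInf n P lam α₀ / α₀) *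
              (1 + (eLpNorm u₀ (ENNReal.ofReal α₀) (volume.restrict U)).toReal) ^
                nuInf n P lam α₀))) := by
  obtain ⟨ω, hω, hloc⟩ := RegSol.exists_interior_bound hn P hlam0 hlam1 ha hα₁ hα₂
  obtain ⟨hμ0, hμ1, hν1⟩ := muInf_nuInf_bounds hn P hlam0 hlam1 ha hα₁ hα₂
  set μ := muInf n P lam α₀
  set ν := nuInf n P lam α₀
  have hα0 : 0 < α₀ := by linarith
  have hα1 : 1 ≤ α₀ := by linarith
  have hν0 : 0 < ν := by linarith
  refine ⟨ω, hω, fun U hU hb hC => ?_⟩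
  obtain ⟨𝒜⟩ := exists_atlas hU hb hC
  have hσ := isFiniteMeasure_surfaceMeasure hn hU hb 𝒜
  -- The constant must exist even when `α₀ ≤ n μ₀`, where nothing is claimed about it and any value
  -- serves.
  obtain ⟨C₃, hC₃, hglob⟩ : ∃ C₃ : ℝ, 0 < C₃ ∧ (n * mu0 P lam < α₀ →
      ∀ {T : ℝ} {u w φ : Eu n → ℝ → ℝ} {Du : Eu n → ℝ → Eu n} {u₀ : Eu n → ℝ},
      RegSol P lam U T u w Du →
      Function.uncurry w =ᵐ[(surfaceMeasure U).prod (volume.restrict (Ioo 0 T))]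
        (fun z => φ z.1 z.2 * u z.1 z.2 ^ lam) →
      HasInitialDatum U α₀ u u₀ → ∀ t ∈ Ioo 0 T, dataInt P lam α₀ U φ t ≠ ∞ →
      C₃ * (dataInt P lam α₀ U φ t).toReal < initTerm P lam α₀ U u₀ →
      ∫ x in U, u x t ^ α₀ ≤ bigU P lam α₀ C₃ U φ u₀ t) := by
    by_cases hα : n * mu0 P lam < α₀
    · obtain ⟨C₃, h1, h2⟩ := RegSol.exists_integral_le_bigU hn hU hb 𝒜 hlam0 ha hα (by linarith)
      exact ⟨C₃, h1, fun _ => h2⟩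
    · exact ⟨1, one_pos, fun h => absurd h hα⟩
  refine ⟨C₃, hC₃, fun U' hU' hcomp hsub => ?_⟩
  obtain ⟨d, hd, hd1, hball⟩ := exists_ball_subset hU hcomp hsub
  obtain ⟨C₁, hC₁, hint⟩ := hloc hU hb 𝒜 hσ hd hd1
  have h2ν : 1 ≤ (2 : ℝ) ^ (ν / α₀) := Real.one_le_rpow (by norm_num) (by positivity)
  -- The factor `2^{ν/α₀}` is needed only for part (3), where it accounts for the `2` in the bound
  -- of `𝒰`.
  refine ⟨C₁ * 2 ^ (ν / α₀), by positivity, fun T ε hT hε hεT φ u _ hu => ?_⟩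
  have hε1 : ε < 1 := hεT.trans_le (min_le_left _ _)
  obtain ⟨v, w, Du, hv, hvu, hw⟩ := hu.exists_regSol hU
  have hw' : Function.uncurry w =ᵐ[(surfaceMeasure U).prod (volume.restrict (Ioo 0 T))]
      (fun z => φ z.1 z.2 * v z.1 z.2 ^ lam) := by
    filter_upwards [hw, RegSol.ae_mem_closure_bdry (U := U) 0 T] with z hz hz2
    rw [hz, hvu z.1 hz2.1 z.2 hz2.2]
  set I := ∫⁻ z in U ×ˢ Ioo 0 T, ENNReal.ofReal (v z.1 z.2) ^ α₀ with hI
  have hnorm : eLpNorm (Function.uncurry u) (ENNReal.ofReal α₀) (volume.restrict (U ×ˢ Ioo 0 T)) =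
      I ^ (1 / α₀) := by
    rw [eLpNorm_eq_lintegral_rpow_enorm_toReal (ENNReal.ofReal_pos.2 hα0).ne' ENNReal.ofReal_ne_top,
      ENNReal.toReal_ofReal hα0.le, hI]
    congr 1
    refine setLIntegral_congr_fun (hU.measurableSet.prod measurableSet_Ioo) fun z hz => ?_
    have h1 := hvu z.1 (subset_closure hz.1) z.2 hz.2
    change ‖u z.1 z.2‖ₑ ^ α₀ = ENNReal.ofReal (v z.1 z.2) ^ α₀
    rw [← h1, ← ofReal_norm, Real.norm_of_nonneg (hv.nonneg _ _)]
  have hsup : eLpNorm (Function.uncurry u) ∞ (volume.restrict (U' ×ˢ Ioo ε T)) ≤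
      ENNReal.ofReal (C₁ * ε ^ (-(2 * ω))) * max ((I ^ (1 / α₀)) ^ μ) ((I ^ (1 / α₀)) ^ ν) := by
    rw [eLpNorm_exponent_top]
    refine eLpNormEssSup_le_of_ae_enorm_bound ?_
    filter_upwards [ae_restrict_mem (hU'.measurableSet.prod measurableSet_Ioo)] with z hz
    have hzU : z.1 ∈ U := hsub (subset_closure hz.1)
    have h1 := hvu z.1 (subset_closure hzU) z.2 ⟨hε.trans hz.2.1, hz.2.2⟩
    change ‖u z.1 z.2‖ₑ ≤ _
    rw [← h1, ← ofReal_norm, Real.norm_of_nonneg (hv.nonneg _ _)]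
    exact hint hv hε hε1 z.1 (hball z.1 hz.1) z.2 hz.2
  have hT3 : 1 ≤ (1 + T) ^ (3 * ω) := Real.one_le_rpow (by linarith) (by positivity)
  have hε0 : 0 < ε ^ (-(2 * ω)) := Real.rpow_pos_of_pos hε _
  -- The interior bound works on cylinders of duration at most `ε < 1` and has no growth in `T`; the
  -- factor `(1 + T)^{3ω} ≥ 1` is only inserted.
  have hconst : C₁ * ε ^ (-(2 * ω)) ≤ C₁ * 2 ^ (ν / α₀) * ε ^ (-(2 * ω)) * (1 + T) ^ (3 * ω) := by
    calc C₁ * ε ^ (-(2 * ω)) = C₁ * 1 * ε ^ (-(2 * ω)) * 1 := by ring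
      _ ≤ _ := by gcongr
  refine ⟨?_, fun hα u₀ h₀ => ?_⟩
  · rw [hnorm]
    exact hsup.trans (mul_le_mul' (ENNReal.ofReal_le_ofReal hconst) le_rfl)
  have h₀v : HasInitialDatum U α₀ v u₀ :=
    h₀.congr hU hT fun x hx t ht => hvu x (subset_closure hx) t ht
  have hs0 : 0 < mu1 n P lam α₀ / α₀ := div_pos (mu1_pos hn ha hα) hα0
  have hu₀ := h₀v.ae_nonneg hα1 hT hU fun t _ x _ => hv.nonneg x t
  have hI₀ : 0 ≤ ∫ x in U, u₀ x ^ α₀ := integral_nonneg_of_ae (by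
    filter_upwards [hu₀] with x hx using Real.rpow_nonneg hx _)
  have hinit := initTerm_pos (P := P) (lam := lam) hI₀
  have hIeq := hv.lintegral_rpow_eq hb hα0
  -- A common form of the hypotheses of (2) and (3): a bound at the final time `T` gives the
  -- estimate at all earlier times by monotonicity.
  have hreg : ∀ c : ℝ, dataInt P lam α₀ U φ T ≤ ENNReal.ofReal c → C₃ * c < initTerm P lam α₀ U u₀ →
      0 ≤ c → ∀ t ∈ Ioo 0 T, ∫ x in U, v x t ^ α₀ ≤ bigU P lam α₀ C₃ U φ u₀ t := by
    intro c hc hlt hc0 t ht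
    have h1 : dataInt P lam α₀ U φ t ≤ ENNReal.ofReal c := (dataInt_mono P lam α₀ U φ ht.2.le).trans hc
    refine hglob hα hv hw' h₀v t ht (ne_top_of_le_ne_top ENNReal.ofReal_ne_top h1) ?_
    have h2 := ENNReal.toReal_mono ENNReal.ofReal_ne_top h1
    rw [ENNReal.toReal_ofReal hc0] at h2
    exact (mul_le_mul_of_nonneg_left h2 hC₃.le).trans_lt hlt
  constructor
  · intro hdata
    have hfin : dataInt P lam α₀ U φ T ≠ ∞ := hdata.ne_top
    have hlt : C₃ * (dataInt P lam α₀ U φ T).toReal < initTerm P lam α₀ U u₀ := by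
      have h1 := (ENNReal.toReal_lt_toReal hfin ENNReal.ofReal_ne_top).2 hdata
      rw [ENNReal.toReal_ofReal (by positivity), one_div, inv_mul_eq_div, lt_div_iff₀ hC₃] at h1
      linarith
    obtain ⟨hJ0, hJ⟩ := lintegral_le_integral_bigU hs0 hC₃ hT.le hfin hlt
      (hreg _ (ENNReal.ofReal_toReal hfin).ge hlt ENNReal.toReal_nonneg)
    rw [← hIeq] at hJ
    set J := ∫ t in 0..T, bigU P lam α₀ C₃ U φ u₀ t
    have hpow : ∀ r, 0 ≤ r → (I ^ (1 / α₀)) ^ r ≤ ENNReal.ofReal (J ^ (r / α₀)) := fun r hr => by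
      rw [← ENNReal.rpow_mul, one_div_mul_eq_div, ← ENNReal.ofReal_rpow_of_nonneg hJ0 (by positivity)]
      exact ENNReal.rpow_le_rpow hJ (by positivity)
    refine hsup.trans ?_
    rw [ENNReal.ofReal_mul (p := C₁ * 2 ^ (ν / α₀) * ε ^ (-(2 * ω)) * (1 + T) ^ (3 * ω)) (by positivity),
      ENNReal.ofReal_max]
    exact mul_le_mul' (ENNReal.ofReal_le_ofReal hconst) (max_le_max (hpow μ hμ0) (hpow ν hν0.le))
  · intro hdata
    have h2s : 0 < (2 : ℝ) ^ (-(mu1 n P lam α₀) / α₀) := by positivity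
    have h2s1 : (2 : ℝ) ^ (-(mu1 n P lam α₀) / α₀) ≤ 1 :=
      Real.rpow_le_one_of_one_le_of_nonpos (by norm_num) (by rw [neg_div]; linarith)
    set c := (1 - 2 ^ (-(mu1 n P lam α₀) / α₀)) / C₃ * initTerm P lam α₀ U u₀ with hc
    have hc0 : 0 ≤ c := mul_nonneg (div_nonneg (by linarith) hC₃.le) hinit.le
    have hCc : C₃ * c = (1 - 2 ^ (-(mu1 n P lam α₀) / α₀)) * initTerm P lam α₀ U u₀ := by
      rw [hc]; field_simp
    have hfin : dataInt P lam α₀ U φ T ≠ ∞ := ne_top_of_le_ne_top ENNReal.ofReal_ne_top hdata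
    have hle : C₃ * (dataInt P lam α₀ U φ T).toReal ≤
        (1 - 2 ^ (-(mu1 n P lam α₀) / α₀)) * initTerm P lam α₀ U u₀ := by
      have h1 := ENNReal.toReal_mono ENNReal.ofReal_ne_top hdata
      rw [ENNReal.toReal_ofReal hc0] at h1
      rw [← hCc]
      exact mul_le_mul_of_nonneg_left h1 hC₃.le
    have hX := hreg c hdata (by rw [hCc]; nlinarith) hc0
    set N := (eLpNorm u₀ (ENNReal.ofReal α₀) (volume.restrict U)).toReal with hN
    have hN0 : 0 ≤ N := ENNReal.toReal_nonneg
    have hIN : ∫ x in U, u₀ x ^ α₀ = N ^ α₀ := integral_rpow_eq_eLpNorm hα0 h₀.1 hu₀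
    have h1N : 1 + N ^ α₀ ≤ (1 + N) ^ α₀ := by
      simpa using Real.add_rpow_le_rpow_add zero_le_one hN0 hα1
    -- Using `1 + T` in place of `T` makes `R ≥ 1`. Both powers in the maximum are then at most
    -- `R^{ν/α₀}`, which splits into the three factors of the claim.
    set R := 2 * (1 + T) * (1 + N) ^ α₀ with hR
    have hN1 : 1 ≤ (1 + N) ^ α₀ := Real.one_le_rpow (by linarith) hα0.le
    have hR1 : 1 ≤ R := by rw [hR]; nlinarith
    have hIR : I ≤ ENNReal.ofReal R := by
      rw [hI, hIeq]
      calc ∫⁻ t in Ioo 0 T, ENNReal.ofReal (∫ x in U, v x t ^ α₀)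
          ≤ ∫⁻ _t in Ioo 0 T, ENNReal.ofReal (2 * (1 + ∫ x in U, u₀ x ^ α₀)) :=
            setLIntegral_mono_ae' measurableSet_Ioo (Eventually.of_forall fun t ht =>
              ENNReal.ofReal_le_ofReal ((hX t ht).trans
                (bigU_le_two_mul hs0 hC₃ hI₀ hfin hle ht.2.le)))
        _ = ENNReal.ofReal (2 * (1 + ∫ x in U, u₀ x ^ α₀) * T) := by
            rw [setLIntegral_const, Real.volume_Ioo, sub_zero, ← ENNReal.ofReal_mul (by positivity)]
        _ ≤ _ := by
            refine ENNReal.ofReal_le_ofReal ?_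
            rw [hIN, hR]
            nlinarith
    have hpow : ∀ r, 0 ≤ r → r ≤ ν → (I ^ (1 / α₀)) ^ r ≤ ENNReal.ofReal (R ^ (ν / α₀)) :=
      fun r hr hrν => by
        rw [← ENNReal.rpow_mul, one_div_mul_eq_div,
          ← ENNReal.ofReal_rpow_of_nonneg (by linarith) (by positivity)]
        refine (ENNReal.rpow_le_rpow hIR (by positivity)).trans
          (ENNReal.rpow_le_rpow_of_exponent_le (ENNReal.one_le_ofReal.2 hR1) (by gcongr))
    have hRν : R ^ (ν / α₀) = 2 ^ (ν / α₀) * (1 + T) ^ (ν / α₀) * (1 + N) ^ ν := by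
      rw [hR, Real.mul_rpow (by positivity) (by positivity), Real.mul_rpow (by norm_num) (by linarith),
        ← Real.rpow_mul (by linarith), mul_div_cancel₀ _ hα0.ne']
    refine hsup.trans ((mul_le_mul' le_rfl (max_le (hpow μ hμ0 (by linarith)) (hpow ν hν0.le le_rfl))).trans
      ?_)
    rw [← ENNReal.ofReal_mul (by positivity)]
    refine ENNReal.ofReal_le_ofReal ?_
    rw [hRν, Real.rpow_add (by linarith)]
    have hA : 0 ≤ C₁ * ε ^ (-(2 * ω)) * 2 ^ (ν / α₀) * (1 + T) ^ (ν / α₀) * (1 + N) ^ ν := by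
      positivity
    calc _ = C₁ * ε ^ (-(2 * ω)) * 2 ^ (ν / α₀) * (1 + T) ^ (ν / α₀) * (1 + N) ^ ν * 1 := by ring
      _ ≤ C₁ * ε ^ (-(2 * ω)) * 2 ^ (ν / α₀) * (1 + T) ^ (ν / α₀) * (1 + N) ^ ν * (1 + T) ^ (3 * ω) :=
          mul_le_mul_of_nonneg_left hT3 hA
      _ = _ := by ring
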